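/- All graphs are finite and simple. For a graph $G$ and $X\subseteq V(G)$, let $B_G(X,1)$ be the set of vertices that belong to $X$ or have a neighbour in $X$. An *induced packing* of $k$ cycles in $G$ is a set of $k$ pairwise vertex-disjoint cycles of $G$ such that no edge of $G$ joins two of them. **Theorem 1.4.** Let $\mathcal C$ be a class of graphs closed under taking induced subgraphs (and isomorphism), and let $h$ be a real-valued function such that for every positive integer $k$, every $G\in\mathcal C$ contains either $k$ pairwise vertex-disjoint cycles or a set $X$ of at most $h(k)$ vertices such that $G-X$ has no cycles. Then for every positive integer $k$, every $G\in\mathcal C$ has either 1. an induced packing of $k$ cycles, or 2. a set $X$ of at most $\max\{0,\,63h(k)+164k-173\}$ vertices such that $G-B_G(X,1)$ is a forest. Moreover, one of the two can be found in polynomial time for fixed $k$. More precisely, there are a random access machine program (with additions and subtractions at unit cost), a number $c$ and a function $a$, depending only on $\mathcal C$ and $h$, such that for every positive integer $k$ and every $n$-vertex graph $G\in\mathcal C$, the program, given $k$ and the adjacency matrix of $G$, stops after at most $a(k)\,(n+1)^c$ steps and outputs the vertex sequences of the cycles of an induced packing as in 1 or the list of elements of a set $X$ as in 2. -/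

import Mathlib

namespace InducedErdosPosa

open SimpleGraph

/-! ### Graphs -/

/-- A class of graphs; only its finite members matter below. -/
abbrev GraphClass : Type 1 := ∀ V : Type, SimpleGraph V → Prop

/-- Closed under taking induced subgraphs (in particular, under isomorphism): whenever a finite
graph `H` belongs to the class, so does every graph with an induced embedding into `H`. -/
def GraphClass.IsHereditary (C : GraphClass) : Prop :=
  ∀ (V W : Type) [Finite V] [Finite W] (G : SimpleGraph V) (H : SimpleGraph W),
    G.IsIndContained H → C W H → C V G

section
variable {V : Type} (G : SimpleGraph V)

/-- A closed walk, bundled with its base vertex. -/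
abbrev ClosedWalk : Type := Σ v : V, G.Walk v v

/-- `B_G(S, d)`: the vertices at distance at most `d` from some vertex of `S`. -/
def ballAround (S : Set V) (d : ℕ) : Set V := {u | ∃ v ∈ S, G.edist u v ≤ d}

/-- `G - A` is a forest. -/
def IsForestWithout (A : Set V) : Prop := (G.induce Aᶜ).IsAcyclic

variable {G} in
/-- The `k` closed walks are cycles that are pairwise vertex-disjoint. -/
structure IsCyclePacking {k : ℕ} (p : Fin k → ClosedWalk G) : Prop where
  isCycle : ∀ i, (p i).2.IsCycle
  disjoint : ∀ i j, i ≠ j → (p i).2.support.Disjoint (p j).2.support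

variable {G} in
/-- The `k` closed walks are pairwise vertex-disjoint cycles, with no edge of `G` between two of
them. -/
structure IsInducedCyclePacking {k : ℕ} (p : Fin k → ClosedWalk G) : Prop
    extends IsCyclePacking p where
  not_adj : ∀ i j, i ≠ j → ∀ u ∈ (p i).2.support, ∀ v ∈ (p j).2.support, ¬ G.Adj u v

end

/-! ### Programs and their running time

A random access machine given by structured programs. It has registers and arrays that hold
natural numbers and are named by natural numbers (a program mentions only finitely many names).
Each assignment, array access and test costs one step. Addition and truncated subtraction are the
only arithmetic operations, so one step lengthens the largest number in memory by at most one bit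
(beyond the constants of the program), and polynomial time here is the same as polynomial time on
Turing machines. -/

/-- A memory state: the contents of the registers and of the arrays. -/
structure State where
  reg : ℕ → ℕ
  arr : ℕ → ℕ → ℕ

/-- Write a register. -/
def State.setReg (s : State) (x v : ℕ) : State :=
  { s with reg := Function.update s.reg x v }

/-- Write cell `i` of array `a`. -/
def State.setArr (s : State) (a i v : ℕ) : State :=
  { s with arr := Function.update s.arr a (Function.update (s.arr a) i v) }

/-- Programs. The arguments `x y z` are register names, `a` is an array name, `c` a constant. -/
inductive Program where
  /-- `x := c` -/
  | const (x c : ℕ)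
  /-- `x := y + z` -/
  | add (x y z : ℕ)
  /-- `x := y - z`, truncated at `0` -/
  | sub (x y z : ℕ)
  /-- `x := a[y]` -/
  | load (x a y : ℕ)
  /-- `a[x] := y` -/
  | store (a x y : ℕ)
  /-- `P; Q` -/
  | seq (P Q : Program)
  /-- `if x < y then P else Q` -/
  | ite (x y : ℕ) (P Q : Program)
  /-- `while x < y do P` -/
  | while (x y : ℕ) (P : Program)

/-- `Runs P s t s'`: started in state `s`, the program `P` halts after exactly `t` steps, in
state `s'`. -/
inductive Runs : Program → State → ℕ → State → Prop where
  | const (s : State) (x c : ℕ) : Runs (.const x c) s 1 (s.setReg x c)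
  | add (s : State) (x y z : ℕ) : Runs (.add x y z) s 1 (s.setReg x (s.reg y + s.reg z))
  | sub (s : State) (x y z : ℕ) : Runs (.sub x y z) s 1 (s.setReg x (s.reg y - s.reg z))
  | load (s : State) (x a y : ℕ) : Runs (.load x a y) s 1 (s.setReg x (s.arr a (s.reg y)))
  | store (s : State) (a x y : ℕ) : Runs (.store a x y) s 1 (s.setArr a (s.reg x) (s.reg y))
  | seq {P Q : Program} {s s' s'' : State} {t t' : ℕ} :
      Runs P s t s' → Runs Q s' t' s'' → Runs (.seq P Q) s (t + t') s''
  | ite_true {x y : ℕ} {P Q : Program} {s s' : State} {t : ℕ} :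
      s.reg x < s.reg y → Runs P s t s' → Runs (.ite x y P Q) s (t + 1) s'
  | ite_false {x y : ℕ} {P Q : Program} {s s' : State} {t : ℕ} :
      ¬ s.reg x < s.reg y → Runs Q s t s' → Runs (.ite x y P Q) s (t + 1) s'
  | while_true {x y : ℕ} {P : Program} {s s' s'' : State} {t t' : ℕ} :
      s.reg x < s.reg y → Runs P s t s' → Runs (.while x y P) s' t' s'' →
      Runs (.while x y P) s (t + t' + 1) s''
  | while_false {x y : ℕ} {P : Program} {s : State} :
      ¬ s.reg x < s.reg y → Runs (.while x y P) s 1 s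

/-- The initial state on input `l`: the list is stored in array `0` and its length in
register `0`; everything else is `0`. -/
def initState (l : List ℕ) : State where
  reg := Function.update (fun _ => 0) 0 l.length
  arr := Function.update (fun _ _ => 0) 0 (fun i => l.getD i 0)

/-- The output in a final state: the contents of array `1`, up to the length in register `1`. -/
def State.output (s : State) : List ℕ := (List.range (s.reg 1)).map (s.arr 1)

/-- On input `l`, the program `P` halts within `T` steps and outputs `out`. -/
def Program.OutputsWithin (P : Program) (l out : List ℕ) (T : ℕ) : Prop :=
  ∃ (t : ℕ) (s : State), t ≤ T ∧ Runs P (initState l) t s ∧ s.output = out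

/-! ### Encoding of inputs and outputs -/

open Classical in
/-- The input consisting of a graph `G` on `{0, …, n-1}` and a number `k`: the numbers `n` and
`k`, followed by the adjacency matrix of `G`, row by row. -/
noncomputable def encodeInput {n : ℕ} (G : SimpleGraph (Fin n)) (k : ℕ) : List ℕ :=
  n :: k :: (List.finRange n).flatMap fun i =>
    (List.finRange n).map fun j => if G.Adj i j then 1 else 0

/-- A family of closed walks is output as the number `0` followed, for each walk, by the length
of its vertex sequence (first vertex repeated at the end) and this sequence itself. -/
def encodeWalks {n k : ℕ} {G : SimpleGraph (Fin n)} (p : Fin k → ClosedWalk G) : List ℕ :=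
  0 :: (List.ofFn p).flatMap fun w => w.2.support.length :: w.2.support.map Fin.val

/-- A set of vertices is output as the number `1` followed by a list of its elements, without
repetition and in any order. -/
def EncodesSet {n : ℕ} (X : Finset (Fin n)) (out : List ℕ) : Prop :=
  ∃ l : List (Fin n), l.Nodup ∧ l.toFinset = X ∧ out = 1 :: l.map Fin.val

/-- `out` describes an induced packing of `k` cycles of `G`, or a set `X` of at most `b` vertices
such that `G - B_G(X, 1)` is a forest. -/
def IsSolution {n : ℕ} (G : SimpleGraph (Fin n)) (k : ℕ) (b : ℝ) (out : List ℕ) : Prop :=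
  (∃ p : Fin k → ClosedWalk G, IsInducedCyclePacking p ∧ out = encodeWalks p) ∨
  (∃ X : Finset (Fin n), (X.card : ℝ) ≤ b ∧ IsForestWithout G (ballAround G X 1) ∧
    EncodesSet X out)

end InducedErdosPosa

/-! ### Expressions with bounded sums and iterated arrays, and their compilation. -/

namespace InducedErdosPosa

/-! Fix `k` and let `H` be the integer part of `h k`. The graph is exhausted in stages. Stage `i`
works in the set `V i` of vertices not yet deleted. It starts with a shortest cycle of `G[V i]` and
keeps adding shortest ears, which gives a connected induced subgraph `G[W i]` with degrees two and
three and no adjacent branch vertices (those of degree three). A set `X i` collects the balls of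
radius two around the branch vertices, plus at most four vertices of the starting cycle. An ear
joins two distinct nonadjacent vertices of `W i` outside `X i`; its interior avoids `W i` and the
neighbours of `X i`, and sees only the two ends in `W i`. Because ears and the starting cycle are
shortest, every outside vertex without a neighbour in `X i` keeps at most one neighbour in `W i`
(`MinStart.good`, `MinEar.good`). When no ear is left, `W i` and its neighbours are deleted. The
stages end when no cycle remains.

Let `W` and `X` be the unions over the stages. If `G[W]` has `k` disjoint cycles, deleting the
vertices of `X` that are on none of them, and then pruning vertices of degree less than two, leaves
induced cycles without edges between them, the given ones included (`Skel.exists_pack`). Otherwise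
the hypothesis, applied to `G[W]`, gives `H` vertices that meet all its cycles, and counting edges
leaves at most `4 H` branch vertices (`Skel.card_branch_le`). Each stage contains a cycle, so
without a packing there are at most `k - 1` stages. Hence `X` has at most `52 H + 4 (k - 1)`
vertices, and all its subsets can be tested in time that is a function of `k` times a polynomial in
`n`. This finds a packing without finding disjoint cycles first.

A cycle that avoids the closed neighbourhood of `X` may still come close to `W`. With no ear left,
it then produces a hanging cycle: one that attaches to `W i` only at one vertex or at two adjacent
vertices (`not_hang`). The second phase treats hanging pairs from the last stage to the first. It
picks an induced cycle for the pair, records it if it is disjoint from and not adjacent to the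
recorded cycles, and adds to `X` the ball of radius two around one vertex of the pair. If the cycle
touches a recorded one, it is charged to the first later stage that can be reached from there; no
stage is charged twice (`Charged.charge`). Either `k` cycles get recorded, or at most `k - 1` are
recorded and at most `k - 2` charged, so `X` ends with at most `52 H + 4 (k - 1) + 13 ((k - 1) + (k
- 2)) = 52 H + 30 k - 43` vertices, below the claimed bound. With no hanging pair left, a cycle
avoiding the closed neighbourhood of `X` would survive all deletions, although the last stage leaves
no cycle (`Fam.no_thick`).

The algorithm carries out this proof; the program itself does not depend on the class or on `h`. Its
atomic actions fill an array with the values of an expression in time polynomial in `n + k`, so it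
remains to count atomic actions. Cycles are handled through thick sets, whose minimal nonempty
members are vertex sets of induced cycles and whose largest member in a set is computed by pruning.
The global arrays hold: 0 the input, 1 and 2 the output and its length, 3 and 4 the sets `W` and
`X`, 5 the level of each vertex, 6 the current stage, 7 the status (0 running, 1 no cycle left, 2
packing found), 8 and 9 the tested subset and the candidate packing, 10 to 12 a chosen length and
ends, 13 a new ear or cycle, 14 the recorded cycles, 15 to 17 the state of the output routine. -/

/-- Arithmetic expressions with bounded sums and iterated arrays, in parametric higher-order
abstract syntax: `V` is the type of variables and `A` the type of arrays. -/
inductive Expr (V A : Type) : Type where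
  | var (v : V)
  | num (c : ℕ)
  | add (a b : Expr V A)
  | sub (a b : Expr V A)
  | cond (a b c d : Expr V A)
  | read (a : A) (e : Expr V A)
  | sum (f : V → Expr V A)
  | iter (f : V → Expr V A) (g : V → A → V → Expr V A) (b : A → Expr V A)

namespace Expr

/-- The array obtained by iterating `g` for `t` rounds, starting with `f`; arrays vanish from
index `N` on. -/
def iterate (N : ℕ) (f : ℕ → ℕ) (g : ℕ → (ℕ → ℕ) → ℕ → ℕ) : ℕ → ℕ → ℕ
  | 0 => fun i => if i < N then f i else 0
  | t + 1 => fun i => if i < N then g t (iterate N f g t) i else 0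

/-- The value of an expression; sums range over the numbers below `N`. -/
def eval (N : ℕ) : Expr ℕ (ℕ → ℕ) → ℕ
  | var v => v
  | num c => c
  | add a b => eval N a + eval N b
  | sub a b => eval N a - eval N b
  | cond a b c d => if eval N a < eval N b then eval N c else eval N d
  | read a e => a (eval N e)
  | sum f => ∑ i ∈ Finset.range N, eval N (f i)
  | iter f g b => eval N
      (b (iterate N (fun i => eval N (f i)) (fun t A i => eval N (g t A i)) N))

/-- Two instances of the same parametric expression: one over names, one over values. -/
def Wf : List (ℕ × ℕ) → List (ℕ × (ℕ → ℕ)) → Expr ℕ ℕ → Expr ℕ (ℕ → ℕ) → Prop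
  | Γ, _, var x, var v => (x, v) ∈ Γ
  | _, _, num c, num d => c = d
  | Γ, Δ, add a b, add a' b' => Wf Γ Δ a a' ∧ Wf Γ Δ b b'
  | Γ, Δ, sub a b, sub a' b' => Wf Γ Δ a a' ∧ Wf Γ Δ b b'
  | Γ, Δ, cond a b c d, cond a' b' c' d' => Wf Γ Δ a a' ∧ Wf Γ Δ b b' ∧ Wf Γ Δ c c' ∧ Wf Γ Δ d d'
  | Γ, Δ, read a e, read a' e' => (a, a') ∈ Δ ∧ Wf Γ Δ e e'
  | Γ, Δ, sum f, sum f' => ∀ x v, Wf ((x, v) :: Γ) Δ (f x) (f' v)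
  | Γ, Δ, iter f g b, iter f' g' b' =>
      (∀ x v, Wf ((x, v) :: Γ) Δ (f x) (f' v)) ∧
      (∀ x v a A y w, Wf ((y, w) :: (x, v) :: Γ) ((a, A) :: Δ) (g x a y) (g' v A w)) ∧
      ∀ a A, Wf Γ ((a, A) :: Δ) (b a) (b' A)
  | _, _, _, _ => False

end Expr

/-- `for i < N do (body; a[i] := m)`, where register `0` holds `N`. -/
def fillProg (a i m : ℕ) (body : Program) : Program :=
  .seq (.const i 0) (.while i 0
    (.seq body (.seq (.store a i m) (.seq (.const m 1) (.add i i m)))))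

/-- Compile an expression; the value ends up in register `ℓ`, and no register or array with a
smaller name is changed. -/
def Expr.compile : ℕ → Expr ℕ ℕ → Program
  -- There is no copy instruction, so the value is added to zero. This needs `x ≠ ℓ`, which holds
  -- because context names are below `ℓ`.
  | ℓ, .var x => .seq (.const ℓ 0) (.add ℓ ℓ x)
  | ℓ, .num c => .const ℓ c
  | ℓ, .add a b => .seq (compile ℓ a) (.seq (compile (ℓ + 1) b) (.add ℓ ℓ (ℓ + 1)))
  | ℓ, .sub a b => .seq (compile ℓ a) (.seq (compile (ℓ + 1) b) (.sub ℓ ℓ (ℓ + 1)))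
  | ℓ, .cond a b c d => .seq (compile ℓ a) (.seq (compile (ℓ + 1) b)
      (.ite ℓ (ℓ + 1) (compile ℓ c) (compile ℓ d)))
  | ℓ, .read a e => .seq (compile ℓ e) (.load ℓ a ℓ)
  | ℓ, .sum f => .seq (.const ℓ 0) (.seq (.const (ℓ + 1) 0) (.while (ℓ + 1) 0
      (.seq (compile (ℓ + 2) (f (ℓ + 1))) (.seq (.add ℓ ℓ (ℓ + 2))
        (.seq (.const (ℓ + 2) 1) (.add (ℓ + 1) (ℓ + 1) (ℓ + 2)))))))
  | ℓ, .iter f g b => .seq (fillProg ℓ (ℓ + 1) (ℓ + 2) (compile (ℓ + 2) (f (ℓ + 1))))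
      (.seq (.const ℓ 0) (.seq (.while ℓ 0
        (.seq (fillProg (ℓ + 1) (ℓ + 1) (ℓ + 2) (compile (ℓ + 2) (g ℓ ℓ (ℓ + 1))))
        -- The new round is computed into array `ℓ + 1` while array `ℓ` is still being read, and
        -- only then copied back.
        (.seq (fillProg ℓ (ℓ + 1) (ℓ + 2) (.load (ℓ + 2) (ℓ + 1) (ℓ + 1)))
        (.seq (.const (ℓ + 1) 1) (.add ℓ ℓ (ℓ + 1))))))
      (.seq (compile (ℓ + 1) (b ℓ)) (.seq (.const ℓ 0) (.add ℓ ℓ (ℓ + 1))))))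

/-- `s'` agrees with `s` on the registers and arrays with names below `ℓ`. -/
def Agree (ℓ : ℕ) (s s' : State) : Prop :=
  (∀ r < ℓ, s'.reg r = s.reg r) ∧ ∀ a < ℓ, s'.arr a = s.arr a

/-- Register `0` holds `N`, and all arrays but the input vanish from `N` on. -/
def Clean (N : ℕ) (s : State) : Prop :=
  s.reg 0 = N ∧ ∀ a ≥ 1, ∀ i ≥ N, s.arr a i = 0

lemma Agree.trans {ℓ : ℕ} {s s' s'' : State} (h : Agree ℓ s s') (h' : Agree ℓ s' s'') :
    Agree ℓ s s'' :=
  ⟨fun r hr => (h'.1 r hr).trans (h.1 r hr), fun a ha => (h'.2 a ha).trans (h.2 a ha)⟩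

lemma Agree.mono {ℓ ℓ' : ℕ} {s s' : State} (h : Agree ℓ s s') (hl : ℓ' ≤ ℓ) : Agree ℓ' s s' :=
  ⟨fun r hr => h.1 r (hr.trans_le hl), fun a ha => h.2 a (ha.trans_le hl)⟩

@[simp] lemma setReg_reg (s : State) (x v r : ℕ) :
    (s.setReg x v).reg r = if r = x then v else s.reg r := by
  simp [State.setReg, Function.update_apply]

@[simp] lemma setReg_arr (s : State) (x v : ℕ) : (s.setReg x v).arr = s.arr := rfl

@[simp] lemma setArr_reg (s : State) (a i v : ℕ) : (s.setArr a i v).reg = s.reg := rfl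

@[simp] lemma setArr_arr (s : State) (a i v b : ℕ) :
    (s.setArr a i v).arr b = if b = a then Function.update (s.arr a) i v else s.arr b := by
  simp [State.setArr, Function.update_apply]

lemma Agree.setReg {ℓ : ℕ} {s : State} {x v : ℕ} (h : ℓ ≤ x) : Agree ℓ s (s.setReg x v) :=
  ⟨fun r hr => by simp; omega, fun _ _ => rfl⟩

lemma Clean.setReg {N : ℕ} {s : State} {x v : ℕ} (h : Clean N s) (hx : 1 ≤ x) :
    Clean N (s.setReg x v) :=
  ⟨by rw [setReg_reg, if_neg (by omega)]; exact h.1, h.2⟩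

lemma Clean.setArr {N : ℕ} {s : State} {a i v : ℕ} (h : Clean N s) (hi : i < N) :
    Clean N (s.setArr a i v) := by
  refine ⟨h.1, fun b hb j hj => ?_⟩
  have := h.2 b hb j hj
  simp only [setArr_arr]
  split_ifs with hba
  · subst hba
    rw [Function.update_of_ne (by omega)]
    exact this
  · exact this

/-- A counting loop. -/
lemma runs_while_count {N i T : ℕ} {body : Program} (Inv : ℕ → State → Prop)
    (hreg : ∀ j s, Inv j s → s.reg i = j ∧ s.reg 0 = N)
    (hstep : ∀ j s, j < N → Inv j s → ∃ t s', Runs body s t s' ∧ t ≤ T ∧ Inv (j + 1) s') :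
    ∀ d j s, j + d = N → Inv j s →
      ∃ t s', Runs (.while i 0 body) s t s' ∧ t ≤ d * (T + 1) + 1 ∧ Inv N s' := by
  intro d
  induction d with
  | zero =>
    intro j s hj hI
    obtain ⟨h1, h2⟩ := hreg j s hI
    refine ⟨1, s, .while_false (by omega), by omega, ?_⟩
    obtain rfl : j = N := by omega
    exact hI
  | succ d ih =>
    intro j s hj hI
    obtain ⟨h1, h2⟩ := hreg j s hI
    obtain ⟨t, s', hr, ht, hI'⟩ := hstep j s (by omega) hI
    obtain ⟨t', s'', hr', ht', hI''⟩ := ih (j + 1) s' (by omega) hI'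
    refine ⟨_, s'', .while_true (by omega) hr hr', ?_, hI''⟩
    have : (d + 1) * (T + 1) = d * (T + 1) + (T + 1) := by ring
    omega

/-- Array `a` is exempt from the agreement that the body may rely on, since part of it is already
overwritten. A body that reads its own target therefore does not qualify; such updates go through an
auxiliary array. -/
lemma fillProg_runs {N a i m T : ℕ} {body : Program} {s₀ : State} {F : ℕ → ℕ}
    (hi : 1 ≤ i) (him : m = i + 1) (ham : a < m)
    (hs₀ : Clean N s₀)
    (hbody : ∀ s j, j < N → Clean N s → s.reg i = j → (∀ r < i, s.reg r = s₀.reg r) →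
      (∀ b < m, b ≠ a → s.arr b = s₀.arr b) →
      ∃ t s', Runs body s t s' ∧ t ≤ T ∧ s'.reg m = F j ∧ Agree m s s' ∧ Clean N s') :
    ∃ t s', Runs (fillProg a i m body) s₀ t s' ∧ t ≤ N * (T + 4) + 2 ∧
      (s'.arr a = fun j => if j < N then F j else s₀.arr a j) ∧
      (∀ b < m, b ≠ a → s'.arr b = s₀.arr b) ∧ (∀ r < i, s'.reg r = s₀.reg r) ∧ Clean N s' := by
  let Inv : ℕ → State → Prop := fun j s => s.reg i = j ∧ Clean N s ∧
    (s.arr a = fun l => if l < j then F l else s₀.arr a l) ∧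
    (∀ b < m, b ≠ a → s.arr b = s₀.arr b) ∧ (∀ r < i, s.reg r = s₀.reg r)
  obtain ⟨t, s', hr, ht, hI⟩ := runs_while_count (N := N) (i := i) (T := T + 3)
    (body := .seq body (.seq (.store a i m) (.seq (.const m 1) (.add i i m)))) Inv
    (fun j s h => ⟨h.1, h.2.1.1⟩) (by
      rintro j s hj ⟨h1, h2, h3, h4, h5⟩
      obtain ⟨t, s', hr, ht, hF, hA, hC⟩ := hbody s j hj h2 h1 h5 h4
      have hi' : s'.reg i = j := by rw [hA.1 i (by omega), h1]
      refine ⟨_, _, .seq hr (.seq (.store _ _ _ _) (.seq (.const _ _ _) (.add _ _ _ _))),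
        by omega, ?_, ?_, ?_, ?_, ?_⟩
      · have : i ≠ m := by omega
        simp [this, hi']
      · exact ((hC.setArr (by omega)).setReg (by omega)).setReg hi
      · funext l
        have := hA.2 a ham
        simp only [setReg_arr, setArr_arr, if_true, this, h3, hF, hi', Function.update_apply]
        split_ifs <;> first | rfl | omega | (subst_vars; rfl)
      · intro b hb hba
        simp [hba, hA.2 b hb, h4 b hb hba]
      · intro r hr
        have h6 : r ≠ i := by omega
        have h7 : r ≠ m := by omega
        simp [h6, h7, hA.1 r (by omega), h5 r hr])
    N 0 (s₀.setReg i 0) (by omega)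
    ⟨by simp, hs₀.setReg hi, by simp, by simp, fun r hr => by
      have : r ≠ i := by omega
      simp [this]⟩
  obtain ⟨-, h2, h3, h4, h5⟩ := hI
  refine ⟨_, s', .seq (.const _ _ _) hr, ?_, h3, h4, h5, h2⟩
  have : T + 3 + 1 = T + 4 := by omega
  rw [this] at ht
  omega

/-- Resource bounds of the form `K (N + 1) ^ K`. -/
def unit (N K : ℕ) : ℕ := K * (N + 1) ^ K

lemma unit_mono {N K K' : ℕ} (h : K ≤ K') : unit N K ≤ unit N K' :=
  Nat.mul_le_mul h (Nat.pow_le_pow_right (by omega) h)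

/-- One number serves both as factor and as exponent, so the inductions on programs carry a single
constant. Sequential composition adds the constants, and the next lemma does the same for a loop of
`N` rounds. -/
lemma add_unit_le (N c K K' : ℕ) : unit N K + unit N K' + c ≤ unit N (K + K' + c) := by
  have h1 : (N + 1) ^ K ≤ (N + 1) ^ (K + K' + c) := Nat.pow_le_pow_right (by omega) (by omega)
  have h2 : (N + 1) ^ K' ≤ (N + 1) ^ (K + K' + c) := Nat.pow_le_pow_right (by omega) (by omega)
  have h3 : 1 ≤ (N + 1) ^ (K + K' + c) := Nat.one_le_pow _ _ (by omega)
  unfold unit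
  nlinarith [Nat.mul_le_mul_left K h1, Nat.mul_le_mul_left K' h2, Nat.mul_le_mul_left c h3]

lemma mul_unit_le (N c d K : ℕ) : N * (unit N K + c) + d ≤ unit N (K + c + d + 1) := by
  have h3 : 1 ≤ (N + 1) ^ K := Nat.one_le_pow _ _ (by omega)
  have h4 : (N + 1) * (N + 1) ^ K ≤ (N + 1) ^ (K + c + d + 1) := by
    rw [← pow_succ']
    exact Nat.pow_le_pow_right (by omega) (by omega)
  unfold unit
  calc N * (K * (N + 1) ^ K + c) + d ≤ (K + c + d) * ((N + 1) * (N + 1) ^ K) := by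
        have h5 : N * c ≤ N * c * (N + 1) ^ K := Nat.le_mul_of_pos_right _ h3
        have h6 : d ≤ d * ((N + 1) * (N + 1) ^ K) := Nat.le_mul_of_pos_right _ (by positivity)
        nlinarith [Nat.zero_le (c * (N + 1) ^ K), Nat.zero_le (K * (N + 1) ^ K)]
    _ ≤ (K + c + d + 1) * (N + 1) ^ (K + c + d + 1) := Nat.mul_le_mul (by omega) h4

end InducedErdosPosa

namespace InducedErdosPosa

/-- Induction on the expression over names. The constant `K` is chosen before the value instance,
the contexts and `N`, so one polynomial bounds the time on all inputs. Context names lie below `ℓ`,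
where compiled code changes nothing, so the contexts stay valid from one subprogram to the next. -/
theorem compile_runs (e : Expr ℕ ℕ) : ∀ ℓ, 1 ≤ ℓ → ∃ K, ∀ (e' : Expr ℕ (ℕ → ℕ))
    (Γ : List (ℕ × ℕ)) (Δ : List (ℕ × (ℕ → ℕ))), e.Wf Γ Δ e' → ∀ (N : ℕ) (s : State), Clean N s →
    (∀ p ∈ Γ, p.1 < ℓ ∧ s.reg p.1 = p.2) → (∀ p ∈ Δ, p.1 < ℓ ∧ s.arr p.1 = p.2) →
    ∃ t s', Runs (e.compile ℓ) s t s' ∧ t ≤ unit N K ∧ s'.reg ℓ = e'.eval N ∧ Agree ℓ s s' ∧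
      Clean N s' := by
  have hctx : ∀ {ℓ ℓ' : ℕ} {Γ : List (ℕ × ℕ)} {s s' : State}, ℓ ≤ ℓ' → Agree ℓ s s' →
      (∀ p ∈ Γ, p.1 < ℓ ∧ s.reg p.1 = p.2) → ∀ p ∈ Γ, p.1 < ℓ' ∧ s'.reg p.1 = p.2 :=
    fun hl hA h p hp => ⟨(h p hp).1.trans_le hl, (hA.1 _ (h p hp).1).trans (h p hp).2⟩
  have hctx' : ∀ {ℓ ℓ' : ℕ} {Δ : List (ℕ × (ℕ → ℕ))} {s s' : State}, ℓ ≤ ℓ' → Agree ℓ s s' →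
      (∀ p ∈ Δ, p.1 < ℓ ∧ s.arr p.1 = p.2) → ∀ p ∈ Δ, p.1 < ℓ' ∧ s'.arr p.1 = p.2 :=
    fun hl hA h p hp => ⟨(h p hp).1.trans_le hl, (hA.2 _ (h p hp).1).trans (h p hp).2⟩
  have h1 : ∀ N c, c ≤ unit N c := fun N c => Nat.le_mul_of_pos_right _ (by positivity)
  induction e with
  | var x =>
    intro ℓ hℓ
    refine ⟨2, fun e' Γ Δ hw N s hs hΓ hΔ => ?_⟩
    cases e' <;> simp only [Expr.Wf] at hw
    obtain ⟨hx, hx'⟩ := hΓ _ hw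
    refine ⟨_, _, .seq (.const _ _ _) (.add _ _ _ _), h1 N 2, ?_, ?_, ?_⟩
    · have : x ≠ ℓ := by simp at hx; omega
      simp at hx'
      simp [this, hx', Expr.eval]
    · exact (Agree.setReg le_rfl).trans (Agree.setReg le_rfl)
    · exact (hs.setReg hℓ).setReg hℓ
  | num c =>
    intro ℓ hℓ
    refine ⟨2, fun e' Γ Δ hw N s hs hΓ hΔ => ?_⟩
    cases e' <;> simp only [Expr.Wf] at hw
    subst hw
    exact ⟨_, _, .const _ _ _, (by omega : 1 ≤ 2).trans (h1 N 2), by simp [Expr.eval],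
      Agree.setReg le_rfl, hs.setReg hℓ⟩
  | add a b iha ihb =>
    intro ℓ hℓ
    obtain ⟨K, hK⟩ := iha ℓ hℓ
    obtain ⟨K', hK'⟩ := ihb (ℓ + 1) (by omega)
    refine ⟨K + K' + 1, fun e' Γ Δ hw N s hs hΓ hΔ => ?_⟩
    cases e' <;> simp only [Expr.Wf] at hw
    obtain ⟨t, s', hr, ht, hv, hA, hC⟩ := hK _ Γ Δ hw.1 N s hs hΓ hΔ
    obtain ⟨t', s'', hr', ht', hv', hA', hC'⟩ := hK' _ Γ Δ hw.2 N s' hC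
      (hctx (by omega) hA hΓ) (hctx' (by omega) hA hΔ)
    refine ⟨_, _, .seq hr (.seq hr' (.add _ _ _ _)), ?_, ?_, ?_, hC'.setReg hℓ⟩
    · have := add_unit_le N 1 K K'; omega
    · simp [hv', hA'.1 ℓ (by omega), hv, Expr.eval]
    · exact (hA.trans (hA'.mono (by omega))).trans (Agree.setReg le_rfl)
  | sub a b iha ihb =>
    intro ℓ hℓ
    obtain ⟨K, hK⟩ := iha ℓ hℓ
    obtain ⟨K', hK'⟩ := ihb (ℓ + 1) (by omega)
    refine ⟨K + K' + 1, fun e' Γ Δ hw N s hs hΓ hΔ => ?_⟩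
    cases e' <;> simp only [Expr.Wf] at hw
    obtain ⟨t, s', hr, ht, hv, hA, hC⟩ := hK _ Γ Δ hw.1 N s hs hΓ hΔ
    obtain ⟨t', s'', hr', ht', hv', hA', hC'⟩ := hK' _ Γ Δ hw.2 N s' hC
      (hctx (by omega) hA hΓ) (hctx' (by omega) hA hΔ)
    refine ⟨_, _, .seq hr (.seq hr' (.sub _ _ _ _)), ?_, ?_, ?_, hC'.setReg hℓ⟩
    · have := add_unit_le N 1 K K'; omega
    · simp [hv', hA'.1 ℓ (by omega), hv, Expr.eval]
    · exact (hA.trans (hA'.mono (by omega))).trans (Agree.setReg le_rfl)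
  | cond a b c d iha ihb ihc ihd =>
    intro ℓ hℓ
    obtain ⟨K, hK⟩ := iha ℓ hℓ
    obtain ⟨K', hK'⟩ := ihb (ℓ + 1) (by omega)
    obtain ⟨Kc, hKc⟩ := ihc ℓ hℓ
    obtain ⟨Kd, hKd⟩ := ihd ℓ hℓ
    refine ⟨(K + K' + 1) + (Kc + Kd + 0) + 0, fun e' Γ Δ hw N s hs hΓ hΔ => ?_⟩
    have hle := add_unit_le N 0 (K + K' + 1) (Kc + Kd + 0)
    have hle1 := add_unit_le N 1 K K'
    have hle2 := add_unit_le N 0 Kc Kd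
    cases e' <;> simp only [Expr.Wf] at hw
    obtain ⟨t, s', hr, ht, hv, hA, hC⟩ := hK _ Γ Δ hw.1 N s hs hΓ hΔ
    obtain ⟨t', s'', hr', ht', hv', hA', hC'⟩ := hK' _ Γ Δ hw.2.1 N s' hC
      (hctx (by omega) hA hΓ) (hctx' (by omega) hA hΔ)
    have hA'' := hA.trans (hA'.mono (by omega))
    obtain ⟨tc, sc, hrc, htc, hvc, hAc, hCc⟩ := hKc _ Γ Δ hw.2.2.1 N s'' hC'
      (hctx le_rfl hA'' hΓ) (hctx' le_rfl hA'' hΔ)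
    obtain ⟨td, sd, hrd, htd, hvd, hAd, hCd⟩ := hKd _ Γ Δ hw.2.2.2 N s'' hC'
      (hctx le_rfl hA'' hΓ) (hctx' le_rfl hA'' hΔ)
    have e1 := Iff.of_eq (congrArg₂ (· < ·) ((hA'.1 ℓ (by omega)).trans hv) hv')
    by_cases hlt : s''.reg ℓ < s''.reg (ℓ + 1)
    · refine ⟨_, _, .seq hr (.seq hr' (.ite_true hlt hrc)), by omega, ?_, hA''.trans hAc, hCc⟩
      rw [Expr.eval, if_pos (e1.1 hlt), hvc]
    · refine ⟨_, _, .seq hr (.seq hr' (.ite_false hlt hrd)), by omega, ?_, hA''.trans hAd, hCd⟩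
      rw [Expr.eval, if_neg (mt e1.2 hlt), hvd]
  | read a e ih =>
    intro ℓ hℓ
    obtain ⟨K, hK⟩ := ih ℓ hℓ
    refine ⟨K + 0 + 1, fun e' Γ Δ hw N s hs hΓ hΔ => ?_⟩
    cases e' <;> simp only [Expr.Wf] at hw
    obtain ⟨t, s', hr, ht, hv, hA, hC⟩ := hK _ Γ Δ hw.2 N s hs hΓ hΔ
    obtain ⟨ha, ha'⟩ := hΔ _ hw.1
    refine ⟨_, _, .seq hr (.load _ _ _ _), ?_, ?_, hA.trans (Agree.setReg le_rfl), hC.setReg hℓ⟩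
    · have := add_unit_le N 1 K 0; omega
    · simp only at ha ha'
      simp [hv, hA.2 _ ha, ha', Expr.eval]
  | sum f ih =>
    intro ℓ hℓ
    -- The bound variable lives in register `ℓ + 1` and the running sum in register `ℓ`, so the body
    -- is compiled from `ℓ + 2` on.
    obtain ⟨K, hK⟩ := ih (ℓ + 1) (ℓ + 2) (by omega)
    refine ⟨K + 4 + 3 + 1, fun e' Γ Δ hw N s hs hΓ hΔ => ?_⟩
    cases e' <;> simp only [Expr.Wf] at hw
    rename_i f'
    let Inv : ℕ → State → Prop := fun j s' => s'.reg (ℓ + 1) = j ∧ Clean N s' ∧ Agree ℓ s s' ∧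
      s'.reg ℓ = ∑ i ∈ Finset.range j, (f' i).eval N
    obtain ⟨t, s', hr, ht, -, hC, hA, hv⟩ := runs_while_count (N := N) (i := ℓ + 1)
      (T := unit N K + 3)
      (body := .seq ((f (ℓ + 1)).compile (ℓ + 2)) (.seq (.add ℓ ℓ (ℓ + 2))
        (.seq (.const (ℓ + 2) 1) (.add (ℓ + 1) (ℓ + 1) (ℓ + 2))))) Inv
      (fun j s h => ⟨h.1, h.2.1.1⟩) (by
        rintro j s' hj ⟨h1, h2, h3, h4⟩
        obtain ⟨t, s'', hr, ht, hv, hA, hC⟩ := hK _ ((ℓ + 1, j) :: Γ) Δ (hw _ _) N s' h2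
          (by
            intro p hp
            rcases List.mem_cons.1 hp with rfl | hp
            · exact ⟨by simp, h1⟩
            · exact hctx (by omega) h3 hΓ p hp) (hctx' (by omega) h3 hΔ)
        refine ⟨_, _, .seq hr (.seq (.add _ _ _ _) (.seq (.const _ _ _) (.add _ _ _ _))),
          by omega, ?_, ?_, ?_, ?_⟩
        · simp [hA.1 (ℓ + 1) (by omega), h1]
        · exact ((hC.setReg hℓ).setReg (by omega)).setReg (by omega)
        · exact ((((h3.trans (hA.mono (by omega))).trans (Agree.setReg le_rfl))).trans
            (Agree.setReg (by omega))).trans (Agree.setReg (by omega))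
        · simp [hA.1 ℓ (by omega), h4, hv, Finset.sum_range_succ])
      N 0 ((s.setReg ℓ 0).setReg (ℓ + 1) 0) (by omega)
      ⟨by simp, (hs.setReg hℓ).setReg (by omega),
        (Agree.setReg le_rfl).trans (Agree.setReg (by omega)), by simp⟩
    refine ⟨_, s', .seq (.const _ _ _) (.seq (.const _ _ _) hr), ?_, by rw [hv, Expr.eval], hA, hC⟩
    have := mul_unit_le N 4 3 K
    rw [show unit N K + 3 + 1 = unit N K + 4 by omega] at ht
    omega
  | iter f g b ihf ihg ihb =>
    intro ℓ hℓ
    obtain ⟨K, hK⟩ := ihf (ℓ + 1) (ℓ + 2) (by omega)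
    obtain ⟨K', hK'⟩ := ihg ℓ ℓ (ℓ + 1) (ℓ + 2) (by omega)
    obtain ⟨Kb, hKb⟩ := ihb ℓ (ℓ + 1) (by omega)
    -- Bounds one round: `N * (unit N K' + 4) + 2` steps for the new array, then `N * 5 + 2` steps
    -- to copy it.
    let M := ((K' + 4 + 2 + 1) + (0 + 5 + 2 + 1) + 0)
    refine ⟨(K + 4 + 2 + 1) + ((M + 3 + 1 + 1) + Kb + 3) + 0, fun e' Γ Δ hw N s hs hΓ hΔ => ?_⟩
    cases e' <;> simp only [Expr.Wf] at hw
    rename_i f' g' b'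
    obtain ⟨hwf, hwg, hwb⟩ := hw
    set A : ℕ → ℕ → ℕ := Expr.iterate N (fun i => (f' i).eval N) (fun t A i => (g' t A i).eval N)
      with hAdef
    obtain ⟨t₀, s₀, hr₀, ht₀, ha₀, hb₀, hr₀', hC₀⟩ := fillProg_runs (N := N) (a := ℓ) (i := ℓ + 1)
      (m := ℓ + 2) (T := unit N K) (body := (f (ℓ + 1)).compile (ℓ + 2)) (s₀ := s)
      (F := fun i => (f' i).eval N) (by omega) rfl (by omega) hs (by
        intro s' j hj hC hi hr hb
        have hag : Agree ℓ s s' := ⟨fun r h => hr r (by omega), fun b h => hb b (by omega) (by omega)⟩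
        exact hK _ ((ℓ + 1, j) :: Γ) Δ (hwf _ _) N s' hC (by
            intro p hp
            rcases List.mem_cons.1 hp with rfl | hp
            · exact ⟨by simp, hi⟩
            · exact hctx (by omega) hag hΓ p hp) (hctx' (by omega) hag hΔ))
    have ha₀' : s₀.arr ℓ = A 0 := by
      rw [ha₀, hAdef]
      funext j
      simp only [Expr.iterate]
      split_ifs with hj
      · rfl
      · exact hs.2 ℓ hℓ j (by omega)
    let Inv : ℕ → State → Prop := fun j s' => s'.reg ℓ = j ∧ Clean N s' ∧ Agree ℓ s s' ∧
      s'.arr ℓ = A j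
    obtain ⟨t, s', hr, ht, -, hC, hA, hv⟩ := runs_while_count (N := N) (i := ℓ)
      (T := unit N M + 2)
      (body := (Program.seq (fillProg (ℓ + 1) (ℓ + 1) (ℓ + 2) ((g ℓ ℓ (ℓ + 1)).compile (ℓ + 2)))
        (.seq (fillProg ℓ (ℓ + 1) (ℓ + 2) (.load (ℓ + 2) (ℓ + 1) (ℓ + 1)))
        (.seq (.const (ℓ + 1) 1) (.add ℓ ℓ (ℓ + 1)))))) Inv
      (fun j s h => ⟨h.1, h.2.1.1⟩) (by
        rintro j s' hj ⟨h1, h2, h3, h4⟩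
        obtain ⟨t₁, s₁, hr₁, ht₁, ha₁, hb₁, hr₁', hC₁⟩ := fillProg_runs (N := N) (a := ℓ + 1)
          (i := ℓ + 1) (m := ℓ + 2) (T := unit N K') (body := (g ℓ ℓ (ℓ + 1)).compile (ℓ + 2))
          (s₀ := s') (F := fun i => (g' j (A j) i).eval N) (by omega) rfl (by omega) h2 (by
            intro s'' i hi hC hri hr hb
            have hag : Agree ℓ s s'' := h3.trans
              ⟨fun r h => hr r (by omega), fun b h => hb b (by omega) (by omega)⟩
            exact hK' _ ((ℓ + 1, i) :: (ℓ, j) :: Γ) ((ℓ, A j) :: Δ) (hwg _ _ _ _ _ _) N s'' hC (by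
                intro p hp
                rcases List.mem_cons.1 hp with rfl | hp
                · exact ⟨by simp, hri⟩
                rcases List.mem_cons.1 hp with rfl | hp
                · exact ⟨by simp, (hr ℓ (by omega)).trans h1⟩
                · exact hctx (by omega) hag hΓ p hp) (by
                intro p hp
                rcases List.mem_cons.1 hp with rfl | hp
                · exact ⟨by simp, (hb ℓ (by omega) (by omega)).trans h4⟩
                · exact hctx' (by omega) hag hΔ p hp))
        obtain ⟨t₂, s₂, hr₂, ht₂, ha₂, hb₂, hr₂', hC₂⟩ := fillProg_runs (N := N) (a := ℓ)
          (i := ℓ + 1) (m := ℓ + 2) (T := 1) (body := .load (ℓ + 2) (ℓ + 1) (ℓ + 1))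
          (s₀ := s₁) (F := fun i => s₁.arr (ℓ + 1) i) (by omega) rfl (by omega) hC₁ (by
            intro s'' i hi hC hri hr hb
            exact ⟨1, _, .load _ _ _ _, le_rfl, by simp [hri, hb (ℓ + 1)], Agree.setReg le_rfl,
              hC.setReg (by omega)⟩)
        refine ⟨_, _, .seq hr₁ (.seq hr₂ (.seq (.const _ _ _) (.add _ _ _ _))), ?_, ?_, ?_, ?_, ?_⟩
        · have e1 := mul_unit_le N 4 2 K'
          have e2 := mul_unit_le N 5 2 0
          have e3 := add_unit_le N 0 (K' + 4 + 2 + 1) (0 + 5 + 2 + 1)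
          have e4 : unit N 0 = 0 := by simp [unit]
          rw [e4] at e2
          have e5 : N * (1 + 4) = N * (0 + 5) := by ring
          simp only [M]
          omega
        · simp [hr₂' ℓ (by omega), hr₁' ℓ (by omega), h1]
        · exact (hC₂.setReg (by omega)).setReg hℓ
        · refine h3.trans ⟨fun r hr => ?_, fun b hb => ?_⟩
          · have e1 : r ≠ ℓ := by omega
            have e2 : r ≠ ℓ + 1 := by omega
            simp [e1, e2, hr₂' r (by omega), hr₁' r (by omega)]
          · simp [hb₂ b (by omega) (by omega), hb₁ b (by omega) (by omega)]
        · simp only [setReg_arr, ha₂, ha₁, hb₁ ℓ (by omega) (by omega), h4]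
          funext i
          rw [hAdef]
          simp only [Expr.iterate]
          split_ifs with hi
          · rfl
          -- From index `N` on, the iterates vanish by definition and the array by cleanliness.
          · have e1 := hC₂.2 ℓ hℓ i (by omega)
            have e2 : s₂.arr ℓ i = A j i := by
              rw [ha₂]; simp only [hi, if_false, hb₁ ℓ (by omega) (by omega), h4]
            rw [← hAdef, ← e2, e1])
      N 0 (s₀.setReg ℓ 0) (by omega)
      ⟨by simp, hC₀.setReg hℓ, by
        refine ⟨fun r hr => ?_, fun b hb => ?_⟩
        · have e1 : r ≠ ℓ := by omega
          simp [e1, hr₀' r (by omega)]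
        · simp [hb₀ b (by omega) (by omega)], by simpa using ha₀'⟩
    obtain ⟨tb, sb, hrb, htb, hvb, hAb, hCb⟩ := hKb _ Γ ((ℓ, A N) :: Δ) (hwb _ _) N s' hC
      (hctx (by omega) hA hΓ) (by
        intro p hp
        rcases List.mem_cons.1 hp with rfl | hp
        · exact ⟨by simp, hv⟩
        · exact hctx' (by omega) hA hΔ p hp)
    refine ⟨_, _, .seq hr₀ (.seq (.const _ _ _) (.seq hr (.seq hrb (.seq (.const _ _ _)
      (.add _ _ _ _))))), ?_, ?_, ?_, ?_⟩
    · have e1 := mul_unit_le N 4 2 K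
      have e2 := mul_unit_le N 3 1 M
      have e3 := add_unit_le N 3 (M + 3 + 1 + 1) Kb
      have e4 := add_unit_le N 0 (K + 4 + 2 + 1) ((M + 3 + 1 + 1) + Kb + 3)
      have e5 : unit N M + 2 + 1 = unit N M + 3 := by omega
      rw [e5] at ht
      omega
    · have e1 : ℓ + 1 ≠ ℓ := by omega
      simp only [setReg_reg, if_true, e1, if_false, hvb, zero_add, Expr.eval]
      rfl
    · exact ((hA.trans (hAb.mono (by omega))).trans (Agree.setReg le_rfl)).trans (Agree.setReg le_rfl)
    · exact (hCb.setReg hℓ).setReg hℓ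

end InducedErdosPosa

/-! ### While programs over global arrays, their cost, and their compilation. -/

namespace InducedErdosPosa

/-- The contents of the global arrays. -/
abbrev St : Type := ℕ → ℕ → ℕ

/-- Closed parametric expressions over the global arrays. -/
abbrev PTerm : Type 1 := ∀ V A : Type, (ℕ → A) → Expr V A

/-- Parametric expressions over the global arrays with one free variable. -/
abbrev PFun : Type 1 := ∀ V A : Type, (ℕ → A) → V → Expr V A

/-- While programs whose atomic actions overwrite a global array by the values of an expression. -/
inductive Code : Type 1 where
  | fill (j : ℕ) (e : PFun)
  | seq (P Q : Code)
  | ite (e : PTerm) (P Q : Code)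
  | while (e : PTerm) (P : Code)

/-- The value of a closed expression. -/
def PTerm.val (e : PTerm) (N : ℕ) (σ : St) : ℕ := (e ℕ (ℕ → ℕ) σ).eval N

/-- The values of an expression with one free variable. -/
def PFun.val (e : PFun) (N : ℕ) (σ : St) (i : ℕ) : ℕ := (e ℕ (ℕ → ℕ) σ i).eval N

/-- Overwrite array `j` by `F`, below `N`. -/
def St.set (N : ℕ) (σ : St) (j : ℕ) (F : ℕ → ℕ) : St :=
  fun a i => if a = j then (if i < N then F i else σ j i) else σ a i

/-- Execution with a count of the atomic actions and tests. -/
inductive Exec (N : ℕ) : Code → St → ℕ → St → Prop where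
  | fill (j : ℕ) (e : PFun) (σ : St) : Exec N (.fill j e) σ 1 (σ.set N j (e.val N σ))
  | seq {P Q : Code} {σ σ' σ'' : St} {c c' : ℕ} :
      Exec N P σ c σ' → Exec N Q σ' c' σ'' → Exec N (.seq P Q) σ (c + c') σ''
  | ite_true {e : PTerm} {P Q : Code} {σ σ' : St} {c : ℕ} :
      0 < e.val N σ → Exec N P σ c σ' → Exec N (.ite e P Q) σ (c + 1) σ'
  | ite_false {e : PTerm} {P Q : Code} {σ σ' : St} {c : ℕ} :
      ¬ 0 < e.val N σ → Exec N Q σ c σ' → Exec N (.ite e P Q) σ (c + 1) σ'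
  | while_true {e : PTerm} {P : Code} {σ σ' σ'' : St} {c c' : ℕ} :
      0 < e.val N σ → Exec N P σ c σ' → Exec N (.while e P) σ' c' σ'' →
      Exec N (.while e P) σ (c + c' + 1) σ''
  | while_false {e : PTerm} {P : Code} {σ : St} :
      ¬ 0 < e.val N σ → Exec N (.while e P) σ 1 σ

/-- The number of names reserved for global arrays. -/
abbrev numGlobals : ℕ := 32

/-- The global arrays as a context for expressions. -/
def globals (σ : St) : List (ℕ × (ℕ → ℕ)) := (List.range numGlobals).map fun j => (j, σ j)

@[simp] lemma mem_globals {σ : St} {a : ℕ} {A : ℕ → ℕ} :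
    (a, A) ∈ globals σ ↔ a < numGlobals ∧ σ a = A := by
  simp only [globals, List.mem_map, List.mem_range, Prod.mk.injEq]
  constructor
  · rintro ⟨j, hj, rfl, h⟩
    exact ⟨hj, h⟩
  · rintro ⟨h1, h2⟩
    exact ⟨a, h1, rfl, h2⟩

/-- The instances over names and over values of all expressions of the code correspond, and only
global arrays other than the input are overwritten. -/
def Code.Wf : Code → Prop
  | .fill j e => (1 ≤ j ∧ j < numGlobals) ∧
      ∀ σ x v, (e ℕ ℕ id x).Wf [(x, v)] (globals σ) (e ℕ (ℕ → ℕ) σ v)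
  | .seq P Q => P.Wf ∧ Q.Wf
  | .ite e P Q => (∀ σ, (e ℕ ℕ id).Wf [] (globals σ) (e ℕ (ℕ → ℕ) σ)) ∧ P.Wf ∧ Q.Wf
  | .while e P => (∀ σ, (e ℕ ℕ id).Wf [] (globals σ) (e ℕ (ℕ → ℕ) σ)) ∧ P.Wf

/-- Compile code. -/
def Code.compile : Code → Program
  -- The values are gathered in the auxiliary array 32 first, because `e` may read array `j` itself.
  | .fill j e => .seq (fillProg 32 32 33 ((e ℕ ℕ id 32).compile 33))
      (fillProg j 32 33 (.load 33 32 32))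
  | .seq P Q => .seq P.compile Q.compile
  | .ite e P Q => .seq ((e ℕ ℕ id).compile 32) (.seq (.const 33 0) (.ite 33 32 P.compile Q.compile))
  | .while e P => .seq (.seq ((e ℕ ℕ id).compile 32) (.const 33 0))
      (.while 33 32 (.seq P.compile (.seq ((e ℕ ℕ id).compile 32) (.const 33 0))))

/-- The memory state `s` holds the global arrays `σ`. -/
def Rep (N : ℕ) (σ : St) (s : State) : Prop := Clean N s ∧ ∀ j < numGlobals, s.arr j = σ j

lemma Rep.of_agree {N : ℕ} {σ : St} {s s' : State} (h : Rep N σ s) (hA : Agree 32 s s')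
    (hC : Clean N s') : Rep N σ s' :=
  ⟨hC, fun j hj => (hA.2 j hj).trans (h.2 j hj)⟩

lemma globals_ok {N : ℕ} {σ : St} {s : State} (h : Rep N σ s) {ℓ : ℕ} (hl : 32 ≤ ℓ) :
    ∀ p ∈ globals σ, p.1 < ℓ ∧ s.arr p.1 = p.2 := by
  rintro ⟨a, A⟩ hp
  obtain ⟨h1, h2⟩ := mem_globals.1 hp
  exact ⟨h1.trans_le hl, (h.2 a h1).trans h2⟩

/-- The value goes to register 32 and is compared with the zero in register 33; the spare step in `t
+ 1` pays for that comparison. -/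
lemma test_runs (e : PTerm) (hw : ∀ σ, (e ℕ ℕ id).Wf [] (globals σ) (e ℕ (ℕ → ℕ) σ)) :
    ∃ K, ∀ (N : ℕ) (σ : St) (s : State), Rep N σ s →
      ∃ t s', Runs (.seq ((e ℕ ℕ id).compile 32) (.const 33 0)) s t s' ∧ t + 1 ≤ unit N K ∧
        Rep N σ s' ∧ s'.reg 33 = 0 ∧ s'.reg 32 = e.val N σ := by
  obtain ⟨K, hK⟩ := compile_runs (e ℕ ℕ id) 32 (by omega)
  refine ⟨K + 0 + 2, fun N σ s hs => ?_⟩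
  obtain ⟨t, s', hr, ht, hv, hA, hC⟩ := hK _ [] _ (hw σ) N s hs.1 (by simp)
    (globals_ok hs le_rfl)
  have := add_unit_le N 2 K 0
  exact ⟨_, _, .seq hr (.const _ _ _), by omega,
    hs.of_agree (hA.trans (Agree.setReg (by omega))) (hC.setReg (by omega)), by simp, by simp [hv, PTerm.val]⟩

/-- Every atomic action and every test costs at most one `unit N K`, with `K` depending only on the
code. Running times are thereby reduced to counting actions and tests. -/
theorem Code.runs (P : Code) : P.Wf → ∃ K, ∀ (N : ℕ) (σ : St) (c : ℕ) (σ' : St),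
    Exec N P σ c σ' → ∀ s, Rep N σ s →
    ∃ t s', Runs P.compile s t s' ∧ t ≤ c * unit N K ∧ Rep N σ' s' := by
  induction P with
  | fill j e =>
    rintro ⟨⟨hj, hj'⟩, hw⟩
    obtain ⟨K, hK⟩ := compile_runs (e ℕ ℕ id 32) 33 (by omega)
    refine ⟨(K + 4 + 2 + 1) + (0 + 5 + 2 + 1) + 0, fun N σ c σ' hE s hs => ?_⟩
    cases hE
    obtain ⟨t, s₁, hr, ht, ha, hb, hreg, hC⟩ := fillProg_runs (N := N) (a := 32) (i := 32) (m := 33)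
      (T := unit N K) (body := (e ℕ ℕ id 32).compile 33) (s₀ := s) (F := e.val N σ) (by omega) rfl
      (by omega) hs.1 (by
        intro s' i hi hC hri hr hb
        exact hK _ [(32, i)] _ (hw σ 32 i) N s' hC (by simp [hri])
          (globals_ok ⟨hC, fun j hj => (hb j (lt_trans hj (by decide)) (ne_of_lt hj)).trans
            (hs.2 j hj)⟩ (by simp)))
    obtain ⟨t₂, s₂, hr₂, ht₂, ha₂, hb₂, hreg₂, hC₂⟩ := fillProg_runs (N := N) (a := j) (i := 32)
      (m := 33) (T := 1) (body := .load 33 32 32) (s₀ := s₁) (F := s₁.arr 32) (by omega) rfl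
      (lt_trans hj' (by decide)) hC (by
        intro s'' i hi hC hri hr hb
        exact ⟨1, _, .load _ _ _ _, le_rfl, by simp [hri, hb 32 (by omega) (ne_of_gt hj')],
          Agree.setReg le_rfl, hC.setReg (by omega)⟩)
    refine ⟨_, _, .seq hr hr₂, ?_, hC₂, ?_⟩
    · have e1 := mul_unit_le N 4 2 K
      have e2 := mul_unit_le N 5 2 0
      have e3 := add_unit_le N 0 (K + 4 + 2 + 1) (0 + 5 + 2 + 1)
      have e4 : unit N 0 = 0 := by simp [unit]
      rw [e4] at e2
      have e5 : N * (1 + 4) = N * (0 + 5) := by ring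
      omega
    · intro a haG
      have haG' : a < 32 := haG
      have hjG' : j < 32 := hj'
      by_cases haj : a = j
      · subst haj
        rw [ha₂, ha]
        funext i
        simp only [St.set, if_true]
        split_ifs with hi
        · rfl
        · rw [hb a (by omega) (by omega), hs.2 a haG]
      · rw [hb₂ a (by omega) haj, hb a (by omega) (by omega), hs.2 a haG]
        funext i
        simp [St.set, haj]
  | seq P Q ihP ihQ =>
    rintro ⟨hP, hQ⟩
    obtain ⟨K, hK⟩ := ihP hP
    obtain ⟨K', hK'⟩ := ihQ hQ
    refine ⟨K + K', fun N σ c σ' hE s hs => ?_⟩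
    cases hE with
    | seq h1 h2 =>
      rename_i σ₁ c₁ c₂
      obtain ⟨t, s₁, hr, ht, hs₁⟩ := hK _ _ _ _ h1 s hs
      obtain ⟨t', s₂, hr', ht', hs₂⟩ := hK' _ _ _ _ h2 s₁ hs₁
      refine ⟨_, _, .seq hr hr', ?_, hs₂⟩
      have e1 := Nat.mul_le_mul_left c₁ (unit_mono (N := N) (show K ≤ K + K' by omega))
      have e2 := Nat.mul_le_mul_left c₂ (unit_mono (N := N) (show K' ≤ K + K' by omega))
      rw [add_mul]
      omega
  | ite e P Q ihP ihQ =>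
    rintro ⟨he, hP, hQ⟩
    obtain ⟨K₀, hK₀⟩ := test_runs e he
    obtain ⟨K, hK⟩ := ihP hP
    obtain ⟨K', hK'⟩ := ihQ hQ
    refine ⟨K₀ + K + K', fun N σ c σ' hE s hs => ?_⟩
    obtain ⟨t, s₁, hr, ht, hs₁, h33, h32⟩ := hK₀ N σ s hs
    have hu := unit_mono (N := N) (show K₀ ≤ K₀ + K + K' by omega)
    cases hr with
    | seq hra hrb =>
    cases hE with
    | ite_true hv h1 =>
      rename_i c₁
      obtain ⟨t', s₂, hr', ht', hs₂⟩ := hK _ _ _ _ h1 s₁ hs₁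
      refine ⟨_, _, .seq hra (.seq hrb (.ite_true (by rw [h33, h32]; exact hv) hr')), ?_, hs₂⟩
      have e1 := Nat.mul_le_mul_left c₁ (unit_mono (N := N) (show K ≤ K₀ + K + K' by omega))
      rw [add_mul]
      omega
    | ite_false hv h1 =>
      rename_i c₁
      obtain ⟨t', s₂, hr', ht', hs₂⟩ := hK' _ _ _ _ h1 s₁ hs₁
      refine ⟨_, _, .seq hra (.seq hrb (.ite_false (by rw [h33, h32]; exact hv) hr')), ?_, hs₂⟩
      have e1 := Nat.mul_le_mul_left c₁ (unit_mono (N := N) (show K' ≤ K₀ + K + K' by omega))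
      rw [add_mul]
      omega
  | _ e P ih =>
    rintro ⟨he, hP⟩
    obtain ⟨K₀, hK₀⟩ := test_runs e he
    obtain ⟨K, hK⟩ := ih hP
    refine ⟨K₀ + K, fun N σ c σ' hE s hs => ?_⟩
    have hu := unit_mono (N := N) (show K₀ ≤ K₀ + K by omega)
    have hu' := unit_mono (N := N) (show K ≤ K₀ + K by omega)
    -- The compiled loop evaluates its condition before the first round and again at the end of each
    -- round. Here `t₀` is the time of the evaluation just made; it is paid by the test that
    -- follows, not by the round before it.
    suffices H : ∀ R, Exec N R σ c σ' → R = .while e P → ∀ t₀ s, t₀ + 1 ≤ unit N K₀ → Rep N σ s →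
        s.reg 33 = 0 → s.reg 32 = e.val N σ → ∃ t s', Runs (.while 33 32
          (.seq P.compile (.seq ((e ℕ ℕ id).compile 32) (.const 33 0)))) s t s' ∧
          t₀ + t ≤ c * unit N (K₀ + K) ∧ Rep N σ' s' by
      obtain ⟨t, s₁, hr, ht, hs₁, h33, h32⟩ := hK₀ N σ s hs
      obtain ⟨t', s₂, hr', ht', hs₂⟩ := H _ hE rfl t s₁ ht hs₁ h33 h32
      exact ⟨_, _, .seq hr hr', ht', hs₂⟩
    intro R hR
    clear hE hs s
    induction hR with
    | fill => intro h; cases h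
    | seq => intro h; cases h
    | ite_true => intro h; cases h
    | ite_false => intro h; cases h
    | while_true hv h1 h2 ih1 ih2 =>
      rename_i c₁ c₂
      intro h t₀ s ht₀ hs h33 h32
      cases h
      obtain ⟨t, s₁, hr, ht, hs₁⟩ := hK _ _ _ _ h1 s hs
      obtain ⟨t', s₂, hr', ht', hs₂, h33', h32'⟩ := hK₀ _ _ s₁ hs₁
      obtain ⟨t'', s₃, hr'', ht'', hs₃⟩ := ih2 rfl t' s₂ ht' hs₂ h33' h32'
      refine ⟨_, s₃, .while_true (by rw [h33, h32]; exact hv) (.seq hr hr') hr'', ?_, hs₃⟩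
      have e1 := Nat.mul_le_mul_left c₁ hu'
      rw [add_mul, add_mul]
      omega
    | while_false hv =>
      intro h t₀ s ht₀ hs h33 h32
      cases h
      exact ⟨_, s, .while_false (by rw [h33, h32]; exact hv), by omega, hs⟩

/-- A while loop terminates when a measure decreases. -/
lemma Exec.while_measure {N : ℕ} {e : PTerm} {P : Code} (Inv : St → Prop) (μ : St → ℕ) (T : ℕ)
    (h : ∀ σ, Inv σ → 0 < e.val N σ → ∃ c σ', Exec N P σ c σ' ∧ c ≤ T ∧ Inv σ' ∧ μ σ' < μ σ)
    (σ : St) (hσ : Inv σ) : ∃ c σ', Exec N (.while e P) σ c σ' ∧ c ≤ μ σ * (T + 1) + 1 ∧ Inv σ' ∧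
      ¬ 0 < e.val N σ' := by
  induction hm : μ σ using Nat.strong_induction_on generalizing σ with
  | _ m ih =>
    by_cases hv : 0 < e.val N σ
    · obtain ⟨c, σ', hE, hc, hI, hlt⟩ := h σ hσ hv
      obtain ⟨c', σ'', hE', hc', hI', hv'⟩ := ih (μ σ') (hm ▸ hlt) σ' hI rfl
      refine ⟨_, σ'', .while_true hv hE hE', ?_, hI', hv'⟩
      have : (μ σ' + 1) * (T + 1) ≤ m * (T + 1) := Nat.mul_le_mul_right _ (by omega)
      rw [add_mul] at this
      omega
    · exact ⟨1, σ, .while_false hv, by omega, hσ, hv⟩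

end InducedErdosPosa

/-! ### Links, ears, and the invariant of a stage. -/

namespace InducedErdosPosa

set_option linter.unusedSectionVars false

section
variable {α : Type*} [DecidableEq α] {G : SimpleGraph α}

open Classical in
/-- The neighbours of `v` in `W`. -/
noncomputable def nb (G : SimpleGraph α) (W : Finset α) (v : α) : Finset α := W.filter (G.Adj v)

@[simp] lemma mem_nb {W : Finset α} {v u : α} : u ∈ nb G W v ↔ u ∈ W ∧ G.Adj v u := by
  simp [nb]

lemma nb_mono {W W' : Finset α} (h : W ⊆ W') (v : α) : nb G W v ⊆ nb G W' v :=
  fun u hu => by rw [mem_nb] at *; exact ⟨h hu.1, hu.2⟩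

/-- `u` and `v` are joined by a path in `G[S]`, or equal. -/
def Reach (G : SimpleGraph α) (S : Set α) : α → α → Prop :=
  Relation.ReflTransGen fun a b => a ∈ S ∧ b ∈ S ∧ G.Adj a b

lemma Reach.symm {S : Set α} {u v : α} (h : Reach G S u v) : Reach G S v u := by
  induction h with
  | refl => exact .refl
  | tail _ h ih => exact .head ⟨h.2.1, h.1, h.2.2.symm⟩ ih

lemma Reach.trans {S : Set α} {u v w : α} (h : Reach G S u v) (h' : Reach G S v w) :
    Reach G S u w := Relation.ReflTransGen.trans h h'

lemma Reach.mono {S S' : Set α} (hS : S ⊆ S') {u v : α} (h : Reach G S u v) : Reach G S' u v := by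
  induction h with
  | refl => exact .refl
  | tail _ h ih => exact .tail ih ⟨hS h.1, hS h.2.1, h.2.2⟩

lemma Reach.single {S : Set α} {u v : α} (hu : u ∈ S) (hv : v ∈ S) (h : G.Adj u v) :
    Reach G S u v := Relation.ReflTransGen.single ⟨hu, hv, h⟩

lemma Reach.mem {S : Set α} {u v : α} (h : Reach G S u v) (hu : u ∈ S) : v ∈ S := by
  induction h with
  | refl => exact hu
  | tail _ h _ => exact h.2.1

/-- A path of `l + 2` vertices from `x` to `y`, with all interior vertices in `S`. -/
structure IsLink (G : SimpleGraph α) (S : Set α) (x y : α) (l : ℕ) (p : ℕ → α) : Prop where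
  pos : 1 ≤ l
  fst : p 0 = x
  lst : p (l + 1) = y
  adj : ∀ i ≤ l, G.Adj (p i) (p (i + 1))
  mem : ∀ i, 1 ≤ i → i ≤ l → p i ∈ S

/-- There is a path from `x` to `y` through `l ≥ 1` interior vertices, all in `S`. -/
def Link (G : SimpleGraph α) (S : Set α) (x y : α) (l : ℕ) : Prop := ∃ p, IsLink G S x y l p

/-- The vertices strictly between `i` and `j` are cut out. A chord joining the two ends is excluded
because nothing would be left inside. -/
lemma IsLink.shortcut {S : Set α} {x y : α} {l : ℕ} {p : ℕ → α} (h : IsLink G S x y l p) {i j : ℕ}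
    (hij : i + 1 < j) (hj : j ≤ l + 1) (ha : G.Adj (p i) (p j)) (hne : ¬(i = 0 ∧ j = l + 1)) :
    Link G S x y (l - (j - i - 1)) := by
  refine ⟨fun m => if m ≤ i then p m else p (m + (j - i - 1)), by omega, by simp [h.fst], ?_, ?_, ?_⟩
  · rw [if_neg (by omega), ← h.lst]; congr 1; omega
  · intro m hm
    by_cases h1 : m + 1 ≤ i
    · simpa [h1, (by omega : m ≤ i)] using h.adj m (by omega)
    · by_cases h2 : m ≤ i
      · obtain rfl : m = i := by omega
        simp only [le_refl, if_true, h1, if_false]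
        rwa [show m + 1 + (j - m - 1) = j by omega]
      · simp only [h1, h2, if_false]
        have := h.adj (m + (j - i - 1)) (by omega)
        rwa [show m + 1 + (j - i - 1) = m + (j - i - 1) + 1 by omega]
  · intro m hm hm'
    show (if m ≤ i then p m else p (m + (j - i - 1))) ∈ S
    split_ifs with h1
    · exact h.mem m hm (by omega)
    · exact h.mem _ (by omega) (by omega)

lemma IsLink.chordless {S : Set α} {x y : α} {l : ℕ} {p : ℕ → α} (h : IsLink G S x y l p)
    (hmin : ∀ l', Link G S x y l' → l ≤ l') {i j : ℕ} (hij : i < j) (hj : j ≤ l + 1)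
    (ha : G.Adj (p i) (p j)) : j = i + 1 ∨ i = 0 ∧ j = l + 1 := by
  by_contra hcon
  have := hmin _ (h.shortcut (i := i) (j := j) (by omega) hj ha (by omega))
  omega

/-- If an interior vertex `p j` repeats an earlier interior vertex `p i`, then `p i` is adjacent to
`p (j + 1)` and a shorter link arises. Repetitions involving an end are impossible because the ends
lie outside `S`. -/
lemma IsLink.inj {S : Set α} {x y : α} {l : ℕ} {p : ℕ → α} (h : IsLink G S x y l p)
    (hmin : ∀ l', Link G S x y l' → l ≤ l') (hx : x ∉ S) (hy : y ∉ S) (hxy : x ≠ y) {i j : ℕ}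
    (hij : i < j) (hj : j ≤ l + 1) : p i ≠ p j := by
  intro he
  by_cases hjl : j = l + 1
  · subst hjl
    by_cases hi : i = 0
    · subst hi; exact hxy (h.fst.symm.trans (he.trans h.lst))
    · exact hy (h.lst ▸ he ▸ h.mem i (by omega) (by omega))
  · by_cases hi : i = 0
    · subst hi; exact hx (h.fst ▸ he.symm ▸ h.mem j (by omega) (by omega))
    · have := h.chordless hmin (i := i) (j := j + 1) (by omega) (by omega)
        (he ▸ h.adj j (by omega))
      omega

/-- The vertices of `V` outside `W` that have no neighbour in `X`. -/
def Free (G : SimpleGraph α) (V W X : Finset α) : Set α :=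
  {v | v ∈ V ∧ v ∉ W ∧ ∀ x ∈ X, ¬ G.Adj v x}

/-- The free vertices whose neighbours in `W` are among `x` and `y`. -/
def Via (G : SimpleGraph α) (V W X : Finset α) (x y : α) : Set α :=
  {v | v ∈ Free G V W X ∧ ∀ w ∈ W, G.Adj v w → w = x ∨ w = y}

/-- Admissible pairs of end vertices of ears. -/
structure EarEnds (G : SimpleGraph α) (W X : Finset α) (x y : α) : Prop where
  x_mem : x ∈ W
  x_not : x ∉ X
  y_mem : y ∈ W
  y_not : y ∉ X
  ne : x ≠ y
  not_adj : ¬ G.Adj x y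

/-- The vertices at distance at most two from `v` in `G[W]`. -/
noncomputable def ball2 (G : SimpleGraph α) (W : Finset α) (v : α) : Finset α :=
  {v} ∪ nb G W v ∪ (nb G W v).biUnion (nb G W)

/-- There are no triangles and no 4-cycles in `G[V]`. -/
def NoShort (G : SimpleGraph α) (V : Finset α) : Prop :=
  (∀ a ∈ V, ∀ b ∈ V, ∀ c ∈ V, G.Adj a b → G.Adj b c → ¬ G.Adj c a) ∧
  ∀ a ∈ V, ∀ b ∈ V, ∀ c ∈ V, ∀ d ∈ V, G.Adj a b → G.Adj b c → G.Adj c d → G.Adj d a →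
    a = c ∨ b = d

/-- The invariant of the construction by ears: `W` induces a connected subgraph of `G[V]` of
degrees two and three without adjacent vertices of degree three, `X` contains the balls of radius
two around these, and every vertex outside that is not adjacent to `X` has at most one neighbour in
`W`. -/
structure Good (G : SimpleGraph α) (V W X : Finset α) : Prop where
  sub : W ⊆ V
  subX : X ⊆ W
  ne : X.Nonempty
  deg : ∀ v ∈ W, (nb G W v).card = 2 ∨ (nb G W v).card = 3
  indep : ∀ v ∈ W, ∀ w ∈ W, G.Adj v w → (nb G W v).card = 3 → (nb G W w).card = 2
  ball : ∀ v ∈ W, (nb G W v).card = 3 → ball2 G W v ⊆ X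
  uniq : ∀ v ∈ Free G V W X, ∀ a ∈ W, ∀ b ∈ W, G.Adj v a → G.Adj v b → a = b
  conn : ∀ u ∈ W, ∀ v ∈ W, Reach G W u v
  -- If the starting cycle has at most four vertices, all of it goes into `X` and no ear has
  -- admissible ends; otherwise the shortest cycle has at least five vertices.
  girth : X = W ∨ NoShort G V

lemma mem_ball2 {W : Finset α} {v u : α} :
    u ∈ ball2 G W v ↔ u = v ∨ (u ∈ W ∧ G.Adj v u) ∨ ∃ w ∈ W, G.Adj v w ∧ u ∈ W ∧ G.Adj w u := by
  simp only [ball2, Finset.mem_union, Finset.mem_singleton, mem_nb, Finset.mem_biUnion]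
  tauto

lemma ball2_card_le {W : Finset α} (hd : ∀ v ∈ W, (nb G W v).card ≤ 3) {v : α} (hv : v ∈ W) :
    (ball2 G W v).card ≤ 13 := by
  unfold ball2
  have h1 := Finset.card_union_le ({v} ∪ nb G W v) ((nb G W v).biUnion (nb G W))
  have h2 := Finset.card_union_le {v} (nb G W v)
  have h3 := Finset.card_biUnion_le_card_mul (nb G W v) (nb G W) 3
    (fun w hw => hd w (mem_nb.1 hw).1)
  have h4 := hd v hv
  simp only [Finset.card_singleton] at h2
  omega

/-- The degree three vertices of `G[W]`. -/
noncomputable def branch (G : SimpleGraph α) (W : Finset α) : Finset α :=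
  W.filter fun v => (nb G W v).card = 3

lemma mem_branch {W : Finset α} {v : α} : v ∈ branch G W ↔ v ∈ W ∧ (nb G W v).card = 3 := by
  simp [branch]

end
end InducedErdosPosa

/-! ### Adding a shortest ear. -/

namespace InducedErdosPosa

set_option linter.unusedSectionVars false

section
variable {α : Type*} [DecidableEq α] {G : SimpleGraph α}

/-- The interior vertices of a link. -/
def inner (l : ℕ) (p : ℕ → α) : Finset α := (Finset.Icc 1 l).image p

lemma mem_inner {l : ℕ} {p : ℕ → α} {v : α} : v ∈ inner l p ↔ ∃ i, 1 ≤ i ∧ i ≤ l ∧ p i = v := by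
  simp [inner, and_assoc]

/-- A shortest ear. -/
structure MinEar (G : SimpleGraph α) (V W X : Finset α) (x y : α) (l : ℕ) (p : ℕ → α) : Prop where
  ends : EarEnds G W X x y
  link : IsLink G (Via G V W X x y) x y l p
  min : ∀ x' y' l', EarEnds G W X x' y' → Link G (Via G V W X x' y') x' y' l' → l ≤ l'

namespace MinEar
variable {V W X : Finset α} {x y : α} {l : ℕ} {p : ℕ → α}

lemma min' (h : MinEar G V W X x y l p) : ∀ l', Link G (Via G V W X x y) x y l' → l ≤ l' :=
  fun l' hl => h.min x y l' h.ends hl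

lemma inj (h : MinEar G V W X x y l p) {i j : ℕ} (hi : i ≤ l + 1) (hj : j ≤ l + 1)
    (he : p i = p j) : i = j := by
  have hx : x ∉ Via G V W X x y := fun hx => hx.1.2.1 h.ends.x_mem
  have hy : y ∉ Via G V W X x y := fun hy => hy.1.2.1 h.ends.y_mem
  rcases lt_trichotomy i j with hij | hij | hij
  · exact absurd he (h.link.inj h.min' hx hy h.ends.ne hij hj)
  · exact hij
  · exact absurd he.symm (h.link.inj h.min' hx hy h.ends.ne hij hi)

lemma adj_iff (h : MinEar G V W X x y l p) {i j : ℕ} (hi : i ≤ l + 1) (hj : j ≤ l + 1) :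
    G.Adj (p i) (p j) ↔ j = i + 1 ∨ i = j + 1 := by
  constructor
  · intro ha
    have key : ∀ {i j}, i < j → j ≤ l + 1 → G.Adj (p i) (p j) → j = i + 1 := by
      intro i j hij hj ha
      rcases h.link.chordless h.min' hij hj ha with h1 | ⟨rfl, rfl⟩
      · exact h1
      · rw [h.link.fst, h.link.lst] at ha
        exact absurd ha h.ends.not_adj
    rcases lt_trichotomy i j with hij | hij | hij
    · exact .inl (key hij hj ha)
    · subst hij; exact absurd rfl ha.ne
    · exact .inr (key hij hi ha.symm)
  · rintro (rfl | rfl)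
    · exact h.link.adj i (by omega)
    · exact (h.link.adj j (by omega)).symm

lemma free (h : MinEar G V W X x y l p) {i : ℕ} (hi : 1 ≤ i) (hi' : i ≤ l) :
    p i ∈ Free G V W X := (h.link.mem i hi hi').1

lemma adj_W (h : MinEar G V W X x y l p) {i : ℕ} (hi : 1 ≤ i) (hi' : i ≤ l) {w : α} (hw : w ∈ W) :
    G.Adj (p i) w ↔ w = x ∧ i = 1 ∨ w = y ∧ i = l := by
  constructor
  · intro ha
    rcases (h.link.mem i hi hi').2 w hw ha with rfl | rfl
    · have : G.Adj (p i) (p 0) := by rwa [h.link.fst]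
      rw [h.adj_iff (by omega) (by omega)] at this
      exact .inl ⟨rfl, by omega⟩
    · have : G.Adj (p i) (p (l + 1)) := by rwa [h.link.lst]
      rw [h.adj_iff (by omega) (by omega)] at this
      exact .inr ⟨rfl, by omega⟩
  · rintro (⟨rfl, rfl⟩ | ⟨rfl, rfl⟩)
    · rw [← h.link.fst]; exact (h.link.adj 0 (by omega)).symm
    · rw [← h.link.lst]; exact h.link.adj i le_rfl

/-- A single interior vertex would be a free vertex with two neighbours in `W`, against `uniq`. -/
lemma two_le (hG : Good G V W X) (h : MinEar G V W X x y l p) : 2 ≤ l := by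
  by_contra hl
  have hl1 : l = 1 := by have := h.link.pos; omega
  subst hl1
  refine h.ends.ne (hG.uniq _ (h.free (i := 1) le_rfl le_rfl) x h.ends.x_mem y h.ends.y_mem ?_ ?_)
  · exact (h.adj_W le_rfl le_rfl h.ends.x_mem).2 (by simp)
  · exact (h.adj_W le_rfl le_rfl h.ends.y_mem).2 (by simp)

lemma mem_p (h : MinEar G V W X x y l p) {i : ℕ} (hi : i ≤ l + 1) : p i ∈ W ∪ inner l p := by
  rw [Finset.mem_union]
  by_cases h0 : i = 0
  · subst h0; left; rw [h.link.fst]; exact h.ends.x_mem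
  by_cases h1 : i = l + 1
  · subst h1; left; rw [h.link.lst]; exact h.ends.y_mem
  · right; exact mem_inner.2 ⟨i, by omega, by omega, rfl⟩

lemma nb_inner (h : MinEar G V W X x y l p) {i : ℕ} (hi : 1 ≤ i) (hi' : i ≤ l) :
    nb G (W ∪ inner l p) (p i) = {p (i - 1), p (i + 1)} := by
  ext u
  simp only [mem_nb, Finset.mem_insert, Finset.mem_singleton]
  constructor
  · rintro ⟨hu, ha⟩
    rcases Finset.mem_union.1 hu with hu | hu
    · rcases (h.adj_W hi hi' hu).1 ha with ⟨rfl, rfl⟩ | ⟨rfl, rfl⟩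
      · left; exact h.link.fst.symm
      · right; exact h.link.lst.symm
    · obtain ⟨j, hj, hj', rfl⟩ := mem_inner.1 hu
      rcases (h.adj_iff (by omega) (by omega)).1 ha with rfl | rfl
      · right; rfl
      · left; rfl
  · rintro (rfl | rfl)
    · exact ⟨h.mem_p (by omega), (h.adj_iff (by omega) (by omega)).2 (by omega)⟩
    · exact ⟨h.mem_p (by omega), (h.adj_iff (by omega) (by omega)).2 (by omega)⟩

lemma nb_inner_card (h : MinEar G V W X x y l p) {i : ℕ} (hi : 1 ≤ i) (hi' : i ≤ l) :
    (nb G (W ∪ inner l p) (p i)).card = 2 := by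
  rw [h.nb_inner hi hi', Finset.card_pair]
  intro he
  have := h.inj (by omega) (by omega) he
  omega

lemma nb_x (hG : Good G V W X) (h : MinEar G V W X x y l p) :
    nb G (W ∪ inner l p) x = insert (p 1) (nb G W x) := by
  have hl := h.two_le hG
  ext u
  simp only [mem_nb, Finset.mem_insert, Finset.mem_union]
  constructor
  · rintro ⟨hu | hu, ha⟩
    · exact .inr ⟨hu, ha⟩
    · obtain ⟨j, hj, hj', rfl⟩ := mem_inner.1 hu
      rcases (h.adj_W hj hj' h.ends.x_mem).1 ha.symm with ⟨-, rfl⟩ | ⟨h1, -⟩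
      · exact .inl rfl
      · exact absurd h1 h.ends.ne
  · rintro (rfl | ⟨hu, ha⟩)
    · exact ⟨.inr (mem_inner.2 ⟨1, by omega, by omega, rfl⟩), by
        rw [← h.link.fst]; exact h.link.adj 0 (by omega)⟩
    · exact ⟨.inl hu, ha⟩

lemma nb_y (hG : Good G V W X) (h : MinEar G V W X x y l p) :
    nb G (W ∪ inner l p) y = insert (p l) (nb G W y) := by
  have hl := h.two_le hG
  ext u
  simp only [mem_nb, Finset.mem_insert, Finset.mem_union]
  constructor
  · rintro ⟨hu | hu, ha⟩
    · exact .inr ⟨hu, ha⟩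
    · obtain ⟨j, hj, hj', rfl⟩ := mem_inner.1 hu
      rcases (h.adj_W hj hj' h.ends.y_mem).1 ha.symm with ⟨h1, -⟩ | ⟨-, rfl⟩
      · exact absurd h1.symm h.ends.ne
      · exact .inl rfl
  · rintro (rfl | ⟨hu, ha⟩)
    · exact ⟨.inr (mem_inner.2 ⟨l, by omega, by omega, rfl⟩), by
        rw [← h.link.lst]; exact (h.link.adj l (by omega)).symm⟩
    · exact ⟨.inl hu, ha⟩

lemma nb_other (h : MinEar G V W X x y l p) {w : α} (hw : w ∈ W) (hx : w ≠ x) (hy : w ≠ y) :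
    nb G (W ∪ inner l p) w = nb G W w := by
  ext u
  simp only [mem_nb, Finset.mem_union]
  constructor
  · rintro ⟨hu | hu, ha⟩
    · exact ⟨hu, ha⟩
    · obtain ⟨j, hj, hj', rfl⟩ := mem_inner.1 hu
      rcases (h.adj_W hj hj' hw).1 ha.symm with ⟨h1, -⟩ | ⟨h1, -⟩ <;> contradiction
  · rintro ⟨hu, ha⟩
    exact ⟨.inl hu, ha⟩

/-- A vertex of degree three belongs to its own ball and hence to `X`. So the ends of an ear have
degree two before the ear is added. -/
lemma card_nb_end (hG : Good G V W X) {w : α} (hw : w ∈ W) (hX : w ∉ X) : (nb G W w).card = 2 := by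
  rcases hG.deg w hw with h | h
  · exact h
  · exact absurd (hG.ball w hw h (mem_ball2.2 (.inl rfl))) hX

lemma card_x (hG : Good G V W X) (h : MinEar G V W X x y l p) :
    (nb G (W ∪ inner l p) x).card = 3 := by
  have hl := h.two_le hG
  rw [h.nb_x hG, Finset.card_insert_of_notMem, card_nb_end hG h.ends.x_mem h.ends.x_not]
  exact fun h1 => (h.free (i := 1) le_rfl (by omega)).2.1 (mem_nb.1 h1).1

lemma card_y (hG : Good G V W X) (h : MinEar G V W X x y l p) :
    (nb G (W ∪ inner l p) y).card = 3 := by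
  have hl := h.two_le hG
  rw [h.nb_y hG, Finset.card_insert_of_notMem, card_nb_end hG h.ends.y_mem h.ends.y_not]
  exact fun h1 => (h.free (i := l) (by omega) (by omega)).2.1 (mem_nb.1 h1).1

lemma branch_eq (hG : Good G V W X) (h : MinEar G V W X x y l p) :
    branch G (W ∪ inner l p) = insert x (insert y (branch G W)) := by
  ext v
  simp only [mem_branch, Finset.mem_insert, Finset.mem_union]
  constructor
  · rintro ⟨hv | hv, hc⟩
    · by_cases hx : v = x
      · exact .inl hx
      by_cases hy : v = y
      · exact .inr (.inl hy)
      · rw [h.nb_other hv hx hy] at hc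
        exact .inr (.inr ⟨hv, hc⟩)
    · obtain ⟨j, hj, hj', rfl⟩ := mem_inner.1 hv
      rw [h.nb_inner_card hj hj'] at hc
      omega
  · rintro (rfl | rfl | ⟨hv, hc⟩)
    · exact ⟨.inl h.ends.x_mem, h.card_x hG⟩
    · exact ⟨.inl h.ends.y_mem, h.card_y hG⟩
    · have hX := hG.ball v hv hc (mem_ball2.2 (.inl rfl))
      refine ⟨.inl hv, ?_⟩
      rw [h.nb_other hv (fun h1 => h.ends.x_not (h1 ▸ hX)) (fun h1 => h.ends.y_not (h1 ▸ hX))]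
      exact hc

/-- Exactly two new branch vertices per ear: they pay for the two balls, of at most 13 vertices
each, that enter `X`. -/
lemma branch_card (hG : Good G V W X) (h : MinEar G V W X x y l p) :
    (branch G (W ∪ inner l p)).card = (branch G W).card + 2 := by
  have hnot : ∀ v ∈ W, v ∉ X → v ∉ branch G W := fun v hv hX hb =>
    hX (hG.ball v hv (mem_branch.1 hb).2 (mem_ball2.2 (.inl rfl)))
  rw [h.branch_eq hG, Finset.card_insert_of_notMem, Finset.card_insert_of_notMem]
  · exact hnot y h.ends.y_mem h.ends.y_not
  · rw [Finset.mem_insert, not_or]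
    exact ⟨h.ends.ne, hnot x h.ends.x_mem h.ends.x_not⟩

/-- In the graph with the ear, the new vertices free of the enlarged set still have at most one
neighbour. -/
lemma uniq_step (hG : Good G V W X) (h : MinEar G V W X x y l p) {v : α}
    (hv : v ∈ Free G V (W ∪ inner l p)
      (X ∪ ball2 G (W ∪ inner l p) x ∪ ball2 G (W ∪ inner l p) y)) {a b : α}
    (ha : a ∈ W ∪ inner l p) (hb : b ∈ W ∪ inner l p) (hva : G.Adj v a) (hvb : G.Adj v b) :
    a = b := by
  have hl := h.two_le hG
  obtain ⟨hvV, hvW', hvX'⟩ := hv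
  have hvF : v ∈ Free G V W X := ⟨hvV, fun hw => hvW' (Finset.mem_union_left _ hw),
    fun z hz => hvX' z (by simp [hz])⟩
  have hnX : ∀ u ∈ W ∪ inner l p, G.Adj v u → u ∉ ball2 G (W ∪ inner l p) x ∧
      u ∉ ball2 G (W ∪ inner l p) y := fun u hu hvu =>
    ⟨fun hb => hvX' u (by simp [hb]) hvu, fun hb => hvX' u (by simp [hb]) hvu⟩
  have hxW' : x ∈ W ∪ inner l p := Finset.mem_union_left _ h.ends.x_mem
  have hyW' : y ∈ W ∪ inner l p := Finset.mem_union_left _ h.ends.y_mem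
  -- neighbours on the ear are far from its end
  have hidx : ∀ i, 1 ≤ i → i ≤ l → G.Adj v (p i) → i + 2 ≤ l := by
    intro i hi hi' hvi
    obtain ⟨-, h2⟩ := hnX (p i) (h.mem_p (by omega)) hvi
    by_contra hcon
    have hly : G.Adj y (p l) := by rw [← h.link.lst]; exact (h.link.adj l le_rfl).symm
    rcases (by omega : i = l ∨ i + 1 = l) with rfl | rfl
    · exact h2 (mem_ball2.2 (.inr (.inl ⟨h.mem_p (by omega), hly⟩)))
    · exact h2 (mem_ball2.2 (.inr (.inr ⟨_, h.mem_p (by omega), hly, h.mem_p (by omega),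
        (h.link.adj i (by omega)).symm⟩)))
  -- no neighbour on the ear together with a neighbour in `W`
  have hmixed : ∀ u ∈ W, G.Adj v u → ∀ i, 1 ≤ i → i ≤ l → ¬ G.Adj v (p i) := by
    intro u hu hvu
    classical
    by_contra! hcon
    have hex : ∃ i, 1 ≤ i ∧ i ≤ l ∧ G.Adj v (p i) := hcon
    set i := Nat.find hex with hidef
    obtain ⟨hi, hi', hvi⟩ := Nat.find_spec hex
    have hmin : ∀ j < i, ¬(1 ≤ j ∧ j ≤ l ∧ G.Adj v (p j)) := fun j hj => Nat.find_min hex hj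
    have hil := hidx i hi hi' hvi
    obtain ⟨h1, h2⟩ := hnX u (Finset.mem_union_left _ hu) hvu
    have hux : u ≠ x := fun he => h1 (mem_ball2.2 (.inl he))
    have huxa : ¬ G.Adj x u := fun he =>
      h1 (mem_ball2.2 (.inr (.inl ⟨Finset.mem_union_left _ hu, he⟩)))
    have huX : u ∉ X := fun he => hvX' u (by simp [he]) hvu
    have hvia : v ∈ Via G V W X x u :=
      ⟨hvF, fun w hw hvw => .inr (hG.uniq v hvF w hw u hu hvw hvu)⟩
    -- The ear is followed from `x` to `p i`, then left through `v` towards `u`. This is an ear with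
    -- `i + 1` interior vertices, and `i + 2 ≤ l` makes it shorter. Its end `u` is admissible since
    -- `v` has no neighbour in the ball of `x`, so `u` is neither `x` nor adjacent to `x`.
    have := h.min x u (i + 1) ⟨h.ends.x_mem, h.ends.x_not, hu, huX, hux.symm, huxa⟩
      ⟨fun m => if m ≤ i then p m else if m = i + 1 then v else u, by omega, by simp [h.link.fst],
        by simp, ?_, ?_⟩
    · omega
    · intro m hm
      by_cases h3 : m + 1 ≤ i
      · simpa [h3, (by omega : m ≤ i)] using h.link.adj m (by omega)
      · by_cases h4 : m = i
        · subst h4; simp only [le_refl, if_true, h3, if_false]; exact hvi.symm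
        · obtain rfl : m = i + 1 := by omega
          simpa using hvu
    · intro m hm hm'
      split_ifs with h3 h4
      · refine ⟨h.free hm (by omega), fun w hw hmw => ?_⟩
        rcases (h.adj_W hm (by omega) hw).1 hmw with ⟨h5, -⟩ | ⟨-, h5⟩
        · exact .inl h5
        · omega
      · exact hvia
      · omega
  -- no two neighbours on the ear
  have hear : ∀ i j, 1 ≤ i → i < j → j ≤ l → G.Adj v (p i) → G.Adj v (p j) → False := by
    intro i j hi hij hj hvi hvj
    have hW0 : ∀ u ∈ W, ¬ G.Adj v u := fun u hu hvu => hmixed u hu hvu i hi (by omega) hvi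
    have hV : ∀ m, 1 ≤ m → m ≤ l → p m ∈ V := fun m h1 h2 => (h.free h1 h2).1
    -- The other alternative `X = W` leaves no possible end `x`.
    have hns : NoShort G V := by
      rcases hG.girth with h1 | h1
      · exact absurd (h1 ▸ h.ends.x_mem) h.ends.x_not
      · exact h1
    by_cases h1 : j = i + 1
    · subst h1
      exact hns.1 v hvV (p i) (hV i hi (by omega)) (p (i + 1)) (hV _ (by omega) hj) hvi
        (h.link.adj i (by omega)) hvj.symm
    by_cases h2 : j = i + 2
    · subst h2
      rcases hns.2 v hvV (p i) (hV i hi (by omega)) (p (i + 1)) (hV _ (by omega) (by omega))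
        (p (i + 2)) (hV _ (by omega) hj) hvi (h.link.adj i (by omega))
        (h.link.adj (i + 1) (by omega)) hvj.symm with h3 | h3
      · exact hvW' (h3 ▸ h.mem_p (by omega))
      · have := h.inj (by omega) (by omega) h3; omega
    -- Now `j ≥ i + 3`, so `v` replaces at least two interior vertices and the ear becomes shorter.
    have := h.min x y (l - (j - i - 2)) h.ends
      ⟨fun m => if m ≤ i then p m else if m = i + 1 then v else p (m + (j - i - 2)), by omega,
        by simp [h.link.fst], ?_, ?_, ?_⟩
    · omega
    · rw [if_neg (by omega), if_neg (by omega), ← h.link.lst]; congr 1; omega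
    · intro m hm
      by_cases h3 : m + 1 ≤ i
      · simpa [h3, (by omega : m ≤ i)] using h.link.adj m (by omega)
      by_cases h4 : m = i
      · subst h4; simp only [le_refl, if_true, h3, if_false]; exact hvi.symm
      by_cases h5 : m = i + 1
      · subst h5
        rw [if_neg (by omega : ¬ i + 1 ≤ i), if_pos rfl, if_neg (by omega : ¬ i + 1 + 1 ≤ i),
          if_neg (by omega : ¬ i + 1 + 1 = i + 1)]
        rwa [show i + 1 + 1 + (j - i - 2) = j by omega]
      · rw [if_neg (by omega : ¬ m ≤ i), if_neg h5, if_neg h3, if_neg (by omega : ¬ m + 1 = i + 1)]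
        have := h.link.adj (m + (j - i - 2)) (by omega)
        rwa [show m + 1 + (j - i - 2) = m + (j - i - 2) + 1 by omega]
    · intro m hm hm'
      split_ifs with h3 h4
      · exact h.link.mem m hm (by omega)
      · exact ⟨hvF, fun w hw hvw => absurd hvw (hW0 w hw)⟩
      · exact h.link.mem _ (by omega) (by omega)
  rcases Finset.mem_union.1 ha with ha | ha <;> rcases Finset.mem_union.1 hb with hb | hb
  · exact hG.uniq v hvF a ha b hb hva hvb
  · obtain ⟨j, hj, hj', rfl⟩ := mem_inner.1 hb
    exact absurd hvb (hmixed a ha hva j hj hj')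
  · obtain ⟨j, hj, hj', rfl⟩ := mem_inner.1 ha
    exact absurd hva (hmixed b hb hvb j hj hj')
  · obtain ⟨i, hi, hi', rfl⟩ := mem_inner.1 ha
    obtain ⟨j, hj, hj', rfl⟩ := mem_inner.1 hb
    rcases lt_trichotomy i j with hij | rfl | hij
    · exact (hear i j hi hij hj' hva hvb).elim
    · rfl
    · exact (hear j i hj hij hi' hvb hva).elim

/-- Adding a shortest ear preserves the invariant. -/
theorem good (hG : Good G V W X) (h : MinEar G V W X x y l p) :
    Good G V (W ∪ inner l p)
      (X ∪ ball2 G (W ∪ inner l p) x ∪ ball2 G (W ∪ inner l p) y) := by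
  have hl := h.two_le hG
  have hxW' : x ∈ W ∪ inner l p := Finset.mem_union_left _ h.ends.x_mem
  have hyW' : y ∈ W ∪ inner l p := Finset.mem_union_left _ h.ends.y_mem
  have hball : ∀ v ∈ W ∪ inner l p, ball2 G (W ∪ inner l p) v ⊆ W ∪ inner l p := by
    intro v hv u hu
    rcases mem_ball2.1 hu with rfl | ⟨hu, -⟩ | ⟨_, -, -, hu, -⟩ <;> assumption
  have hbr : ∀ v ∈ W ∪ inner l p, (nb G (W ∪ inner l p) v).card = 3 →
      v = x ∨ v = y ∨ (v ∈ W ∧ (nb G W v).card = 3) := by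
    intro v hv hc
    have := mem_branch.2 ⟨hv, hc⟩
    rw [h.branch_eq hG] at this
    simpa [mem_branch] using this
  have hdeg : ∀ v ∈ W ∪ inner l p, (nb G (W ∪ inner l p) v).card = 2 ∨
      (nb G (W ∪ inner l p) v).card = 3 := by
    intro v hv
    rcases Finset.mem_union.1 hv with hv | hv
    · by_cases hx : v = x
      · subst hx; exact .inr (h.card_x hG)
      by_cases hy : v = y
      · subst hy; exact .inr (h.card_y hG)
      · rw [h.nb_other hv hx hy]; exact hG.deg v hv
    · obtain ⟨j, hj, hj', rfl⟩ := mem_inner.1 hv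
      exact .inl (h.nb_inner_card hj hj')
  have hnear : ∀ v ∈ W, (nb G W v).card = 3 → ∀ z ∈ W, z ∉ X → z ≠ v ∧ ¬ G.Adj v z := by
    intro v hv hc z hz hzX
    have := hG.ball v hv hc
    exact ⟨fun he => hzX (this (mem_ball2.2 (.inl he))),
      fun he => hzX (this (mem_ball2.2 (.inr (.inl ⟨hz, he⟩))))⟩
  refine ⟨?_, ?_, ?_, hdeg, ?_, ?_, fun v hv a ha b hb => h.uniq_step hG hv ha hb, ?_, ?_⟩
  · refine Finset.union_subset hG.sub fun v hv => ?_
    obtain ⟨j, hj, hj', rfl⟩ := mem_inner.1 hv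
    exact (h.free hj hj').1
  · exact Finset.union_subset (Finset.union_subset
      (hG.subX.trans Finset.subset_union_left) (hball x hxW')) (hball y hyW')
  · exact hG.ne.mono (by rw [Finset.union_assoc]; exact Finset.subset_union_left)
  -- The new branch vertices `x` and `y` are nonadjacent by admissibility. Neither is adjacent to an
  -- old branch vertex, since `X` contains the neighbours of those and the ends avoid `X`.
  · intro v hv w hw hvw hc
    by_contra hcw
    have hcw := (hdeg w hw).resolve_left hcw
    have hxx := h.ends
    rcases hbr v hv hc with rfl | rfl | ⟨hv', hc'⟩ <;>
      rcases hbr w hw hcw with rfl | rfl | ⟨hw', hcw'⟩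
    · exact hvw.ne rfl
    · exact hxx.not_adj hvw
    · exact (hnear w hw' hcw' v hxx.x_mem hxx.x_not).2 hvw.symm
    · exact hxx.not_adj hvw.symm
    · exact hvw.ne rfl
    · exact (hnear w hw' hcw' v hxx.y_mem hxx.y_not).2 hvw.symm
    · exact (hnear v hv' hc' w hxx.x_mem hxx.x_not).2 hvw
    · exact (hnear v hv' hc' w hxx.y_mem hxx.y_not).2 hvw
    · have := hG.indep v hv' w hw' hvw hc'; omega
  · intro v hv hc
    rcases hbr v hv hc with rfl | rfl | ⟨hv', hc'⟩
    · exact fun u hu => by simp [hu]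
    · exact fun u hu => by simp [hu]
    -- The ball of an old branch vertex does not grow: neither that vertex nor any of its neighbours
    -- is an end of the ear.
    · intro u hu
      have hX := hG.ball v hv' hc'
      have hvx := hnear v hv' hc' x h.ends.x_mem h.ends.x_not
      have hvy := hnear v hv' hc' y h.ends.y_mem h.ends.y_not
      have hnbv : nb G (W ∪ inner l p) v = nb G W v := h.nb_other hv' hvx.1.symm hvy.1.symm
      rw [Finset.mem_union, Finset.mem_union]
      left; left
      apply hX
      rw [ball2, hnbv] at hu
      rw [ball2]
      simp only [Finset.mem_union, Finset.mem_singleton, Finset.mem_biUnion] at hu ⊢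
      rcases hu with hu | ⟨w, hw, hu⟩
      · exact .inl hu
      · rw [h.nb_other (mem_nb.1 hw).1 (fun he => hvx.2 (he ▸ (mem_nb.1 hw).2))
          (fun he => hvy.2 (he ▸ (mem_nb.1 hw).2))] at hu
        exact .inr ⟨w, hw, hu⟩
  · have hpx : ∀ i, i ≤ l + 1 → Reach G (↑(W ∪ inner l p)) x (p i) := by
      intro i
      induction i with
      | zero => intro _; rw [h.link.fst]; exact .refl
      | succ i ih =>
        intro hi
        exact (ih (by omega)).trans (Reach.single (h.mem_p (by omega)) (h.mem_p hi)
          (h.link.adj i (by omega)))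
    have hall : ∀ u ∈ W ∪ inner l p, Reach G (↑(W ∪ inner l p)) x u := by
      intro u hu
      rcases Finset.mem_union.1 hu with hu | hu
      · exact (hG.conn x h.ends.x_mem u hu).mono (by simp)
      · obtain ⟨j, hj, hj', rfl⟩ := mem_inner.1 hu
        exact hpx j (by omega)
    exact fun u hu v hv => (hall u hu).symm.trans (hall v hv)
  · rcases hG.girth with h1 | h1
    · exact absurd (h1 ▸ h.ends.x_mem) h.ends.x_not
    · exact .inr h1

end MinEar
end
end InducedErdosPosa

/-! ### Thick sets, induced cycles, and the core. -/

namespace InducedErdosPosa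

set_option linter.unusedSectionVars false

section
variable {α : Type*} [DecidableEq α] {G : SimpleGraph α}

/-- Every vertex of `M` has at least two neighbours in `M`. -/
def Thick (G : SimpleGraph α) (M : Finset α) : Prop := ∀ v ∈ M, 2 ≤ (nb G M v).card

/-- A cycle on the vertices of a shortest link and its adjacent ends. -/
structure MinCycle (G : SimpleGraph α) (V : Finset α) (x y : α) (l : ℕ) (p : ℕ → α) : Prop where
  x_mem : x ∈ V
  y_mem : y ∈ V
  adj : G.Adj x y
  link : IsLink G (↑(V \ {x, y}) : Set α) x y l p
  min : ∀ l', Link G (↑(V \ {x, y}) : Set α) x y l' → l ≤ l'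

/-- There is a path that closes up to a cycle in `G[M]`, if at most one vertex has degree less
than two and this one is not isolated. -/
lemma exists_link_of_deg {M : Finset α} {a : α} (ha : a ∈ M) (han : (nb G M a).Nonempty)
    (hM : ∀ v ∈ M, v ≠ a → 2 ≤ (nb G M v).card) :
    ∃ x ∈ M, ∃ y ∈ M, G.Adj x y ∧ ∃ l, Link G (↑(M \ {x, y}) : Set α) x y l := by
  classical
  -- `Q r` says that some path with `r` edges in `G[M]` starts at `a`. On a longest such path all
  -- neighbours of the last vertex lie on the path, and one other than its predecessor closes a
  -- cycle. The last vertex is not `a`, so it does have a second neighbour.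
  let Q : ℕ → Prop := fun r => ∃ p : ℕ → α, p 0 = a ∧ (∀ i ≤ r, p i ∈ M) ∧
    (∀ i < r, G.Adj (p i) (p (i + 1))) ∧ ∀ i ≤ r, ∀ j ≤ r, p i = p j → i = j
  have hQ1 : Q 1 := by
    obtain ⟨b, hb⟩ := han
    obtain ⟨hb, hab⟩ := mem_nb.1 hb
    refine ⟨fun i => if i = 0 then a else b, rfl, fun i _ => ?_, fun i hi => ?_, fun i hi j hj => ?_⟩
    · beta_reduce; split_ifs <;> assumption
    · obtain rfl : i = 0 := by omega
      simpa using hab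
    · interval_cases i <;> interval_cases j <;> simp [hab.ne, hab.ne.symm]
  have hbd : ∀ r, Q r → r ≤ M.card := by
    rintro r ⟨p, -, hp, -, hinj⟩
    have := Finset.card_le_card_of_injOn (s := Finset.range (r + 1)) (t := M) p
      (fun i hi => hp i (by simp at hi; omega))
      (fun i hi j hj he => hinj i (by simp at hi; omega) j (by simp at hj; omega) he)
    simp at this
    omega
  obtain ⟨r, hr, hmax⟩ : ∃ r, Q r ∧ ∀ r', Q r' → r' ≤ r :=
    ⟨Nat.findGreatest Q M.card, Nat.findGreatest_spec (hbd 1 hQ1) hQ1,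
      fun r' h' => Nat.le_findGreatest (hbd r' h') h'⟩
  have hr1 := hmax 1 hQ1
  obtain ⟨p, hp0, hp, hadj, hinj⟩ := hr
  have hne : p r ≠ a := fun he => by
    have := hinj r le_rfl 0 (by omega) (he.trans hp0.symm)
    omega
  have hcov : ∀ u ∈ nb G M (p r), ∃ i < r, p i = u := by
    intro u hu
    obtain ⟨hu, hau⟩ := mem_nb.1 hu
    by_contra! hcon
    have hu' : ∀ i ≤ r, p i ≠ u := by
      intro i hi
      rcases hi.lt_or_eq with h | rfl
      · exact hcon i h
      · exact hau.ne
    have : Q (r + 1) := by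
      refine ⟨fun i => if i ≤ r then p i else u, by simp [hp0], fun i hi => ?_, fun i hi => ?_,
        fun i hi j hj he => ?_⟩
      · beta_reduce
        split_ifs with h
        · exact hp i h
        · exact hu
      · by_cases h : i + 1 ≤ r
        · simpa [h, (by omega : i ≤ r)] using hadj i (by omega)
        · obtain rfl : i = r := by omega
          simpa using hau
      · by_cases h1 : i ≤ r <;> by_cases h2 : j ≤ r <;> simp only [h1, h2, if_true, if_false] at he
        · exact hinj i h1 j h2 he
        · exact absurd he (hu' i h1)
        · exact absurd he.symm (hu' j h2)
        · omega
    have := hmax _ this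
    omega
  have hdeg := hM (p r) (hp r le_rfl) hne
  obtain ⟨u, hu, hune⟩ : ∃ u ∈ nb G M (p r), u ≠ p (r - 1) := by
    by_contra! hcon
    have : nb G M (p r) ⊆ {p (r - 1)} := fun u hu => by simpa using hcon u hu
    have := Finset.card_le_card this
    simp at this
    omega
  obtain ⟨i, hi, rfl⟩ := hcov u hu
  have hir : i ≠ r - 1 := fun h => hune (by rw [h])
  refine ⟨p i, hp i hi.le, p r, hp r le_rfl, (mem_nb.1 hu).2.symm, r - i - 1,
    fun m => p (i + m), by omega, rfl, by congr 1; omega, fun m hm => hadj (i + m) (by omega),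
    fun m hm hm' => ?_⟩
  simp only [Finset.coe_sdiff, Finset.coe_insert, Finset.coe_singleton, Set.mem_sdiff,
    Finset.mem_coe, Set.mem_insert_iff, Set.mem_singleton_iff]
  refine ⟨hp _ (by omega), ?_⟩
  rintro (h | h)
  · have := hinj _ (by omega) _ (by omega) h; omega
  · have := hinj _ (by omega) _ (by omega) h; omega

namespace MinCycle
variable {V : Finset α} {x y : α} {l : ℕ} {p : ℕ → α}

/-- The vertex set of the cycle. -/
def verts (x y : α) (l : ℕ) (p : ℕ → α) : Finset α := {x, y} ∪ inner l p

lemma inj (h : MinCycle G V x y l p) {i j : ℕ} (hi : i ≤ l + 1) (hj : j ≤ l + 1)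
    (he : p i = p j) : i = j := by
  have hx : x ∉ (↑(V \ {x, y}) : Set α) := by simp
  have hy : y ∉ (↑(V \ {x, y}) : Set α) := by simp
  rcases lt_trichotomy i j with hij | hij | hij
  · exact absurd he (h.link.inj h.min hx hy h.adj.ne hij hj)
  · exact hij
  · exact absurd he.symm (h.link.inj h.min hx hy h.adj.ne hij hi)

lemma mem_verts (h : MinCycle G V x y l p) {v : α} : v ∈ verts x y l p ↔ ∃ i ≤ l + 1, p i = v := by
  simp only [verts, Finset.mem_union, Finset.mem_insert, Finset.mem_singleton, mem_inner]
  constructor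
  · rintro ((rfl | rfl) | ⟨i, h1, h2, h3⟩)
    · exact ⟨0, by omega, h.link.fst⟩
    · exact ⟨l + 1, le_rfl, h.link.lst⟩
    · exact ⟨i, by omega, h3⟩
  · rintro ⟨i, hi, rfl⟩
    by_cases h0 : i = 0
    · subst h0; exact .inl (.inl h.link.fst)
    by_cases h1 : i = l + 1
    · subst h1; exact .inl (.inr h.link.lst)
    · exact .inr ⟨i, by omega, by omega, rfl⟩

lemma adj_iff (h : MinCycle G V x y l p) {i j : ℕ} (hij : i < j) (hj : j ≤ l + 1) :
    G.Adj (p i) (p j) ↔ j = i + 1 ∨ i = 0 ∧ j = l + 1 := by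
  constructor
  · exact h.link.chordless h.min hij hj
  · rintro (rfl | ⟨rfl, rfl⟩)
    · exact h.link.adj i (by omega)
    · rw [h.link.fst, h.link.lst]; exact h.adj

lemma verts_sub (h : MinCycle G V x y l p) : verts x y l p ⊆ V := by
  intro v hv
  simp only [verts, Finset.mem_union, Finset.mem_insert, Finset.mem_singleton, mem_inner] at hv
  rcases hv with (rfl | rfl) | ⟨i, h1, h2, rfl⟩
  · exact h.x_mem
  · exact h.y_mem
  · have := h.link.mem i h1 h2
    simp only [Finset.coe_sdiff, Set.mem_sdiff, Finset.mem_coe] at this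
    exact this.1

lemma card_verts (h : MinCycle G V x y l p) : (verts x y l p).card = l + 2 := by
  have : verts x y l p = (Finset.range (l + 2)).image p := by
    ext v
    rw [h.mem_verts]
    simp [Nat.lt_succ_iff]
  rw [this, Finset.card_image_of_injOn, Finset.card_range]
  intro i hi j hj he
  simp only [Finset.coe_range, Set.mem_Iio] at hi hj
  exact h.inj (by omega) (by omega) he

lemma deg (h : MinCycle G V x y l p) {v : α} (hv : v ∈ verts x y l p) :
    (nb G (verts x y l p) v).card = 2 := by
  obtain ⟨i, hi, rfl⟩ := h.mem_verts.1 hv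
  have hl := h.link.pos
  obtain ⟨a, b, ha, hb, hab, key⟩ : ∃ a b, a ≤ l + 1 ∧ b ≤ l + 1 ∧ a ≠ b ∧
      ∀ j ≤ l + 1, (G.Adj (p i) (p j) ↔ j = a ∨ j = b) := by
    refine ⟨if i = 0 then l + 1 else i - 1, if i = l + 1 then 0 else i + 1, ?_, ?_, ?_, ?_⟩
    · split_ifs <;> omega
    · split_ifs <;> omega
    · split_ifs <;> omega
    · intro j hj
      rcases lt_trichotomy i j with hij | rfl | hij
      · rw [h.adj_iff hij hj]; split_ifs <;> omega
      · simp only [SimpleGraph.irrefl, false_iff]; split_ifs <;> omega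
      · rw [G.adj_comm, h.adj_iff hij hi]; split_ifs <;> omega
  have : nb G (verts x y l p) (p i) = {p a, p b} := by
    ext u
    simp only [mem_nb, Finset.mem_insert, Finset.mem_singleton]
    constructor
    · rintro ⟨hu, hau⟩
      obtain ⟨j, hj, rfl⟩ := h.mem_verts.1 hu
      rcases (key j hj).1 hau with rfl | rfl <;> simp
    · rintro (rfl | rfl)
      · exact ⟨h.mem_verts.2 ⟨a, ha, rfl⟩, (key a ha).2 (.inl rfl)⟩
      · exact ⟨h.mem_verts.2 ⟨b, hb, rfl⟩, (key b hb).2 (.inr rfl)⟩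
  rw [this, Finset.card_pair]
  exact fun he => hab (h.inj ha hb he)

lemma conn (h : MinCycle G V x y l p) {u v : α} (hu : u ∈ verts x y l p)
    (hv : v ∈ verts x y l p) : Reach G ↑(verts x y l p) u v := by
  have hp : ∀ i ≤ l + 1, Reach G ↑(verts x y l p) (p 0) (p i) := by
    intro i
    induction i with
    | zero => intro _; exact .refl
    | succ i ih =>
      intro hi
      exact (ih (by omega)).trans (Reach.single (h.mem_verts.2 ⟨i, by omega, rfl⟩)
        (h.mem_verts.2 ⟨i + 1, hi, rfl⟩) (h.link.adj i (by omega)))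
  obtain ⟨i, hi, rfl⟩ := h.mem_verts.1 hu
  obtain ⟨j, hj, rfl⟩ := h.mem_verts.1 hv
  exact (hp i hi).symm.trans (hp j hj)

lemma thick (h : MinCycle G V x y l p) : Thick G (verts x y l p) := fun _ hv => (h.deg hv).ge

end MinCycle

lemma exists_minCycle {M : Finset α} {x y : α} (hx : x ∈ M) (hy : y ∈ M) (hxy : G.Adj x y) {l : ℕ}
    (h : Link G (↑(M \ {x, y}) : Set α) x y l) : ∃ l p, MinCycle G M x y l p := by
  classical
  have hex : ∃ l, Link G (↑(M \ {x, y}) : Set α) x y l := ⟨l, h⟩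
  obtain ⟨p, hp⟩ := Nat.find_spec hex
  exact ⟨Nat.find hex, p, hx, hy, hxy, hp, fun l' hl' => Nat.find_min' hex hl'⟩

/-- A minimal nonempty thick set. -/
structure IsCyc (G : SimpleGraph α) (M : Finset α) : Prop where
  ne : M.Nonempty
  thick : Thick G M
  min : ∀ M' ⊆ M, M'.Nonempty → Thick G M' → M' = M

lemma exists_isCyc_subset {M : Finset α} (hne : M.Nonempty) (ht : Thick G M) :
    ∃ M' ⊆ M, IsCyc G M' := by
  classical
  obtain ⟨M', hM', hmin⟩ := Finset.exists_min_image
    (M.powerset.filter fun M' => M'.Nonempty ∧ Thick G M') Finset.card ⟨M, by simp [hne, ht]⟩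
  simp only [Finset.mem_filter, Finset.mem_powerset] at hM' hmin
  exact ⟨M', hM'.1, hM'.2.1, hM'.2.2, fun M'' h1 h2 h3 =>
    Finset.eq_of_subset_of_card_le h1 (hmin M'' ⟨h1.trans hM'.1, h2, h3⟩)⟩

lemma Thick.nb_nonempty {M : Finset α} (ht : Thick G M) {v : α} (hv : v ∈ M) :
    (nb G M v).Nonempty := Finset.card_pos.1 (by have := ht v hv; omega)

lemma Thick.exists_minCycle {M : Finset α} (hne : M.Nonempty) (ht : Thick G M) :
    ∃ x y l p, MinCycle G M x y l p := by
  obtain ⟨a, ha⟩ := hne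
  obtain ⟨x, hx, y, hy, hxy, l, hl⟩ := exists_link_of_deg ha (ht.nb_nonempty ha)
    (fun v hv _ => ht v hv)
  exact ⟨x, y, InducedErdosPosa.exists_minCycle hx hy hxy hl⟩

/-- A nonempty thick set contains a cycle through a shortest link, which is chordless and itself
thick. By minimality it is everything, so a minimal thick set is the vertex set of an induced cycle.
-/
lemma IsCyc.exists_minCycle {M : Finset α} (h : IsCyc G M) :
    ∃ x y l p, MinCycle G M x y l p ∧ MinCycle.verts x y l p = M := by
  obtain ⟨x, y, l, p, hc⟩ := h.thick.exists_minCycle h.ne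
  exact ⟨x, y, l, p, hc, h.min _ hc.verts_sub ⟨x, by simp [MinCycle.verts]⟩ hc.thick⟩

lemma IsCyc.deg {M : Finset α} (h : IsCyc G M) {v : α} (hv : v ∈ M) : (nb G M v).card = 2 := by
  obtain ⟨x, y, l, p, hc, rfl⟩ := h.exists_minCycle
  exact hc.deg hv

/-- If `z` is absent or isolated, erasing it costs no other vertex a neighbour; otherwise a longest
path from `z` closes up. This is for a part of a thick set cut off at the single vertex `z`, where
only `z` may lose neighbours. -/
lemma exists_thick_of_deg {M : Finset α} {z : α} (hne : ∃ v ∈ M, v ≠ z)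
    (hM : ∀ v ∈ M, v ≠ z → 2 ≤ (nb G M v).card) : ∃ M' ⊆ M, M'.Nonempty ∧ Thick G M' := by
  by_cases hz : z ∈ M ∧ (nb G M z).Nonempty
  · obtain ⟨x, hx, y, hy, hxy, l, hl⟩ := exists_link_of_deg hz.1 hz.2 hM
    obtain ⟨l, p, hc⟩ := exists_minCycle hx hy hxy hl
    exact ⟨_, hc.verts_sub, ⟨x, by simp [MinCycle.verts]⟩, hc.thick⟩
  · obtain ⟨v, hv, hvz⟩ := hne
    refine ⟨M.erase z, Finset.erase_subset _ _, ⟨v, by simp [hv, hvz]⟩, fun u hu0 => ?_⟩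
    obtain ⟨huz, hu⟩ := Finset.mem_erase.1 hu0
    refine (hM u hu huz).trans (Finset.card_le_card fun w hw => ?_)
    obtain ⟨hw, huw⟩ := mem_nb.1 hw
    refine mem_nb.2 ⟨Finset.mem_erase.2 ⟨?_, hw⟩, huw⟩
    rintro rfl
    exact hz ⟨hw, u, mem_nb.2 ⟨(Finset.mem_erase.1 hu0).2, huw.symm⟩⟩

lemma Thick.union {M M' : Finset α} (h : Thick G M) (h' : Thick G M') : Thick G (M ∪ M') := by
  intro v hv
  rcases Finset.mem_union.1 hv with hv | hv
  · exact (h v hv).trans (Finset.card_le_card (nb_mono Finset.subset_union_left v))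
  · exact (h' v hv).trans (Finset.card_le_card (nb_mono Finset.subset_union_right v))

open Classical in
/-- The largest thick subset. -/
noncomputable def core (G : SimpleGraph α) (S : Finset α) : Finset α :=
  (S.powerset.filter (Thick G)).sup id

lemma core_subset (S : Finset α) : core G S ⊆ S := by
  refine Finset.sup_le fun M hM => ?_
  simp only [Finset.mem_filter, Finset.mem_powerset] at hM
  exact hM.1

lemma subset_core {S M : Finset α} (hM : M ⊆ S) (ht : Thick G M) : M ⊆ core G S :=
  Finset.le_sup (f := id) (by simp [hM, ht])

lemma core_thick (S : Finset α) : Thick G (core G S) := by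
  refine Finset.sup_induction (p := Thick G) ?_ (fun a ha b hb => ha.union hb) ?_
  · intro v hv; simp at hv
  · intro M hM
    simp only [Finset.mem_filter] at hM
    exact hM.2

lemma core_mono {S S' : Finset α} (h : S ⊆ S') : core G S ⊆ core G S' :=
  subset_core ((core_subset S).trans h) (core_thick S)

lemma core_nonempty {S : Finset α} :
    (core G S).Nonempty ↔ ∃ M ⊆ S, M.Nonempty ∧ Thick G M :=
  ⟨fun h => ⟨_, core_subset S, h, core_thick S⟩, fun ⟨_, h1, h2, h3⟩ => h2.mono (subset_core h1 h3)⟩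

/-- Containing a nonempty thick set is a monotone property, so minimality under the removal of
single vertices, which greedy deletion provides, is minimality among all subsets. -/
lemma isCyc_of_core {D : Finset α} (hne : (core G D).Nonempty)
    (hmin : ∀ v ∈ D, ¬ (core G (D.erase v)).Nonempty) : IsCyc G D := by
  have key : ∀ M ⊆ D, M.Nonempty → Thick G M → M = D := by
    intro M hM h1 h2
    by_contra hcon
    obtain ⟨v, hv, hvM⟩ := Finset.exists_of_ssubset (hM.ssubset_of_ne hcon)
    refine hmin v hv (core_nonempty.2 ⟨M, fun u hu => Finset.mem_erase.2 ⟨?_, hM hu⟩, h1, h2⟩)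
    rintro rfl; exact hvM hu
  have hD := key _ (core_subset D) hne (core_thick D)
  exact ⟨hD ▸ hne, hD ▸ core_thick D, key⟩

/-- A graph without cycles has at most as many edges as vertices. -/
lemma sum_deg_le (S : Finset α) : ¬ (core G S).Nonempty →
    ∑ v ∈ S, (nb G S v).card ≤ 2 * S.card := by
  induction hn : S.card using Nat.strong_induction_on generalizing S with
  | _ n ih =>
    intro hS
    by_cases hne : S.Nonempty
    · obtain ⟨v, hv, hlt⟩ : ∃ v ∈ S, (nb G S v).card < 2 := by
        by_contra! hcon
        exact hS (core_nonempty.2 ⟨S, subset_rfl, hne, hcon⟩)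
      have hc := Finset.card_erase_add_one hv
      have := ih _ (by omega) (S.erase v) rfl
        (fun h => hS (h.mono (core_mono (Finset.erase_subset _ _))))
      rw [← Finset.add_sum_erase S _ hv]
      -- Removing `v` costs each of its at most one neighbours one degree, and `v` itself
      -- contributes at most one; so the sum drops by at most two.
      have h2 : ∑ u ∈ S.erase v, (nb G S u).card ≤ ∑ u ∈ S.erase v,
          ((nb G (S.erase v) u).card + if u ∈ nb G S v then 1 else 0) := by
        refine Finset.sum_le_sum fun u hu => ?_
        split_ifs with h
        · have : nb G S u ⊆ insert v (nb G (S.erase v) u) := fun w hw => by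
            rw [Finset.mem_insert, mem_nb, Finset.mem_erase]
            have := mem_nb.1 hw
            tauto
          exact (Finset.card_le_card this).trans (Finset.card_insert_le _ _)
        · refine (Finset.card_le_card fun w hw => ?_).trans (Nat.le_add_right _ _)
          obtain ⟨hw, huw⟩ := mem_nb.1 hw
          refine mem_nb.2 ⟨Finset.mem_erase.2 ⟨?_, hw⟩, huw⟩
          rintro rfl
          exact h (mem_nb.2 ⟨(Finset.mem_erase.1 hu).2, huw.symm⟩)
      rw [Finset.sum_add_distrib, ← Finset.sum_filter, Finset.sum_const, smul_eq_mul, mul_one] at h2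
      have h3 : ((S.erase v).filter (· ∈ nb G S v)).card ≤ (nb G S v).card :=
        Finset.card_le_card fun u hu => (Finset.mem_filter.1 hu).2
      omega
    · rw [Finset.not_nonempty_iff_eq_empty] at hne
      simp [hne]

end
end InducedErdosPosa

/-! ### Starting a stage with a shortest cycle; traversing cycles. -/

namespace InducedErdosPosa

set_option linter.unusedSectionVars false

section
variable {α : Type*} [DecidableEq α] {G : SimpleGraph α}

/-- A shortest cycle of `G[V]`. -/
structure MinStart (G : SimpleGraph α) (V : Finset α) (x y : α) (l : ℕ) (p : ℕ → α) : Prop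
    extends MinCycle G V x y l p where
  min_all : ∀ x' ∈ V, ∀ y' ∈ V, G.Adj x' y' → ∀ l', Link G (↑(V \ {x', y'}) : Set α) x' y' l' → l ≤ l'

/-- A triangle or a 4-cycle is a link with one or two interior vertices between adjacent ends,
shorter than `l ≥ 3`. -/
lemma MinStart.noShort {V : Finset α} {x y : α} {l : ℕ} {p : ℕ → α} (h : MinStart G V x y l p)
    (hl : 3 ≤ l) : NoShort G V := by
  constructor
  · intro a ha b hb c hc hab hbc hca
    have := h.min_all a ha c hc hca.symm 1 ⟨fun m => if m = 0 then a else if m = 1 then b else c,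
      le_rfl, by simp, by simp, fun i hi => ?_, fun i hi hi' => ?_⟩
    · omega
    · interval_cases i <;> simp [hab, hbc]
    · obtain rfl : i = 1 := by omega
      simp [hb, hab.ne.symm, hbc.ne]
  · intro a ha b hb c hc d hd hab hbc hcd hda
    by_contra! hcon
    have := h.min_all a ha d hd hda.symm 2
      ⟨fun m => if m = 0 then a else if m = 1 then b else if m = 2 then c else d,
      by omega, by simp, by simp, fun i hi => ?_, fun i hi hi' => ?_⟩
    · omega
    · interval_cases i <;> simp [hab, hbc, hcd]
    · interval_cases i
      · simp [hb, hab.ne.symm, hcon.2]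
      · simp [hc, hcon.1.symm, hcd.ne]

/-- A shortest cycle satisfies the invariant of the construction by ears. -/
theorem MinStart.good {V : Finset α} {x y : α} {l : ℕ} {p : ℕ → α} (h : MinStart G V x y l p) :
    Good G V (MinCycle.verts x y l p) (if l < 3 then MinCycle.verts x y l p else {x}) := by
  have hx : x ∈ MinCycle.verts x y l p := by simp [MinCycle.verts]
  have hpV : ∀ i ≤ l + 1, p i ∈ V := fun i hi => h.verts_sub (h.mem_verts.2 ⟨i, hi, rfl⟩)
  refine ⟨h.verts_sub, ?_, ?_, fun v hv => .inl (h.deg hv), ?_, ?_, ?_,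
    fun u hu v hv => h.conn hu hv, ?_⟩
  · split_ifs
    · exact subset_rfl
    · simpa using hx
  · split_ifs
    · exact ⟨x, hx⟩
    · exact ⟨x, by simp⟩
  · intro v hv w hw _ h3
    have := h.deg hv
    omega
  · intro v hv h3
    have := h.deg hv
    omega
  · rintro v ⟨hvV, hvC, hvX⟩
    split_ifs at hvX with hl
    · exact fun a ha b hb hva hvb => absurd hva (hvX a ha)
    have hvx : ¬ G.Adj v x := hvX x (by simp)
    have hne : ∀ i ≤ l + 1, v ≠ p i := fun i hi he => hvC (h.mem_verts.2 ⟨i, hi, he.symm⟩)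
    have key : ∀ i j, i < j → j ≤ l + 1 → G.Adj v (p i) → G.Adj v (p j) → False := by
      intro i j hij hj hi hj'
      -- The arc from `p i` to `p j` together with `v` is a cycle, so `l ≤ j - i`. As `v` is not
      -- adjacent to `x = p 0`, only `i = 1` and `j = l + 1` remain, and then `v`, `p 1`, `p 0`, `p
      -- (l + 1)` form a 4-cycle, against `l ≥ 3`.
      have h1 := h.min_all v hvV (p j) (hpV j hj) hj' (j - i)
        ⟨fun m => if m = 0 then v else p (i + m - 1), by omega, by simp, ?_, ?_, ?_⟩
      · have hi0 : i ≠ 0 := by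
          rintro rfl
          exact hvx (h.link.fst ▸ hi)
        obtain ⟨rfl, rfl⟩ : i = 1 ∧ j = l + 1 := by omega
        have := h.min_all v hvV (p (l + 1)) (hpV _ hj) hj' 2
          ⟨fun m => if m = 0 then v else if m = 1 then p 1 else if m = 2 then p 0 else p (l + 1),
            by omega, by simp, by simp, fun m hm => ?_, fun m hm hm' => ?_⟩
        · omega
        · interval_cases m
          · simpa using hi
          · simpa using (h.link.adj 0 (by omega)).symm
          · simpa [h.link.fst, h.link.lst] using h.adj
        · have hn : ∀ m ≤ l, p m ≠ p (l + 1) := fun m hm he => by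
            have := h.inj (by omega) le_rfl he; omega
          interval_cases m
          · simp [hpV 1 (by omega), (hne 1 (by omega)).symm, hn 1 (by omega)]
          · simp [hpV 0 (by omega), (hne 0 (by omega)).symm, hn 0 (by omega)]
      · rw [if_neg (by omega)]; congr 1; omega
      · intro m hm
        by_cases hm0 : m = 0
        · subst hm0; simpa using hi
        · rw [if_neg hm0, if_neg (by omega)]
          have := h.link.adj (i + m - 1) (by omega)
          rwa [show i + m - 1 + 1 = i + (m + 1) - 1 by omega] at this
      · intro m hm hm'
        rw [if_neg (by omega)]
        have hn : p (i + m - 1) ≠ p j := fun he => by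
          have := h.inj (by omega) hj he; omega
        simp [hpV (i + m - 1) (by omega), (hne (i + m - 1) (by omega)).symm, hn]
    intro a ha b hb hva hvb
    obtain ⟨i, hi, rfl⟩ := h.mem_verts.1 ha
    obtain ⟨j, hj, rfl⟩ := h.mem_verts.1 hb
    rcases lt_trichotomy i j with hij | rfl | hij
    · exact (key i j hij hj hva hvb).elim
    · rfl
    · exact (key j i hij hi hvb hva).elim
  · split_ifs with hl
    · exact .inl rfl
    · exact .inr (h.noShort (by omega))

lemma MinStart.card_le {V : Finset α} {x y : α} {l : ℕ} {p : ℕ → α} (h : MinStart G V x y l p) :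
    (if l < 3 then MinCycle.verts x y l p else {x}).card ≤ 4 := by
  split_ifs with hl
  · rw [h.card_verts]; omega
  · simp

/-! ### Traversing cycles -/

/-- All vertices of `G[Y]` have degree two. -/
def TwoReg (G : SimpleGraph α) (Y : Finset α) : Prop := ∀ v ∈ Y, (nb G Y v).card = 2

/-- A walk in `G[Y]` that never turns back. -/
structure IsTrav (G : SimpleGraph α) (Y : Finset α) (c : ℕ → α) : Prop where
  mem : ∀ t, c t ∈ Y
  adj : ∀ t, G.Adj (c t) (c (t + 1))
  ne : ∀ t, c (t + 2) ≠ c t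

lemma TwoReg.eq_or {Y : Finset α} (hY : TwoReg G Y) {v a b u : α} (hv : v ∈ Y) (ha : a ∈ nb G Y v)
    (hb : b ∈ nb G Y v) (hab : a ≠ b) (hu : u ∈ nb G Y v) : u = a ∨ u = b := by
  have h1 : ({a, b} : Finset α) ⊆ nb G Y v := by
    intro w hw
    rcases Finset.mem_insert.1 hw with rfl | hw
    · exact ha
    · rw [Finset.mem_singleton.1 hw]; exact hb
  have h2 := Finset.eq_of_subset_of_card_le h1 (by rw [hY v hv, Finset.card_pair hab])
  simpa [← h2] using hu

/-- The traversal of a 2-regular graph returns to its start. -/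
lemma IsTrav.period {Y : Finset α} {c : ℕ → α} (h : IsTrav G Y c) (hY : TwoReg G Y) :
    ∃ L, 3 ≤ L ∧ L ≤ Y.card ∧ c L = c 0 ∧ ∀ i < L, ∀ j < L, c i = c j → i = j := by
  classical
  have hex : ∃ L, ∃ j < L, c j = c L := by
    obtain ⟨i, hi, j, hj, hne, he⟩ := Finset.exists_ne_map_eq_of_card_lt_of_maps_to
      (s := Finset.range (Y.card + 1)) (t := Y) (f := c) (by simp) (fun t _ => h.mem t)
    rcases lt_or_gt_of_ne hne with hlt | hlt
    · exact ⟨j, i, hlt, he⟩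
    · exact ⟨i, j, hlt, he.symm⟩
  set L := Nat.find hex with hL
  obtain ⟨j, hj, he⟩ := Nat.find_spec hex
  have hmin : ∀ i < L, ∀ j < i, c j ≠ c i := fun i hi j hj he =>
    Nat.find_min hex hi ⟨j, hj, he⟩
  have hinj : ∀ i < L, ∀ j < L, c i = c j → i = j := by
    intro i hi j hj he
    rcases lt_trichotomy i j with h1 | h1 | h1
    · exact absurd he (hmin j hj i h1)
    · exact h1
    · exact absurd he.symm (hmin i hi j h1)
  have hjL1 : j + 1 ≠ L := fun h1 => (h.adj j).ne (by rw [h1]; exact he)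
  have hjL2 : j + 2 ≠ L := fun h1 => h.ne j (by rw [h1]; exact he.symm)
  -- If the first repetition were `c L = c j` with `j > 0`, the vertex `c j` would have the three
  -- distinct neighbours `c (j - 1)`, `c (j + 1)` and `c (L - 1)`.
  have hj0 : j = 0 := by
    by_contra hj0
    have e1 : c (j - 1) ∈ nb G Y (c j) := mem_nb.2 ⟨h.mem _, by
      have := (h.adj (j - 1)).symm
      rwa [show j - 1 + 1 = j by omega] at this⟩
    have e2 : c (j + 1) ∈ nb G Y (c j) := mem_nb.2 ⟨h.mem _, h.adj j⟩
    have e3 : c (L - 1) ∈ nb G Y (c j) := mem_nb.2 ⟨h.mem _, by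
      have := (h.adj (L - 1)).symm
      rw [show L - 1 + 1 = L by omega] at this
      rwa [he]⟩
    rcases hY.eq_or (h.mem j) e1 e2 (fun e => by have := hinj _ (by omega) _ (by omega) e; omega)
      e3 with e | e
    · have := hinj _ (by omega) _ (by omega) e; omega
    · have := hinj _ (by omega) _ (by omega) e; omega
  subst hj0
  refine ⟨L, by omega, ?_, he.symm, hinj⟩
  have := Finset.card_le_card_of_injOn (s := Finset.range L) (t := Y) c (fun t _ => h.mem t)
    (fun i hi j hj e => hinj i (by simpa using hi) j (by simpa using hj) e)
  simpa using this

lemma IsTrav.reach {Y : Finset α} {c : ℕ → α} (h : IsTrav G Y c) (t : ℕ) :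
    Reach G ↑Y (c 0) (c t) := by
  induction t with
  | zero => exact .refl
  | succ t ih => exact ih.trans (Reach.single (h.mem t) (h.mem _) (h.adj t))

/-- The walk along a sequence of vertices. -/
def walkAlong (c : ℕ → α) (hc : ∀ t, G.Adj (c t) (c (t + 1))) : ∀ L, G.Walk (c 0) (c L)
  | 0 => .nil
  | L + 1 => (walkAlong c hc L).concat (hc L)

lemma walkAlong_support (c : ℕ → α) (hc : ∀ t, G.Adj (c t) (c (t + 1))) (L : ℕ) :
    (walkAlong c hc L).support = (List.range (L + 1)).map c := by
  induction L with
  | zero => rfl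
  | succ L ih =>
    rw [walkAlong, SimpleGraph.Walk.support_concat, ih, List.range_succ (n := L + 1)]
    simp

lemma walkAlong_edges (c : ℕ → α) (hc : ∀ t, G.Adj (c t) (c (t + 1))) (L : ℕ) {e : Sym2 α}
    (he : e ∈ (walkAlong c hc L).edges) : ∃ i < L, e = s(c i, c (i + 1)) := by
  induction L with
  | zero => simp [walkAlong] at he
  | succ L ih =>
    rw [walkAlong, SimpleGraph.Walk.edges_concat] at he
    simp only [List.concat_eq_append, List.mem_append, List.mem_singleton] at he
    rcases he with he | he
    · obtain ⟨i, hi, h⟩ := ih he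
      exact ⟨i, by omega, h⟩
    · exact ⟨L, by omega, he⟩

/-- A sequence that runs around a cycle. -/
lemma exists_isCycle {c : ℕ → α} (hc : ∀ t, G.Adj (c t) (c (t + 1))) {L : ℕ} (hL : 3 ≤ L)
    (h0 : c L = c 0) (hinj : ∀ i < L, ∀ j < L, c i = c j → i = j) :
    ∃ w : G.Walk (c 0) (c 0), w.IsCycle ∧ w.support = (List.range (L + 1)).map c := by
  obtain ⟨L, rfl⟩ : ∃ M, L = M + 1 := ⟨L - 1, by omega⟩
  set p := walkAlong (fun t => c (t + 1)) (fun t => hc (t + 1)) L with hp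
  have hsupp := walkAlong_support (fun t => c (t + 1)) (fun t => hc (t + 1)) L
  have hinj' : ∀ i, 1 ≤ i → i ≤ L + 1 → ∀ j, 1 ≤ j → j ≤ L + 1 → c i = c j → i = j := by
    intro i hi hi' j hj hj' e
    have : ∀ i, 1 ≤ i → i ≤ L + 1 → c i = c (if i = L + 1 then 0 else i) := by
      intro i hi hi'
      split_ifs with h
      · rw [h, h0]
      · rfl
    rw [this i hi hi', this j hj hj'] at e
    have := hinj _ (by split_ifs <;> omega) _ (by split_ifs <;> omega) e
    split_ifs at this <;> omega
  -- The edge from `c 0` to `c 1` is put in front of the path from `c 1` to `c L = c 0`.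
  refine ⟨.cons (hc 0) (p.copy rfl h0), ?_, ?_⟩
  · rw [SimpleGraph.Walk.cons_isCycle_iff, SimpleGraph.Walk.isPath_copy,
      SimpleGraph.Walk.edges_copy]
    constructor
    · rw [SimpleGraph.Walk.isPath_def, hp, hsupp]
      refine List.Nodup.map_on ?_ List.nodup_range
      intro i hi j hj e
      simp only [List.mem_range] at hi hj
      have := hinj' (i + 1) (by omega) (by omega) (j + 1) (by omega) (by omega) e
      omega
    · intro he
      obtain ⟨i, hi, e⟩ := walkAlong_edges _ _ _ he
      rw [Sym2.eq_iff] at e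
      rcases e with ⟨e1, e2⟩ | ⟨e1, e2⟩
      · have := hinj' 1 le_rfl (by omega) _ (by omega) (by omega) e2
        omega
      · have h2 := hinj' 1 le_rfl (by omega) _ (by omega) (by omega) e2
        rw [← h0] at e1
        have h3 := hinj' (L + 1) (by omega) le_rfl _ (by omega) (by omega) e1
        omega
  · rw [SimpleGraph.Walk.support_cons, SimpleGraph.Walk.support_copy, hp, hsupp,
      List.range_succ_eq_map (n := L + 1)]
    simp [Function.comp_def]

end
end InducedErdosPosa

/-! ### Cycles as walks and as thick sets; recovering an induced packing. -/

namespace InducedErdosPosa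

set_option linter.unusedSectionVars false

section
variable {α : Type*} [DecidableEq α] {G : SimpleGraph α}

/-- Degree two always leaves a neighbour other than the vertex just visited. The recursion keeps the
current vertex together with the next one. -/
lemma TwoReg.exists_isTrav {Y : Finset α} (hY : TwoReg G Y) {v : α} (hv : v ∈ Y) :
    ∃ c, IsTrav G Y c ∧ c 0 = v := by
  classical
  have hstep : ∀ a : α, ∀ b : Y, ∃ u : Y, u.1 ∈ nb G Y b.1 ∧ u.1 ≠ a := by
    intro a b
    by_contra! hcon
    have : nb G Y b.1 ⊆ {a} := fun u hu => by
      simpa using hcon ⟨u, (mem_nb.1 hu).1⟩ hu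
    have := Finset.card_le_card this
    rw [hY b.1 b.2, Finset.card_singleton] at this
    omega
  choose f hf hf' using hstep
  let s : ℕ → Y × Y := fun t => Nat.rec (⟨v, hv⟩, f v ⟨v, hv⟩) (fun _ p => (p.2, f p.1.1 p.2)) t
  have hs1 : ∀ t, (s (t + 1)).1 = (s t).2 := fun t => rfl
  have hs2 : ∀ t, (s (t + 1)).2 = f (s t).1.1 (s t).2 := fun t => rfl
  have hadj : ∀ t, (s t).2.1 ∈ nb G Y (s t).1.1 := by
    intro t
    cases t with
    | zero => exact hf v ⟨v, hv⟩
    | succ t => rw [hs2, hs1]; exact hf _ _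
  refine ⟨fun t => (s t).1.1, ⟨fun t => (s t).1.2, fun t => ?_, fun t => ?_⟩, rfl⟩
  · show G.Adj _ (s (t + 1)).1.1
    rw [hs1]; exact (mem_nb.1 (hadj t)).2
  · show (s (t + 1 + 1)).1.1 ≠ _
    rw [hs1 (t + 1), hs2]; exact hf' _ _

/-- This lemma and the next two translate between cycles as walks in `H` and thick sets in `G`. The
embedding is needed because the construction takes place on the natural numbers, while the
hypothesis and the conclusion speak of induced subgraphs on other types. -/
lemma exists_isCycle_of_thick {β : Type*} {H : SimpleGraph β} (f : H ↪g G) {M : Finset α}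
    (hne : M.Nonempty) (ht : Thick G M) (hM : ∀ v ∈ M, ∃ b, f b = v) :
    ∃ (b : β) (w : H.Walk b b), w.IsCycle := by
  obtain ⟨D, hDM, hD⟩ := exists_isCyc_subset hne ht
  obtain ⟨v, hv⟩ := hD.ne
  have h2 : TwoReg G D := fun u hu => hD.deg hu
  obtain ⟨c, hc, -⟩ := h2.exists_isTrav hv
  obtain ⟨L, h3, -, h0, hinj⟩ := hc.period h2
  choose c' hc' using fun t => hM (c t) (hDM (hc.mem t))
  classical
  obtain ⟨w, hw, -⟩ := exists_isCycle (G := H) (c := c')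
    (fun t => f.map_adj_iff.1 (by rw [hc', hc']; exact hc.adj t)) h3
    (f.injective (by rw [hc', hc', h0]))
    (fun i hi j hj e => hinj i hi j hj (by rw [← hc', ← hc', e]))
  exact ⟨_, w, hw⟩

lemma thick_support {β : Type*} {H : SimpleGraph β} (f : H ↪g G) {b : β} {w : H.Walk b b}
    (hw : w.IsCycle) : Thick G (w.support.map f).toFinset := by
  classical
  intro v hv
  simp only [List.mem_toFinset, List.mem_map] at hv
  obtain ⟨a, ha, rfl⟩ := hv
  have h2 := hw.ncard_neighborSet_toSubgraph_eq_two ha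
  obtain ⟨x, y, hxy, hs⟩ := Set.ncard_eq_two.1 h2
  have hmem : ∀ u ∈ w.toSubgraph.neighborSet a, f u ∈ nb G (w.support.map f).toFinset (f a) := by
    intro u hu
    refine mem_nb.2 ⟨?_, f.map_adj_iff.2 hu.adj_sub⟩
    simp only [List.mem_toFinset, List.mem_map]
    exact ⟨u, (SimpleGraph.Walk.mem_verts_toSubgraph _).1 hu.snd_mem, rfl⟩
  have h3 : ({f x, f y} : Finset α) ⊆ nb G (w.support.map f).toFinset (f a) := by
    intro u hu
    simp only [Finset.mem_insert, Finset.mem_singleton] at hu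
    rcases hu with rfl | rfl
    · exact hmem x (by simp [hs])
    · exact hmem y (by simp [hs])
  have := Finset.card_le_card h3
  rwa [Finset.card_pair (fun e => hxy (f.injective e))] at this

lemma isAcyclic_of_core {β : Type*} {H : SimpleGraph β} (f : H ↪g G)
    (h : ∀ M : Finset α, (∀ v ∈ M, ∃ b, f b = v) → M.Nonempty → ¬ Thick G M) : H.IsAcyclic := by
  intro b w hw
  refine h _ ?_ ⟨f b, ?_⟩ (thick_support f hw)
  · intro v hv
    simp only [List.mem_toFinset, List.mem_map] at hv
    obtain ⟨a, -, rfl⟩ := hv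
    exact ⟨a, rfl⟩
  · simp only [List.mem_toFinset, List.mem_map]
    exact ⟨b, w.start_mem_support, rfl⟩

/-! ### Recovering cycles -/

/-- `W` induces a graph of degrees two and three without adjacent vertices of degree three, and `X`
contains these vertices and their neighbours. -/
structure Skel (G : SimpleGraph α) (W X : Finset α) : Prop where
  subX : X ⊆ W
  deg : ∀ v ∈ W, (nb G W v).card = 2 ∨ (nb G W v).card = 3
  indep : ∀ v ∈ W, ∀ w ∈ W, G.Adj v w → (nb G W v).card = 3 → (nb G W w).card = 2
  ball : ∀ v ∈ W, (nb G W v).card = 3 → ball2 G W v ⊆ X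

lemma nb_eq_of_subset {M Y : Finset α} (hMY : M ⊆ Y) {v : α} (hM : (nb G M v).card = 2)
    (hY : (nb G Y v).card ≤ 2) : nb G M v = nb G Y v :=
  Finset.eq_of_subset_of_card_le (nb_mono hMY v) (by omega)

lemma Reach.closed {Y M : Finset α} (hcl : ∀ v ∈ M, ∀ u ∈ Y, G.Adj v u → u ∈ M) {v u : α}
    (hv : v ∈ M) (h : Reach G ↑Y v u) : u ∈ M := by
  induction h with
  | refl => exact hv
  | tail _ h ih => exact hcl _ ih _ h.2.1 h.2.2

/-- A set of vertices that meets all cycles bounds the number of vertices of degree three. -/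
theorem Skel.card_branch_le {W X : Finset α} (h : Skel G W X) {Y : Finset α} (hY : Y ⊆ W)
    (hc : ¬ (core G (W \ Y)).Nonempty) : (branch G W).card ≤ 4 * Y.card := by
  classical
  have h1 := sum_deg_le _ hc
  -- The degrees in `W` of the vertices outside `Y` are summed in two ways. Their neighbours outside
  -- `Y` contribute at most `2 |W \ Y|` for lack of cycles and those in `Y` at most `3 |Y|`. On the
  -- other hand the sum is `2 |W \ Y|` plus the number of branch vertices outside `Y`.
  have h2 : ∑ v ∈ W \ Y, (nb G W v).card ≤
      ∑ v ∈ W \ Y, (nb G (W \ Y) v).card + ∑ v ∈ W \ Y, (nb G Y v).card := by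
    rw [← Finset.sum_add_distrib]
    refine Finset.sum_le_sum fun v _ => (Finset.card_le_card fun u hu => ?_).trans
      (Finset.card_union_le _ _)
    simp only [Finset.mem_union, mem_nb, Finset.mem_sdiff] at hu ⊢
    tauto
  have h3 : ∑ v ∈ W \ Y, (nb G Y v).card ≤ 3 * Y.card := by
    have hsw : ∑ v ∈ W \ Y, (nb G Y v).card = ∑ u ∈ Y, (nb G (W \ Y) u).card := by
      refine (Finset.sum_card_bipartiteAbove_eq_sum_card_bipartiteBelow G.Adj).trans ?_
      refine Finset.sum_congr rfl fun u _ => ?_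
      congr 1
      ext v
      simp [G.adj_comm]
    rw [hsw, mul_comm]
    refine Finset.sum_le_card_nsmul _ _ 3 fun u hu => ?_
    have := Finset.card_le_card (nb_mono (G := G) (Finset.sdiff_subset : W \ Y ⊆ W) u)
    rcases h.deg u (hY hu) with h | h <;> omega
  have h4 : ∑ v ∈ W \ Y, (nb G W v).card = 2 * (W \ Y).card + (branch G W \ Y).card := by
    have : ∀ v ∈ W \ Y, (nb G W v).card = 2 + if (nb G W v).card = 3 then 1 else 0 := by
      intro v hv
      rcases h.deg v (Finset.mem_sdiff.1 hv).1 with h | h <;> simp [h]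
    rw [Finset.sum_congr rfl this, Finset.sum_add_distrib, Finset.sum_const, ← Finset.sum_filter,
      Finset.sum_const, smul_eq_mul, smul_eq_mul, mul_one, mul_comm]
    congr 2
    ext v
    simp only [Finset.mem_filter, Finset.mem_sdiff, mem_branch]
    tauto
  have h5 : (branch G W).card ≤ (branch G W \ Y).card + Y.card := by
    have := Finset.card_union_le (branch G W \ Y) Y
    refine (Finset.card_le_card ?_).trans this
    intro v hv
    by_cases hvY : v ∈ Y <;> simp [hv, hvY]
  omega

end

section
variable {G : SimpleGraph ℕ}

open Classical in
/-- The least vertices of the components of `G[Y]`. -/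
noncomputable def mins (G : SimpleGraph ℕ) (Y : Finset ℕ) : Finset ℕ :=
  Y.filter fun v => ∀ u ∈ Y, Reach G ↑Y v u → v ≤ u

lemma mem_mins {Y : Finset ℕ} {v : ℕ} :
    v ∈ mins G Y ↔ v ∈ Y ∧ ∀ u ∈ Y, Reach G ↑Y v u → v ≤ u := by simp [mins]

lemma mins_eq {Y : Finset ℕ} {u v : ℕ} (hu : u ∈ mins G Y) (hv : v ∈ mins G Y)
    (h : Reach G ↑Y u v) : u = v := by
  rw [mem_mins] at hu hv
  exact le_antisymm (hu.2 v hv.1 h) (hv.2 u hu.1 h.symm)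

lemma exists_mins_of_closed {Y M : Finset ℕ} (hM : M ⊆ Y) (hne : M.Nonempty)
    (hcl : ∀ v ∈ M, ∀ u ∈ Y, G.Adj v u → u ∈ M) : ∃ v ∈ M, v ∈ mins G Y := by
  refine ⟨M.min' hne, M.min'_mem hne, mem_mins.2 ⟨hM (M.min'_mem hne), fun u _ hr => ?_⟩⟩
  exact M.min'_le u (Reach.closed hcl (M.min'_mem hne) hr)

/-- `G[Y]` consists of at least `k` induced cycles without edges between them. -/
structure Pack (G : SimpleGraph ℕ) (k : ℕ) (Y : Finset ℕ) : Prop where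
  reg : TwoReg G Y
  card : k ≤ (mins G Y).card

/-- Disjoint nonempty sets closed under adjacency in `G[Y]` contain different component minima.
Counting minima instead of components makes the number of cycles available to the program. -/
lemma le_card_mins {k : ℕ} {Y : Finset ℕ} (M : Fin k → Finset ℕ) (hM : ∀ i, M i ⊆ Y)
    (hne : ∀ i, (M i).Nonempty) (hcl : ∀ i, ∀ v ∈ M i, ∀ u ∈ Y, G.Adj v u → u ∈ M i)
    (hd : ∀ i j, i ≠ j → Disjoint (M i) (M j)) : k ≤ (mins G Y).card := by
  choose r hr hr' using fun i => exists_mins_of_closed (hM i) (hne i) (hcl i)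
  have := Finset.card_le_card_of_injOn (s := Finset.univ) (t := mins G Y) r (fun i _ => hr' i)
    (fun i _ j _ e => by
      by_contra hij
      exact Finset.disjoint_left.1 (hd i j hij) (hr i) (e ▸ hr j))
  simpa using this

/-- Disjoint cycles can be recovered from the part of `X` that they do not meet. -/
theorem Skel.exists_pack {W X : Finset ℕ} (h : Skel G W X) {k : ℕ} (M : Fin k → Finset ℕ)
    (hM : ∀ i, M i ⊆ W) (hcyc : ∀ i, IsCyc G (M i)) (hd : ∀ i j, i ≠ j → Disjoint (M i) (M j)) :
    ∃ B ⊆ X, Pack G k (core G (W \ B)) := by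
  classical
  set U := Finset.univ.biUnion M with hU
  have hUm : ∀ {v}, v ∈ U ↔ ∃ i, v ∈ M i := by simp [hU]
  -- Only vertices of `X` off the given cycles are removed. The cycles survive the pruning, and
  -- every vertex of `X` that remains is on one of them.
  set Y := core G (W \ (X \ U)) with hY
  have hYW : Y ⊆ W := (core_subset _).trans Finset.sdiff_subset
  have hMY : ∀ i, M i ⊆ Y := by
    intro i
    refine subset_core (fun v hv => ?_) (hcyc i).thick
    simp only [Finset.mem_sdiff, not_and, not_not]
    exact ⟨hM i hv, fun _ => hUm.2 ⟨i, hv⟩⟩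
  have hXU : ∀ v ∈ Y, v ∈ X → v ∈ U := by
    intro v hv hX
    have := core_subset _ hv
    simp only [Finset.mem_sdiff, not_and, not_not] at this
    exact this.2 hX
  have hreg : TwoReg G Y := by
    intro v hv
    have h2 : 2 ≤ (nb G Y v).card := core_thick _ v hv
    have hle := Finset.card_le_card (nb_mono (G := G) hYW v)
    rcases h.deg v (hYW hv) with h3 | h3
    · omega
    -- Suppose `v` has degree three in `Y`. Then `v` and its neighbours in `Y` lie in `X`, hence on
    -- the given cycles. The cycle through `v` does not use some neighbour `u`. As `u` has degree
    -- two in `W`, the cycle through `u` contains `v`; by disjointness it is the same cycle, and `u`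
    -- is a neighbour of `v` on it after all.
    by_contra hcon
    have hb := h.ball v (hYW hv) h3
    obtain ⟨i, hvi⟩ := hUm.1 (hXU v hv (hb (mem_ball2.2 (.inl rfl))))
    obtain ⟨u, hu, hui⟩ : ∃ u ∈ nb G Y v, u ∉ nb G (M i) v := by
      by_contra! hsub
      have := Finset.card_le_card (s := nb G Y v) hsub
      have := (hcyc i).deg hvi
      omega
    obtain ⟨huY, hvu⟩ := mem_nb.1 hu
    have huX := hb (mem_ball2.2 (.inr (.inl ⟨hYW huY, hvu⟩)))
    obtain ⟨j, huj⟩ := hUm.1 (hXU u huY huX)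
    have hu2 := h.indep v (hYW hv) u (hYW huY) hvu h3
    have := nb_eq_of_subset (hM j) ((hcyc j).deg huj) hu2.le
    have hvj : v ∈ M j := (mem_nb.1 (this ▸ mem_nb.2 ⟨hYW hv, hvu.symm⟩)).1
    obtain rfl : i = j := by
      by_contra hij
      exact Finset.disjoint_left.1 (hd i j hij) hvi hvj
    exact hui (mem_nb.2 ⟨huj, hvu⟩)
  refine ⟨X \ U, Finset.sdiff_subset, hreg, le_card_mins M hMY (fun i => (hcyc i).ne) ?_ hd⟩
  intro i v hv u hu hvu
  have := nb_eq_of_subset (hMY i) ((hcyc i).deg hv) (hreg v (hMY i hv)).le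
  exact (mem_nb.1 (this ▸ mem_nb.2 ⟨hu, hvu⟩)).1

end

end InducedErdosPosa

/-! ### Stages without ears, and hanging cycles. -/

namespace InducedErdosPosa

set_option linter.unusedSectionVars false

section
variable {α : Type*} [DecidableEq α] {G : SimpleGraph α}

/-- Together with `IsLink.suffix`: an interior vertex with a further neighbour `w` cuts a piece out
of a link. On a link that is shortest over all admissible pairs of ends, this rules out further
attachments of the interior. -/
lemma IsLink.initial {S : Set α} {x y w : α} {l i : ℕ} {p : ℕ → α} (h : IsLink G S x y l p)
    (hi : 1 ≤ i) (hil : i ≤ l) (hw : G.Adj (p i) w) : Link G S x w i := by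
  refine ⟨fun m => if m ≤ i then p m else w, hi, by simp [h.fst], by simp, fun m hm => ?_,
    fun m hm hm' => ?_⟩
  · by_cases h1 : m + 1 ≤ i
    · simpa [h1, (by omega : m ≤ i)] using h.adj m (by omega)
    · obtain rfl : m = i := by omega
      simpa using hw
  · rw [if_pos hm']; exact h.mem m hm (by omega)

lemma IsLink.suffix {S : Set α} {x y w : α} {l i : ℕ} {p : ℕ → α} (h : IsLink G S x y l p)
    (hi : 1 ≤ i) (hil : i ≤ l) (hw : G.Adj (p i) w) : Link G S w y (l - i + 1) := by
  refine ⟨fun m => if m = 0 then w else p (i + m - 1), by omega, by simp, ?_, fun m hm => ?_,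
    fun m hm hm' => ?_⟩
  · rw [if_neg (by omega), ← h.lst]; congr 1; omega
  · by_cases h1 : m = 0
    · subst h1; simpa using hw.symm
    · rw [if_neg h1, if_neg (by omega)]
      have := h.adj (i + m - 1) (by omega)
      rwa [show i + m - 1 + 1 = i + (m + 1) - 1 by omega] at this
  · rw [if_neg (by omega)]; exact h.mem _ (by omega) (by omega)

lemma Link.extend {S : Set α} {x v y : α} {l : ℕ} (h : Link G S x v l) (hv : v ∈ S)
    (hy : G.Adj v y) : Link G S x y (l + 1) := by
  obtain ⟨p, h⟩ := h
  refine ⟨fun m => if m ≤ l + 1 then p m else y, by omega, by simp [h.fst], by simp, fun m hm => ?_,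
    fun m hm hm' => ?_⟩
  · by_cases h1 : m + 1 ≤ l + 1
    · simpa [h1, (by omega : m ≤ l + 1), (by omega : m ≤ l)] using h.adj m (by omega)
    · obtain rfl : m = l + 1 := by omega
      simpa [h.lst] using hy
  · rw [if_pos hm']
    by_cases h1 : m ≤ l
    · exact h.mem m hm h1
    · obtain rfl : m = l + 1 := by omega
      rw [h.lst]; exact hv

lemma Reach.link {S : Set α} {x u v y : α} (h : Reach G S u v) (hu : u ∈ S) (hx : G.Adj x u)
    (hy : G.Adj v y) : ∃ l, Link G S x y l := by
  induction h generalizing y with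
  | refl =>
    refine ⟨1, fun m => if m = 0 then x else if m = 1 then u else y, le_rfl, by simp, by simp,
      fun m hm => ?_, fun m hm hm' => ?_⟩
    · interval_cases m <;> simp [hx, hy]
    · obtain rfl : m = 1 := by omega
      simpa using hu
  | tail _ h ih =>
    obtain ⟨l, hl⟩ := ih h.2.2
    exact ⟨_, hl.extend h.2.1 hy⟩

lemma IsLink.mono {S T : Set α} {x y : α} {l : ℕ} {p : ℕ → α} (h : IsLink G S x y l p)
    (hT : ∀ i, 1 ≤ i → i ≤ l → p i ∈ T) : IsLink G T x y l p :=
  ⟨h.pos, h.fst, h.lst, h.adj, hT⟩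

/-- There are no ears. -/
def NoEar (G : SimpleGraph α) (V W X : Finset α) : Prop :=
  ∀ x y l, EarEnds G W X x y → ¬ Link G (Via G V W X x y) x y l

lemma exists_min_link {S : Set α} (P : α → α → Prop) {x y : α} {l : ℕ} (hP : P x y)
    (h : Link G S x y l) : ∃ x y l p, P x y ∧ IsLink G S x y l p ∧
      ∀ x' y' l', P x' y' → Link G S x' y' l' → l ≤ l' := by
  classical
  have hex : ∃ l, ∃ x y, P x y ∧ Link G S x y l := ⟨l, x, y, hP, h⟩
  obtain ⟨x, y, hP, p, hp⟩ := Nat.find_spec hex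
  exact ⟨x, y, _, p, hP, hp, fun x' y' l' h1 h2 => Nat.find_min' hex ⟨x', y', h1, h2⟩⟩

/-- Two sets of vertices of `W` that are far apart are not joined by a path whose interior vertices
attach only to these sets. -/
lemma NoEar.no_link {V W X : Finset α} (hG : Good G V W X) (hN : NoEar G V W X) {A A' : Set α}
    (hA : ∀ a ∈ A, a ∈ W ∧ a ∉ X) (hA' : ∀ a ∈ A', a ∈ W ∧ a ∉ X)
    (hAA' : ∀ a ∈ A, ∀ b ∈ A', a ≠ b ∧ ¬ G.Adj a b) {a b : α} (ha : a ∈ A) (hb : b ∈ A') {l : ℕ} :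
    ¬ Link G {v | v ∈ Free G V W X ∧ ∀ w ∈ W, G.Adj v w → w ∈ A ∨ w ∈ A'} a b l := by
  intro hl
  -- The length is minimised over all pairs of ends at once. A further neighbour `w ∈ A` of an
  -- interior vertex starts a shorter link, unless that vertex is the first one, where `uniq` gives
  -- `w = x`; likewise for `A'` at the other end. So a shortest link is an ear.
  obtain ⟨x, y, l, p, ⟨hx, hy⟩, hp, hmin⟩ := exists_min_link (fun x y => x ∈ A ∧ y ∈ A') ⟨ha, hb⟩ hl
  refine hN x y l ⟨(hA x hx).1, (hA x hx).2, (hA' y hy).1, (hA' y hy).2, (hAA' x hx y hy).1,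
    (hAA' x hx y hy).2⟩ ⟨p, hp.mono fun i hi hil => ⟨(hp.mem i hi hil).1, fun w hw hiw => ?_⟩⟩
  rcases (hp.mem i hi hil).2 w hw hiw with h | h
  · left
    by_cases h1 : i = 1
    · subst h1
      refine hG.uniq _ (hp.mem 1 hi hil).1 w hw x (hA x hx).1 hiw ?_
      rw [← hp.fst]; exact (hp.adj 0 (by omega)).symm
    · have := hmin w y _ ⟨h, hy⟩ (hp.suffix hi hil hiw)
      omega
  · right
    by_cases h1 : i = l
    · subst h1
      refine hG.uniq _ (hp.mem i hi hil).1 w hw y (hA' y hy).1 hiw ?_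
      rw [← hp.lst]; exact hp.adj i le_rfl
    · have := hmin x w _ ⟨hx, h⟩ (hp.initial hi hil hiw)
      omega

/-- The vertices reachable from `z` through vertices that attach to `z` and `y` only. -/
def Blob (G : SimpleGraph α) (V W X : Finset α) (z y : α) : Set α :=
  {v | Reach G (Via G V W X z y ∪ {z, y}) z v}

/-- The vertices `z` and `y` are equal or adjacent, and a cycle outside `W` hangs off them. -/
structure Hang (G : SimpleGraph α) (V W X : Finset α) (z y : α) : Prop where
  z_mem : z ∈ W
  z_not : z ∉ X
  y_mem : y ∈ W
  y_not : y ∉ X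
  eq_or_adj : z = y ∨ G.Adj z y
  cyc : ∃ M : Finset α, ↑M ⊆ Blob G V W X z y ∧ M.Nonempty ∧ Thick G M

lemma Free.anti {V W X X' : Finset α} (h : X ⊆ X') : Free G V W X' ⊆ Free G V W X :=
  fun _ hv => ⟨hv.1, hv.2.1, fun x hx => hv.2.2 x (h hx)⟩

lemma Via.anti {V W X X' : Finset α} (h : X ⊆ X') (z y : α) : Via G V W X' z y ⊆ Via G V W X z y :=
  fun _ hv => ⟨Free.anti h hv.1, hv.2⟩

lemma Blob.anti {V W X X' : Finset α} (h : X ⊆ X') (z y : α) :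
    Blob G V W X' z y ⊆ Blob G V W X z y :=
  fun _ hv => Reach.mono (Set.union_subset_union_left _ (Via.anti h z y)) hv

/-- A larger `X` leaves fewer free vertices. Hence no hanging pair appears while `X` grows, and
after the last hanging stage has been treated, the later ones stay free of hanging pairs. -/
lemma Hang.anti {V W X X' : Finset α} (h : X ⊆ X') {z y : α} (hh : Hang G V W X' z y) :
    Hang G V W X z y := by
  obtain ⟨M, h1, h2⟩ := hh.cyc
  exact ⟨hh.z_mem, fun hz => hh.z_not (h hz), hh.y_mem, fun hz => hh.y_not (h hz), hh.eq_or_adj,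
    M, h1.trans (Blob.anti h z y), h2⟩

lemma Reach.self_mem {S : Set α} {v u : α} (h : Reach G S v u) :
    Reach G {w | Reach G S v w} v u := by
  induction h with
  | refl => exact .refl
  | tail h1 h ih => exact ih.tail ⟨h1, h1.tail h, h.2.2⟩

lemma IsLink.reach {S T : Set α} {x y : α} {l : ℕ} {p : ℕ → α} (h : IsLink G S x y l p)
    (hT : ∀ i ≤ l + 1, p i ∈ T) {i : ℕ} (hi : i ≤ l + 1) : Reach G T x (p i) := by
  induction i with
  | zero => rw [h.fst]; exact .refl
  | succ i ih =>
    exact (ih (by omega)).trans (Reach.single (hT i (by omega)) (hT _ hi) (h.adj i (by omega)))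

/-- If nothing hangs off `W` then all cycles that avoid the closed neighbourhood of `X` avoid that
of `W`. -/
theorem not_hang {V W X₀ X : Finset α} (hG : Good G V W X₀) (hN : NoEar G V W X₀) (hX : X₀ ⊆ X)
    (hH : ∀ z y, ¬ Hang G V W X z y) {M : Finset α} (hMV : M ⊆ V) (ht : Thick G M)
    (hMX : ∀ v ∈ M, v ∉ X ∧ ∀ x ∈ X, ¬ G.Adj v x) :
    ∀ v ∈ M, v ∉ W ∧ ∀ w ∈ W, ¬ G.Adj v w := by
  classical
  have hfree : ∀ v ∈ M, v ∉ W → v ∈ Free G V W X := fun v hv hW => ⟨hMV hv, hW, (hMX v hv).2⟩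
  have hF0 : Free G V W X ⊆ Free G V W X₀ := Free.anti hX
  -- no cycle inside `W`
  have h1 : ∀ M' ⊆ M, M' ⊆ W → M'.Nonempty → ¬ Thick G M' := by
    rintro M' hM' hM'W ⟨v, hv⟩ ht'
    obtain ⟨x, hx⟩ := hG.ne
    -- Vertices of `M` avoid `X`, so they have degree two in `W`, and those in `M'` have both
    -- neighbours in `M'`. Since `G[W]` is connected, `M'` would contain a vertex of `X₀`.
    refine (hMX x (hM' (Reach.closed (Y := W) (M := M') (fun v hv u hu hvu => ?_) hv
      (hG.conn v (hM'W hv) x (hG.subX hx))))).1 (hX hx)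
    have hd : (nb G W v).card = 2 := by
      rcases hG.deg v (hM'W hv) with h | h
      · exact h
      · exact absurd (hX (hG.ball v (hM'W hv) h (mem_ball2.2 (.inl rfl)))) (hMX v (hM' hv)).1
    have := Finset.eq_of_subset_of_card_le (nb_mono hM'W v) (hd.le.trans (ht' v hv))
    exact (mem_nb.1 (this ▸ mem_nb.2 ⟨hu, hvu⟩)).1
  -- no cycle meets a component with attachments
  have h2 : ∀ v ∈ M, v ∉ W → ∀ u w, Reach G (Free G V W X) v u → w ∈ W → ¬ G.Adj u w := by
    intro v hv hvW u z hu hz huz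
    have hvF := hfree v hv hvW
    have hnX : ∀ u w, Reach G (Free G V W X) v u → G.Adj u w → w ∉ X := fun u w hu huw hw =>
      (hu.mem hvF).2.2 w hw huw
    -- If the component `K` of `v` attaches to `z` alone, the part of `M` in `K` and `z` keeps all
    -- degrees except at `z`, so a cycle hangs off `z`. Otherwise a shortest path through `K`
    -- between different attachments is an ear if its ends are nonadjacent, and closes up to a
    -- hanging cycle if they are adjacent.
    by_cases huniq : ∀ u' z', Reach G (Free G V W X) v u' → z' ∈ W → G.Adj u' z' → z' = z
    · set K := {u | Reach G (Free G V W X) v u} with hK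
      have hKB : K ⊆ Via G V W X z z := fun u' hu' =>
        ⟨hu'.mem hvF, fun w hw huw => .inl (huniq u' w hu' hw huw)⟩
      obtain ⟨M', hM', hne, ht'⟩ := exists_thick_of_deg (G := G)
        (M := M.filter fun u => u ∈ K ∨ u = z) (z := z)
        ⟨v, by simp only [Finset.mem_filter]; exact ⟨hv, .inl .refl⟩, fun h => hvW (h ▸ hz)⟩ (by
          intro a ha haz
          simp only [Finset.mem_filter] at ha
          have haK : a ∈ K := ha.2.resolve_right haz
          refine (ht a ha.1).trans (Finset.card_le_card fun b hb => ?_)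
          obtain ⟨hb, hab⟩ := mem_nb.1 hb
          refine mem_nb.2 ⟨Finset.mem_filter.2 ⟨hb, ?_⟩, hab⟩
          by_cases hbW : b ∈ W
          · exact .inr (huniq a b haK hbW hab)
          · exact .inl (Relation.ReflTransGen.tail haK ⟨Reach.mem haK hvF, hfree b hb hbW, hab⟩))
      refine hH z z ⟨hz, hnX u z hu huz, hz, hnX u z hu huz, .inl rfl, M', fun a ha => ?_, hne, ht'⟩
      have haM := hM' ha
      simp only [Finset.mem_filter] at haM
      rcases haM.2 with haK | rfl
      · have hmono : K ⊆ Via G V W X z z ∪ {z, z} := hKB.trans Set.subset_union_left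
        refine Reach.trans (Reach.single (.inr (by simp)) (hmono hu) huz.symm) ?_
        exact ((Reach.self_mem hu).mono hmono).symm.trans ((Reach.self_mem haK).mono hmono)
      · exact Relation.ReflTransGen.refl
    · push Not at huniq
      obtain ⟨u', z', hu', hz', huz', hne⟩ := huniq
      set K := {u | Reach G (Free G V W X) v u} with hK
      obtain ⟨l, hl⟩ := Reach.link (S := K) (Reach.trans (Reach.symm (Reach.self_mem hu))
        (Reach.self_mem hu')) hu huz.symm huz'
      obtain ⟨x, y, l, p, ⟨hx, hy, hxy⟩, hp, hmin⟩ := exists_min_link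
        (fun x y => x ∈ W ∧ y ∈ W ∧ x ≠ y) ⟨hz, hz', hne.symm⟩ hl
      have hl := hp.pos
      have hp1 : G.Adj (p 1) x := by rw [← hp.fst]; exact (hp.adj 0 (by omega)).symm
      have hpl : G.Adj (p l) y := by rw [← hp.lst]; exact hp.adj l le_rfl
      have hxX : x ∉ X := hnX _ x (hp.mem 1 le_rfl hl) hp1
      have hyX : y ∉ X := hnX _ y (hp.mem l hl le_rfl) hpl
      -- A further neighbour in `W` would yield a shorter path between different attachments. The
      -- exception is `l = 1`, where it would be a second neighbour of a free vertex.
      have hvia : ∀ i, 1 ≤ i → i ≤ l → p i ∈ Via G V W X x y := by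
        intro i hi hil
        refine ⟨Reach.mem (hp.mem i hi hil) hvF, fun w hw hiw => ?_⟩
        by_contra! hcon
        by_cases hil' : i < l
        · have := hmin x w i ⟨hx, hw, hcon.1.symm⟩ (hp.initial hi hil hiw)
          omega
        by_cases hi' : 1 < i
        · have := hmin w y _ ⟨hw, hy, hcon.2⟩ (hp.suffix hi hil hiw)
          omega
        obtain rfl : i = 1 := by omega
        exact hcon.1 (hG.uniq _ (hF0 (Reach.mem (hp.mem 1 hi hil) hvF)) w hw x hx hiw hp1)
      by_cases hadj : G.Adj x y
      · have hT : ∀ i ≤ l + 1, p i ∈ Via G V W X x y ∪ {x, y} := by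
          intro i hi
          by_cases h0 : i = 0
          · subst h0; right; simp [hp.fst]
          by_cases h0' : i = l + 1
          · subst h0'; right; simp [hp.lst]
          · exact .inl (hvia i (by omega) (by omega))
        set M₁ : Finset α := MinCycle.verts x y l p
        have hlink : IsLink G (↑(M₁ \ {x, y}) : Set α) x y l p := hp.mono fun i hi hil => by
          have := (hvia i hi hil).1.2.1
          rw [Finset.mem_coe, Finset.mem_sdiff]
          refine ⟨Finset.mem_union_right _ (mem_inner.2 ⟨i, hi, hil, rfl⟩), ?_⟩
          simp only [Finset.mem_insert, Finset.mem_singleton]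
          rintro (h | h)
          · exact this (h ▸ hx)
          · exact this (h ▸ hy)
        obtain ⟨l', p', hc⟩ := exists_minCycle (G := G) (M := M₁) (x := x) (y := y)
          (by simp [M₁, MinCycle.verts]) (by simp [M₁, MinCycle.verts]) hadj ⟨p, hlink⟩
        refine hH x y ⟨hx, hxX, hy, hyX, .inr hadj, MinCycle.verts x y l' p', fun a ha => ?_,
          ⟨x, by simp [MinCycle.verts]⟩, hc.thick⟩
        have ha' := hc.verts_sub ha
        simp only [M₁, MinCycle.verts, Finset.mem_union, Finset.mem_insert, Finset.mem_singleton,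
          mem_inner] at ha'
        rcases ha' with (rfl | rfl) | ⟨i, hi, hil, rfl⟩
        · exact Relation.ReflTransGen.refl
        · have := hp.reach hT (i := l + 1) le_rfl
          rwa [hp.lst] at this
        · exact hp.reach hT (by omega)
      · exact hN x y l ⟨hx, fun h => hxX (hX h), hy, fun h => hyX (hX h), hxy, hadj⟩
          ⟨p, hp.mono fun i hi hil => Via.anti hX x y (hvia i hi hil)⟩
  have h3 : ∀ v ∈ M, v ∉ W := by
    by_contra! hcon
    obtain ⟨v, hv, hvW⟩ := hcon
    refine h1 (M.filter (· ∈ W)) (Finset.filter_subset _ _)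
      (fun a ha => (Finset.mem_filter.1 ha).2) ⟨v, by simp [hv, hvW]⟩ fun a ha => ?_
    obtain ⟨haM, haW⟩ := Finset.mem_filter.1 ha
    refine (ht a haM).trans (Finset.card_le_card fun b hb => ?_)
    obtain ⟨hb, hab⟩ := mem_nb.1 hb
    refine mem_nb.2 ⟨Finset.mem_filter.2 ⟨hb, ?_⟩, hab⟩
    by_contra hbW
    exact h2 b hb hbW b a .refl haW hab.symm
  exact fun v hv => ⟨h3 v hv, fun w hw => h2 v hv (h3 v hv) v w .refl hw⟩

end
end InducedErdosPosa

/-! ### Recording and charging the cycles of the second phase. -/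

namespace InducedErdosPosa

set_option linter.unusedSectionVars false

section
variable {α : Type*} [DecidableEq α] {G : SimpleGraph α}

/-- A walk from `z` is cut at its last visit to `z` or `y`; from there on it stays among the
vertices that attach to these two only. -/
lemma Blob.cases {V W X : Finset α} {z y d : α} (h : d ∈ Blob G V W X z y) :
    d = z ∨ d = y ∨ d ∈ Via G V W X z y ∧
      ∃ a, (a = z ∨ a = y) ∧ ∃ u ∈ Via G V W X z y, G.Adj a u ∧ Reach G (Via G V W X z y) u d := by
  have key : ∀ {d}, Reach G (Via G V W X z y ∪ {z, y}) z d → d = z ∨ d = y ∨ d ∈ Via G V W X z y ∧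
      ∃ a, (a = z ∨ a = y) ∧ ∃ u ∈ Via G V W X z y, G.Adj a u ∧ Reach G (Via G V W X z y) u d := by
    intro d h
    induction h with
    | refl => exact .inl rfl
    | @tail b c _ h ih =>
      have hb := h.1
      have hbc := h.2.2
      rcases h.2.1 with hc | hc
      · refine .inr (.inr ⟨hc, ?_⟩)
        have hend : b = z ∨ b = y → ∃ a, (a = z ∨ a = y) ∧ ∃ u ∈ Via G V W X z y, G.Adj a u ∧
            Reach G (Via G V W X z y) u c := fun h => ⟨b, h, c, hc, hbc, .refl⟩
        rcases ih with h | h | ⟨hbV, a, ha, u, hu, hau, hr⟩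
        · exact hend (.inl h)
        · exact hend (.inr h)
        · exact ⟨a, ha, u, hu, hau, hr.tail ⟨hbV, hc, hbc⟩⟩
      · simp only [Set.mem_insert_iff, Set.mem_singleton_iff] at hc
        tauto
  exact key h

lemma Blob.subset {V W X : Finset α} {z y d : α} (hWV : W ⊆ V) (hz : z ∈ W) (hy : y ∈ W)
    (h : d ∈ Blob G V W X z y) : d ∈ V := by
  rcases Blob.cases h with rfl | rfl | h
  · exact hWV hz
  · exact hWV hy
  · exact h.1.1.1

lemma Blob.reach {V W X : Finset α} {z y d : α} (hWV : W ⊆ V) (hz : z ∈ W) (hy : y ∈ W)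
    (h : d ∈ Blob G V W X z y) : Reach G ↑V z d := by
  refine Reach.mono ?_ h
  rintro v (hv | hv)
  · exact hv.1.1
  · simp only [Set.mem_insert_iff, Set.mem_singleton_iff] at hv
    rcases hv with rfl | rfl
    · exact hWV hz
    · exact hWV hy

/-- Two far blobs are not joined outside the neighbourhood of `W`. -/
lemma NoEar.no_reach {V W X : Finset α} (hG : Good G V W X) (hN : NoEar G V W X) {z y z' y' : α}
    (hz : z ∈ W ∧ z ∉ X) (hy : y ∈ W ∧ y ∉ X) (hz' : z' ∈ W ∧ z' ∉ X) (hy' : y' ∈ W ∧ y' ∉ X)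
    (hfar : ∀ a, a = z ∨ a = y → ∀ b, b = z' ∨ b = y' → a ≠ b ∧ ¬ G.Adj a b) {d d' : α}
    (hd : d ∈ Blob G V W X z y) (hdv : d ∈ Via G V W X z y) (hd' : d' ∈ Blob G V W X z' y')
    (hdv' : d' ∈ Via G V W X z' y') {T : Set α}
    (hT : ∀ v ∈ T, v ∈ Via G V W X z y ∨ v ∈ Via G V W X z' y' ∨
      v ∈ V ∧ v ∉ W ∧ ∀ w ∈ W, ¬ G.Adj v w) : ¬ Reach G T d d' := by
  intro hr
  have hd1 : d ∉ W := hdv.1.2.1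
  have hd1' : d' ∉ W := hdv'.1.2.1
  obtain ⟨a, ha, u, hu, hau, hud⟩ : ∃ a, (a = z ∨ a = y) ∧ ∃ u ∈ Via G V W X z y, G.Adj a u ∧
      Reach G (Via G V W X z y) u d := by
    rcases Blob.cases hd with rfl | rfl | h
    · exact absurd hz.1 hd1
    · exact absurd hy.1 hd1
    · exact h.2
  obtain ⟨b, hb, u', hu', hbu', hud'⟩ : ∃ a, (a = z' ∨ a = y') ∧ ∃ u ∈ Via G V W X z' y',
      G.Adj a u ∧ Reach G (Via G V W X z' y') u d' := by
    rcases Blob.cases hd' with rfl | rfl | h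
    · exact absurd hz'.1 hd1'
    · exact absurd hy'.1 hd1'
    · exact h.2
  -- The paths from the two pairs to `d` and `d'` and the path inside `T` all run in `K`. Together
  -- they form a link between the pairs that `NoEar.no_link` forbids.
  set K : Set α := {v | v ∈ Free G V W X ∧ ∀ w ∈ W, G.Adj v w →
    w ∈ ({a | a = z ∨ a = y} : Set α) ∨ w ∈ ({b | b = z' ∨ b = y'} : Set α)} with hK
  have hK1 : Via G V W X z y ⊆ K := fun v hv => ⟨hv.1, fun w hw hvw => .inl (hv.2 w hw hvw)⟩
  have hK2 : Via G V W X z' y' ⊆ K := fun v hv => ⟨hv.1, fun w hw hvw => .inr (hv.2 w hw hvw)⟩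
  have hK3 : T ⊆ K := by
    intro v hv
    rcases hT v hv with h | h | ⟨h1, h2, h3⟩
    · exact hK1 h
    · exact hK2 h
    · exact ⟨⟨h1, h2, fun x hx => h3 x (hG.subX hx)⟩, fun w hw hvw => absurd hvw (h3 w hw)⟩
  obtain ⟨l, hl⟩ := Reach.link (S := K) (((hud.mono hK1).trans (hr.mono hK3)).trans
    (hud'.mono hK2).symm) (hK1 hu) hau hbu'.symm
  refine NoEar.no_link hG hN (A := {a | a = z ∨ a = y}) (A' := {b | b = z' ∨ b = y'}) ?_ ?_ hfar
    ha hb hl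
  · rintro _ (rfl | rfl) <;> assumption
  · rintro _ (rfl | rfl) <;> assumption

/-- A sequence of stages of the construction. -/
structure Fam (G : SimpleGraph α) (V W X : ℕ → Finset α) (m : ℕ) : Prop where
  good : ∀ i < m, Good G (V i) (W i) (X i)
  noear : ∀ i < m, NoEar G (V i) (W i) (X i)
  step : ∀ i < m, ∀ v, v ∈ V (i + 1) ↔ v ∈ V i ∧ v ∉ W i ∧ ∀ w ∈ W i, ¬ G.Adj v w

/-- The pair `z`, `y` has been used in stage `i`, and all later hanging pairs belong to stages up to
`i`. -/
structure Used (G : SimpleGraph α) (V W X : ℕ → Finset α) (m : ℕ) (X' : Finset α) (i : ℕ)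
    (z y : α) : Prop where
  lt : i < m
  z_mem : z ∈ W i ∧ z ∉ X i
  y_mem : y ∈ W i ∧ y ∉ X i
  eq_or_adj : z = y ∨ G.Adj z y
  ball : ball2 G (W i) z ⊆ X'
  last : ∀ j < m, ∀ z' y', Hang G (V j) (W j) X' z' y' → j ≤ i

/-- `l` is the first stage after `i` that is reachable from `d`. -/
structure FirstReach (G : SimpleGraph α) (V W : ℕ → Finset α) (m i : ℕ) (d : α) (l : ℕ) : Prop where
  mem : d ∈ V (i + 1)
  lt : i < l
  lt' : l < m
  reach : ∃ w ∈ W l, Reach G ↑(V (i + 1)) d w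
  first : ∀ j, i < j → j < l → ∀ w ∈ W j, ¬ Reach G ↑(V (i + 1)) d w

/-- The state of the second phase: the cycles in `R` are recorded, and every unrecorded one is
charged to a stage in `Φ`. -/
structure Charged (G : SimpleGraph α) (V W X : ℕ → Finset α) (m : ℕ) (X' : Finset α)
    (R : Finset (Finset α)) (Φ : Finset ℕ) : Prop where
  rec_cyc : ∀ D ∈ R, IsCyc G D
  rec_used : ∀ D ∈ R, ∃ i z y, Used G V W X m X' i z y ∧ ↑D ⊆ Blob G (V i) (W i) (X i) z y
  rec_far : ∀ D ∈ R, ∀ D' ∈ R, D ≠ D' → ∀ d ∈ D, ∀ d' ∈ D', d ≠ d' ∧ ¬ G.Adj d d'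
  charged : ∀ l ∈ Φ, ∃ i z y d d', Used G V W X m X' i z y ∧ d ∈ Blob G (V i) (W i) (X i) z y ∧
    d ∈ Via G (V i) (W i) (X i) z y ∧ (d = d' ∨ G.Adj d d') ∧ FirstReach G V W m i d' l

namespace Fam
variable {V W X : ℕ → Finset α} {m : ℕ}

lemma anti (h : Fam G V W X m) {i j : ℕ} (hij : i ≤ j) (hj : j ≤ m) : V j ⊆ V i := by
  induction j, hij using Nat.le_induction with
  | base => exact subset_rfl
  | succ j hij ih => exact fun v hv => ih (by omega) ((h.step j (by omega) v).1 hv).1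

lemma sub_succ (h : Fam G V W X m) {i j : ℕ} (hij : i < j) (hj : j < m) : W j ⊆ V (i + 1) :=
  (h.good j hj).sub.trans (h.anti hij hj.le)

lemma not_touch (h : Fam G V W X m) {i : ℕ} (hi : i < m) {v : α} (hv : v ∈ V (i + 1)) {w : α}
    (hw : w ∈ W i) : w ≠ v ∧ ¬ G.Adj w v := by
  obtain ⟨-, h1, h2⟩ := (h.step i hi v).1 hv
  exact ⟨fun e => h1 (e ▸ hw), fun e => h2 w hw e.symm⟩

end Fam

lemma Used.mono {V W X : ℕ → Finset α} {m : ℕ} {X' X'' : Finset α} {i : ℕ} {z y : α}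
    (h : Used G V W X m X' i z y) (hX : X' ⊆ X'') : Used G V W X m X'' i z y :=
  ⟨h.lt, h.z_mem, h.y_mem, h.eq_or_adj, h.ball.trans hX,
    fun j hj z' y' hh => h.last j hj z' y' (hh.anti hX)⟩

/-- Both `z` and `y` are at distance at most one from `z`, so the ball of radius two around `z`,
which is part of `X'`, contains them and all their neighbours in `W i`. -/
lemma Used.far {V W X : ℕ → Finset α} {m : ℕ} {X' : Finset α} {i : ℕ} {z y : α}
    (h : Used G V W X m X' i z y) {z' y' : α} (hz' : z' ∈ W i ∧ z' ∉ X') (hy' : y' ∈ W i ∧ y' ∉ X') :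
    ∀ a, a = z ∨ a = y → ∀ b, b = z' ∨ b = y' → a ≠ b ∧ ¬ G.Adj a b := by
  intro a ha b hb
  have hbX : b ∈ W i ∧ b ∉ X' := by rcases hb with rfl | rfl <;> assumption
  have hza : a = z ∨ G.Adj z a := by
    rcases ha with rfl | rfl
    · exact .inl rfl
    · exact h.eq_or_adj.imp Eq.symm id
  have haW : a ∈ W i := by
    rcases ha with rfl | rfl
    · exact h.z_mem.1
    · exact h.y_mem.1
  constructor
  · rintro rfl
    exact hbX.2 (h.ball (mem_ball2.2 (hza.imp id fun e => .inl ⟨haW, e⟩)))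
  · intro hab
    rcases hza with rfl | hza
    · exact hbX.2 (h.ball (mem_ball2.2 (.inr (.inl ⟨hbX.1, hab⟩))))
    · exact hbX.2 (h.ball (mem_ball2.2 (.inr (.inr ⟨a, haW, hza, hbX.1, hab⟩))))

lemma Used.mem {V W X : ℕ → Finset α} {m : ℕ} {X' : Finset α} {i : ℕ} {z y : α}
    (h : Used G V W X m X' i z y) : z ∈ X' ∧ y ∈ X' := by
  refine ⟨h.ball (mem_ball2.2 (.inl rfl)), h.ball (mem_ball2.2 ?_)⟩
  rcases h.eq_or_adj with e | e
  · exact .inl e.symm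
  · exact .inr (.inl ⟨h.y_mem.1, e⟩)

namespace Charged
variable {V W X : ℕ → Finset α} {m : ℕ} {X' : Finset α} {R : Finset (Finset α)} {Φ : Finset ℕ}

lemma mono (h : Charged G V W X m X' R Φ) {X'' : Finset α} (hX : X' ⊆ X'') :
    Charged G V W X m X'' R Φ := by
  refine ⟨h.rec_cyc, fun D hD => ?_, h.rec_far, fun l hl => ?_⟩
  · obtain ⟨i, z, y, h1, h2⟩ := h.rec_used D hD
    exact ⟨i, z, y, h1.mono hX, h2⟩
  · obtain ⟨i, z, y, d, d', h1, h2⟩ := h.charged l hl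
    exact ⟨i, z, y, d, d', h1.mono hX, h2⟩

/-- A charged stage comes strictly after the stage that charges it, so stage `0` is never charged.
-/
lemma card_le (h : Charged G V W X m X' R Φ) : Φ.card ≤ m - 1 := by
  have : Φ ⊆ Finset.Ico 1 m := by
    intro l hl
    obtain ⟨i, z, y, d, d', -, -, -, -, h5⟩ := h.charged l hl
    have := h5.lt
    have := h5.lt'
    simp only [Finset.mem_Ico]
    omega
  simpa using Finset.card_le_card this

/-- Recording a cycle. -/
lemma record (h : Charged G V W X m X' R Φ) {i : ℕ} {z y : α} (hX : X i ⊆ X') (hi : i < m)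
    (hh : Hang G (V i) (W i) X' z y)
    (hlast : ∀ j < m, ∀ z' y', Hang G (V j) (W j) X' z' y' → j ≤ i) {D : Finset α}
    (hD : IsCyc G D) (hDB : ↑D ⊆ Blob G (V i) (W i) X' z y)
    (hfar : ∀ D' ∈ R, ∀ d ∈ D, ∀ d' ∈ D', d ≠ d' ∧ ¬ G.Adj d d') :
    Charged G V W X m (X' ∪ ball2 G (W i) z) (insert D R) Φ := by
  have h' := h.mono (X'' := X' ∪ ball2 G (W i) z) Finset.subset_union_left
  refine ⟨?_, ?_, ?_, h'.charged⟩
  · intro D' hD'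
    rcases Finset.mem_insert.1 hD' with rfl | hD'
    · exact hD
    · exact h.rec_cyc D' hD'
  · intro D' hD'
    rcases Finset.mem_insert.1 hD' with rfl | hD'
    · refine ⟨i, z, y, ⟨hi, ⟨hh.z_mem, fun e => hh.z_not (hX e)⟩,
        ⟨hh.y_mem, fun e => hh.y_not (hX e)⟩, hh.eq_or_adj, Finset.subset_union_right,
        fun j hj z' y' hh' => hlast j hj z' y' (hh'.anti Finset.subset_union_left)⟩,
        hDB.trans (Blob.anti hX z y)⟩
    · exact h'.rec_used D' hD'
  · intro D₁ h1 D₂ h2 hne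
    rcases Finset.mem_insert.1 h1 with rfl | g1 <;> rcases Finset.mem_insert.1 h2 with rfl | g2
    · exact absurd rfl hne
    · exact hfar D₂ g2
    · intro d hd d' hd'
      have := hfar D₁ g1 d' hd' d hd
      exact ⟨this.1.symm, fun e => this.2 e.symm⟩
    · exact h.rec_far D₁ g1 D₂ g2 hne

/-- A cycle that touches a recorded one is charged to a new stage. -/
lemma charge (hF : Fam G V W X m) (h : Charged G V W X m X' R Φ) {i : ℕ} {z y : α}
    (hX : X i ⊆ X') (hi : i < m) (hh : Hang G (V i) (W i) X' z y)
    (hlast : ∀ j < m, ∀ z' y', Hang G (V j) (W j) X' z' y' → j ≤ i) {d d' : α}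
    (hd : d ∈ Blob G (V i) (W i) X' z y) {D' : Finset α} (hD' : D' ∈ R) (hd' : d' ∈ D')
    (hdd' : d = d' ∨ G.Adj d d') :
    ∃ l ∉ Φ, Charged G V W X m (X' ∪ ball2 G (W i) z) R (insert l Φ) := by
  classical
  have hz0 : z ∈ W i ∧ z ∉ X i := ⟨hh.z_mem, fun e => hh.z_not (hX e)⟩
  have hy0 : y ∈ W i ∧ y ∉ X i := ⟨hh.y_mem, fun e => hh.y_not (hX e)⟩
  obtain ⟨i', z', y', hu', hDB'⟩ := h.rec_used D' hD'
  have hdB' := hDB' hd'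
  have hii' : i ≤ i' := hu'.last i hi z y hh
  -- Within a single stage the two pairs are far apart, and blobs that touch would provide a
  -- forbidden link between them.
  have hne : i ≠ i' := by
    rintro rfl
    have hfar := hu'.far ⟨hh.z_mem, hh.z_not⟩ ⟨hh.y_mem, hh.y_not⟩
    have hmem' := hu'.mem
    have hdW : d = z ∨ d = y → d ∈ W i := by rintro (rfl | rfl); exacts [hh.z_mem, hh.y_mem]
    have hdW' : d' = z' ∨ d' = y' → d' ∈ W i ∧ d' ∈ X' := by
      rintro (rfl | rfl)
      exacts [⟨hu'.z_mem.1, hmem'.1⟩, ⟨hu'.y_mem.1, hmem'.2⟩]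
    have hdc := Blob.cases hd
    have hdc' := Blob.cases hdB'
    rw [← or_assoc] at hdc hdc'
    rcases hdc with hd1 | ⟨hd1, -⟩ <;> rcases hdc' with hd2 | ⟨hd2, -⟩
    · have := hfar d' hd2 d hd1
      rcases hdd' with e | e
      · exact this.1 e.symm
      · exact this.2 e.symm
    · rcases hdd' with e | e
      · exact hd2.1.2.1 (e ▸ hdW hd1)
      · have h3 := hd2.2 d (hdW hd1) e.symm
        exact (hfar d h3 d hd1).1 rfl
    · rcases hdd' with e | e
      · exact hd1.1.2.1 (e ▸ (hdW' hd2).1)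
      · exact hd1.1.2.2 d' (hdW' hd2).2 e
    · have hdv := Via.anti hX z y hd1
      refine NoEar.no_reach (hF.good i hi) (hF.noear i hi) hu'.z_mem hu'.y_mem hz0 hy0 hfar hdB' hd2
        (Blob.anti hX z y hd) hdv (T := Via G (V i) (W i) (X i) z' y' ∪ Via G (V i) (W i) (X i) z y)
        (fun v hv => hv.imp id .inl) ?_
      rcases hdd' with rfl | e
      · exact .refl
      · exact Reach.single (.inl hd2) (.inr hdv) e.symm
  have hlt : i < i' := lt_of_le_of_ne hii' hne
  have hi' := hu'.lt
  have hGi' := hF.good i' hi'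
  have hV' : V i' ⊆ V (i + 1) := hF.anti hlt hi'.le
  have hd'V : d' ∈ V (i + 1) := hV' (Blob.subset hGi'.sub hu'.z_mem.1 hu'.y_mem.1 hdB')
  have hdv : d ∈ Via G (V i) (W i) X' z y := by
    have : d ∉ W i := by
      intro hdW
      have := hF.not_touch hi hd'V hdW
      rcases hdd' with e | e
      · exact this.1 e
      · exact this.2 e
    rcases Blob.cases hd with rfl | rfl | h
    · exact absurd hh.z_mem this
    · exact absurd hh.y_mem this
    · exact h.1
  -- The stage `i'` of the recorded cycle is a candidate: its blob connects `d'` with `z'` inside `V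
  -- (i + 1)`.
  have hex : ∃ l, i < l ∧ l < m ∧ ∃ w ∈ W l, Reach G ↑(V (i + 1)) d' w :=
    ⟨i', hlt, hi', z', hu'.z_mem.1, ((Blob.reach hGi'.sub hu'.z_mem.1 hu'.y_mem.1 hdB').mono
      (by simpa using hV')).symm⟩
  set l := Nat.find hex with hl
  obtain ⟨hil, hlm, w, hw, hwr⟩ := Nat.find_spec hex
  have hfirst : ∀ j, i < j → j < l → ∀ w ∈ W j, ¬ Reach G ↑(V (i + 1)) d' w :=
    fun j hij hjl w hw hr => Nat.find_min hex hjl ⟨hij, by omega, w, hw, hr⟩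
  have hFR : FirstReach G V W m i d' l := ⟨hd'V, hil, hlm, ⟨w, hw, hwr⟩, hfirst⟩
  refine ⟨l, fun hlΦ => ?_, ?_⟩
  -- Suppose `l` was charged before, by a pair in stage `j ≥ i`. Both `d'` and `d₁'` reach the
  -- connected graph on `W l` inside `V (i + 1)`. If `j = i`, two far blobs of one stage are joined
  -- away from `W i`. If `i < j`, stage `j` precedes `l` and is reachable from `d'`, so `l` was not
  -- the first.
  · obtain ⟨j, z₁, y₁, d₁, d₁', hu₁, hB₁, hv₁, hdd₁, hF₁⟩ := h.charged l hlΦ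
    obtain ⟨w₁, hw₁, hwr₁⟩ := hF₁.reach
    have hij : i ≤ j := hu₁.last i hi z y hh
    have hVj : V (j + 1) ⊆ V (i + 1) := hF.anti (by omega) (by have := hu₁.lt; omega)
    -- the two cycles touch the same component
    have hcon : Reach G ↑(V (i + 1)) d' d₁' := by
      refine hwr.trans (((hF.good l hlm).conn w hw w₁ hw₁).mono ?_ |>.trans
        (hwr₁.mono (by simpa using hVj)).symm)
      simpa using hF.sub_succ hil hlm
    rcases hij.eq_or_lt with rfl | hij
    · have hfar := hu₁.far ⟨hh.z_mem, hh.z_not⟩ ⟨hh.y_mem, hh.y_not⟩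
      have hdv0 := Via.anti hX z y hdv
      refine NoEar.no_reach (hF.good i hi) (hF.noear i hi) hu₁.z_mem hu₁.y_mem hz0 hy0 hfar hB₁ hv₁
        (Blob.anti hX z y hd) hdv0 (T := Via G (V i) (W i) (X i) z₁ y₁ ∪
          (Via G (V i) (W i) (X i) z y ∪ ↑(V (i + 1))))
        (fun v hv => hv.imp id (Or.imp id fun hv => (hF.step i hi v).1 hv)) ?_
      have e1 : Reach G (Via G (V i) (W i) (X i) z₁ y₁ ∪ (Via G (V i) (W i) (X i) z y ∪
          ↑(V (i + 1)))) d₁ d₁' := by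
        rcases hdd₁ with rfl | e
        · exact .refl
        · exact Reach.single (.inl hv₁) (.inr (.inr hF₁.mem)) e
      have e2 : Reach G (Via G (V i) (W i) (X i) z₁ y₁ ∪ (Via G (V i) (W i) (X i) z y ∪
          ↑(V (i + 1)))) d d' := by
        rcases hdd' with rfl | e
        · exact .refl
        · exact Reach.single (.inr (.inl hdv0)) (.inr (.inr hd'V)) e
      refine e1.trans (Reach.trans (hcon.symm.mono ?_) e2.symm)
      exact fun v hv => .inr (.inr hv)
    · have hGj := hF.good j hu₁.lt
      have hVj' : V j ⊆ V (i + 1) := hF.anti (by omega) hu₁.lt.le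
      refine hfirst j hij hF₁.lt z₁ hu₁.z_mem.1 (hcon.trans (Reach.trans (v := d₁) ?_
        ((Blob.reach hGj.sub hu₁.z_mem.1 hu₁.y_mem.1 hB₁).symm.mono (by simpa using hVj'))))
      rcases hdd₁ with rfl | e
      · exact .refl
      · exact Reach.single (hVj hF₁.mem)
          (hVj' (Blob.subset hGj.sub hu₁.z_mem.1 hu₁.y_mem.1 hB₁)) e.symm
  · have h' := h.mono (X'' := X' ∪ ball2 G (W i) z) Finset.subset_union_left
    refine ⟨h'.rec_cyc, h'.rec_used, h'.rec_far, fun l' hl' => ?_⟩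
    rcases Finset.mem_insert.1 hl' with rfl | hl'
    · exact ⟨i, z, y, d, d', ⟨hi, hz0, hy0, hh.eq_or_adj, Finset.subset_union_right,
        fun j hj z' y' hh' => hlast j hj z' y' (hh'.anti Finset.subset_union_left)⟩,
        Blob.anti hX z y hd, Via.anti hX z y hdv, hdd', hFR⟩
    · exact h'.charged l' hl'

end Charged

/-- If nothing hangs off any stage and the last stage leaves no cycle, then all cycles meet the
closed neighbourhood of `X'`. -/
theorem Fam.no_thick {V W X : ℕ → Finset α} {m : ℕ} {X' : Finset α} (hF : Fam G V W X m)
    (hX : ∀ i < m, X i ⊆ X') (hH : ∀ i < m, ∀ z y, ¬ Hang G (V i) (W i) X' z y)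
    (hend : ∀ M ⊆ V m, M.Nonempty → ¬ Thick G M) {M : Finset α} (hM : M ⊆ V 0) (ht : Thick G M)
    (hne : M.Nonempty) (hMX : ∀ v ∈ M, v ∉ X' ∧ ∀ x ∈ X', ¬ G.Adj v x) : False := by
  have : ∀ i ≤ m, M ⊆ V i := by
    intro i
    induction i with
    | zero => intro _; exact hM
    | succ i ih =>
      intro hi v hv
      have := not_hang (hF.good i hi) (hF.noear i hi) (hX i hi) (hH i hi) (ih (by omega)) ht hMX v hv
      exact (hF.step i hi v).2 ⟨ih (by omega) hv, this⟩
  exact hend M (this m le_rfl) hne ht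

end

section
variable {G : SimpleGraph ℕ}

/-- No edge of the union leaves a recorded cycle, so degrees in the union are degrees in the cycles,
and each cycle is closed under adjacency. -/
lemma pack_of_far {R : Finset (Finset ℕ)} (hc : ∀ D ∈ R, IsCyc G D)
    (hfar : ∀ D ∈ R, ∀ D' ∈ R, D ≠ D' → ∀ d ∈ D, ∀ d' ∈ D', d ≠ d' ∧ ¬ G.Adj d d') :
    Pack G R.card (R.biUnion id) := by
  have hcl : ∀ D ∈ R, ∀ v ∈ D, ∀ u ∈ R.biUnion id, G.Adj v u → u ∈ D := by
    intro D hD v hv u hu hvu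
    obtain ⟨D', hD', hu'⟩ := Finset.mem_biUnion.1 hu
    by_cases e : D = D'
    · exact e ▸ hu'
    · exact absurd hvu (hfar D hD D' hD' e v hv u hu').2
  constructor
  · intro v hv
    obtain ⟨D, hD, hvD⟩ := Finset.mem_biUnion.1 hv
    rw [← (hc D hD).deg hvD]
    congr 1
    ext u
    simp only [mem_nb]
    exact ⟨fun h => ⟨hcl D hD v hvD u h.1 h.2, h.2⟩,
      fun h => ⟨Finset.mem_biUnion.2 ⟨D, hD, h.1⟩, h.2⟩⟩
  · refine le_card_mins (fun i => (R.equivFin.symm i).1)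
      (fun i => Finset.subset_biUnion_of_mem id (R.equivFin.symm i).2)
      (fun i => (hc _ (R.equivFin.symm i).2).ne) (fun i => hcl _ (R.equivFin.symm i).2) ?_
    intro i j hij
    rw [Finset.disjoint_left]
    intro d hd hd'
    refine (hfar _ (R.equivFin.symm i).2 _ (R.equivFin.symm j).2 (fun e => hij ?_) d hd d hd').1 rfl
    exact R.equivFin.symm.injective (Subtype.ext e)

end
end InducedErdosPosa

/-! ### Logical and graph-theoretic expressions and their values. -/

namespace InducedErdosPosa

namespace Expr
variable {V A : Type}

/-! ### Truth values -/

/-- Negation. -/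
def notE (e : Expr V A) : Expr V A := .cond (.num 0) e (.num 0) (.num 1)
/-- Conjunction. -/
def andE (a b : Expr V A) : Expr V A := .cond (.num 0) a b (.num 0)
/-- Disjunction. -/
def orE (a b : Expr V A) : Expr V A := .add a b
/-- Comparison. -/
def ltE (a b : Expr V A) : Expr V A := .cond a b (.num 1) (.num 0)
/-- Comparison. -/
def leE (a b : Expr V A) : Expr V A := .cond b a (.num 0) (.num 1)
/-- Equality. -/
def eqE (a b : Expr V A) : Expr V A := .cond a b (.num 0) (.cond b a (.num 0) (.num 1))
/-- Existential quantification. -/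
def exE (f : V → Expr V A) : Expr V A := .sum f
/-- Universal quantification. -/
def allE (f : V → Expr V A) : Expr V A := notE (.sum fun v => notE (f v))
/-- The number of indices with a property. -/
def cntE (f : V → Expr V A) : Expr V A := .sum fun v => .cond (.num 0) (f v) (.num 1) (.num 0)
/-- The least index with a property. -/
def muE (f : V → Expr V A) : Expr V A :=
  -- Counts the numbers `v` such that no `u ≤ v` has the property. If some index has it, this count
  -- is the least one.
  .sum fun v => allE fun u => orE (ltE (.var v) (.var u)) (notE (f u))

attribute [simp] eval

variable {N : ℕ} {a b : Expr ℕ (ℕ → ℕ)} {f : ℕ → Expr ℕ (ℕ → ℕ)}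

@[simp] lemma tr_notE : 0 < (notE a).eval N ↔ ¬ 0 < a.eval N := by
  simp only [notE, eval]; split_ifs <;> simp [*]

@[simp] lemma tr_andE : 0 < (andE a b).eval N ↔ 0 < a.eval N ∧ 0 < b.eval N := by
  simp only [andE, eval]; split_ifs <;> simp [*]

@[simp] lemma tr_orE : 0 < (orE a b).eval N ↔ 0 < a.eval N ∨ 0 < b.eval N := by
  simp only [orE, eval]; omega

@[simp] lemma tr_ltE : 0 < (ltE a b).eval N ↔ a.eval N < b.eval N := by
  simp only [ltE, eval]; split_ifs <;> simp [*]

@[simp] lemma tr_leE : 0 < (leE a b).eval N ↔ a.eval N ≤ b.eval N := by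
  simp only [leE, eval]; split_ifs <;> omega

@[simp] lemma tr_eqE : 0 < (eqE a b).eval N ↔ a.eval N = b.eval N := by
  simp only [eqE, eval]; split_ifs <;> omega

@[simp] lemma tr_exE : 0 < (exE f).eval N ↔ ∃ i < N, 0 < (f i).eval N := by
  simp only [exE, eval, Finset.sum_pos_iff, Finset.mem_range]

@[simp] lemma tr_allE : 0 < (allE f).eval N ↔ ∀ i < N, 0 < (f i).eval N := by
  rw [allE, tr_notE, ← exE, tr_exE]
  simp only [tr_notE]
  push Not
  rfl

@[simp] lemma eval_cntE : (cntE f).eval N = ((Finset.range N).filter fun i => 0 < (f i).eval N).card := by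
  simp only [cntE, eval, Finset.card_filter]
  rfl

lemma eval_cntE' {S : Finset ℕ} (h : ∀ i, i ∈ S ↔ i < N ∧ 0 < (f i).eval N) :
    (cntE f).eval N = S.card := by
  rw [eval_cntE]
  congr 1
  ext i
  simp [h]

lemma eval_muE_eq {m : ℕ} (hm : m < N) (h : 0 < (f m).eval N)
    (h' : ∀ i < m, ¬ 0 < (f i).eval N) : (muE f).eval N = m := by
  have : ∀ i ∈ Finset.range N, (allE fun u => orE (ltE (.var i) (.var u)) (notE (f u))).eval N =
      if i < m then 1 else 0 := by
    intro i hi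
    have h1 : ∀ e : Expr ℕ (ℕ → ℕ), (notE e).eval N = if 0 < (notE e).eval N then 1 else 0 := by
      intro e
      simp only [notE, eval]; split_ifs <;> simp_all
    rw [allE, h1, ← allE]
    refine if_congr ?_ rfl rfl
    simp only [tr_allE, tr_orE, tr_ltE, tr_notE, eval]
    constructor
    · intro hall
      rcases hall m hm with h2 | h2
      · exact h2
      · exact absurd h h2
    · intro him j hj
      by_cases hij : i < j
      · exact .inl hij
      · exact .inr (h' j (by omega))
  simp only [muE, eval]
  rw [Finset.sum_congr rfl this, ← Finset.sum_filter, Finset.sum_const, smul_eq_mul, mul_one]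
  have : (Finset.range N).filter (· < m) = Finset.range m := by ext; simp; omega
  rw [this, Finset.card_range]

lemma eval_muE (h : ∃ i < N, 0 < (f i).eval N) :
    (muE f).eval N < N ∧ 0 < (f ((muE f).eval N)).eval N ∧
      ∀ i < (muE f).eval N, ¬ 0 < (f i).eval N := by
  classical
  obtain ⟨h1, h2⟩ := Nat.find_spec h
  have h3 : ∀ i < Nat.find h, ¬ 0 < (f i).eval N := fun i hi h4 =>
    Nat.find_min h hi ⟨hi.trans h1, h4⟩
  rw [eval_muE_eq h1 h2 h3]
  exact ⟨h1, h2, h3⟩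

/-! ### Graphs -/

/-- The number of vertices. -/
def nE (a : ℕ → A) : Expr V A := .read (a 0) (.num 0)
/-- The parameter. -/
def kE (a : ℕ → A) : Expr V A := .read (a 0) (.num 1)
/-- Adjacency. -/
def adjE (a : ℕ → A) (u v : Expr V A) : Expr V A :=
  andE (andE (ltE u (nE a)) (ltE v (nE a)))
    -- The matrix entry lies behind the two header cells. Without multiplication, the product of `u`
    -- and `n` is formed as a sum of `u` copies of `n`.
    (.read (a 0) (.add (.num 2) (.add (.sum fun w => .cond (.var w) u (nE a) (.num 0)) v)))

/-- The largest thick subset of `S`. -/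
def coreE (a : ℕ → A) (S : V → Expr V A) (b : A → Expr V A) : Expr V A :=
  .iter S (fun _ B v => andE (.read B (.var v))
    (ltE (.num 1) (cntE fun u => andE (.read B (.var u)) (adjE a (.var v) (.var u))))) b

/-- The component of `z` in `S`. -/
def compE (a : ℕ → A) (S : V → Expr V A) (z : Expr V A) (b : A → Expr V A) : Expr V A :=
  .iter (fun v => eqE (.var v) z) (fun _ B v => orE (.read B (.var v)) (andE (S v)
    (exE fun u => andE (.read B (.var u)) (andE (S u) (adjE a (.var u) (.var v)))))) b

/-- There is a path from `x` to `y` through at least one and at most `L + 1` vertices of `S`. -/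
def pathE (a : ℕ → A) (S : V → Expr V A) (x y L : Expr V A) : Expr V A :=
  .iter (fun v => andE (S v) (adjE a x (.var v)))
    -- There are always `N` rounds; the comparison of `t` with `L` stops the growth after `L` of
    -- them.
    (fun t B v => orE (.read B (.var v)) (andE (andE (ltE (.var t) L) (S v))
      (exE fun u => andE (.read B (.var u)) (adjE a (.var u) (.var v)))))
    fun B => exE fun v => andE (.read B (.var v)) (adjE a (.var v) y)

/-- A minimal subset of `S` with the property `P`. -/
def greedyE (S : V → Expr V A) (P : (V → Expr V A) → Expr V A) (b : A → Expr V A) : Expr V A :=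
  -- Round `t` removes the vertex `t` if the rest still has the property.
  .iter S (fun t B v => andE (.read B (.var v)) (orE (notE (eqE (.var v) (.var t)))
    (notE (P fun u => andE (.read B (.var u)) (notE (eqE (.var u) (.var t))))))) b

end Expr

/-- The vertices on which a function is positive. -/
def supp (N : ℕ) (F : ℕ → ℕ) : Finset ℕ := (Finset.range N).filter fun v => 0 < F v

@[simp] lemma mem_supp {N : ℕ} {F : ℕ → ℕ} {v : ℕ} : v ∈ supp N F ↔ v < N ∧ 0 < F v := by
  simp [supp]

/-- The array `A` holds the size `n` and the adjacency matrix of the graph `G` on the natural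
numbers below `n`, and the parameter `k`. -/
structure Holds (N n k : ℕ) (G : SimpleGraph ℕ) (A : ℕ → ℕ) : Prop where
  le : n ≤ N
  n_eq : A 0 = n
  k_eq : A 1 = k
  adj : ∀ u < n, ∀ v < n, (0 < A (2 + (u * n + v)) ↔ G.Adj u v)
  lt : ∀ u v, G.Adj u v → u < n

namespace Expr
variable {N n k : ℕ} {G : SimpleGraph ℕ} {σ : St}

lemma tr_adjE (h : Holds N n k G (σ 0)) {u v : Expr ℕ (ℕ → ℕ)} :
    0 < (adjE σ u v).eval N ↔ G.Adj (u.eval N) (v.eval N) := by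
  simp only [adjE, nE, tr_andE, tr_ltE, eval, h.n_eq]
  constructor
  · rintro ⟨⟨hu, hv⟩, hp⟩
    rw [← Finset.sum_filter, Finset.sum_const, smul_eq_mul,
      show (Finset.range N).filter (· < u.eval N) = Finset.range (u.eval N) from by
        have := h.le
        ext; simp; omega, Finset.card_range] at hp
    exact (h.adj _ hu _ hv).1 hp
  · intro ha
    have hu := h.lt _ _ ha
    have hv := h.lt _ _ ha.symm
    refine ⟨⟨hu, hv⟩, ?_⟩
    rw [← Finset.sum_filter, Finset.sum_const, smul_eq_mul,
      show (Finset.range N).filter (· < u.eval N) = Finset.range (u.eval N) from by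
        have := h.le
        ext; simp; omega, Finset.card_range]
    exact (h.adj _ hu _ hv).2 ha

/-- The set of vertices with a property. -/
abbrev ext (N : ℕ) (S : ℕ → Expr ℕ (ℕ → ℕ)) : Finset ℕ := supp N fun v => (S v).eval N

lemma supp_iterate_zero {f : ℕ → ℕ} {g : ℕ → (ℕ → ℕ) → ℕ → ℕ} :
    supp N (iterate N f g 0) = supp N f := by
  ext v; by_cases hv : v < N <;> simp [iterate, hv]

lemma mem_supp_iterate_succ {f : ℕ → ℕ} {g : ℕ → (ℕ → ℕ) → ℕ → ℕ} {t v : ℕ} :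
    v ∈ supp N (iterate N f g (t + 1)) ↔ v < N ∧ 0 < g t (iterate N f g t) v := by
  by_cases hv : v < N <;> simp [iterate, hv]

/-- A decreasing sequence of sets is stationary after as many steps as there are elements. -/
lemma stationary_of_anti {U : ℕ → Finset ℕ} (hN : (U 0).card ≤ N) (h : ∀ t, U (t + 1) ⊆ U t)
    (hs : ∀ t, U (t + 1) = U t → U (t + 2) = U (t + 1)) : U (N + 1) = U N := by
  have key : ∀ t, U (t + 1) = U t ∨ (U (t + 1)).card + (t + 1) ≤ (U 0).card := by
    intro t
    induction t with
    | zero =>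
      rcases (h 0).eq_or_ssubset with e | e
      · exact .inl e
      · have := Finset.card_lt_card e; right; omega
    | succ t ih =>
      rcases ih with ih | ih
      · exact .inl (hs t ih)
      rcases (h (t + 1)).eq_or_ssubset with e | e
      · exact .inl e
      · have := Finset.card_lt_card e; right; omega
  rcases key N with e | e
  · exact e
  · omega

/-- Each round discards the vertices with fewer than two remaining neighbours. Thick subsets survive
every round. After `N` rounds nothing changes any more, so what is left is thick. -/
lemma supp_coreE (h : Holds N n k G (σ 0)) (S : ℕ → Expr ℕ (ℕ → ℕ)) (b : (ℕ → ℕ) → Expr ℕ (ℕ → ℕ)) :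
    ∃ B : ℕ → ℕ, supp N B = core G (ext N S) ∧ (coreE σ S b).eval N = (b B).eval N := by
  refine ⟨_, ?_, rfl⟩
  set g : ℕ → (ℕ → ℕ) → ℕ → ℕ := fun _ B v => (andE (.read B (.var v))
    (ltE (.num 1) (cntE fun u => andE (.read B (.var u)) (adjE σ (.var v) (.var u))))).eval N
  set U : ℕ → Finset ℕ := fun t => supp N (iterate N (fun i => (S i).eval N) g t) with hU
  have hstep : ∀ t v, v ∈ U (t + 1) ↔ v ∈ U t ∧ 2 ≤ (nb G (U t) v).card := by
    intro t v
    refine mem_supp_iterate_succ.trans ?_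
    have : (cntE fun u => andE (.read (iterate N (fun i => (S i).eval N) g t) (.var u))
        (adjE σ (.var v) (.var u))).eval N = (nb G (U t) v).card :=
      eval_cntE' fun u => by simp [U, and_assoc, tr_adjE h]
    simp only [g, tr_andE, tr_ltE, eval, this, U, mem_supp, and_assoc]
    rfl
  have hsub : ∀ t, U (t + 1) ⊆ U t := fun t v hv => ((hstep t v).1 hv).1
  have h0 : U 0 = ext N S := supp_iterate_zero
  have hcore : ∀ t, core G (ext N S) ⊆ U t := by
    intro t
    induction t with
    | zero => rw [h0]; exact core_subset _
    | succ t ih =>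
      exact fun v hv => (hstep t v).2 ⟨ih hv, (core_thick _ v hv).trans
        (Finset.card_le_card (nb_mono ih v))⟩
  have hstat : U (N + 1) = U N := by
    refine stationary_of_anti ?_ hsub fun t e => ?_
    · rw [h0]
      exact (Finset.card_filter_le _ _).trans (by simp)
    · ext v; rw [hstep (t + 1), e, ← hstep t, e]
  have hle : ∀ t, U t ⊆ U 0 := by
    intro t
    induction t with
    | zero => exact subset_rfl
    | succ t ih => exact (hsub t).trans ih
  refine Finset.Subset.antisymm ?_ (hcore N)
  refine subset_core (h0 ▸ hle N) fun v hv => ?_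
  have hv' : v ∈ U (N + 1) := by rw [hstat]; exact hv
  exact ((hstep N v).1 hv').2

/-- An increasing sequence of sets is stationary after as many steps as there are elements. -/
lemma stationary_of_mono {U : ℕ → Finset ℕ} (hN : ∀ t, (U t).card ≤ N) (h : ∀ t, U t ⊆ U (t + 1))
    (hs : ∀ t, U (t + 1) = U t → U (t + 2) = U (t + 1)) : U (N + 1) = U N := by
  have key : ∀ t, U (t + 1) = U t ∨ t + 1 ≤ (U (t + 1)).card := by
    intro t
    induction t with
    | zero =>
      rcases (h 0).eq_or_ssubset with e | e
      · exact .inl e.symm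
      · have := Finset.card_lt_card e; right; omega
    | succ t ih =>
      rcases ih with ih | ih
      · exact .inl (hs t ih)
      rcases (h (t + 1)).eq_or_ssubset with e | e
      · exact .inl e.symm
      · have := Finset.card_lt_card e; right; omega
  rcases key N with e | e
  · exact e
  · have := hN (N + 1); omega

lemma supp_compE (h : Holds N n k G (σ 0)) (S : ℕ → Expr ℕ (ℕ → ℕ)) (z : Expr ℕ (ℕ → ℕ))
    (hz : z.eval N < N) (b : (ℕ → ℕ) → Expr ℕ (ℕ → ℕ)) :
    ∃ B : ℕ → ℕ, (∀ v, v ∈ supp N B ↔ Reach G ↑(ext N S) (z.eval N) v) ∧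
      (compE σ S z b).eval N = (b B).eval N := by
  refine ⟨_, ?_, rfl⟩
  set g : ℕ → (ℕ → ℕ) → ℕ → ℕ := fun _ B v => (orE (.read B (.var v)) (andE (S v)
    (exE fun u => andE (.read B (.var u)) (andE (S u) (adjE σ (.var u) (.var v)))))).eval N
  set f : ℕ → ℕ := fun v => (eqE (.var v) z).eval N
  set U : ℕ → Finset ℕ := fun t => supp N (iterate N f g t) with hU
  have hstep : ∀ t v, v ∈ U (t + 1) ↔ v ∈ U t ∨
      ∃ u ∈ U t, u ∈ ext N S ∧ v ∈ ext N S ∧ G.Adj u v := by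
    intro t v
    refine mem_supp_iterate_succ.trans ?_
    simp only [U, g, tr_andE, tr_orE, eval, tr_exE, tr_adjE h, mem_supp]
    constructor
    · rintro ⟨h1, h2 | ⟨h2, u, h3, h4, h5, h6⟩⟩
      · exact .inl ⟨h1, h2⟩
      · exact .inr ⟨u, ⟨h3, h4⟩, ⟨h3, h5⟩, ⟨h1, h2⟩, h6⟩
    · rintro (⟨h1, h2⟩ | ⟨u, ⟨h3, h4⟩, ⟨-, h5⟩, ⟨h1, h2⟩, h6⟩)
      · exact ⟨h1, .inl h2⟩
      · exact ⟨h1, .inr ⟨h2, u, h3, h4, h5, h6⟩⟩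
  have h0 : ∀ v, v ∈ U 0 ↔ v = z.eval N := by
    intro v
    rw [hU]
    simp only [supp_iterate_zero, mem_supp, f, tr_eqE, eval]
    constructor
    · exact fun h => h.2
    · rintro rfl; exact ⟨hz, rfl⟩
  have hsub : ∀ t, U t ⊆ U (t + 1) := fun t v hv => (hstep t v).2 (.inl hv)
  have hstat : U (N + 1) = U N := by
    refine stationary_of_mono (fun t => ?_) hsub fun t e => ?_
    · exact (Finset.card_filter_le _ _).trans (by simp)
    · ext v; rw [hstep (t + 1), e, ← hstep t, e]
  have hle : ∀ t, U 0 ⊆ U t := by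
    intro t
    induction t with
    | zero => exact subset_rfl
    | succ t ih => exact ih.trans (hsub t)
  intro v
  constructor
  · have : ∀ t v, v ∈ U t → Reach G ↑(ext N S) (z.eval N) v := by
      intro t
      induction t with
      | zero => intro v hv; rw [(h0 v).1 hv]; exact .refl
      | succ t ih =>
        intro v hv
        rcases (hstep t v).1 hv with hv | ⟨u, hu, h1, h2, h3⟩
        · exact ih v hv
        · exact (ih u hu).tail ⟨h1, h2, h3⟩
    exact this N v
  · intro hr
    show v ∈ U N
    induction hr with
    | refl => exact hle N ((h0 _).2 rfl)
    | tail _ h1 ih =>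
      rw [← hstat]
      exact (hstep N _).2 (.inr ⟨_, ih, h1.1, h1.2.1, h1.2.2⟩)

/-- Every vertex present after `t` rounds ends a path from `x` with at most `min t L + 1` vertices
of `S`. Conversely, the vertices of a link enter one per round, and `L ≤ N` makes `N` rounds
sufficient. -/
lemma tr_pathE (h : Holds N n k G (σ 0)) {S : ℕ → Expr ℕ (ℕ → ℕ)} {x y L : Expr ℕ (ℕ → ℕ)}
    (hL : L.eval N ≤ N) : 0 < (pathE σ S x y L).eval N ↔
      ∃ l ≤ L.eval N + 1, Link G ↑(ext N S) (x.eval N) (y.eval N) l := by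
  set g : ℕ → (ℕ → ℕ) → ℕ → ℕ := fun t B v => (orE (.read B (.var v))
    (andE (andE (ltE (.var t) L) (S v))
      (exE fun u => andE (.read B (.var u)) (adjE σ (.var u) (.var v))))).eval N
  set f : ℕ → ℕ := fun v => (andE (S v) (adjE σ x (.var v))).eval N
  set U : ℕ → Finset ℕ := fun t => supp N (iterate N f g t) with hU
  have hstep : ∀ t v, v ∈ U (t + 1) ↔ v ∈ U t ∨ t < L.eval N ∧ v ∈ ext N S ∧
      ∃ u ∈ U t, G.Adj u v := by
    intro t v
    refine mem_supp_iterate_succ.trans ?_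
    simp only [U, g, tr_andE, tr_orE, eval, tr_exE, tr_adjE h, mem_supp, tr_ltE]
    constructor
    · rintro ⟨h1, h2 | ⟨⟨h2, h2'⟩, u, h3, h4, h5⟩⟩
      · exact .inl ⟨h1, h2⟩
      · exact .inr ⟨h2, ⟨h1, h2'⟩, u, ⟨h3, h4⟩, h5⟩
    · rintro (⟨h1, h2⟩ | ⟨h2, ⟨h1, h2'⟩, u, ⟨h3, h4⟩, h5⟩)
      · exact ⟨h1, .inl h2⟩
      · exact ⟨h1, .inr ⟨⟨h2, h2'⟩, u, h3, h4, h5⟩⟩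
  have h0 : ∀ v, v ∈ U 0 ↔ v ∈ ext N S ∧ G.Adj (x.eval N) v := by
    intro v
    rw [hU]
    simp only [supp_iterate_zero, mem_supp, f, tr_andE, tr_adjE h, eval, and_assoc]
  have hsub : ∀ t, U t ⊆ U (t + 1) := fun t v hv => (hstep t v).2 (.inl hv)
  have hmono : ∀ s t, s ≤ t → U s ⊆ U t := fun s t hst => by
    induction t, hst using Nat.le_induction with
    | base => exact subset_rfl
    | succ t _ ih => exact ih.trans (hsub t)
  have key : ∀ t v, v ∈ U t → v ∈ ext N S ∧ ∀ y, G.Adj v y →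
      ∃ l ≤ min t (L.eval N) + 1, Link G ↑(ext N S) (x.eval N) y l := by
    intro t
    induction t with
    | zero =>
      intro v hv
      obtain ⟨h1, h2⟩ := (h0 v).1 hv
      refine ⟨h1, fun y hy => ⟨1, by omega, fun m => if m = 0 then x.eval N else if m = 1 then v
        else y, le_rfl, by simp, by simp, fun m hm => ?_, fun m hm hm' => ?_⟩⟩
      · interval_cases m <;> simp [h2, hy]
      · obtain rfl : m = 1 := by omega
        simpa using h1
    | succ t ih =>
      intro v hv
      rcases (hstep t v).1 hv with hv | ⟨ht, hvS, u, hu, huv⟩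
      · obtain ⟨h1, h2⟩ := ih v hv
        refine ⟨h1, fun y hy => ?_⟩
        obtain ⟨l, hl, hl'⟩ := h2 y hy
        exact ⟨l, by omega, hl'⟩
      · obtain ⟨l, hl, hl'⟩ := (ih u hu).2 v huv
        exact ⟨hvS, fun y hy => ⟨l + 1, by omega, hl'.extend hvS hy⟩⟩
  have hb : 0 < (pathE σ S x y L).eval N ↔ ∃ v ∈ U N, G.Adj v (y.eval N) := by
    show 0 < (exE fun v => andE (.read (iterate N f g N) (.var v)) (adjE σ (.var v) y)).eval N ↔ _
    simp only [tr_exE, tr_andE, tr_adjE h, eval, U, mem_supp, and_assoc]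
  rw [hb]
  constructor
  · rintro ⟨v, hv, hvy⟩
    obtain ⟨l, hl, hl'⟩ := (key N v hv).2 _ hvy
    exact ⟨l, by omega, hl'⟩
  · rintro ⟨l, hl, p, hp⟩
    have hpos := hp.pos
    have : ∀ i, i + 1 ≤ l → p (i + 1) ∈ U i := by
      intro i
      induction i with
      | zero =>
        intro hi
        refine (h0 _).2 ⟨by simpa using hp.mem 1 le_rfl hi, ?_⟩
        have := hp.adj 0 (by omega)
        rwa [hp.fst] at this
      | succ i ih =>
        intro hi
        exact (hstep i _).2 (.inr ⟨by omega, by simpa using hp.mem (i + 1 + 1) (by omega) hi, _,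
          ih (by omega), hp.adj (i + 1) (by omega)⟩)
    refine ⟨p l, hmono (l - 1) N (by omega) ?_, ?_⟩
    · have := this (l - 1) (by omega)
      rwa [show l - 1 + 1 = l by omega] at this
    · have := hp.adj l le_rfl
      rwa [hp.lst] at this

/-- A vertex kept in its own round was indispensable then; by monotonicity it is indispensable in
the smaller final set. `B` is chosen before `b`, so all cells of an array filled with such
expressions refer to the same set. -/
lemma supp_greedyE {S : ℕ → Expr ℕ (ℕ → ℕ)} {P : (ℕ → Expr ℕ (ℕ → ℕ)) → Expr ℕ (ℕ → ℕ)}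
    {Q : Finset ℕ → Prop} (hP : ∀ T, 0 < (P T).eval N ↔ Q (ext N T))
    (hQ : ∀ T T' : Finset ℕ, T ⊆ T' → Q T → Q T') (hS : Q (ext N S)) :
    ∃ B : ℕ → ℕ, supp N B ⊆ ext N S ∧ Q (supp N B) ∧ (∀ v ∈ supp N B, ¬ Q ((supp N B).erase v)) ∧
      ∀ b : (ℕ → ℕ) → Expr ℕ (ℕ → ℕ), (greedyE S P b).eval N = (b B).eval N := by
  refine ⟨_, ?_, ?_, ?_, fun _ => rfl⟩
  all_goals
    set g : ℕ → (ℕ → ℕ) → ℕ → ℕ := fun t B v => (andE (.read B (.var v))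
      (orE (notE (eqE (.var v) (.var t)))
      (notE (P fun u => andE (.read B (.var u)) (notE (eqE (.var u) (.var t))))))).eval N
    set U : ℕ → Finset ℕ := fun t => supp N (iterate N (fun i => (S i).eval N) g t) with hU
    have hstep : ∀ t v, v ∈ U (t + 1) ↔ v ∈ U t ∧ (v ≠ t ∨ ¬ Q ((U t).erase t)) := by
      intro t v
      have : ext N (fun u => andE (.read (iterate N (fun i => (S i).eval N) g t) (.var u))
          (notE (eqE (.var u) (.var t)))) = (U t).erase t := by
        ext u
        simp only [mem_supp, tr_andE, eval, tr_notE, tr_eqE, Finset.mem_erase, U]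
        tauto
      refine mem_supp_iterate_succ.trans ?_
      simp only [U, g, tr_andE, tr_orE, eval, tr_notE, tr_eqE, hP, this, mem_supp]
      rw [and_assoc]
    have h0 : U 0 = ext N S := supp_iterate_zero
    have hsub : ∀ t, U (t + 1) ⊆ U t := fun t v hv => ((hstep t v).1 hv).1
    have hmono : ∀ s t, s ≤ t → U t ⊆ U s := fun s t hst => by
      induction t, hst using Nat.le_induction with
      | base => exact subset_rfl
      | succ t _ ih => exact (hsub t).trans ih
  · exact (hmono 0 N (Nat.zero_le _)).trans h0.subset
  · have : ∀ t, Q (U t) := by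
      intro t
      induction t with
      | zero => rwa [h0]
      | succ t ih =>
        by_cases hq : Q ((U t).erase t)
        · refine hQ _ _ (fun v hv => (hstep t v).2 ?_) hq
          exact ⟨Finset.mem_of_mem_erase hv, .inl (Finset.ne_of_mem_erase hv)⟩
        · exact hQ _ _ (fun v hv => (hstep t v).2 ⟨hv, .inr hq⟩) ih
    exact this N
  · intro v hv hq
    have hv : v ∈ U N := hv
    have hvN : v < N := (mem_supp.1 hv).1
    have hv1 := hmono (v + 1) N (by omega) hv
    rcases (hstep v v).1 hv1 with ⟨-, h1 | h1⟩
    · exact h1 rfl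
    · exact h1 (hQ _ _ (Finset.erase_subset_erase v (hmono v N hvN.le)) hq)

end Expr
end InducedErdosPosa

/-! ### Levels of vertices and the invariant of the first phase. -/

namespace InducedErdosPosa

/-- The vertices not removed before stage `i`. -/
def Vl (n : ℕ) (lev : ℕ → ℕ) (i : ℕ) : Finset ℕ := (Finset.range n).filter fun v => i ≤ lev v

/-- The part of `W` that belongs to stage `i`. -/
def Wl (W : Finset ℕ) (lev : ℕ → ℕ) (i : ℕ) : Finset ℕ := W.filter fun v => lev v = i

@[simp] lemma mem_Vl {n : ℕ} {lev : ℕ → ℕ} {i v : ℕ} : v ∈ Vl n lev i ↔ v < n ∧ i ≤ lev v := by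
  simp [Vl]

@[simp] lemma mem_Wl {W : Finset ℕ} {lev : ℕ → ℕ} {i v : ℕ} : v ∈ Wl W lev i ↔ v ∈ W ∧ lev v = i := by
  simp [Wl]

/-- The number of stages that have been started. -/
def numStages (W : Finset ℕ) (lev : ℕ → ℕ) (c : ℕ) : ℕ := c + if Wl W lev c = ∅ then 0 else 1

/-- The invariant of the first phase, where `lev` is the stage at which a vertex is removed and `c`
is the current stage. -/
structure Inv (G : SimpleGraph ℕ) (n : ℕ) (W X : Finset ℕ) (lev : ℕ → ℕ) (c : ℕ) : Prop where
  sub : W ⊆ Finset.range n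
  subX : X ⊆ W
  lev_le : ∀ v < n, lev v ≤ c
  good : ∀ i < c, Good G (Vl n lev i) (Wl W lev i) (Wl X lev i)
  noear : ∀ i < c, NoEar G (Vl n lev i) (Wl W lev i) (Wl X lev i)
  step : ∀ i < c, ∀ v, v ∈ Vl n lev (i + 1) ↔
    v ∈ Vl n lev i ∧ v ∉ Wl W lev i ∧ ∀ w ∈ Wl W lev i, ¬ G.Adj v w
  cur : Wl W lev c = ∅ ∨ Good G (Vl n lev c) (Wl W lev c) (Wl X lev c)
  card : X.card ≤ 13 * ∑ i ∈ Finset.range (c + 1), (branch G (Wl W lev i)).card +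
    4 * numStages W lev c

namespace Inv
variable {G : SimpleGraph ℕ} {n : ℕ} {W X : Finset ℕ} {lev : ℕ → ℕ} {c : ℕ}

lemma lev_le' (h : Inv G n W X lev c) {v : ℕ} (hv : v ∈ W) : lev v ≤ c :=
  h.lev_le v (by simpa using h.sub hv)

lemma good_of_mem (h : Inv G n W X lev c) {v : ℕ} (hv : v ∈ W) :
    Good G (Vl n lev (lev v)) (Wl W lev (lev v)) (Wl X lev (lev v)) := by
  rcases (h.lev_le' hv).lt_or_eq with hlt | he
  · exact h.good _ hlt
  · rw [he]
    refine h.cur.resolve_left fun e => ?_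
    have : v ∈ Wl W lev c := mem_Wl.2 ⟨hv, he⟩
    simp [e] at this

/-- The vertex of higher level survived the deletion of the neighbours of the lower stage, so no
edge joins different stages. -/
lemma lev_eq (h : Inv G n W X lev c) {u v : ℕ} (hu : u ∈ W) (hv : v ∈ W) (huv : G.Adj u v) :
    lev u = lev v := by
  have key : ∀ {u v}, u ∈ W → v ∈ W → G.Adj u v → ¬ lev u < lev v := by
    intro u v hu hv huv hlt
    have hc := h.lev_le' hv
    have := (h.step (lev u) (by omega) v).1
      (mem_Vl.2 ⟨by simpa using h.sub hv, hlt⟩)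
    exact this.2.2 u (mem_Wl.2 ⟨hu, rfl⟩) huv.symm
  have h1 := key hu hv huv
  have h2 := key hv hu huv.symm
  omega

lemma nb_eq (h : Inv G n W X lev c) {v : ℕ} (hv : v ∈ W) : nb G W v = nb G (Wl W lev (lev v)) v := by
  ext u
  simp only [mem_nb, mem_Wl]
  exact ⟨fun ⟨h1, h2⟩ => ⟨⟨h1, h.lev_eq h1 hv h2.symm⟩, h2⟩, fun ⟨⟨h1, _⟩, h2⟩ => ⟨h1, h2⟩⟩

/-- Since stages are not joined by edges, degrees and balls in `W` are those in the single stages.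
-/
lemma skel (h : Inv G n W X lev c) : Skel G W X := by
  refine ⟨h.subX, fun v hv => ?_, fun v hv w hw hvw h3 => ?_, fun v hv h3 u hu => ?_⟩
  · rw [h.nb_eq hv]; exact (h.good_of_mem hv).deg v (mem_Wl.2 ⟨hv, rfl⟩)
  · have e := h.lev_eq hv hw hvw
    rw [h.nb_eq hw, ← e]
    rw [h.nb_eq hv] at h3
    exact (h.good_of_mem hv).indep v (mem_Wl.2 ⟨hv, rfl⟩) w (mem_Wl.2 ⟨hw, e.symm⟩) hvw h3
  · rw [h.nb_eq hv] at h3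
    refine (mem_Wl.1 ((h.good_of_mem hv).ball v (mem_Wl.2 ⟨hv, rfl⟩) h3 ?_)).1
    rw [mem_ball2] at hu ⊢
    rcases hu with rfl | ⟨hu, hvu⟩ | ⟨w, hw, hvw, hu, hwu⟩
    · exact .inl rfl
    · exact .inr (.inl ⟨mem_Wl.2 ⟨hu, (h.lev_eq hv hu hvu).symm⟩, hvu⟩)
    · have e1 := h.lev_eq hv hw hvw
      have e2 := h.lev_eq hw hu hwu
      exact .inr (.inr ⟨w, mem_Wl.2 ⟨hw, e1.symm⟩, hvw, mem_Wl.2 ⟨hu, by omega⟩, hwu⟩)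

lemma card_le (h : Inv G n W X lev c) :
    X.card ≤ 13 * (branch G W).card + 4 * numStages W lev c := by
  have : branch G W = (Finset.range (c + 1)).biUnion fun i => branch G (Wl W lev i) := by
    ext v
    simp only [mem_branch, Finset.mem_biUnion, Finset.mem_range, mem_Wl]
    constructor
    · rintro ⟨hv, h3⟩
      have := h.lev_le' hv
      exact ⟨lev v, by omega, ⟨hv, rfl⟩, by rwa [← h.nb_eq hv]⟩
    · rintro ⟨i, -, ⟨hv, rfl⟩, h3⟩
      exact ⟨hv, by rwa [h.nb_eq hv]⟩
  rw [this, Finset.card_biUnion]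
  · exact h.card
  · intro i _ j _ hij
    rw [Function.onFun, Finset.disjoint_left]
    intro v hv hv'
    have h1 := mem_Wl.1 (mem_branch.1 hv).1
    have h2 := mem_Wl.1 (mem_branch.1 hv').1
    exact hij (h1.2.symm.trans h2.2)

lemma good_of_lt (h : Inv G n W X lev c) {i : ℕ} (hi : i < numStages W lev c) :
    Good G (Vl n lev i) (Wl W lev i) (Wl X lev i) := by
  unfold numStages at hi
  split_ifs at hi with hW
  · exact h.good i (by omega)
  · rcases (show i ≤ c by omega).lt_or_eq with hlt | rfl
    · exact h.good i hlt
    · exact h.cur.resolve_left hW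

/-- If the search for a packing fails, then `W` is simple. -/
theorem of_fail (h : Inv G n W X lev c) {k H : ℕ}
    (hH : (∃ M : Fin k → Finset ℕ, (∀ i, M i ⊆ W) ∧ (∀ i, IsCyc G (M i)) ∧
      ∀ i j, i ≠ j → Disjoint (M i) (M j)) ∨
      ∃ Y ⊆ W, Y.card ≤ H ∧ ¬ (core G (W \ Y)).Nonempty)
    (hf : ∀ B ⊆ X, ¬ Pack G k (core G (W \ B))) :
    (branch G W).card ≤ 4 * H ∧ numStages W lev c + 1 ≤ k := by
  constructor
  · rcases hH with ⟨M, h1, h2, h3⟩ | ⟨Y, hY, hc, hn⟩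
    · obtain ⟨B, hB, hp⟩ := h.skel.exists_pack M h1 h2 h3
      exact absurd hp (hf B hB)
    · have := h.skel.card_branch_le hY hn
      omega
  -- Every stage contains an induced cycle and the stages are disjoint, so `k` started stages would
  -- already give a packing.
  · by_contra hcon
    have hex : ∀ i : Fin k, ∃ M ⊆ Wl W lev i, IsCyc G M := by
      intro i
      have hg := h.good_of_lt (i := i) (by have := i.2; omega)
      refine exists_isCyc_subset (hg.ne.mono hg.subX) fun v hv => ?_
      rcases hg.deg v hv with e | e <;> omega
    choose M hM hcyc using hex
    obtain ⟨B, hB, hp⟩ := h.skel.exists_pack M (fun i v hv => (mem_Wl.1 (hM i hv)).1) hcyc (by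
      intro i j hij
      rw [Finset.disjoint_left]
      intro v hv hv'
      have h1 := mem_Wl.1 (hM i hv)
      have h2 := mem_Wl.1 (hM j hv')
      exact hij (Fin.ext (h1.2.symm.trans h2.2)))
    exact hf B hB hp

lemma init (G : SimpleGraph ℕ) (n : ℕ) {lev : ℕ → ℕ} (hl : ∀ v < n, lev v = 0) :
    Inv G n ∅ ∅ lev 0 := by
  refine ⟨by simp, by simp, fun v hv => (hl v hv).le, by simp, by simp, by simp, .inl ?_, by simp⟩
  simp [Wl]

lemma Wl_union_of_lt {S : Finset ℕ} (hS : ∀ v ∈ S, lev v = c) {i : ℕ} (hi : i < c) :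
    Wl (W ∪ S) lev i = Wl W lev i := by
  ext v
  simp only [mem_Wl, Finset.mem_union]
  constructor
  · rintro ⟨h1 | h1, h2⟩
    · exact ⟨h1, h2⟩
    · have := hS v h1; omega
  · rintro ⟨h1, h2⟩
    exact ⟨.inl h1, h2⟩

lemma Wl_union_cur {S : Finset ℕ} (hS : ∀ v ∈ S, lev v = c) : Wl (W ∪ S) lev c = Wl W lev c ∪ S := by
  ext v
  simp only [mem_Wl, Finset.mem_union]
  constructor
  · rintro ⟨h1 | h1, h2⟩
    · exact .inl ⟨h1, h2⟩
    · exact .inr h1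
  · rintro (⟨h1, h2⟩ | h1)
    · exact ⟨.inl h1, h2⟩
    · exact ⟨.inr h1, hS v h1⟩

lemma lev_of_mem (h : Inv G n W X lev c) {v : ℕ} (hv : v ∈ Vl n lev c) : lev v = c := by
  have h1 := mem_Vl.1 hv
  exact le_antisymm (h.lev_le v h1.1) h1.2

/-- Enlarging the current stage. -/
lemma extend (h : Inv G n W X lev c) {S T : Finset ℕ} (hS : S ⊆ Vl n lev c)
    (hT : T ⊆ Wl (W ∪ S) lev c)
    (hg : Good G (Vl n lev c) (Wl W lev c ∪ S) (Wl X lev c ∪ T)) (hne : Wl W lev c ∪ S ≠ ∅)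
    -- The budget for new vertices of `X`: 13 for each new branch vertex, and 4 if the stage is
    -- newly started. Afterwards `c + 1` stages have been started.
    (hcard : T.card + 13 * (branch G (Wl W lev c)).card + 4 * numStages W lev c ≤
      13 * (branch G (Wl W lev c ∪ S)).card + 4 * (c + 1)) :
    Inv G n (W ∪ S) (X ∪ T) lev c := by
  have hS' : ∀ v ∈ S, lev v = c := fun v hv => h.lev_of_mem (hS hv)
  have hT' : ∀ v ∈ T, lev v = c := fun v hv => (mem_Wl.1 (hT hv)).2
  refine ⟨?_, ?_, h.lev_le, fun i hi => ?_, fun i hi => ?_, fun i hi => ?_, .inr ?_, ?_⟩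
  · refine Finset.union_subset h.sub fun v hv => ?_
    simpa using (mem_Vl.1 (hS hv)).1
  · exact Finset.union_subset (h.subX.trans Finset.subset_union_left)
      fun v hv => (mem_Wl.1 (hT hv)).1
  · rw [Wl_union_of_lt hS' hi, Wl_union_of_lt hT' hi]; exact h.good i hi
  · rw [Wl_union_of_lt hS' hi, Wl_union_of_lt hT' hi]; exact h.noear i hi
  · rw [Wl_union_of_lt hS' hi]; exact h.step i hi
  · rw [Wl_union_cur hS', Wl_union_cur hT']; exact hg
  · have h1 := h.card
    have h2 := Finset.card_union_le X T
    rw [Finset.sum_range_succ] at h1 ⊢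
    rw [Wl_union_cur hS', Finset.sum_congr rfl (fun i hi => by
      rw [Wl_union_of_lt hS' (by simpa using hi)])]
    have h3 : numStages (W ∪ S) lev c = c + 1 := by
      rw [numStages, Wl_union_cur hS', if_neg hne]
    rw [h3]
    omega

/-- Starting a stage. -/
lemma start (h : Inv G n W X lev c) (hW : Wl W lev c = ∅) {x y l : ℕ} {p : ℕ → ℕ}
    (hs : MinStart G (Vl n lev c) x y l p) :
    Inv G n (W ∪ MinCycle.verts x y l p)
      (X ∪ if l < 3 then MinCycle.verts x y l p else {x}) lev c := by
  have hX : Wl X lev c = ∅ := by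
    rw [Finset.eq_empty_iff_forall_notMem] at hW ⊢
    exact fun v hv => hW v (mem_Wl.2 ⟨h.subX (mem_Wl.1 hv).1, (mem_Wl.1 hv).2⟩)
  refine h.extend hs.verts_sub (fun v hv => ?_) ?_ ?_ ?_
  · have := hs.good.subX hv
    exact mem_Wl.2 ⟨Finset.mem_union_right _ this, h.lev_of_mem (hs.verts_sub this)⟩
  · rw [hW, hX, Finset.empty_union, Finset.empty_union]
    exact hs.good
  · rw [hW, Finset.empty_union, ← Finset.nonempty_iff_ne_empty]
    exact hs.good.ne.mono hs.good.subX
  · have h1 := hs.card_le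
    have h2 : numStages W lev c = c := by simp [numStages, hW]
    have h3 : branch G (Wl W lev c) = ∅ := by simp [hW, branch]
    rw [h2, h3, Finset.card_empty]
    omega

/-- Adding an ear. -/
lemma ear (h : Inv G n W X lev c) {x y l : ℕ} {p : ℕ → ℕ}
    (he : MinEar G (Vl n lev c) (Wl W lev c) (Wl X lev c) x y l p) :
    Inv G n (W ∪ inner l p) (X ∪ (ball2 G (Wl (W ∪ inner l p) lev c) x ∪
      ball2 G (Wl (W ∪ inner l p) lev c) y)) lev c := by
  have hW : Wl W lev c ≠ ∅ := fun e => by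
    have := he.ends.x_mem
    simp [e] at this
  have hg := h.cur.resolve_left hW
  have hg' := he.good hg
  have hS : inner l p ⊆ Vl n lev c := Finset.subset_union_right.trans hg'.sub
  have hS' : ∀ v ∈ inner l p, lev v = c := fun v hv => h.lev_of_mem (hS hv)
  rw [Wl_union_cur hS']
  have hd : ∀ v ∈ Wl W lev c ∪ inner l p, (nb G (Wl W lev c ∪ inner l p) v).card ≤ 3 := by
    intro v hv
    rcases hg'.deg v hv with e | e <;> omega
  refine h.extend hS ?_ ?_ ?_ ?_
  · rw [Wl_union_cur hS']
    have := hg'.subX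
    rw [Finset.union_assoc] at this
    exact Finset.subset_union_right.trans this
  · rw [← Finset.union_assoc]; exact hg'
  · rw [← Finset.nonempty_iff_ne_empty]
    exact (Finset.nonempty_iff_ne_empty.2 hW).mono Finset.subset_union_left
  · rw [he.branch_card hg, numStages, if_neg hW]
    have h1 := ball2_card_le hd (Finset.mem_union_left _ he.ends.x_mem)
    have h2 := ball2_card_le hd (Finset.mem_union_left _ he.ends.y_mem)
    have h3 := Finset.card_union_le (ball2 G (Wl W lev c ∪ inner l p) x)
      (ball2 G (Wl W lev c ∪ inner l p) y)
    omega

/-- Finishing a stage. -/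
lemma finish (h : Inv G n W X lev c) (hW : Wl W lev c ≠ ∅)
    (hN : NoEar G (Vl n lev c) (Wl W lev c) (Wl X lev c)) {lev' : ℕ → ℕ}
    (hl : ∀ v < n, (v ∈ Vl n lev c ∧ v ∉ Wl W lev c ∧ (∀ w ∈ Wl W lev c, ¬ G.Adj v w)) ∧
        lev' v = c + 1 ∨
      ¬ (v ∈ Vl n lev c ∧ v ∉ Wl W lev c ∧ (∀ w ∈ Wl W lev c, ¬ G.Adj v w)) ∧ lev' v = lev v) :
    Inv G n W X lev' (c + 1) ∧ Wl W lev' (c + 1) = ∅ := by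
  have hg := h.cur.resolve_left hW
  -- Only vertices of level `c` change, and they rise to `c + 1`; thresholds up to `c` do not
  -- notice.
  have hVl : ∀ i ≤ c, Vl n lev' i = Vl n lev i := by
    intro i hi
    ext v
    simp only [mem_Vl]
    refine and_congr_right fun hv => ?_
    rcases hl v hv with ⟨h1, h2⟩ | ⟨-, h2⟩
    · have := h.lev_of_mem h1.1; omega
    · rw [h2]
  have hlW : ∀ v ∈ W, lev' v = lev v := by
    intro v hv
    rcases hl v (by simpa using h.sub hv) with ⟨h1, -⟩ | ⟨-, h2⟩
    · exact absurd (mem_Wl.2 ⟨hv, h.lev_of_mem h1.1⟩) h1.2.1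
    · exact h2
  have hWl : ∀ U ⊆ W, ∀ i, Wl U lev' i = Wl U lev i := by
    intro U hU i
    ext v
    simp only [mem_Wl]
    exact and_congr_right fun hv => by rw [hlW v (hU hv)]
  have he : Wl W lev' (c + 1) = ∅ := by
    rw [hWl W subset_rfl, Finset.eq_empty_iff_forall_notMem]
    intro v hv
    obtain ⟨h1, h2⟩ := mem_Wl.1 hv
    have := h.lev_le' h1
    omega
  refine ⟨⟨h.sub, h.subX, fun v hv => ?_, fun i hi => ?_, fun i hi => ?_, fun i hi => ?_, .inl he,
    ?_⟩, he⟩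
  · have := h.lev_le v hv
    rcases hl v hv with ⟨-, h2⟩ | ⟨-, h2⟩ <;> omega
  · rw [hWl W subset_rfl, hWl X h.subX, hVl i (by omega)]
    rcases (show i ≤ c by omega).lt_or_eq with hlt | rfl
    · exact h.good i hlt
    · exact hg
  · rw [hWl W subset_rfl, hWl X h.subX, hVl i (by omega)]
    rcases (show i ≤ c by omega).lt_or_eq with hlt | rfl
    · exact h.noear i hlt
    · exact hN
  · rw [hWl W subset_rfl, hVl i (by omega)]
    rcases (show i ≤ c by omega).lt_or_eq with hlt | rfl
    · rw [hVl (i + 1) (by omega)]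
      exact h.step i hlt
    · intro v
      constructor
      · intro hv
        obtain ⟨h1, h2⟩ := mem_Vl.1 hv
        rcases hl v h1 with ⟨h3, -⟩ | ⟨-, h3⟩
        · exact h3
        · have := h.lev_le v h1; omega
      · intro hv
        have h1 := (mem_Vl.1 hv.1).1
        rcases hl v h1 with ⟨-, h3⟩ | ⟨h3, -⟩
        · exact mem_Vl.2 ⟨h1, h3.ge⟩
        · exact absurd hv h3
  · have h1 := h.card
    rw [Finset.sum_range_succ, he, Finset.sum_congr rfl (fun i _ => by rw [hWl W subset_rfl])]
    have h2 : numStages W lev' (c + 1) = c + 1 := by rw [numStages, if_pos he]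
    have h3 : numStages W lev c = c + 1 := by rw [numStages, if_neg hW]
    rw [h2]
    rw [h3] at h1
    omega

lemma fam (h : Inv G n W X lev c) : Fam G (Vl n lev) (Wl W lev) (Wl X lev) c :=
  ⟨h.good, h.noear, h.step⟩

end Inv

end InducedErdosPosa

/-! ### The program. -/

namespace InducedErdosPosa

namespace Expr
variable {V A : Type} (a : ℕ → A)

/-- Membership in the set stored in array `j`. -/
def inE (j : ℕ) (v : Expr V A) : Expr V A := .read (a j) v
/-- The number stored in array `j`. -/
def getE (j : ℕ) : Expr V A := .read (a j) (.num 0)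
/-- Membership in `Vl`. -/
def VlE (i v : Expr V A) : Expr V A := andE (ltE v (nE a)) (leE i (.read (a 5) v))
/-- Membership in `Wl` of the set stored in array `j`. -/
def WlE (j : ℕ) (i v : Expr V A) : Expr V A := andE (inE a j v) (eqE (.read (a 5) v) i)
/-- Membership in `Via`. -/
def viaE (i : Expr V A) (X : V → Expr V A) (x y v : Expr V A) : Expr V A :=
  andE (andE (VlE a i v) (notE (WlE a 3 i v)))
    (andE (allE fun u => orE (notE (X u)) (notE (adjE a v (.var u))))
      (allE fun u => orE (notE (andE (WlE a 3 i (.var u)) (adjE a v (.var u))))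
        (orE (eqE (.var u) x) (eqE (.var u) y))))
/-- Membership in `Via` for the current stage. -/
def viaCurE (x y v : Expr V A) : Expr V A :=
  viaE a (getE a 6) (fun u => WlE a 4 (getE a 6) (.var u)) x y v
/-- There is an ear from `x` to `y` with at most `L + 1` interior vertices. -/
def earE (x y L : Expr V A) : Expr V A :=
  andE (andE (andE (WlE a 3 (getE a 6) x) (notE (WlE a 4 (getE a 6) x)))
    (andE (andE (WlE a 3 (getE a 6) y) (notE (WlE a 4 (getE a 6) y)))
      (andE (notE (eqE x y)) (notE (adjE a x y)))))
    (pathE a (fun v => viaCurE a x y (.var v)) x y L)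
/-- The vertices of the current stage other than `x` and `y`. -/
def restE (x y v : Expr V A) : Expr V A :=
  andE (VlE a (getE a 6) v) (andE (notE (eqE v x)) (notE (eqE v y)))
/-- There is a cycle through the edge from `x` to `y` with at most `L + 3` vertices. -/
def cycE (x y L : Expr V A) : Expr V A :=
  andE (andE (andE (VlE a (getE a 6) x) (VlE a (getE a 6) y)) (adjE a x y))
    (pathE a (fun v => restE a x y (.var v)) x y L)
/-- Membership in `ball2`. -/
def ball2E (i x v : Expr V A) : Expr V A :=
  orE (eqE v x) (orE (andE (WlE a 3 i v) (adjE a x v))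
    (exE fun w => andE (andE (WlE a 3 i (.var w)) (adjE a x (.var w)))
      (andE (WlE a 3 i v) (adjE a (.var w) v))))
/-- Membership in `mins` for the set stored in array `j`. -/
def minsE (j : ℕ) (v : Expr V A) : Expr V A :=
  andE (inE a j v) (compE a (fun u => inE a j (.var u)) v
    fun B => allE fun u => orE (notE (.read B (.var u))) (leE v (.var u)))
/-- The set stored in array `j` is a packing. -/
def packE (j : ℕ) : Expr V A :=
  andE (allE fun v => orE (notE (inE a j (.var v)))
    (eqE (cntE fun u => andE (inE a j (.var u)) (adjE a (.var v) (.var u))) (.num 2)))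
    (leE (kE a) (cntE fun v => minsE a j (.var v)))
/-- Membership in the vertices that carry `Blob`. -/
def sideE (z y v : Expr V A) : Expr V A :=
  orE (viaE a (.read (a 5) z) (fun u => inE a 4 (.var u)) z y v) (orE (eqE v z) (eqE v y))
/-- There is a cycle in the set `S`. -/
def hasCoreE (S : V → Expr V A) : Expr V A := coreE a S fun B => exE fun v => .read B (.var v)
/-- The pair `z`, `y` is hanging. -/
def hangE (z y : Expr V A) : Expr V A :=
  andE (andE (andE (andE (inE a 3 z) (notE (inE a 4 z))) (andE (inE a 3 y) (notE (inE a 4 y))))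
    (andE (eqE (.read (a 5) z) (.read (a 5) y)) (orE (eqE z y) (adjE a z y))))
    (compE a (fun v => sideE a z y (.var v)) z fun B => hasCoreE a fun v => .read B (.var v))

end Expr

open InducedErdosPosa.Expr

namespace Code

/-- Do nothing. -/
def skip : Code := .fill 7 fun _ _ a v => .read (a 7) (.var v)

/-- Choose numbers `L`, `x`, `y` with a given property, with least possible `L`. -/
def choose (P : ∀ V A : Type, (ℕ → A) → Expr V A → Expr V A → Expr V A → Expr V A) : Code :=
  -- Numbers are kept in cell `0`, although filling writes them to all cells. The length is
  -- minimised before the ends are chosen, so it is least over all pairs.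
  .seq (.fill 10 fun V A a _ => muE fun L => exE fun x => exE fun y => P V A a (.var x) (.var y) (.var L))
    (.seq (.fill 11 fun V A a _ => muE fun x => exE fun y => P V A a (.var x) (.var y) (getE a 10))
      (.fill 12 fun V A a _ => muE fun y => P V A a (getE a 11) (.var y) (getE a 10)))

/-- Test all subsets `B` of the set in array `4`. -/
def search : Code :=
  .seq (.fill 8 fun _ _ _ _ => .num 0)
  (.seq (.fill 9 fun _ _ a v => coreE a (fun u => andE (inE a 3 (.var u)) (notE (inE a 8 (.var u))))
      fun B => .read B (.var v))
  (.seq (.while (fun _ _ a => andE (notE (packE a 9))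
      (exE fun v => andE (inE a 4 (.var v)) (notE (inE a 8 (.var v)))))
    -- Binary increment on the subsets of array 4: an element stays if a smaller one is missing, and
    -- a missing element enters if all smaller ones are present.
    (.seq (.fill 8 fun _ _ a v => andE (inE a 4 (.var v)) (.cond (.num 0) (inE a 8 (.var v))
        (exE fun u => andE (andE (inE a 4 (.var u)) (ltE (.var u) (.var v))) (notE (inE a 8 (.var u))))
        (allE fun u => orE (notE (andE (inE a 4 (.var u)) (ltE (.var u) (.var v))))
          (inE a 8 (.var u)))))
      (.fill 9 fun _ _ a v => coreE a (fun u => andE (inE a 3 (.var u)) (notE (inE a 8 (.var u))))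
        fun B => .read B (.var v))))
  (.fill 7 fun _ _ a _ => .cond (.num 0) (packE a 9) (.num 2) (.num 0))))

/-- Add a shortest ear. -/
def addEar : Code :=
  .seq (choose fun _ _ a x y L => earE a x y L)
  (.seq (.fill 13 fun _ _ a v => greedyE (fun u => viaCurE a (getE a 11) (getE a 12) (.var u))
      (fun S => pathE a S (getE a 11) (getE a 12) (getE a 10)) fun B => .read B (.var v))
  (.seq (.fill 3 fun _ _ a v => orE (inE a 3 (.var v)) (inE a 13 (.var v)))
  (.seq (.fill 4 fun _ _ a v => orE (inE a 4 (.var v)) (orE (ball2E a (getE a 6) (getE a 11) (.var v))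
      (ball2E a (getE a 6) (getE a 12) (.var v))))
  search)))

/-- Add a shortest cycle. -/
def addCycle : Code :=
  .seq (choose fun _ _ a x y L => cycE a x y L)
  (.seq (.fill 13 fun _ _ a v => orE (orE (eqE (.var v) (getE a 11)) (eqE (.var v) (getE a 12)))
      (greedyE (fun u => restE a (getE a 11) (getE a 12) (.var u))
      (fun S => pathE a S (getE a 11) (getE a 12) (getE a 10)) fun B => .read B (.var v)))
  (.seq (.fill 3 fun _ _ a v => orE (inE a 3 (.var v)) (inE a 13 (.var v)))
  -- The cycle has `L + 3` vertices, so `L < 2` means at most four; then all of them enter array 4.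
  (.seq (.fill 4 fun _ _ a v => orE (inE a 4 (.var v)) (.cond (getE a 10) (.num 2)
      (inE a 13 (.var v)) (eqE (.var v) (getE a 11))))
  search)))

/-- Finish the current stage. -/
def finishStage : Code :=
  .seq (.fill 5 fun _ _ a v => .cond (.num 0) (andE (VlE a (getE a 6) (.var v))
      (andE (notE (WlE a 3 (getE a 6) (.var v)))
      (allE fun w => orE (notE (WlE a 3 (getE a 6) (.var w))) (notE (adjE a (.var v) (.var w))))))
      (.add (getE a 6) (.num 1)) (.read (a 5) (.var v)))
    (.fill 6 fun _ _ a _ => .add (getE a 6) (.num 1))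

/-- The first phase. -/
def phase1 : Code :=
  .while (fun _ _ a => eqE (getE a 7) (.num 0))
    (.ite (fun _ _ a => exE fun v => WlE a 3 (getE a 6) (.var v))
      (.ite (fun _ _ a => exE fun L => exE fun x => exE fun y => earE a (.var x) (.var y) (.var L))
        addEar finishStage)
      (.ite (fun _ _ a => exE fun L => exE fun x => exE fun y => cycE a (.var x) (.var y) (.var L))
        addCycle (.fill 7 fun _ _ _ _ => .num 1)))

/-- Choose a hanging pair in the last possible stage, and a cycle for it. -/
def hangStep : Code :=
  .seq (.fill 11 fun _ _ a _ => muE fun z => exE fun y => andE (hangE a (.var z) (.var y))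
      (allE fun z' => allE fun y' => orE (notE (hangE a (.var z') (.var y')))
        (leE (.read (a 5) (.var z')) (.read (a 5) (.var z)))))
  (.seq (.fill 12 fun _ _ a _ => muE fun y => hangE a (getE a 11) (.var y))
  (.seq (.fill 13 fun _ _ a v => compE a (fun u => sideE a (getE a 11) (getE a 12) (.var u)) (getE a 11)
      fun B => .read B (.var v))
  (.fill 13 fun _ _ a v => greedyE (fun u => inE a 13 (.var u)) (fun S => hasCoreE a S)
      fun B => .read B (.var v))))

/-- The second phase. -/
def phase2 : Code :=
  .seq (.fill 14 fun _ _ _ _ => .num 0)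
  (.while (fun _ _ a => andE (notE (packE a 14)) (exE fun z => exE fun y => hangE a (.var z) (.var y)))
    (.seq hangStep
    -- The cycle is recorded only if it neither meets nor touches the recorded ones. The ball enters
    -- array 4 in either case.
    (.seq (.fill 14 fun _ _ a v => orE (inE a 14 (.var v)) (andE (inE a 13 (.var v))
        (allE fun u => allE fun w => orE (notE (andE (inE a 13 (.var u)) (inE a 14 (.var w))))
          (andE (notE (eqE (.var u) (.var w))) (notE (adjE a (.var u) (.var w)))))))
    (.fill 4 fun _ _ a v => orE (inE a 4 (.var v))
      (ball2E a (.read (a 5) (getE a 11)) (getE a 11) (.var v))))))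

/-- Write the next cycle of the set in array `9` to the output. -/
def writeCycle : Code :=
  .seq (.fill 11 fun _ _ a _ => muE fun v => andE (minsE a 9 (.var v))
      (eqE (cntE fun u => andE (minsE a 9 (.var u)) (ltE (.var u) (.var v))) (getE a 16)))
  (.seq (.fill 17 fun _ _ a v => .iter
      (fun t => .cond (.num 0) (.var t)
        (muE fun u => andE (inE a 9 (.var u)) (adjE a (getE a 11) (.var u))) (getE a 11))
      (fun t B i => .cond (.num 0) (eqE (.var i) (.add (.var t) (.num 2)))
        (muE fun u => andE (andE (inE a 9 (.var u))
          (adjE a (.read B (.add (.var t) (.num 1))) (.var u)))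
          (notE (eqE (.var u) (.read B (.var t))))) (.read B (.var i)))
      fun B => .read B (.var v))
  (.seq (.fill 10 fun _ _ a _ => muE fun t => andE (ltE (.num 0) (.var t))
      (eqE (.read (a 17) (.var t)) (getE a 11)))
  -- Cells before the current position are kept, that position receives the length `L + 1` of the
  -- vertex sequence, and the sequence follows.
  (.seq (.fill 1 fun _ _ a i => .cond (.var i) (getE a 15) (.read (a 1) (.var i))
      (.cond (getE a 15) (.var i) (.read (a 17) (.sub (.sub (.var i) (getE a 15)) (.num 1)))
        (.add (getE a 10) (.num 1))))
  (.seq (.fill 15 fun _ _ a _ => .add (getE a 15) (.add (getE a 10) (.num 2)))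
  (.fill 16 fun _ _ a _ => .add (getE a 16) (.num 1))))))

/-- Write the cycles of the set in array `9` to the output. -/
def writeCycles : Code :=
  .seq (.fill 1 fun _ _ _ _ => .num 0)
  (.seq (.fill 15 fun _ _ _ _ => .num 1)
  (.seq (.fill 16 fun _ _ _ _ => .num 0)
  (.seq (.while (fun _ _ a => ltE (getE a 16) (kE a)) writeCycle)
  (.fill 2 fun _ _ a _ => getE a 15))))

/-- Write the elements of the set in array `4` to the output. -/
def writeSet : Code :=
  .seq (.fill 1 fun _ _ a i => .cond (.num 0) (.var i) (muE fun v => andE (inE a 4 (.var v))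
      (eqE (.add (cntE fun u => andE (inE a 4 (.var u)) (ltE (.var u) (.var v))) (.num 1)) (.var i)))
      (.num 1))
    (.fill 2 fun _ _ a _ => .add (cntE fun u => inE a 4 (.var u)) (.num 1))

/-- The whole computation. -/
def main : Code :=
  .seq phase1
  (.seq (.ite (fun _ _ a => eqE (getE a 7) (.num 2)) skip
    (.seq phase2 (.fill 9 fun _ _ a v => inE a 14 (.var v))))
  (.ite (fun _ _ a => packE a 9) writeCycles writeSet))

end Code

/-- Both instances come from the same parametric expression, so after unfolding only the membership
of variables and arrays in the contexts has to be checked. -/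
lemma main_wf : Code.main.Wf := by
  simp [Code.main, Code.phase1, Code.phase2, Code.hangStep, Code.writeCycles, Code.writeCycle, Code.writeSet, Code.skip, Code.addEar,
    Code.addCycle, Code.finishStage, Code.search, Code.choose, Code.Wf, Expr.Wf, andE, orE, notE, ltE,
    leE, eqE, exE, allE, cntE, muE, nE, kE, adjE, coreE, compE, pathE, greedyE, inE, getE, VlE, WlE,
    viaE, viaCurE, earE, restE, cycE, ball2E, sideE, hasCoreE, hangE, packE, minsE, numGlobals]

end InducedErdosPosa

/-! ### What the tests of the program decide. -/

namespace InducedErdosPosa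

open InducedErdosPosa.Expr

/-- The global arrays hold the input, and vanish from index `N` on. -/
structure Ok (N n k : ℕ) (G : SimpleGraph ℕ) (σ : St) : Prop where
  holds : Holds N n k G (σ 0)
  pos : 0 < N
  zero : ∀ j, 1 ≤ j → ∀ i, N ≤ i → σ j i = 0

@[simp] lemma St.set_ne {N : ℕ} {σ : St} {j a : ℕ} {F : ℕ → ℕ} (h : a ≠ j) : σ.set N j F a = σ a := by
  funext i; simp [St.set, h]

lemma St.set_eq {N : ℕ} {σ : St} {j : ℕ} {F : ℕ → ℕ} {i : ℕ} (hi : i < N) :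
    σ.set N j F j i = F i := by simp [St.set, hi]

@[simp] lemma St.supp_set {N : ℕ} {σ : St} {j : ℕ} {F : ℕ → ℕ} :
    supp N (σ.set N j F j) = supp N F := by
  ext i; by_cases hi : i < N <;> simp [hi, St.set_eq]

namespace Ok
variable {N n k : ℕ} {G : SimpleGraph ℕ} {σ : St}

lemma set (h : Ok N n k G σ) {j : ℕ} (hj : 1 ≤ j) (F : ℕ → ℕ) : Ok N n k G (σ.set N j F) := by
  refine ⟨?_, h.pos, fun a ha i hi => ?_⟩
  · rw [St.set_ne (by omega)]; exact h.holds
  · by_cases haj : a = j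
    · subst haj
      simp [St.set, not_lt.2 hi, h.zero a ha i hi]
    · rw [St.set_ne haj]; exact h.zero a ha i hi

lemma pos_iff (h : Ok N n k G σ) {j : ℕ} (hj : 1 ≤ j) {v : ℕ} : 0 < σ j v ↔ v ∈ supp N (σ j) := by
  rw [mem_supp]
  refine ⟨fun hp => ⟨?_, hp⟩, fun hp => hp.2⟩
  by_contra hv
  have := h.zero j hj v (by omega)
  omega

lemma tr_inE (h : Ok N n k G σ) {j : ℕ} (hj : 1 ≤ j) {v : Expr ℕ (ℕ → ℕ)} :
    0 < (inE σ j v).eval N ↔ v.eval N ∈ supp N (σ j) := by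
  rw [inE, eval, h.pos_iff hj]

lemma tr_adjE (h : Ok N n k G σ) {u v : Expr ℕ (ℕ → ℕ)} :
    0 < (adjE σ u v).eval N ↔ G.Adj (u.eval N) (v.eval N) := Expr.tr_adjE h.holds

lemma tr_VlE (h : Ok N n k G σ) {i v : Expr ℕ (ℕ → ℕ)} :
    0 < (VlE σ i v).eval N ↔ v.eval N ∈ Vl n (σ 5) (i.eval N) := by
  simp [VlE, nE, h.holds.n_eq]

lemma tr_WlE (h : Ok N n k G σ) {j : ℕ} (hj : 1 ≤ j) {i v : Expr ℕ (ℕ → ℕ)} :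
    0 < (WlE σ j i v).eval N ↔ v.eval N ∈ Wl (supp N (σ j)) (σ 5) (i.eval N) := by
  simp only [WlE, tr_andE, h.tr_inE hj, tr_eqE, eval, mem_Wl]

/-- The set `T` is kept general because ears refer to the part of array 4 in the current stage,
while hanging pairs refer to the whole of it. -/
lemma tr_viaE (h : Ok N n k G σ) {i x y v : Expr ℕ (ℕ → ℕ)} {X : ℕ → Expr ℕ (ℕ → ℕ)}
    {T : Finset ℕ} (hX : ∀ u, u ∈ T ↔ u < N ∧ 0 < (X u).eval N) :
    0 < (viaE σ i X x y v).eval N ↔ v.eval N ∈ Via G (Vl n (σ 5) (i.eval N))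
      (Wl (supp N (σ 3)) (σ 5) (i.eval N)) T (x.eval N) (y.eval N) := by
  simp only [viaE, tr_andE, h.tr_VlE, tr_notE, h.tr_WlE (show 1 ≤ 3 by omega), tr_allE, tr_orE,
    h.tr_adjE, eval, tr_eqE, Via, Free, Set.mem_ofPred_eq]
  constructor
  · rintro ⟨⟨h1, h2⟩, h3, h4⟩
    refine ⟨⟨h1, h2, fun u hu => ?_⟩, fun u hu hvu => ?_⟩
    · obtain ⟨h5, h6⟩ := (hX u).1 hu
      exact (h3 u h5).resolve_left (fun h7 => h7 h6)
    · have : u < N := (mem_supp.1 (mem_Wl.1 hu).1).1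
      exact (h4 u this).resolve_left (fun h7 => h7 ⟨hu, hvu⟩)
  · rintro ⟨⟨h1, h2, h3⟩, h4⟩
    refine ⟨⟨h1, h2⟩, fun u hu => ?_, fun u _ => ?_⟩
    · by_cases h5 : 0 < (X u).eval N
      · exact .inr (h3 u ((hX u).2 ⟨hu, h5⟩))
      · exact .inl h5
    · by_cases h5 : u ∈ Wl (supp N (σ 3)) (σ 5) (i.eval N) ∧ G.Adj (v.eval N) u
      · exact .inr (h4 u h5.1 h5.2)
      · exact .inl h5

lemma mem_Wl_iff (h : Ok N n k G σ) {j : ℕ} (hj : 1 ≤ j) {i : Expr ℕ (ℕ → ℕ)} (u : ℕ) :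
    u ∈ Wl (supp N (σ j)) (σ 5) (i.eval N) ↔ u < N ∧ 0 < (WlE σ j i (.var u)).eval N := by
  rw [h.tr_WlE hj]
  simp only [eval, mem_Wl, mem_supp]
  tauto

/-- The free vertices of the current stage that attach to `x` and `y` only. -/
abbrev ViaCur (N n : ℕ) (G : SimpleGraph ℕ) (σ : St) (x y : ℕ) : Set ℕ :=
  Via G (Vl n (σ 5) (σ 6 0)) (Wl (supp N (σ 3)) (σ 5) (σ 6 0)) (Wl (supp N (σ 4)) (σ 5) (σ 6 0)) x y

lemma coe_ext_viaCurE (h : Ok N n k G σ) {x y : Expr ℕ (ℕ → ℕ)} :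
    (↑(ext N fun v => viaCurE σ x y (.var v)) : Set ℕ) = ViaCur N n G σ (x.eval N) (y.eval N) := by
  ext v
  simp only [Finset.mem_coe, mem_supp]
  rw [viaCurE, h.tr_viaE (T := Wl (supp N (σ 4)) (σ 5) (σ 6 0))
    (fun u => h.mem_Wl_iff (i := getE σ 6) (by omega) u)]
  simp only [getE, eval]
  refine ⟨fun hv => hv.2, fun hv => ⟨?_, hv⟩⟩
  have h1 := (mem_Vl.1 hv.1.1).1
  have h2 := h.holds.le
  omega

/-- There is an ear from `x` to `y` with at most `L + 1` interior vertices. -/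
def EarUpTo (N n : ℕ) (G : SimpleGraph ℕ) (σ : St) (x y L : ℕ) : Prop :=
  EarEnds G (Wl (supp N (σ 3)) (σ 5) (σ 6 0)) (Wl (supp N (σ 4)) (σ 5) (σ 6 0)) x y ∧
    ∃ l ≤ L + 1, Link G (ViaCur N n G σ x y) x y l

lemma tr_earE (h : Ok N n k G σ) {x y L : Expr ℕ (ℕ → ℕ)} (hL : L.eval N ≤ N) :
    0 < (earE σ x y L).eval N ↔ EarUpTo N n G σ (x.eval N) (y.eval N) (L.eval N) := by
  rw [earE, tr_andE, Expr.tr_pathE h.holds hL, h.coe_ext_viaCurE, EarUpTo]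
  refine and_congr_left fun _ => ?_
  simp only [tr_andE, h.tr_WlE (show 1 ≤ 3 by omega), h.tr_WlE (show 1 ≤ 4 by omega), tr_notE,
    tr_eqE, h.tr_adjE, getE, eval]
  exact ⟨fun ⟨⟨h1, h2⟩, ⟨h3, h4⟩, h5, h6⟩ => ⟨h1, h2, h3, h4, h5, h6⟩,
    fun ⟨h1, h2, h3, h4, h5, h6⟩ => ⟨⟨h1, h2⟩, ⟨h3, h4⟩, h5, h6⟩⟩

lemma ext_restE (h : Ok N n k G σ) {x y : Expr ℕ (ℕ → ℕ)} :
    (ext N fun v => restE σ x y (.var v)) = Vl n (σ 5) (σ 6 0) \ {x.eval N, y.eval N} := by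
  ext v
  have := h.holds.le
  simp only [restE, mem_supp, tr_andE, h.tr_VlE, tr_notE, tr_eqE, eval, getE, Finset.mem_sdiff,
    Finset.mem_insert, Finset.mem_singleton, not_or, mem_Vl]
  constructor
  · exact fun hv => hv.2
  · exact fun hv => ⟨by omega, hv⟩

/-- There is a cycle through the edge from `x` to `y` with at most `L + 3` vertices. -/
def CycUpTo (n : ℕ) (G : SimpleGraph ℕ) (σ : St) (x y L : ℕ) : Prop :=
  (x ∈ Vl n (σ 5) (σ 6 0) ∧ y ∈ Vl n (σ 5) (σ 6 0) ∧ G.Adj x y) ∧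
    ∃ l ≤ L + 1, Link G (↑(Vl n (σ 5) (σ 6 0) \ {x, y}) : Set ℕ) x y l

lemma tr_cycE (h : Ok N n k G σ) {x y L : Expr ℕ (ℕ → ℕ)} (hL : L.eval N ≤ N) :
    0 < (cycE σ x y L).eval N ↔ CycUpTo n G σ (x.eval N) (y.eval N) (L.eval N) := by
  rw [cycE, tr_andE, Expr.tr_pathE h.holds hL, h.ext_restE, CycUpTo]
  simp only [tr_andE, h.tr_VlE, h.tr_adjE, getE, eval, and_assoc]

lemma tr_ball2E (h : Ok N n k G σ) {i x v : Expr ℕ (ℕ → ℕ)} : 0 < (ball2E σ i x v).eval N ↔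
    v.eval N ∈ ball2 G (Wl (supp N (σ 3)) (σ 5) (i.eval N)) (x.eval N) := by
  simp only [ball2E, tr_orE, tr_andE, tr_eqE, h.tr_WlE (show 1 ≤ 3 by omega), h.tr_adjE, tr_exE,
    eval, mem_ball2]
  refine or_congr Iff.rfl (or_congr Iff.rfl ?_)
  constructor
  · rintro ⟨w, -, ⟨h1, h2⟩, h3, h4⟩
    exact ⟨w, h1, h2, h3, h4⟩
  · rintro ⟨w, h1, h2, h3, h4⟩
    exact ⟨w, (mem_supp.1 (mem_Wl.1 h1).1).1, ⟨h1, h2⟩, h3, h4⟩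

lemma ext_inE (h : Ok N n k G σ) {j : ℕ} (hj : 1 ≤ j) :
    (ext N fun u => inE σ j (.var u)) = supp N (σ j) := by
  ext v; simp only [mem_supp, h.tr_inE hj, eval]; tauto

lemma tr_minsE (h : Ok N n k G σ) {j : ℕ} (hj : 1 ≤ j) {v : Expr ℕ (ℕ → ℕ)} :
    0 < (minsE σ j v).eval N ↔ v.eval N ∈ mins G (supp N (σ j)) := by
  rw [minsE, tr_andE, h.tr_inE hj, mem_mins]
  refine and_congr_right fun hv => ?_
  have hvN := (mem_supp.1 hv).1
  obtain ⟨B, hB, he⟩ := Expr.supp_compE h.holds (fun u => inE σ j (.var u)) v hvN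
    (fun B => allE fun u => orE (notE (.read B (.var u))) (leE v (.var u)))
  rw [he]
  simp only [tr_allE, tr_orE, tr_notE, tr_leE, eval]
  rw [h.ext_inE hj] at hB
  constructor
  · intro hall u hu hr
    have h1 := mem_supp.1 ((hB u).2 hr)
    exact (hall u h1.1).resolve_left (fun h2 => h2 h1.2)
  · intro hall u hu
    by_cases h1 : 0 < B u
    · have h2 := (hB u).1 (mem_supp.2 ⟨hu, h1⟩)
      exact .inr (hall u (h2.mem hv) h2)
    · exact .inl h1

lemma tr_packE (h : Ok N n k G σ) {j : ℕ} (hj : 1 ≤ j) :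
    0 < (packE σ j : Expr ℕ (ℕ → ℕ)).eval N ↔ Pack G k (supp N (σ j)) := by
  have h1 : (cntE fun v => minsE σ j (.var v) : Expr ℕ (ℕ → ℕ)).eval N
      = (mins G (supp N (σ j))).card := by
    refine eval_cntE' fun v => ?_
    rw [h.tr_minsE hj]
    simp only [eval, mem_mins, mem_supp]
    tauto
  have h2 : ∀ v, (cntE fun u => andE (inE σ j (.var u)) (adjE σ (.var v) (.var u)) :
      Expr ℕ (ℕ → ℕ)).eval N = (nb G (supp N (σ j)) v).card := by
    intro v
    refine eval_cntE' fun u => ?_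
    simp only [tr_andE, h.tr_inE hj, h.tr_adjE, eval, mem_nb, mem_supp]
    tauto
  simp only [packE, tr_andE, tr_allE, tr_orE, tr_notE, tr_eqE, tr_leE, h1, h2, h.tr_inE hj, eval, kE,
    h.holds.k_eq]
  constructor
  · rintro ⟨h3, h4⟩
    exact ⟨fun v hv => (h3 v (mem_supp.1 hv).1).resolve_left (fun h5 => h5 hv), h4⟩
  · rintro ⟨h3, h4⟩
    refine ⟨fun v _ => ?_, h4⟩
    by_cases hv : v ∈ supp N (σ j)
    · exact .inr (h3 v hv)
    · exact .inl hv

lemma tr_hasCoreE (h : Ok N n k G σ) (S : ℕ → Expr ℕ (ℕ → ℕ)) :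
    0 < (hasCoreE σ S).eval N ↔ (core G (ext N S)).Nonempty := by
  obtain ⟨B, hB, he⟩ := Expr.supp_coreE h.holds S (fun B => exE fun v => .read B (.var v))
  rw [hasCoreE, he, ← hB]
  simp only [tr_exE, eval, Finset.Nonempty, mem_supp]

lemma coe_ext_sideE (h : Ok N n k G σ) {z y : Expr ℕ (ℕ → ℕ)}
    (hz : z.eval N ∈ supp N (σ 3)) (hy : y.eval N ∈ supp N (σ 3)) :
    (↑(ext N fun v => sideE σ z y (.var v)) : Set ℕ) =
      Via G (Vl n (σ 5) (σ 5 (z.eval N))) (Wl (supp N (σ 3)) (σ 5) (σ 5 (z.eval N))) (supp N (σ 4))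
        (z.eval N) (y.eval N) ∪ {z.eval N, y.eval N} := by
  ext v
  have h0 := h.holds.le
  simp only [Finset.mem_coe, mem_supp, sideE, tr_orE, tr_eqE, eval, Set.mem_union,
    Set.mem_insert_iff, Set.mem_singleton_iff]
  rw [h.tr_viaE (T := supp N (σ 4)) (fun u => by
    rw [h.tr_inE (by omega)]; simp only [eval, mem_supp]; tauto)]
  simp only [eval]
  refine ⟨fun hv => hv.2, fun hv => ⟨?_, hv⟩⟩
  rcases hv with hv | rfl | rfl
  · have := (mem_Vl.1 hv.1.1).1; omega
  · exact (mem_supp.1 hz).1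
  · exact (mem_supp.1 hy).1

/-- A hanging pair in the stage of `z`. -/
abbrev HangAt (N n : ℕ) (G : SimpleGraph ℕ) (σ : St) (z y : ℕ) : Prop :=
  Hang G (Vl n (σ 5) (σ 5 z)) (Wl (supp N (σ 3)) (σ 5) (σ 5 z)) (supp N (σ 4)) z y

lemma supp_blob (h : Ok N n k G σ) {z y : Expr ℕ (ℕ → ℕ)}
    (hz : z.eval N ∈ supp N (σ 3)) (hy : y.eval N ∈ supp N (σ 3))
    (b : (ℕ → ℕ) → Expr ℕ (ℕ → ℕ)) : ∃ B : ℕ → ℕ, (↑(supp N B) : Set ℕ) =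
      Blob G (Vl n (σ 5) (σ 5 (z.eval N))) (Wl (supp N (σ 3)) (σ 5) (σ 5 (z.eval N))) (supp N (σ 4))
        (z.eval N) (y.eval N) ∧
      (compE σ (fun v => sideE σ z y (.var v)) z b).eval N = (b B).eval N := by
  obtain ⟨B, hB, he⟩ := Expr.supp_compE h.holds (fun v => sideE σ z y (.var v)) z
    (mem_supp.1 hz).1 b
  refine ⟨B, ?_, he⟩
  ext v
  rw [Finset.mem_coe, hB, h.coe_ext_sideE hz hy]
  rfl

lemma tr_hangE (h : Ok N n k G σ) {z y : Expr ℕ (ℕ → ℕ)} :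
    0 < (hangE σ z y).eval N ↔ HangAt N n G σ (z.eval N) (y.eval N) := by
  simp only [hangE, tr_andE, h.tr_inE (show 1 ≤ 3 by omega), h.tr_inE (show 1 ≤ 4 by omega), tr_notE,
    tr_eqE, tr_orE, h.tr_adjE, eval]
  have key : z.eval N ∈ supp N (σ 3) → y.eval N ∈ supp N (σ 3) →
      (0 < (compE σ (fun v => sideE σ z y (.var v)) z fun B =>
        hasCoreE σ fun v => .read B (.var v)).eval N ↔ ∃ M : Finset ℕ, ↑M ⊆
      Blob G (Vl n (σ 5) (σ 5 (z.eval N))) (Wl (supp N (σ 3)) (σ 5) (σ 5 (z.eval N))) (supp N (σ 4))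
        (z.eval N) (y.eval N) ∧ M.Nonempty ∧ Thick G M) := by
    intro hz hy
    obtain ⟨B, hB, he⟩ := h.supp_blob hz hy fun B => hasCoreE σ fun v => .read B (.var v)
    rw [he, h.tr_hasCoreE, core_nonempty, ← hB]
    simp only [Finset.coe_subset]
    rfl
  constructor
  · rintro ⟨⟨⟨⟨h1, h2⟩, h3, h4⟩, h5, h6⟩, h7⟩
    exact ⟨mem_Wl.2 ⟨h1, rfl⟩, h2, mem_Wl.2 ⟨h3, h5.symm⟩, h4, h6, (key h1 h3).1 h7⟩
  · rintro ⟨h1, h2, h3, h4, h6, h7⟩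
    have h1 := (mem_Wl.1 h1).1
    have h3 := mem_Wl.1 h3
    exact ⟨⟨⟨⟨h1, h2⟩, h3.1, h4⟩, h3.2.symm, h6⟩, (key h1 h3.1).2 h7⟩

end Ok
end InducedErdosPosa

/-! ### Enumerating the subsets of `X` in search of a packing. -/

namespace InducedErdosPosa

open InducedErdosPosa.Expr

/-! ### Enumerating subsets -/

/-- The colexicographic order. -/
def Before (R B : Finset ℕ) : Prop := ∃ v ∈ B, v ∉ R ∧ ∀ u, v < u → (u ∈ R ↔ u ∈ B)

open Classical in
/-- The successor of `B` among the subsets of `X` in colexicographic order. -/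
noncomputable def nextSubset (X B : Finset ℕ) : Finset ℕ :=
  X.filter fun v => v ∈ B ∧ (∃ u ∈ X, u < v ∧ u ∉ B) ∨ v ∉ B ∧ ∀ u ∈ X, u < v → u ∈ B

/-- The least missing element `v₀` is where the carry of the increment stops: smaller elements
leave, `v₀` enters, larger ones stay as they are. -/
lemma exists_next {X B : Finset ℕ} (h : ∃ v ∈ X, v ∉ B) : ∃ v₀ ∈ X, v₀ ∉ B ∧
    (∀ u ∈ X, u < v₀ → u ∈ B) ∧
    ∀ v, v ∈ nextSubset X B ↔ v ∈ X ∧ (v = v₀ ∨ v₀ < v ∧ v ∈ B) := by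
  classical
  obtain ⟨h1, h2⟩ := Nat.find_spec h
  have h3 : ∀ u ∈ X, u < Nat.find h → u ∈ B := fun u hu hlt => by
    by_contra hB
    exact Nat.find_min h hlt ⟨hu, hB⟩
  refine ⟨Nat.find h, h1, h2, h3, fun v => ?_⟩
  simp only [nextSubset, Finset.mem_filter]
  refine and_congr_right fun hv => ?_
  rcases lt_trichotomy v (Nat.find h) with hlt | he | hlt
  · have hvB := h3 v hv hlt
    constructor
    · rintro (⟨-, u, hu, huv, huB⟩ | ⟨h4, -⟩)
      · exact absurd (h3 u hu (huv.trans hlt)) huB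
      · exact absurd hvB h4
    · rintro (h4 | ⟨h4, -⟩) <;> omega
  · constructor
    · exact fun _ => .inl he
    · rintro -
      rw [he]
      exact .inr ⟨h2, h3⟩
  · constructor
    · rintro (⟨h4, -⟩ | ⟨-, h4⟩)
      · exact .inr ⟨hlt, h4⟩
      · exact absurd (h4 _ h1 hlt) h2
    · rintro (h4 | ⟨-, h4⟩)
      · omega
      · exact .inl ⟨h4, _, h1, hlt, h2⟩

lemma not_before_self (B : Finset ℕ) : ¬ Before B B := fun ⟨_, h1, h2, _⟩ => h2 h1

/-- This advances the search invariant, by which all subsets before the current one have been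
rejected, by exactly the current subset. -/
lemma before_next {X B : Finset ℕ} (hB : B ⊆ X) (h : ∃ v ∈ X, v ∉ B) {R : Finset ℕ} (hR : R ⊆ X) :
    Before R (nextSubset X B) ↔ R = B ∨ Before R B := by
  classical
  obtain ⟨v₀, h1, h2, h3, h4⟩ := exists_next h
  constructor
  · rintro ⟨v, hv, hvR, hu⟩
    obtain ⟨hvX, rfl | ⟨hlt, hvB⟩⟩ := (h4 v).1 hv
    · have habove : ∀ u, v < u → (u ∈ R ↔ u ∈ B) := by
        intro u hvu
        rw [hu u hvu, h4]
        constructor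
        · rintro ⟨-, h5 | h5⟩
          · omega
          · exact h5.2
        · exact fun h5 => ⟨hB h5, .inr ⟨hvu, h5⟩⟩
      by_cases hne : ∃ w ∈ B, w ∉ R
      · right
        have hne' : (B \ R).Nonempty := by
          obtain ⟨w, hw, hwR⟩ := hne
          exact ⟨w, by simp [hw, hwR]⟩
        have hm := Finset.max'_mem _ hne'
        set w := (B \ R).max' hne' with hw
        simp only [Finset.mem_sdiff] at hm
        refine ⟨w, hm.1, hm.2, fun u hwu => ?_⟩
        constructor
        · intro huR
          rcases lt_trichotomy u v with h5 | h5 | h5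
          · exact h3 u (hR huR) h5
          · exact absurd (h5 ▸ huR) hvR
          · exact (habove u h5).1 huR
        · intro huB
          by_contra huR
          have := Finset.le_max' (B \ R) u (by simp [huB, huR])
          omega
      · left
        push Not at hne
        refine Finset.Subset.antisymm (fun u huR => ?_) hne
        rcases lt_trichotomy u v with h5 | h5 | h5
        · exact h3 u (hR huR) h5
        · exact absurd (h5 ▸ huR) hvR
        · exact (habove u h5).1 huR
    · right
      refine ⟨v, hvB, hvR, fun u hvu => ?_⟩
      rw [hu u hvu, h4]
      constructor
      · rintro ⟨-, h5 | h5⟩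
        · omega
        · exact h5.2
      · exact fun h5 => ⟨hB h5, .inr ⟨by omega, h5⟩⟩
  · have hB0 : ∀ u, v₀ < u → (u ∈ B ↔ u ∈ nextSubset X B) := by
      intro u hvu
      rw [h4]
      constructor
      · exact fun h5 => ⟨hB h5, .inr ⟨hvu, h5⟩⟩
      · rintro ⟨-, h5 | h5⟩
        · omega
        · exact h5.2
    rintro (rfl | ⟨v, hvB, hvR, hu⟩)
    · exact ⟨v₀, (h4 v₀).2 ⟨h1, .inl rfl⟩, h2, hB0⟩
    · rcases lt_trichotomy v v₀ with h5 | rfl | h5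
      · refine ⟨v₀, (h4 v₀).2 ⟨h1, .inl rfl⟩, fun h6 => h2 ((hu _ h5).1 h6), fun u hvu => ?_⟩
        rw [hu u (by omega), hB0 u hvu]
      · exact absurd hvB h2
      · exact ⟨v, (hB0 v h5).1 hvB, hvR, fun u hvu => by rw [hu u hvu, hB0 u (by omega)]⟩

lemma before_full {X R : Finset ℕ} (hR : R ⊆ X) (hne : R ≠ X) : Before R X := by
  have hne' : (X \ R).Nonempty := by
    obtain ⟨w, hw, hwR⟩ := Finset.exists_of_ssubset (hR.ssubset_of_ne hne)
    exact ⟨w, by simp [hw, hwR]⟩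
  have hm := Finset.max'_mem _ hne'
  simp only [Finset.mem_sdiff] at hm
  refine ⟨_, hm.1, hm.2, fun u hwu => ⟨fun h => hR h, fun hu => ?_⟩⟩
  by_contra huR
  have := Finset.le_max' (X \ R) u (by simp [hu, huR])
  omega

/-! ### Executions -/

lemma PFun.val_def (e : PFun) (N : ℕ) (σ : St) (i : ℕ) : e.val N σ i = (e ℕ (ℕ → ℕ) σ i).eval N := rfl

lemma PTerm.val_def (e : PTerm) (N : ℕ) (σ : St) : e.val N σ = (e ℕ (ℕ → ℕ) σ).eval N := rfl

/-- The arrays outside `J` are the same. -/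
def Keep (J : List ℕ) (σ σ' : St) : Prop := ∀ j, j ∉ J → σ' j = σ j

lemma Keep.trans {J J' : List ℕ} {σ σ' σ'' : St} (h : Keep J σ σ') (h' : Keep J' σ' σ'') :
    Keep (J ++ J') σ σ'' := fun j hj => by
  simp only [List.mem_append, not_or] at hj
  rw [h' j hj.2, h j hj.1]

lemma Keep.set {N : ℕ} {J : List ℕ} {σ σ' : St} (h : Keep J σ σ') (j : ℕ) (F : ℕ → ℕ) :
    Keep (j :: J) σ (σ'.set N j F) := fun i hi => by
  simp only [List.mem_cons, not_or] at hi
  rw [St.set_ne hi.1, h i hi.2]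

lemma Keep.refl {σ : St} : Keep [] σ σ := fun _ _ => rfl

lemma Keep.mono {J J' : List ℕ} {σ σ' : St} (h : Keep J σ σ') (hJ : ∀ j ∈ J, j ∈ J') :
    Keep J' σ σ' := fun j hj => h j fun hj' => hj (hJ j hj')

variable {N n k : ℕ} {G : SimpleGraph ℕ} {σ : St}

/-- The test is repeated after some choices have been stored, so its meaning is required in every
state that differs from `σ` in the arrays 10, 11 and 12 only. -/
lemma choose_exec (h : Ok N n k G σ)
    (P : ∀ V A : Type, (ℕ → A) → Expr V A → Expr V A → Expr V A → Expr V A)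
    (Q : ℕ → ℕ → ℕ → Prop) (hPQ : ∀ σ', Ok N n k G σ' → Keep [10, 11, 12] σ σ' →
      ∀ x y L : Expr ℕ (ℕ → ℕ), L.eval N ≤ N →
        (0 < (P ℕ (ℕ → ℕ) σ' x y L).eval N ↔ Q (x.eval N) (y.eval N) (L.eval N)))
    (hex : ∃ L < N, ∃ x < N, ∃ y < N, Q x y L) :
    ∃ c σ', Exec N (Code.choose P) σ c σ' ∧ c ≤ 3 ∧ Ok N n k G σ' ∧ Keep [10, 11, 12] σ σ' ∧
      Q (σ' 11 0) (σ' 12 0) (σ' 10 0) ∧ σ' 10 0 < N ∧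
      ∀ L < σ' 10 0, ∀ x < N, ∀ y < N, ¬ Q x y L := by
  set F1 : ℕ → ℕ := PFun.val (fun V A a _ => muE fun L => exE fun x => exE fun y =>
    P V A a (.var x) (.var y) (.var L)) N σ with hF1
  set σ1 := σ.set N 10 F1 with hσ1
  set F2 : ℕ → ℕ := PFun.val (fun V A a _ => muE fun x => exE fun y =>
    P V A a (.var x) (.var y) (getE a 10)) N σ1 with hF2
  set σ2 := σ1.set N 11 F2 with hσ2
  set F3 : ℕ → ℕ := PFun.val (fun V A a _ => muE fun y =>
    P V A a (getE a 11) (.var y) (getE a 10)) N σ2 with hF3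
  set σ3 := σ2.set N 12 F3 with hσ3
  have h1 : Ok N n k G σ1 := h.set (by omega) _
  have h2 : Ok N n k G σ2 := h1.set (by omega) _
  have h3 : Ok N n k G σ3 := h2.set (by omega) _
  have e0 : Keep [10, 11, 12] σ σ := Keep.refl.mono (by simp)
  have e1 : Keep [10, 11, 12] σ σ1 := (Keep.refl.set 10 F1).mono (by simp)
  have e2 : Keep [10, 11, 12] σ σ2 := (e1.set 11 F2).mono (by simp)
  have e3 : Keep [10, 11, 12] σ σ3 := (e2.set 12 F3).mono (by simp)
  have hL : F1 0 < N ∧ (∃ x < N, ∃ y < N, Q x y (F1 0)) ∧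
      ∀ L < F1 0, ¬ ∃ x < N, ∃ y < N, Q x y L := by
    have hiff : ∀ L < N, 0 < (exE fun x => exE fun y => P ℕ (ℕ → ℕ) σ (.var x) (.var y) (.var L) :
        Expr ℕ (ℕ → ℕ)).eval N ↔ ∃ x < N, ∃ y < N, Q x y L := by
      intro L hL
      rw [tr_exE]
      refine exists_congr fun x => and_congr_right fun _ => ?_
      rw [tr_exE]
      refine exists_congr fun y => and_congr_right fun _ => ?_
      exact hPQ σ h e0 _ _ _ hL.le
    have := eval_muE (N := N) (f := fun L => exE fun x => exE fun y =>
      P ℕ (ℕ → ℕ) σ (.var x) (.var y) (.var L)) (by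
        obtain ⟨L, hL, hQ⟩ := hex
        exact ⟨L, hL, (hiff L hL).2 hQ⟩)
    have h10 : F1 0 < N := this.1
    exact ⟨h10, (hiff _ h10).1 this.2.1, fun L hL hc =>
      this.2.2 L hL ((hiff L (hL.trans h10)).2 hc)⟩
  have g1 : σ1 10 0 = F1 0 := St.set_eq h.pos
  have hx : F2 0 < N ∧ ∃ y < N, Q (F2 0) y (F1 0) := by
    have hiff : ∀ x, 0 < (exE fun y => P ℕ (ℕ → ℕ) σ1 (.var x) (.var y) (getE σ1 10) :
        Expr ℕ (ℕ → ℕ)).eval N ↔ ∃ y < N, Q x y (F1 0) := by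
      intro x
      rw [tr_exE]
      refine exists_congr fun y => and_congr_right fun _ => ?_
      rw [hPQ σ1 h1 e1 _ _ _ (by simp only [getE, eval, g1]; exact hL.1.le)]
      simp only [getE, eval, g1]
    have := eval_muE (N := N) (f := fun x => exE fun y =>
      P ℕ (ℕ → ℕ) σ1 (.var x) (.var y) (getE σ1 10)) (by
        obtain ⟨x, hx, hQ⟩ := hL.2.1
        exact ⟨x, hx, (hiff x).2 hQ⟩)
    exact ⟨this.1, (hiff _).1 this.2.1⟩
  have g2 : σ2 10 0 = F1 0 := by rw [hσ2, St.set_ne (by omega), g1]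
  have g2' : σ2 11 0 = F2 0 := St.set_eq h.pos
  have hy : F3 0 < N ∧ Q (F2 0) (F3 0) (F1 0) := by
    have hiff : ∀ y, 0 < (P ℕ (ℕ → ℕ) σ2 (getE σ2 11) (.var y) (getE σ2 10)).eval N ↔
        Q (F2 0) y (F1 0) := by
      intro y
      rw [hPQ σ2 h2 e2 _ _ _ (by simp only [getE, eval, g2]; exact hL.1.le)]
      simp only [getE, eval, g2, g2']
    have := eval_muE (N := N) (f := fun y =>
      P ℕ (ℕ → ℕ) σ2 (getE σ2 11) (.var y) (getE σ2 10)) (by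
        obtain ⟨y, hy, hQ⟩ := hx.2
        exact ⟨y, hy, (hiff y).2 hQ⟩)
    exact ⟨this.1, (hiff _).1 this.2.1⟩
  have g3 : σ3 10 0 = F1 0 := by rw [hσ3, St.set_ne (by omega), g2]
  have g3' : σ3 11 0 = F2 0 := by rw [hσ3, St.set_ne (by omega), g2']
  have g3'' : σ3 12 0 = F3 0 := St.set_eq h.pos
  refine ⟨_, σ3, .seq (.fill 10 _ σ) (.seq (.fill 11 _ σ1) (.fill 12 _ σ2)), by omega, h3, e3, ?_, ?_,
    ?_⟩
  · rw [g3, g3', g3'']; exact hy.2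
  · rw [g3]; exact hL.1
  · rw [g3]
    exact fun L hL' x hx y hy hQ => hL.2.2 L hL' ⟨x, hx, y, hy, hQ⟩

/-- The search tests all subsets. -/
lemma search_exec (h : Ok N n k G σ) :
    ∃ c σ', Exec N Code.search σ c σ' ∧ c ≤ 3 * 2 ^ (supp N (σ 4)).card + 4 ∧ Ok N n k G σ' ∧
      Keep [7, 8, 9] σ σ' ∧
      (σ' 7 0 = 2 ∧ Pack G k (supp N (σ' 9)) ∨
        σ' 7 0 = 0 ∧ ∀ B ⊆ supp N (σ 4), ¬ Pack G k (core G (supp N (σ 3) \ B))) := by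
  classical
  set W := supp N (σ 3) with hW
  set X := supp N (σ 4) with hX
  have hcore : ∀ σ1, Ok N n k G σ1 → Keep [7, 8, 9] σ σ1 → supp N (PFun.val (fun _ _ a v =>
      coreE a (fun u => andE (inE a 3 (.var u)) (notE (inE a 8 (.var u))))
      fun B => .read B (.var v)) N σ1) = core G (W \ supp N (σ1 8)) := by
    intro σ1 h1 e1
    have he : ext N (fun u => andE (inE σ1 3 (.var u)) (notE (inE σ1 8 (.var u)))) =
        W \ supp N (σ1 8) := by
      ext u
      simp only [mem_supp, tr_andE, h1.tr_inE (show 1 ≤ 3 by omega), tr_notE,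
        h1.tr_inE (show 1 ≤ 8 by omega), eval, Finset.mem_sdiff, hW, e1 3 (by simp)]
      tauto
    ext v
    rw [mem_supp, PFun.val_def]
    obtain ⟨B, hB, hev⟩ := supp_coreE h1.holds
      (fun u => andE (inE σ1 3 (.var u)) (notE (inE σ1 8 (.var u)))) (fun B => .read B (.var v))
    rw [hev, ← he, ← hB, mem_supp]
    simp only [eval]
  set σ1 := σ.set N 8 (PFun.val (fun _ _ _ _ => .num 0) N σ) with hσ1
  have h1 : Ok N n k G σ1 := h.set (by omega) _
  have e1 : Keep [7, 8, 9] σ σ1 := (Keep.refl.set 8 _).mono (by simp)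
  set σ2 := σ1.set N 9 (PFun.val (fun _ _ a v =>
      coreE a (fun u => andE (inE a 3 (.var u)) (notE (inE a 8 (.var u))))
      fun B => .read B (.var v)) N σ1) with hσ2
  have h2 : Ok N n k G σ2 := h1.set (by omega) _
  have e2 : Keep [7, 8, 9] σ σ2 := (e1.set 9 _).mono (by simp)
  let I : St → Prop := fun τ => Ok N n k G τ ∧ Keep [7, 8, 9] σ τ ∧ supp N (τ 8) ⊆ X ∧
    supp N (τ 9) = core G (W \ supp N (τ 8)) ∧
    ∀ R ⊆ X, Before R (supp N (τ 8)) → ¬ Pack G k (core G (W \ R))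
  -- The number of subsets not yet passed, the current one included; initially at most `2 ^ X.card`.
  let μ : St → ℕ := fun τ => (X.powerset.filter fun R => ¬ Before R (supp N (τ 8))).card
  have hI2 : I σ2 := by
    have hz : supp N (σ2 8) = ∅ := by
      rw [hσ2, St.set_ne (by omega), hσ1, St.supp_set]
      ext v; simp [PFun.val_def]
    refine ⟨h2, e2, by simp [hz], ?_, fun R _ hR => ?_⟩
    · rw [hσ2, St.supp_set, St.set_ne (by omega)]
      exact hcore σ1 h1 e1
    · rw [hz] at hR
      obtain ⟨v, hv, -⟩ := hR
      simp at hv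
  have htest : ∀ τ, I τ → (0 < PTerm.val (fun _ _ a => andE (notE (packE a 9))
      (exE fun v => andE (inE a 4 (.var v)) (notE (inE a 8 (.var v))))) N τ ↔
      ¬ Pack G k (supp N (τ 9)) ∧ ∃ v ∈ X, v ∉ supp N (τ 8)) := by
    intro τ hτ
    simp only [PTerm.val_def, tr_andE, tr_notE, hτ.1.tr_packE (show 1 ≤ 9 by omega), tr_exE,
      hτ.1.tr_inE (show 1 ≤ 4 by omega), hτ.1.tr_inE (show 1 ≤ 8 by omega), eval,
      hτ.2.1 4 (by simp)]
    refine and_congr_right fun _ => ⟨fun ⟨v, _, h3, h4⟩ => ⟨v, h3, h4⟩,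
      fun ⟨v, h3, h4⟩ => ⟨v, (mem_supp.1 h3).1, h3, h4⟩⟩
  have hloop := Exec.while_measure (N := N) (e := fun _ _ a => andE (notE (packE a 9))
      (exE fun v => andE (inE a 4 (.var v)) (notE (inE a 8 (.var v)))))
    (P := .seq (.fill 8 fun _ _ a v => andE (inE a 4 (.var v)) (.cond (.num 0) (inE a 8 (.var v))
        (exE fun u => andE (andE (inE a 4 (.var u)) (ltE (.var u) (.var v))) (notE (inE a 8 (.var u))))
        (allE fun u => orE (notE (andE (inE a 4 (.var u)) (ltE (.var u) (.var v))))
          (inE a 8 (.var u)))))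
      (.fill 9 fun _ _ a v => coreE a (fun u => andE (inE a 3 (.var u)) (notE (inE a 8 (.var u))))
        fun B => .read B (.var v)))
    I μ 2 (by
      intro τ hτ ht
      rw [htest τ hτ] at ht
      obtain ⟨hτ1, hτ2, hτ3, hτ4, hτ5⟩ := hτ
      set τ1 := τ.set N 8 (PFun.val (fun _ _ a v => andE (inE a 4 (.var v)) (.cond (.num 0)
        (inE a 8 (.var v)) (exE fun u => andE (andE (inE a 4 (.var u)) (ltE (.var u) (.var v)))
        (notE (inE a 8 (.var u)))) (allE fun u => orE (notE (andE (inE a 4 (.var u))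
        (ltE (.var u) (.var v)))) (inE a 8 (.var u))))) N τ) with hτ1'
      have hnext : supp N (τ1 8) = nextSubset X (supp N (τ 8)) := by
        have hcond : ∀ a b c : Expr ℕ (ℕ → ℕ), (0 < (Expr.cond (.num 0) a b c).eval N ↔
            0 < a.eval N ∧ 0 < b.eval N ∨ ¬ 0 < a.eval N ∧ 0 < c.eval N) := by
          intro a b c
          simp only [eval]
          split_ifs with h3 <;> simp [h3]
        rw [hτ1', St.supp_set]
        ext v
        rw [mem_supp, PFun.val_def]
        rw [tr_andE, hcond]
        simp only [tr_andE, hτ1.tr_inE (show 1 ≤ 4 by omega),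
          hτ1.tr_inE (show 1 ≤ 8 by omega), tr_exE, tr_notE, tr_ltE, tr_allE, tr_orE, eval,
          hτ2 4 (by simp), nextSubset, Finset.mem_filter]
        rw [← hX]
        have hXN : ∀ u ∈ X, u < N := fun u hu => (mem_supp.1 hu).1
        constructor
        · rintro ⟨-, h3, ⟨h4, u, -, ⟨h5, h6⟩, h7⟩ | ⟨h4, h5⟩⟩
          · exact ⟨h3, .inl ⟨h4, u, h5, h6, h7⟩⟩
          · refine ⟨h3, .inr ⟨h4, fun u hu huv => ?_⟩⟩
            exact (h5 u (hXN u hu)).resolve_left (fun h6 => h6 ⟨hu, huv⟩)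
        · rintro ⟨h3, ⟨h4, u, h5, h6, h7⟩ | ⟨h4, h5⟩⟩
          · exact ⟨hXN v h3, h3, .inl ⟨h4, u, hXN u h5, ⟨h5, h6⟩, h7⟩⟩
          · refine ⟨hXN v h3, h3, .inr ⟨h4, fun u _ => ?_⟩⟩
            by_cases h6 : u ∈ X ∧ u < v
            · exact .inr (h5 u h6.1 h6.2)
            · exact .inl h6
      have ho1 : Ok N n k G τ1 := hτ1.set (by omega) _
      have hk1 : Keep [7, 8, 9] σ τ1 := (hτ2.set 8 _).mono (by simp)
      set τ2 := τ1.set N 9 (PFun.val (fun _ _ a v =>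
        coreE a (fun u => andE (inE a 3 (.var u)) (notE (inE a 8 (.var u))))
        fun B => .read B (.var v)) N τ1) with hτ2'
      have h8 : supp N (τ2 8) = nextSubset X (supp N (τ 8)) := by
        rw [hτ2', St.set_ne (by omega), hnext]
      refine ⟨_, τ2, .seq (.fill 8 _ τ) (.fill 9 _ τ1), le_rfl, ⟨ho1.set (by omega) _,
        (hk1.set 9 _).mono (by simp), ?_, ?_, ?_⟩, ?_⟩
      · rw [h8]; exact Finset.filter_subset _ _
      · rw [hτ2', St.supp_set, St.set_ne (by omega)]
        exact hcore τ1 ho1 hk1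
      · intro R hR hb
        rw [h8, before_next hτ3 ht.2 hR] at hb
        rcases hb with rfl | hb
        · rw [← hτ4]; exact ht.1
        · exact hτ5 R hR hb
      · refine Finset.card_lt_card ⟨fun R hR => ?_, fun hsub => ?_⟩
        · simp only [Finset.mem_filter, Finset.mem_powerset, h8] at hR ⊢
          refine ⟨hR.1, fun hb => hR.2 ((before_next hτ3 ht.2 hR.1).2 (.inr hb))⟩
        · have h3 : supp N (τ 8) ∈ X.powerset.filter fun R => ¬ Before R (supp N (τ 8)) := by
            simp only [Finset.mem_filter, Finset.mem_powerset]
            exact ⟨hτ3, not_before_self _⟩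
          have h4 := hsub h3
          simp only [Finset.mem_filter, Finset.mem_powerset, h8] at h4
          exact h4.2 ((before_next hτ3 ht.2 hτ3).2 (.inl rfl)))
    σ2 hI2
  obtain ⟨c, σ3, hE, hc, hI3, hexit⟩ := hloop
  rw [htest σ3 hI3] at hexit
  obtain ⟨h3, e3, hs1, hs2, hs3⟩ := hI3
  set σ4 := σ3.set N 7 (PFun.val (fun _ _ a _ => .cond (.num 0) (packE a 9) (.num 2) (.num 0)) N σ3)
    with hσ4
  refine ⟨_, σ4, .seq (.fill 8 _ σ) (.seq (.fill 9 _ σ1) (.seq hE (.fill 7 _ σ3))), ?_,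
    h3.set (by omega) _, (e3.set 7 _).mono (by simp), ?_⟩
  · have : μ σ2 ≤ 2 ^ X.card := (Finset.card_filter_le _ _).trans (by simp)
    omega
  · have h9 : supp N (σ4 9) = supp N (σ3 9) := by rw [hσ4, St.set_ne (by omega)]
    have h7 : σ4 7 0 = if Pack G k (supp N (σ3 9)) then 2 else 0 := by
      rw [hσ4, St.set_eq h.pos, PFun.val_def]
      simp only [eval, h3.tr_packE (show 1 ≤ 9 by omega)]
    by_cases hp : Pack G k (supp N (σ3 9))
    · left
      rw [h7, if_pos hp, h9]
      exact ⟨rfl, hp⟩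
    · right
      rw [h7, if_neg hp]
      refine ⟨rfl, fun B hB => ?_⟩
      -- The loop ended without a packing, so no element of `X` was missing from the current subset.
      -- All proper subsets come before `X` and have been rejected.
      have hfull : supp N (σ3 8) = X := by
        refine Finset.Subset.antisymm hs1 fun v hv => ?_
        by_contra hv'
        exact hexit ⟨hp, v, hv, hv'⟩
      by_cases hBX : B = X
      · rw [hBX, ← hfull, ← hs2]; exact hp
      · exact hs3 B hB (hfull ▸ before_full hB hBX)

end InducedErdosPosa

/-! ### Execution of the first phase. -/

namespace InducedErdosPosa

open InducedErdosPosa.Expr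

section
variable {α : Type*} [DecidableEq α] {G : SimpleGraph α}

/-- A shortest path is not longer than the number of vertices. -/
lemma Link.exists_le {S : Set α} {x y : α} {l : ℕ} (h : Link G S x y l) (hx : x ∉ S) (hy : y ∉ S)
    (hxy : x ≠ y) {T : Finset α} (hT : S ⊆ ↑T) : ∃ l' ≤ T.card, Link G S x y l' := by
  classical
  have hex : ∃ l, Link G S x y l := ⟨l, h⟩
  obtain ⟨p, hp⟩ := Nat.find_spec hex
  refine ⟨_, ?_, p, hp⟩
  have hmin : ∀ l', Link G S x y l' → Nat.find hex ≤ l' := fun l' hl' => Nat.find_min' hex hl'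
  have h1 : (inner (Nat.find hex) p).card = Nat.find hex := by
    rw [inner, Finset.card_image_of_injOn, Nat.card_Icc, Nat.add_sub_cancel]
    intro i hi j hj hij
    simp only [Finset.coe_Icc, Set.mem_Icc] at hi hj
    rcases lt_trichotomy i j with h2 | h2 | h2
    · exact absurd hij (hp.inj hmin hx hy hxy h2 (by omega))
    · exact h2
    · exact absurd hij.symm (hp.inj hmin hx hy hxy h2 (by omega))
  rw [← h1]
  refine Finset.card_le_card fun v hv => ?_
  obtain ⟨i, h2, h3, rfl⟩ := mem_inner.1 hv
  exact_mod_cast hT (hp.mem i h2 h3)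

/-- A minimal set that contains the interior of a shortest path is the interior of one. -/
lemma exists_inner_eq {S : Set α} {x y : α} {L : ℕ} {B : Finset α} (hB : (↑B : Set α) ⊆ S)
    (hl : ∃ l ≤ L + 1, Link G (↑B) x y l)
    (hmin : ∀ v ∈ B, ¬ ∃ l ≤ L + 1, Link G (↑(B.erase v)) x y l)
    (hS : ∀ l, Link G S x y l → L + 1 ≤ l) :
    ∃ p, IsLink G S x y (L + 1) p ∧ B = inner (L + 1) p := by
  obtain ⟨l, hl, p, hp⟩ := hl
  have hp' : IsLink G S x y l p := hp.mono fun i h1 h2 => hB (hp.mem i h1 h2)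
  obtain rfl : l = L + 1 := le_antisymm hl (hS l ⟨p, hp'⟩)
  refine ⟨p, hp', Finset.Subset.antisymm (fun v hv => ?_) fun v hv => ?_⟩
  · by_contra hv'
    refine hmin v hv ⟨L + 1, le_rfl, p, hp.mono fun i h1 h2 => ?_⟩
    rw [Finset.mem_coe, Finset.mem_erase]
    exact ⟨fun e => hv' (e ▸ mem_inner.2 ⟨i, h1, h2, rfl⟩), by exact_mod_cast hp.mem i h1 h2⟩
  · obtain ⟨i, h1, h2, rfl⟩ := mem_inner.1 hv
    exact_mod_cast hp.mem i h1 h2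

lemma Link.mono {S T : Set α} {x y : α} {l : ℕ} (h : Link G S x y l) (hT : S ⊆ T) :
    Link G T x y l := by
  obtain ⟨p, hp⟩ := h
  exact ⟨p, hp.mono fun i h1 h2 => hT (hp.mem i h1 h2)⟩

end

variable {N n k : ℕ} {G : SimpleGraph ℕ} {σ : St}

lemma Vl_sub_range {n i : ℕ} {lev : ℕ → ℕ} : Vl n lev i ⊆ Finset.range n := Finset.filter_subset _ _

/-- The program tries only values of `L` below `N`. A shortest link has at most `n ≤ N` interior
vertices, so no ear is overlooked. -/
lemma Ok.noEar (h : Ok N n k G σ)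
    (hne : ¬ ∃ L < N, ∃ x < N, ∃ y < N, Ok.EarUpTo N n G σ x y L) :
    NoEar G (Vl n (σ 5) (σ 6 0)) (Wl (supp N (σ 3)) (σ 5) (σ 6 0))
      (Wl (supp N (σ 4)) (σ 5) (σ 6 0)) := by
  intro x y l he hl
  obtain ⟨l', h1, h2⟩ := hl.exists_le (T := Finset.range n) (fun hx => hx.1.2.1 he.x_mem)
    (fun hy => hy.1.2.1 he.y_mem) he.ne (fun v hv => Vl_sub_range hv.1.1)
  rw [Finset.card_range] at h1
  have hN := h.pos
  have hn := h.holds.le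
  exact hne ⟨N - 1, by omega, x, (mem_supp.1 (mem_Wl.1 he.x_mem).1).1, y,
    (mem_supp.1 (mem_Wl.1 he.y_mem).1).1, he, l', by omega, h2⟩

lemma Ok.noCycle (h : Ok N n k G σ)
    (hne : ¬ ∃ L < N, ∃ x < N, ∃ y < N, Ok.CycUpTo n G σ x y L) (M : Finset ℕ)
    (hM : M ⊆ Vl n (σ 5) (σ 6 0)) (hM0 : M.Nonempty) : ¬ Thick G M := by
  intro ht
  obtain ⟨x, y, l, p, hc⟩ := ht.exists_minCycle hM0
  have hl : Link G (↑(Vl n (σ 5) (σ 6 0) \ {x, y}) : Set ℕ) x y l := by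
    refine Link.mono ⟨p, hc.link⟩ ?_
    exact_mod_cast Finset.sdiff_subset_sdiff hM subset_rfl
  obtain ⟨l', h1, h2⟩ := hl.exists_le (T := Finset.range n) (by simp) (by simp) hc.adj.ne
    (fun v hv => Vl_sub_range (Finset.sdiff_subset (by exact_mod_cast hv)))
  rw [Finset.card_range] at h1
  have hN := h.pos
  have hn := h.holds.le
  have hx := hM hc.x_mem
  have hy := hM hc.y_mem
  have hx' := (mem_Vl.1 hx).1
  have hy' := (mem_Vl.1 hy).1
  exact hne ⟨N - 1, by omega, x, by omega, y, by omega, ⟨hx, hy, hc.adj⟩, l', by omega, h2⟩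

/-- The result of the search in the sets in the arrays `3` and `4`. -/
def Searched (N k : ℕ) (G : SimpleGraph ℕ) (σ : St) : Prop :=
  σ 7 0 = 2 ∧ Pack G k (supp N (σ 9)) ∨
    σ 7 0 = 0 ∧ ∀ B ⊆ supp N (σ 4), ¬ Pack G k (core G (supp N (σ 3) \ B))

/-- Greedy deletion leaves a minimal set that still carries a link with at most `L + 1` interior
vertices. As no ear has fewer, this set is exactly the interior of a shortest ear, which is thus
found without tracing a path. -/
lemma addEar_exec (h : Ok N n k G σ) (hex : ∃ L < N, ∃ x < N, ∃ y < N, Ok.EarUpTo N n G σ x y L) :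
    ∃ c σ', Exec N Code.addEar σ c σ' ∧ c ≤ 3 * 2 ^ (supp N (σ' 4)).card + 10 ∧ Ok N n k G σ' ∧
      Keep [3, 4, 7, 8, 9, 10, 11, 12, 13] σ σ' ∧ Searched N k G σ' ∧
      ∃ x y l p, MinEar G (Vl n (σ 5) (σ 6 0)) (Wl (supp N (σ 3)) (σ 5) (σ 6 0))
        (Wl (supp N (σ 4)) (σ 5) (σ 6 0)) x y l p ∧
        supp N (σ' 3) = supp N (σ 3) ∪ inner l p ∧
        supp N (σ' 4) = supp N (σ 4) ∪
          (ball2 G (Wl (supp N (σ 3) ∪ inner l p) (σ 5) (σ 6 0)) x ∪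
            ball2 G (Wl (supp N (σ 3) ∪ inner l p) (σ 5) (σ 6 0)) y) := by
  classical
  obtain ⟨c, σ1, hE, hc, h1, e1, hQ, hLN, hmin⟩ := choose_exec h (fun _ _ a x y L => earE a x y L)
    (Ok.EarUpTo N n G σ) (fun σ' h' hk x y L hL => by
      rw [h'.tr_earE hL]
      simp only [Ok.EarUpTo, Ok.ViaCur, Ok.EarUpTo, hk 3 (by simp), hk 4 (by simp), hk 5 (by simp),
        hk 6 (by simp)]) hex
  set x := σ1 11 0 with hx
  set y := σ1 12 0 with hy
  set L := σ1 10 0 with hL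
  have hminL : ∀ x' y' l', EarEnds G (Wl (supp N (σ 3)) (σ 5) (σ 6 0))
      (Wl (supp N (σ 4)) (σ 5) (σ 6 0)) x' y' → Link G (Ok.ViaCur N n G σ x' y') x' y' l' →
      L + 1 ≤ l' := by
    intro x' y' l' he hl
    by_contra hlt
    have hpos : 1 ≤ l' := by obtain ⟨p, hp⟩ := hl; exact hp.pos
    exact hmin (l' - 1) (by omega) x' (mem_supp.1 (mem_Wl.1 he.x_mem).1).1 y'
      (mem_supp.1 (mem_Wl.1 he.y_mem).1).1 ⟨he, l', by omega, hl⟩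
  set S : ℕ → Expr ℕ (ℕ → ℕ) := fun u => viaCurE σ1 (getE σ1 11) (getE σ1 12) (.var u) with hS
  have hSe : (↑(ext N S) : Set ℕ) = Ok.ViaCur N n G σ x y := by
    rw [hS, h1.coe_ext_viaCurE]
    simp only [Ok.ViaCur, getE, eval, e1 3 (by simp), e1 4 (by simp), e1 5 (by simp),
      e1 6 (by simp), ← hx, ← hy]
  obtain ⟨B, hB1, hB2, hB3, hB4⟩ := supp_greedyE (N := N) (S := S)
    (P := fun S => pathE σ1 S (getE σ1 11) (getE σ1 12) (getE σ1 10))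
    (Q := fun T => ∃ l ≤ L + 1, Link G (↑T) x y l)
    (fun T => by
      rw [tr_pathE h1.holds (by simp only [getE, eval, ← hL]; exact hLN.le)]
      simp only [getE, eval, ← hL, ← hx, ← hy])
    (fun T T' hT ⟨l, hl, hl'⟩ => ⟨l, hl, hl'.mono (by exact_mod_cast hT)⟩)
    (by rw [hSe]; exact hQ.2)
  rw [← Finset.coe_subset, hSe] at hB1
  obtain ⟨p, hp, hBe⟩ := exists_inner_eq hB1 hB2 hB3 (fun l hl => hminL x y l hQ.1 hl)
  have hme : MinEar G (Vl n (σ 5) (σ 6 0)) (Wl (supp N (σ 3)) (σ 5) (σ 6 0))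
      (Wl (supp N (σ 4)) (σ 5) (σ 6 0)) x y (L + 1) p := ⟨hQ.1, hp, hminL⟩
  set σ2 := σ1.set N 13 (PFun.val (fun _ _ a v => greedyE
    (fun u => viaCurE a (getE a 11) (getE a 12) (.var u))
    (fun S => pathE a S (getE a 11) (getE a 12) (getE a 10)) fun B => .read B (.var v)) N σ1) with hσ2
  have h2 : Ok N n k G σ2 := h1.set (by omega) _
  have h13 : supp N (σ2 13) = inner (L + 1) p := by
    rw [hσ2, St.supp_set, ← hBe]
    ext v
    simp only [mem_supp, PFun.val_def]
    rw [hB4]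
    simp only [eval]
  set σ3 := σ2.set N 3 (PFun.val (fun _ _ a v => orE (inE a 3 (.var v)) (inE a 13 (.var v))) N σ2)
    with hσ3
  have h3 : Ok N n k G σ3 := h2.set (by omega) _
  have e2 : Keep [10, 11, 12, 13] σ σ2 := (e1.set 13 _).mono (by simp)
  have e3 : Keep [3, 10, 11, 12, 13] σ σ3 := (e2.set 3 _).mono (by simp)
  have hW : supp N (σ3 3) = supp N (σ 3) ∪ inner (L + 1) p := by
    rw [hσ3, St.supp_set]
    ext v
    simp only [mem_supp, PFun.val_def, tr_orE, h2.tr_inE (show 1 ≤ 3 by omega),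
      h2.tr_inE (show 1 ≤ 13 by omega), h13, eval, Finset.mem_union, e2 3 (by simp)]
    rw [← h13, mem_supp]
    tauto
  have hx3 : σ3 11 0 = x := by rw [hσ3, St.set_ne (by omega), hσ2, St.set_ne (by omega)]
  have hy3 : σ3 12 0 = y := by rw [hσ3, St.set_ne (by omega), hσ2, St.set_ne (by omega)]
  set σ4 := σ3.set N 4 (PFun.val (fun _ _ a v => orE (inE a 4 (.var v))
    (orE (ball2E a (getE a 6) (getE a 11) (.var v)) (ball2E a (getE a 6) (getE a 12) (.var v)))) N σ3)
    with hσ4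
  have h4 : Ok N n k G σ4 := h3.set (by omega) _
  have e4 : Keep [3, 4, 10, 11, 12, 13] σ σ4 := (e3.set 4 _).mono (by simp)
  have hball : ∀ z ∈ Wl (supp N (σ 3) ∪ inner (L + 1) p) (σ 5) (σ 6 0), ∀ v,
      v ∈ ball2 G (Wl (supp N (σ 3) ∪ inner (L + 1) p) (σ 5) (σ 6 0)) z → v < N := by
    intro z hz v hv
    have key : ∀ u ∈ Wl (supp N (σ 3) ∪ inner (L + 1) p) (σ 5) (σ 6 0), u < N := by
      intro u hu
      have := (mem_Wl.1 hu).1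
      rw [← hW, mem_supp] at this
      exact this.1
    rcases mem_ball2.1 hv with rfl | ⟨h5, -⟩ | ⟨w, -, -, h5, -⟩
    · exact key _ hz
    · exact key _ h5
    · exact key _ h5
  have hmW : ∀ z ∈ Wl (supp N (σ 3)) (σ 5) (σ 6 0),
      z ∈ Wl (supp N (σ 3) ∪ inner (L + 1) p) (σ 5) (σ 6 0) := by
    intro z hz
    rw [mem_Wl] at hz ⊢
    exact ⟨Finset.mem_union_left _ hz.1, hz.2⟩
  have hX : supp N (σ4 4) = supp N (σ 4) ∪
      (ball2 G (Wl (supp N (σ 3) ∪ inner (L + 1) p) (σ 5) (σ 6 0)) x ∪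
        ball2 G (Wl (supp N (σ 3) ∪ inner (L + 1) p) (σ 5) (σ 6 0)) y) := by
    rw [hσ4, St.supp_set]
    ext v
    rw [mem_supp, PFun.val_def]
    simp only [tr_orE, h3.tr_inE (show 1 ≤ 4 by omega), h3.tr_ball2E, getE, eval, hx3, hy3, hW,
      e3 4 (by simp), e3 5 (by simp), e3 6 (by simp), Finset.mem_union]
    constructor
    · exact fun hv => hv.2
    · refine fun hv => ⟨?_, hv⟩
      rcases hv with hv | hv | hv
      · exact (mem_supp.1 hv).1
      · exact hball x (hmW _ hQ.1.x_mem) v hv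
      · exact hball y (hmW _ hQ.1.y_mem) v hv
  obtain ⟨c5, σ5, hE5, hc5, h5, e5, hs⟩ := search_exec h4
  refine ⟨_, σ5, .seq hE (.seq (.fill 13 _ σ1) (.seq (.fill 3 _ σ2) (.seq (.fill 4 _ σ3) hE5))), ?_,
    h5, (e4.trans e5).mono (by simp), ?_, x, y, L + 1, p, hme, ?_, ?_⟩
  · rw [e5 4 (by simp)]; omega
  · rw [Searched, e5 3 (by simp), e5 4 (by simp)]; exact hs
  · rw [e5 3 (by simp), hσ4, St.set_ne (by omega), hW]
  · rw [e5 4 (by simp), hX]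

end InducedErdosPosa

namespace InducedErdosPosa

open InducedErdosPosa.Expr

variable {N n k : ℕ} {G : SimpleGraph ℕ} {σ : St}

lemma addCycle_exec (h : Ok N n k G σ) (hex : ∃ L < N, ∃ x < N, ∃ y < N, Ok.CycUpTo n G σ x y L) :
    ∃ c σ', Exec N Code.addCycle σ c σ' ∧ c ≤ 3 * 2 ^ (supp N (σ' 4)).card + 10 ∧ Ok N n k G σ' ∧
      Keep [3, 4, 7, 8, 9, 10, 11, 12, 13] σ σ' ∧ Searched N k G σ' ∧
      ∃ x y l p, MinStart G (Vl n (σ 5) (σ 6 0)) x y l p ∧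
        supp N (σ' 3) = supp N (σ 3) ∪ MinCycle.verts x y l p ∧
        supp N (σ' 4) = supp N (σ 4) ∪ if l < 3 then MinCycle.verts x y l p else {x} := by
  classical
  obtain ⟨c, σ1, hE, hc, h1, e1, hQ, hLN, hmin⟩ := choose_exec h (fun _ _ a x y L => cycE a x y L)
    (Ok.CycUpTo n G σ) (fun σ' h' hk x y L hL => by
      rw [h'.tr_cycE hL]
      simp only [Ok.CycUpTo, hk 5 (by simp), hk 6 (by simp)]) hex
  set x := σ1 11 0 with hx
  set y := σ1 12 0 with hy
  set L := σ1 10 0 with hL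
  have hn := h.holds.le
  have hminL : ∀ x' ∈ Vl n (σ 5) (σ 6 0), ∀ y' ∈ Vl n (σ 5) (σ 6 0), G.Adj x' y' → ∀ l',
      Link G (↑(Vl n (σ 5) (σ 6 0) \ {x', y'}) : Set ℕ) x' y' l' → L + 1 ≤ l' := by
    intro x' hx' y' hy' ha l' hl
    by_contra hlt
    have hpos : 1 ≤ l' := by obtain ⟨p, hp⟩ := hl; exact hp.pos
    have h3 := (mem_Vl.1 hx').1
    have h4 := (mem_Vl.1 hy').1
    exact hmin (l' - 1) (by omega) x' (by omega) y' (by omega) ⟨⟨hx', hy', ha⟩, l', by omega, hl⟩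
  set S : ℕ → Expr ℕ (ℕ → ℕ) := fun u => restE σ1 (getE σ1 11) (getE σ1 12) (.var u) with hS
  have hSe : ext N S = Vl n (σ 5) (σ 6 0) \ {x, y} := by
    rw [hS, h1.ext_restE]
    simp only [getE, eval, e1 5 (by simp), e1 6 (by simp), ← hx, ← hy]
  obtain ⟨B, hB1, hB2, hB3, hB4⟩ := supp_greedyE (N := N) (S := S)
    (P := fun S => pathE σ1 S (getE σ1 11) (getE σ1 12) (getE σ1 10))
    (Q := fun T => ∃ l ≤ L + 1, Link G (↑T) x y l)
    (fun T => by
      rw [tr_pathE h1.holds (by simp only [getE, eval, ← hL]; exact hLN.le)]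
      simp only [getE, eval, ← hL, ← hx, ← hy])
    (fun T T' hT ⟨l, hl, hl'⟩ => ⟨l, hl, hl'.mono (by exact_mod_cast hT)⟩)
    (by rw [hSe]; exact hQ.2)
  rw [hSe, ← Finset.coe_subset] at hB1
  obtain ⟨p, hp, hBe⟩ := exists_inner_eq hB1 hB2 hB3
    (fun l hl => hminL x hQ.1.1 y hQ.1.2.1 hQ.1.2.2 l hl)
  have hme : MinStart G (Vl n (σ 5) (σ 6 0)) x y (L + 1) p :=
    ⟨⟨hQ.1.1, hQ.1.2.1, hQ.1.2.2, hp, hminL x hQ.1.1 y hQ.1.2.1 hQ.1.2.2⟩, hminL⟩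
  have hvN : ∀ v ∈ MinCycle.verts x y (L + 1) p, v < N := fun v hv => by
    have := (mem_Vl.1 (hme.verts_sub hv)).1
    omega
  set σ2 := σ1.set N 13 (PFun.val (fun _ _ a v => orE
    (orE (eqE (.var v) (getE a 11)) (eqE (.var v) (getE a 12))) (greedyE
    (fun u => restE a (getE a 11) (getE a 12) (.var u))
    (fun S => pathE a S (getE a 11) (getE a 12) (getE a 10)) fun B => .read B (.var v))) N σ1) with hσ2
  have h2 : Ok N n k G σ2 := h1.set (by omega) _
  have h13 : supp N (σ2 13) = MinCycle.verts x y (L + 1) p := by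
    rw [hσ2, St.supp_set]
    ext v
    rw [mem_supp, PFun.val_def, tr_orE, hB4]
    simp only [eval, tr_orE, tr_eqE, getE, ← hx, ← hy, MinCycle.verts, Finset.mem_union,
      Finset.mem_insert, Finset.mem_singleton, ← hBe, mem_supp]
    constructor
    · exact fun ⟨h3, h4⟩ => h4.imp id fun h5 => ⟨h3, h5⟩
    · exact fun h3 => ⟨hvN v (by
        simp only [MinCycle.verts, Finset.mem_union, Finset.mem_insert, Finset.mem_singleton, ← hBe,
          mem_supp]
        exact h3), h3.imp id And.right⟩
  set σ3 := σ2.set N 3 (PFun.val (fun _ _ a v => orE (inE a 3 (.var v)) (inE a 13 (.var v))) N σ2)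
    with hσ3
  have h3 : Ok N n k G σ3 := h2.set (by omega) _
  have e2 : Keep [10, 11, 12, 13] σ σ2 := (e1.set 13 _).mono (by simp)
  have e3 : Keep [3, 10, 11, 12, 13] σ σ3 := (e2.set 3 _).mono (by simp)
  have hW : supp N (σ3 3) = supp N (σ 3) ∪ MinCycle.verts x y (L + 1) p := by
    rw [hσ3, St.supp_set]
    ext v
    simp only [mem_supp, PFun.val_def, tr_orE, h2.tr_inE (show 1 ≤ 3 by omega),
      h2.tr_inE (show 1 ≤ 13 by omega), h13, eval, Finset.mem_union, e2 3 (by simp)]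
    rw [← h13, mem_supp]
    tauto
  have hx3 : σ3 11 0 = x := by rw [hσ3, St.set_ne (by omega), hσ2, St.set_ne (by omega)]
  have hL3 : σ3 10 0 = L := by rw [hσ3, St.set_ne (by omega), hσ2, St.set_ne (by omega)]
  have h133 : supp N (σ3 13) = MinCycle.verts x y (L + 1) p := by rw [hσ3, St.set_ne (by omega), h13]
  set σ4 := σ3.set N 4 (PFun.val (fun _ _ a v => orE (inE a 4 (.var v)) (.cond (getE a 10) (.num 2)
      (inE a 13 (.var v)) (eqE (.var v) (getE a 11)))) N σ3)
    with hσ4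
  have h4 : Ok N n k G σ4 := h3.set (by omega) _
  have e4 : Keep [3, 4, 10, 11, 12, 13] σ σ4 := (e3.set 4 _).mono (by simp)
  have hX : supp N (σ4 4) = supp N (σ 4) ∪
      if L + 1 < 3 then MinCycle.verts x y (L + 1) p else {x} := by
    rw [hσ4, St.supp_set]
    ext v
    rw [mem_supp, PFun.val_def, tr_orE, h3.tr_inE (show 1 ≤ 4 by omega), e3 4 (by simp)]
    have hcond : 0 < (Expr.cond (getE σ3 10) (.num 2) (inE σ3 13 (.var v))
        (eqE (.var v) (getE σ3 11)) : Expr ℕ (ℕ → ℕ)).eval N ↔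
        v ∈ if L + 1 < 3 then MinCycle.verts x y (L + 1) p else {x} := by
      rw [eval]
      by_cases h5 : L + 1 < 3
      · rw [if_pos h5, if_pos (by simp only [getE, eval, hL3]; omega),
          h3.tr_inE (show 1 ≤ 13 by omega), h133, eval]
      · rw [if_neg h5, if_neg (by simp only [getE, eval, hL3]; omega), tr_eqE]
        simp only [getE, eval, hx3, Finset.mem_singleton]
    rw [hcond, eval, Finset.mem_union]
    constructor
    · exact fun hv => hv.2
    · refine fun hv => ⟨?_, hv⟩
      rcases hv with hv | hv
      · exact (mem_supp.1 hv).1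
      · exact hvN v (hme.good.subX hv)
  obtain ⟨c5, σ5, hE5, hc5, h5, e5, hs⟩ := search_exec h4
  refine ⟨_, σ5, .seq hE (.seq (.fill 13 _ σ1) (.seq (.fill 3 _ σ2) (.seq (.fill 4 _ σ3) hE5))), ?_,
    h5, (e4.trans e5).mono (by simp), ?_, x, y, L + 1, p, hme, ?_, ?_⟩
  · rw [e5 4 (by simp)]; omega
  · rw [Searched, e5 3 (by simp), e5 4 (by simp)]; exact hs
  · rw [e5 3 (by simp), hσ4, St.set_ne (by omega), hW]
  · rw [e5 4 (by simp), hX]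

lemma finishStage_exec (h : Ok N n k G σ) : ∃ σ', Exec N Code.finishStage σ 2 σ' ∧ Ok N n k G σ' ∧
    Keep [5, 6] σ σ' ∧ σ' 6 0 = σ 6 0 + 1 ∧
    ∀ v < n, (v ∈ Vl n (σ 5) (σ 6 0) ∧ v ∉ Wl (supp N (σ 3)) (σ 5) (σ 6 0) ∧
        (∀ w ∈ Wl (supp N (σ 3)) (σ 5) (σ 6 0), ¬ G.Adj v w)) ∧ σ' 5 v = σ 6 0 + 1 ∨
      ¬ (v ∈ Vl n (σ 5) (σ 6 0) ∧ v ∉ Wl (supp N (σ 3)) (σ 5) (σ 6 0) ∧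
        (∀ w ∈ Wl (supp N (σ 3)) (σ 5) (σ 6 0), ¬ G.Adj v w)) ∧ σ' 5 v = σ 5 v := by
  set σ1 := σ.set N 5 (PFun.val (fun _ _ a v => .cond (.num 0) (andE (VlE a (getE a 6) (.var v))
      (andE (notE (WlE a 3 (getE a 6) (.var v)))
      (allE fun w => orE (notE (WlE a 3 (getE a 6) (.var w))) (notE (adjE a (.var v) (.var w))))))
      (.add (getE a 6) (.num 1)) (.read (a 5) (.var v))) N σ) with hσ1
  have h1 : Ok N n k G σ1 := h.set (by omega) _
  refine ⟨_, .seq (.fill 5 _ σ) (.fill 6 _ σ1), h1.set (by omega) _,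
    ((Keep.refl.set 5 _).set 6 _).mono (by simp), ?_, fun v hv => ?_⟩
  · rw [St.set_eq h.pos, PFun.val_def]
    simp only [getE, eval]
    rw [hσ1, St.set_ne (by omega)]
  · have hn := h.holds.le
    rw [St.set_ne (by omega), hσ1, St.set_eq (by omega), PFun.val_def, eval]
    have hiff : 0 < (andE (VlE σ (getE σ 6) (.var v)) (andE (notE (WlE σ 3 (getE σ 6) (.var v)))
        (allE fun w => orE (notE (WlE σ 3 (getE σ 6) (.var w)))
          (notE (adjE σ (.var v) (.var w))))) : Expr ℕ (ℕ → ℕ)).eval N ↔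
        v ∈ Vl n (σ 5) (σ 6 0) ∧ v ∉ Wl (supp N (σ 3)) (σ 5) (σ 6 0) ∧
        (∀ w ∈ Wl (supp N (σ 3)) (σ 5) (σ 6 0), ¬ G.Adj v w) := by
      simp only [tr_andE, h.tr_VlE, tr_notE, h.tr_WlE (show 1 ≤ 3 by omega), tr_allE, tr_orE, h.tr_adjE,
        eval, getE]
      refine and_congr_right fun _ => and_congr_right fun _ => ⟨fun h3 w hw => ?_, fun h3 w _ => ?_⟩
      · exact (h3 w (mem_supp.1 (mem_Wl.1 hw).1).1).resolve_left (fun h4 => h4 hw)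
      · by_cases h4 : w ∈ Wl (supp N (σ 3)) (σ 5) (σ 6 0)
        · exact .inr (h3 w h4)
        · exact .inl h4
    by_cases hp : v ∈ Vl n (σ 5) (σ 6 0) ∧ v ∉ Wl (supp N (σ 3)) (σ 5) (σ 6 0) ∧
        (∀ w ∈ Wl (supp N (σ 3)) (σ 5) (σ 6 0), ¬ G.Adj v w)
    · refine .inl ⟨hp, ?_⟩
      rw [if_pos]
      · simp only [eval, getE]
      · simp only [eval]; exact hiff.2 hp
    · refine .inr ⟨hp, ?_⟩
      rw [if_neg]
      · simp only [eval]
      · simp only [eval]; exact fun h3 => hp (hiff.1 h3)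

/-- The first phase is running or complete, without a packing. -/
structure Staged (N n k H : ℕ) (G : SimpleGraph ℕ) (σ : St) : Prop where
  inv : Inv G n (supp N (σ 3)) (supp N (σ 4)) (σ 5) (σ 6 0)
  branch_le : (branch G (supp N (σ 3))).card ≤ 4 * H
  stages_le : numStages (supp N (σ 3)) (σ 5) (σ 6 0) + 1 ≤ k

lemma Staged.card_le {H : ℕ} (h : Staged N n k H G σ) : (supp N (σ 4)).card + 4 ≤ 52 * H + 4 * k := by
  have h1 := h.inv.card_le
  have h2 := h.branch_le
  have h3 := h.stages_le
  omega

/-- The alternatives for cycles in the subsets of the first `n` numbers. -/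
def ErdosPosaUpTo (n k H : ℕ) (G : SimpleGraph ℕ) : Prop := ∀ W ⊆ Finset.range n,
  (∃ M : Fin k → Finset ℕ, (∀ i, M i ⊆ W) ∧ (∀ i, IsCyc G (M i)) ∧
    ∀ i j, i ≠ j → Disjoint (M i) (M j)) ∨
  ∃ Y ⊆ W, Y.card ≤ H ∧ ¬ (core G (W \ Y)).Nonempty

/-- The Erdős–Pósa alternative enters the analysis of the program only here, applied to the current
`W`: a failed search bounds the branch vertices and the stages. -/
lemma Searched.cases {H : ℕ} (hH : ErdosPosaUpTo n k H G)
    (hi : Inv G n (supp N (σ 3)) (supp N (σ 4)) (σ 5) (σ 6 0)) (hs : Searched N k G σ) :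
    σ 7 0 = 0 ∧ Staged N n k H G σ ∨ σ 7 0 = 2 ∧ Pack G k (supp N (σ 9)) := by
  rcases hs with hs | ⟨h7, hf⟩
  · exact .inr hs
  · have := hi.of_fail (hH _ hi.sub) hf
    exact .inl ⟨h7, hi, this.1, this.2⟩

/-- The first phase is complete. -/
structure Complete (N n k H : ℕ) (G : SimpleGraph ℕ) (σ : St) : Prop extends Staged N n k H G σ where
  empty : Wl (supp N (σ 3)) (σ 5) (σ 6 0) = ∅
  no_cycle : ∀ M ⊆ Vl n (σ 5) (σ 6 0), M.Nonempty → ¬ Thick G M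

lemma Inv.ball_card {W X : Finset ℕ} {lev : ℕ → ℕ} {c : ℕ} (h : Inv G n W X lev c) {i x : ℕ}
    (hx : x ∈ Wl W lev i) : (ball2 G (Wl W lev i) x).card ≤ 13 := by
  refine ball2_card_le (fun v hv => ?_) hx
  have h1 := Finset.card_le_card (nb_mono (G := G) (Finset.filter_subset (fun v => lev v = i) W) v)
  rcases h.skel.deg v (mem_Wl.1 hv).1 with e | e <;> exact h1.trans (by omega)

/-- The first phase ends with a packing, or when no cycle is left. -/
lemma phase1_exec {H : ℕ} (hH : ErdosPosaUpTo n k H G) (h : Ok N n k G σ) (h7 : σ 7 0 = 0)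
    (hst : Staged N n k H G σ) : ∃ c σ', Exec N Code.phase1 σ c σ' ∧
      c ≤ (3 * n + 5) * (3 * 2 ^ (52 * H + 4 * k + 26) + 14) + 1 ∧ Ok N n k G σ' ∧
      (σ' 7 0 = 1 ∧ Complete N n k H G σ' ∨ σ' 7 0 = 2 ∧ Pack G k (supp N (σ' 9))) := by
  classical
  let I : St → Prop := fun τ => Ok N n k G τ ∧ (τ 7 0 = 0 ∧ Staged N n k H G τ ∨
    τ 7 0 = 1 ∧ Complete N n k H G τ ∨ τ 7 0 = 2 ∧ Pack G k (supp N (τ 9)))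
  -- Finishing a stage keeps `W` and lowers the last term from 2 to 1. A new cycle or ear enlarges
  -- `W`, which outweighs any change of that term. Once the status is nonzero, the measure is zero.
  let μ : St → ℕ := fun τ => if τ 7 0 = 0 then 3 * (n + 1 - (supp N (τ 3)).card) +
    (if Wl (supp N (τ 3)) (τ 5) (τ 6 0) = ∅ then 1 else 2) else 0
  have htest : ∀ τ, 0 < PTerm.val (fun _ _ a => eqE (getE a 7) (.num 0)) N τ ↔ τ 7 0 = 0 := by
    intro τ
    simp only [PTerm.val_def, tr_eqE, getE, eval]
  obtain ⟨c, σ', hE, hc, ⟨h1, h2⟩, h3⟩ := Exec.while_measure (N := N)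
    (e := fun _ _ a => eqE (getE a 7) (.num 0)) (P :=
    .ite (fun _ _ a => exE fun v => WlE a 3 (getE a 6) (.var v))
      (.ite (fun _ _ a => exE fun L => exE fun x => exE fun y => earE a (.var x) (.var y) (.var L))
        Code.addEar Code.finishStage)
      (.ite (fun _ _ a => exE fun L => exE fun x => exE fun y => cycE a (.var x) (.var y) (.var L))
        Code.addCycle (.fill 7 fun _ _ _ _ => .num 1)))
    I μ (3 * 2 ^ (52 * H + 4 * k + 26) + 13) (by
      rintro τ ⟨hτ, hτ2⟩ ht
      rw [htest] at ht
      have hs : Staged N n k H G τ := by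
        rcases hτ2 with h1 | h1 | h1
        · exact h1.2
        · omega
        · omega
      clear hτ2
      have hcard := hs.card_le
      have hnW : (supp N (τ 3)).card ≤ n := by
        simpa using Finset.card_le_card hs.inv.sub
      have hμ : μ τ = 3 * (n + 1 - (supp N (τ 3)).card) +
        (if Wl (supp N (τ 3)) (τ 5) (τ 6 0) = ∅ then 1 else 2) := if_pos ht
      have hgrow : ∀ τ', Searched N k G τ' → Keep [3, 4, 7, 8, 9, 10, 11, 12, 13] τ τ' →
          Inv G n (supp N (τ' 3)) (supp N (τ' 4)) (τ' 5) (τ' 6 0) → Ok N n k G τ' →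
          (supp N (τ 3)).card < (supp N (τ' 3)).card → I τ' ∧ μ τ' < μ τ := by
        intro τ' hse hk hi hok hlt
        refine ⟨⟨hok, ?_⟩, ?_⟩
        · rcases hse.cases hH hi with h1 | h1
          · exact .inl h1
          · exact .inr (.inr h1)
        · rw [hμ]
          simp only [μ]
          split_ifs <;> omega
      -- Before the step, array 4 has at most `52 * H + 4 * k` elements; an ear adds at most two
      -- balls of 13 vertices, and a starting cycle at most 4.
      have hpow : ∀ m ≤ 52 * H + 4 * k + 26, 3 * 2 ^ m + 10 + 2 ≤ 3 * 2 ^ (52 * H + 4 * k + 26) + 13 := by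
        intro m hm
        have := Nat.pow_le_pow_right (show 0 < 2 by omega) hm
        omega
      have t1 : 0 < PTerm.val (fun _ _ a => exE fun v => WlE a 3 (getE a 6) (.var v)) N τ ↔
          Wl (supp N (τ 3)) (τ 5) (τ 6 0) ≠ ∅ := by
        simp only [PTerm.val_def, tr_exE, hτ.tr_WlE (show 1 ≤ 3 by omega), eval, getE]
        rw [← Finset.nonempty_iff_ne_empty]
        exact ⟨fun ⟨v, _, hv⟩ => ⟨v, hv⟩, fun ⟨v, hv⟩ => ⟨v, (mem_supp.1 (mem_Wl.1 hv).1).1, hv⟩⟩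
      have t2 : 0 < PTerm.val (fun _ _ a => exE fun L => exE fun x => exE fun y =>
          earE a (.var x) (.var y) (.var L)) N τ ↔
          ∃ L < N, ∃ x < N, ∃ y < N, Ok.EarUpTo N n G τ x y L := by
        rw [PTerm.val_def, tr_exE]
        refine exists_congr fun L => and_congr_right fun hL => ?_
        simp only [tr_exE]
        refine exists_congr fun x => and_congr_right fun _ => exists_congr fun y =>
          and_congr_right fun _ => ?_
        rw [hτ.tr_earE (by simp only [eval]; exact hL.le)]
        simp only [eval]
      have t3 : 0 < PTerm.val (fun _ _ a => exE fun L => exE fun x => exE fun y =>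
          cycE a (.var x) (.var y) (.var L)) N τ ↔
          ∃ L < N, ∃ x < N, ∃ y < N, Ok.CycUpTo n G τ x y L := by
        rw [PTerm.val_def, tr_exE]
        refine exists_congr fun L => and_congr_right fun hL => ?_
        simp only [tr_exE]
        refine exists_congr fun x => and_congr_right fun _ => exists_congr fun y =>
          and_congr_right fun _ => ?_
        rw [hτ.tr_cycE (by simp only [eval]; exact hL.le)]
        simp only [eval]
      by_cases hW : Wl (supp N (τ 3)) (τ 5) (τ 6 0) = ∅
      · by_cases hc : ∃ L < N, ∃ x < N, ∃ y < N, Ok.CycUpTo n G τ x y L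
        · obtain ⟨c, τ', hE, hc1, hok, hk, hse, x, y, l, p, hm, h3, h4⟩ := addCycle_exec hτ hc
          have hi : Inv G n (supp N (τ' 3)) (supp N (τ' 4)) (τ' 5) (τ' 6 0) := by
            rw [h3, h4, hk 5 (by simp), hk 6 (by simp)]
            exact hs.inv.start hW hm
          have hlt : (supp N (τ 3)).card < (supp N (τ' 3)).card := by
            rw [h3]
            refine Finset.card_lt_card ⟨Finset.subset_union_left, fun hsub => ?_⟩
            have h5 : x ∈ supp N (τ 3) := hsub (Finset.mem_union_right _ (by simp [MinCycle.verts]))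
            have h6 : x ∈ Wl (supp N (τ 3)) (τ 5) (τ 6 0) :=
              mem_Wl.2 ⟨h5, hs.inv.lev_of_mem hm.x_mem⟩
            simp [hW] at h6
          obtain ⟨g1, g2⟩ := hgrow τ' hse hk hi hok hlt
          refine ⟨_, τ', .ite_false (by rw [t1]; exact not_not.2 hW) (.ite_true (t3.2 hc) hE), ?_, g1, g2⟩
          have h5 := hm.card_le
          have h6 := Finset.card_union_le (supp N (τ 4))
            (if l < 3 then MinCycle.verts x y l p else {x})
          rw [← h4] at h6
          have := hpow (supp N (τ' 4)).card (by omega)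
          omega
        · refine ⟨_, _, .ite_false (by rw [t1]; exact not_not.2 hW)
            (.ite_false (fun h0 => hc (t3.1 h0)) (.fill 7 _ τ)), by omega, ⟨hτ.set (by omega) _, ?_⟩, ?_⟩
          · right; left
            refine ⟨by rw [St.set_eq hτ.pos, PFun.val_def, eval], ⟨⟨?_, ?_, ?_⟩, ?_, ?_⟩⟩
            all_goals simp only [St.set_ne (show (3 : ℕ) ≠ 7 by omega),
              St.set_ne (show (4 : ℕ) ≠ 7 by omega), St.set_ne (show (5 : ℕ) ≠ 7 by omega),
              St.set_ne (show (6 : ℕ) ≠ 7 by omega)]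
            · exact hs.inv
            · exact hs.branch_le
            · exact hs.stages_le
            · exact hW
            · exact hτ.noCycle hc
          · have : ∀ F : ℕ → ℕ, F 0 = 1 → μ (τ.set N 7 F) = 0 := by
              intro F hF
              simp only [μ]
              rw [if_neg (by rw [St.set_eq hτ.pos, hF]; omega)]
            rw [this _ (by rw [PFun.val_def, eval]), hμ]
            split_ifs; all_goals omega
      · by_cases he : ∃ L < N, ∃ x < N, ∃ y < N, Ok.EarUpTo N n G τ x y L
        · obtain ⟨c, τ', hE, hc1, hok, hk, hse, x, y, l, p, hm, h3, h4⟩ := addEar_exec hτ he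
          have hi : Inv G n (supp N (τ' 3)) (supp N (τ' 4)) (τ' 5) (τ' 6 0) := by
            rw [h3, h4, hk 5 (by simp), hk 6 (by simp)]
            exact hs.inv.ear hm
          have hlt : (supp N (τ 3)).card < (supp N (τ' 3)).card := by
            rw [h3]
            refine Finset.card_lt_card ⟨Finset.subset_union_left, fun hsub => ?_⟩
            have h5 : p 1 ∈ supp N (τ 3) := hsub (Finset.mem_union_right _
              (mem_inner.2 ⟨1, le_rfl, hm.link.pos, rfl⟩))
            have h6 := hm.free le_rfl hm.link.pos
            exact h6.2.1 (mem_Wl.2 ⟨h5, hs.inv.lev_of_mem h6.1⟩)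
          obtain ⟨g1, g2⟩ := hgrow τ' hse hk hi hok hlt
          refine ⟨_, τ', .ite_true (t1.2 hW) (.ite_true (t2.2 he) hE), ?_, g1, g2⟩
          have hmem : ∀ z, z ∈ Wl (supp N (τ 3)) (τ 5) (τ 6 0) →
              z ∈ Wl (supp N (τ' 3)) (τ' 5) (τ' 6 0) := by
            intro z hz
            rw [h3, hk 5 (by simp), hk 6 (by simp)]
            exact mem_Wl.2 ⟨Finset.mem_union_left _ (mem_Wl.1 hz).1, (mem_Wl.1 hz).2⟩
          have h5 := hi.ball_card (hmem x hm.ends.x_mem)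
          have h5' := hi.ball_card (hmem y hm.ends.y_mem)
          rw [h3, hk 5 (by simp), hk 6 (by simp)] at h5 h5'
          have h6 := Finset.card_union_le (supp N (τ 4))
            (ball2 G (Wl (supp N (τ 3) ∪ inner l p) (τ 5) (τ 6 0)) x ∪
            ball2 G (Wl (supp N (τ 3) ∪ inner l p) (τ 5) (τ 6 0)) y)
          have h8 := Finset.card_union_le (ball2 G (Wl (supp N (τ 3) ∪ inner l p) (τ 5) (τ 6 0)) x)
            (ball2 G (Wl (supp N (τ 3) ∪ inner l p) (τ 5) (τ 6 0)) y)
          rw [← h4] at h6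
          have := hpow (supp N (τ' 4)).card (by omega)
          omega
        · obtain ⟨τ', hE, hok, hk, h6, hl⟩ := finishStage_exec hτ
          obtain ⟨hi, he'⟩ := hs.inv.finish hW (hτ.noEar he) hl
          refine ⟨_, τ', .ite_true (t1.2 hW) (.ite_false (fun h0 => he (t2.1 h0)) hE), by omega,
            ⟨hok, .inl ⟨?_, ?_, ?_, ?_⟩⟩, ?_⟩
          · rw [hk 7 (by simp)]; exact ht
          · rw [hk 3 (by simp), hk 4 (by simp), h6]; exact hi
          · rw [hk 3 (by simp)]; exact hs.branch_le
          · rw [hk 3 (by simp), h6, numStages, if_pos he']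
            have := hs.stages_le
            rw [numStages, if_neg hW] at this
            omega
          · rw [hμ]
            simp only [μ]
            rw [hk 7 (by simp), if_pos ht, hk 3 (by simp), h6, if_pos he', if_neg hW]
            omega) σ ⟨h, .inl ⟨h7, hst⟩⟩
  rw [htest] at h3
  refine ⟨c, σ', hE, ?_, h1, h2.resolve_left fun h4 => h3 h4.1⟩
  have : μ σ ≤ 3 * n + 5 := by simp only [μ]; split_ifs <;> omega
  exact hc.trans (Nat.add_le_add_right (Nat.mul_le_mul_right _ this) 1)

end InducedErdosPosa

/-! ### Execution of the second phase. -/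

namespace InducedErdosPosa

open InducedErdosPosa.Expr

variable {N n k : ℕ} {G : SimpleGraph ℕ} {σ : St}

/-- The set in array `4` and its neighbours meet all cycles. -/
structure Solved (N n k H : ℕ) (G : SimpleGraph ℕ) (σ : St) : Prop where
  card : (supp N (σ 4)).card = 0 ∨ 2 ≤ k ∧ (supp N (σ 4)).card + 43 ≤ 52 * H + 30 * k
  sub : supp N (σ 4) ⊆ Finset.range n
  no_thick : ∀ M ⊆ Finset.range n, M.Nonempty →
    (∀ v ∈ M, v ∉ supp N (σ 4) ∧ ∀ x ∈ supp N (σ 4), ¬ G.Adj v x) → ¬ Thick G M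

lemma Pack.mono {m : ℕ} {Y : Finset ℕ} (h : Pack G m Y) (hk : k ≤ m) : Pack G k Y :=
  ⟨h.reg, hk.trans h.card⟩

/-- A choice of a hanging pair in the last possible stage, and of a cycle for it. -/
lemma hang_exec (h : Ok N n k G σ) (hex : ∃ z y, Ok.HangAt N n G σ z y) :
    ∃ σ', Exec N Code.hangStep σ 4 σ' ∧ Ok N n k G σ' ∧ Keep [11, 12, 13] σ σ' ∧
      ∃ y, Ok.HangAt N n G σ (σ' 11 0) y ∧
      (∀ z' y', Ok.HangAt N n G σ z' y' → σ 5 z' ≤ σ 5 (σ' 11 0)) ∧ IsCyc G (supp N (σ' 13)) ∧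
      ↑(supp N (σ' 13)) ⊆ Blob G (Vl n (σ 5) (σ 5 (σ' 11 0)))
        (Wl (supp N (σ 3)) (σ 5) (σ 5 (σ' 11 0))) (supp N (σ 4)) (σ' 11 0) y := by
  classical
  have hlt : ∀ {z y}, Ok.HangAt N n G σ z y → z ∈ supp N (σ 3) ∧ y ∈ supp N (σ 3) ∧ z < N ∧ y < N :=
    fun hh => ⟨(mem_Wl.1 hh.z_mem).1, (mem_Wl.1 hh.y_mem).1, (mem_supp.1 (mem_Wl.1 hh.z_mem).1).1,
      (mem_supp.1 (mem_Wl.1 hh.y_mem).1).1⟩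
  set F1 : ℕ → ℕ := PFun.val (fun _ _ a _ => muE fun z => exE fun y =>
    andE (hangE a (.var z) (.var y)) (allE fun z' => allE fun y' =>
      orE (notE (hangE a (.var z') (.var y')))
        (leE (.read (a 5) (.var z')) (.read (a 5) (.var z))))) N σ with hF1
  have hz : ∃ y, Ok.HangAt N n G σ (F1 0) y ∧
      ∀ z' y', Ok.HangAt N n G σ z' y' → σ 5 z' ≤ σ 5 (F1 0) := by
    have hiff : ∀ z, 0 < (exE fun y => andE (hangE σ (.var z) (.var y)) (allE fun z' => allE fun y' =>
        orE (notE (hangE σ (.var z') (.var y')))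
          (leE (.read (σ 5) (.var z')) (.read (σ 5) (.var z)))) : Expr ℕ (ℕ → ℕ)).eval N ↔
        ∃ y, Ok.HangAt N n G σ z y ∧ ∀ z' y', Ok.HangAt N n G σ z' y' → σ 5 z' ≤ σ 5 z := by
      intro z
      simp only [tr_exE, tr_andE, h.tr_hangE, tr_allE, tr_orE, tr_notE, tr_leE, eval]
      constructor
      · rintro ⟨y, -, h1, h2⟩
        refine ⟨y, h1, fun z' y' h3 => ?_⟩
        obtain ⟨-, -, h4, h5⟩ := hlt h3
        exact (h2 z' h4 y' h5).resolve_left (fun h6 => h6 h3)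
      · rintro ⟨y, h1, h2⟩
        refine ⟨y, (hlt h1).2.2.2, h1, fun z' _ y' _ => ?_⟩
        by_cases h3 : Ok.HangAt N n G σ z' y'
        · exact .inr (h2 z' y' h3)
        · exact .inl h3
    refine (hiff _).1 (eval_muE (N := N) (f := fun z => exE fun y =>
      andE (hangE σ (.var z) (.var y)) (allE fun z' => allE fun y' =>
      orE (notE (hangE σ (.var z') (.var y')))
        (leE (.read (σ 5) (.var z')) (.read (σ 5) (.var z))))) ?_).2.1
    obtain ⟨z, hz, hm⟩ := Finset.exists_max_image
      ((Finset.range N).filter fun z => ∃ y, Ok.HangAt N n G σ z y) (σ 5) (by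
        obtain ⟨z, y, hzy⟩ := hex
        exact ⟨z, by simp only [Finset.mem_filter, Finset.mem_range]; exact ⟨(hlt hzy).2.2.1, y, hzy⟩⟩)
    simp only [Finset.mem_filter, Finset.mem_range] at hz hm
    obtain ⟨h1, y, h2⟩ := hz
    exact ⟨z, h1, (hiff z).2 ⟨y, h2, fun z' y' h3 => hm z' ⟨(hlt h3).2.2.1, y', h3⟩⟩⟩
  obtain ⟨y₀, hy₀, hmax⟩ := hz
  set σ1 := σ.set N 11 F1 with hσ1
  have h1 : Ok N n k G σ1 := h.set (by omega) _
  have e1 : Keep [11, 12, 13] σ σ1 := (Keep.refl.set 11 _).mono (by simp)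
  have g1 : σ1 11 0 = F1 0 := St.set_eq h.pos
  have hang1 : ∀ τ, Keep [11, 12, 13] σ τ → ∀ z y, Ok.HangAt N n G τ z y ↔ Ok.HangAt N n G σ z y := by
    intro τ hk z y
    simp only [Ok.HangAt, hk 3 (by simp), hk 4 (by simp), hk 5 (by simp)]
  set F2 : ℕ → ℕ := PFun.val (fun _ _ a _ => muE fun y => hangE a (getE a 11) (.var y)) N σ1 with hF2
  have hy : Ok.HangAt N n G σ (F1 0) (F2 0) := by
    have hiff : ∀ y, 0 < (hangE σ1 (getE σ1 11) (.var y) : Expr ℕ (ℕ → ℕ)).eval N ↔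
        Ok.HangAt N n G σ (F1 0) y := by
      intro y
      rw [h1.tr_hangE, hang1 σ1 e1]
      simp only [getE, eval, g1]
    exact (hiff _).1 (eval_muE (N := N) (f := fun y => hangE σ1 (getE σ1 11) (.var y))
      ⟨y₀, (hlt hy₀).2.2.2, (hiff y₀).2 hy₀⟩).2.1
  set σ2 := σ1.set N 12 F2 with hσ2
  have h2 : Ok N n k G σ2 := h1.set (by omega) _
  have e2 : Keep [11, 12, 13] σ σ2 := (e1.set 12 _).mono (by simp)
  have g2 : σ2 11 0 = F1 0 := by rw [hσ2, St.set_ne (by omega), g1]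
  have g2' : σ2 12 0 = F2 0 := St.set_eq h.pos
  set σ3 := σ2.set N 13 (PFun.val (fun _ _ a v => compE a (fun u => sideE a (getE a 11) (getE a 12)
    (.var u)) (getE a 11) fun B => .read B (.var v)) N σ2) with hσ3
  have h3 : Ok N n k G σ3 := h2.set (by omega) _
  have e3 : Keep [11, 12, 13] σ σ3 := (e2.set 13 _).mono (by simp)
  have g3 : σ3 11 0 = F1 0 := by rw [hσ3, St.set_ne (by omega), g2]
  have hB : (↑(supp N (σ3 13)) : Set ℕ) = Blob G (Vl n (σ 5) (σ 5 (F1 0)))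
      (Wl (supp N (σ 3)) (σ 5) (σ 5 (F1 0))) (supp N (σ 4)) (F1 0) (F2 0) := by
    rw [hσ3, St.supp_set]
    ext v
    obtain ⟨B, hB, he⟩ := h2.supp_blob (z := getE σ2 11) (y := getE σ2 12)
      (by simp only [getE, eval, g2, e2 3 (by simp)]; exact (hlt hy).1)
      (by simp only [getE, eval, g2', e2 3 (by simp)]; exact (hlt hy).2.1) (fun B => .read B (.var v))
    simp only [getE, eval, g2, g2', e2 3 (by simp), e2 4 (by simp), e2 5 (by simp)] at hB
    rw [← hB, Finset.mem_coe, mem_supp, PFun.val_def, he, Finset.mem_coe, mem_supp]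
    simp only [eval]
  obtain ⟨B, hB1, hB2, hB3, hB4⟩ := supp_greedyE (N := N) (S := fun u => inE σ3 13 (.var u))
    (P := fun S => hasCoreE σ3 S) (Q := fun T => (core G T).Nonempty) (fun T => h3.tr_hasCoreE T)
    (fun T T' hT hne => hne.mono (core_mono hT)) (by
      rw [h3.ext_inE (show 1 ≤ 13 by omega)]
      obtain ⟨M, hM, hne, ht⟩ := hy.cyc
      rw [← hB, Finset.coe_subset] at hM
      exact core_nonempty.2 ⟨M, hM, hne, ht⟩)
  rw [h3.ext_inE (show 1 ≤ 13 by omega)] at hB1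
  set σ4 := σ3.set N 13 (PFun.val (fun _ _ a v => greedyE (fun u => inE a 13 (.var u))
    (fun S => hasCoreE a S) fun B => .read B (.var v)) N σ3) with hσ4
  have g4 : σ4 11 0 = F1 0 := by rw [hσ4, St.set_ne (by omega), g3]
  have h13 : supp N (σ4 13) = supp N B := by
    rw [hσ4, St.supp_set]
    ext v
    simp only [mem_supp, PFun.val_def]
    rw [hB4]
    simp only [eval]
  refine ⟨σ4, .seq (.fill 11 _ σ) (.seq (.fill 12 _ σ1) (.seq (.fill 13 _ σ2) (.fill 13 _ σ3))),
    h3.set (by omega) _, (e3.set 13 _).mono (by simp), F2 0, ?_, ?_, ?_, ?_⟩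
  · rw [g4]; exact hy
  · rw [g4]; exact hmax
  · rw [h13]; exact isCyc_of_core hB2 hB3
  · rw [h13, g4, ← hB, Finset.coe_subset]; exact hB1

/-- The second phase ends with a packing or a solution. -/
lemma phase2_exec {H : ℕ} (h : Ok N n k G σ) (hc : Complete N n k H G σ) :
    ∃ c σ', Exec N Code.phase2 σ c σ' ∧ c ≤ 7 * n + 2 ∧ Ok N n k G σ' ∧
      (Pack G k (supp N (σ' 14)) ∨ Solved N n k H G σ') := by
  classical
  set W := supp N (σ 3) with hW
  set X₀ := supp N (σ 4) with hX₀
  set lev := σ 5 with hlev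
  set m := σ 6 0 with hm
  have hfam := hc.inv.fam
  have hemp : Wl W lev m = ∅ := hc.empty
  have hnW : W.card ≤ n := by simpa using Finset.card_le_card hc.inv.sub
  have hlt : ∀ v ∈ W, lev v < m := by
    intro v hv
    refine lt_of_le_of_ne (hc.inv.lev_le' hv) fun e => ?_
    have := mem_Wl.2 ⟨hv, e⟩
    simp [hemp] at this
  -- Each round adds at most 13 vertices to array 4 and either records a cycle in `R` or charges a
  -- new stage in `Φ`.
  let I : St → Prop := fun τ => Ok N n k G τ ∧ Keep [4, 11, 12, 13, 14] σ τ ∧ X₀ ⊆ supp N (τ 4) ∧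
    supp N (τ 4) ⊆ W ∧ ∃ R Φ, Charged G (Vl n lev) (Wl W lev) (Wl X₀ lev) m (supp N (τ 4)) R Φ ∧
      supp N (τ 14) = R.biUnion id ∧ (supp N (τ 4)).card ≤ X₀.card + 13 * (R.card + Φ.card)
  let μ : St → ℕ := fun τ => (W \ supp N (τ 4)).card
  have htest : ∀ τ, I τ → (0 < PTerm.val (fun _ _ a => andE (notE (packE a 14))
      (exE fun z => exE fun y => hangE a (.var z) (.var y))) N τ ↔
      ¬ Pack G k (supp N (τ 14)) ∧ ∃ z y, Ok.HangAt N n G τ z y) := by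
    intro τ hτ
    simp only [PTerm.val_def, tr_andE, tr_notE, hτ.1.tr_packE (show 1 ≤ 14 by omega), tr_exE,
      hτ.1.tr_hangE, eval]
    refine and_congr_right fun _ => ⟨fun ⟨z, _, y, _, hh⟩ => ⟨z, y, hh⟩, fun ⟨z, y, hh⟩ =>
      ⟨z, (mem_supp.1 (mem_Wl.1 hh.z_mem).1).1, y, (mem_supp.1 (mem_Wl.1 hh.y_mem).1).1, hh⟩⟩
  have hat : ∀ τ, I τ → ∀ z y, Ok.HangAt N n G τ z y ↔
      Hang G (Vl n lev (lev z)) (Wl W lev (lev z)) (supp N (τ 4)) z y := by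
    intro τ hτ z y
    simp only [Ok.HangAt, hτ.2.1 3 (by simp), hτ.2.1 5 (by simp), ← hlev, ← hW]
  have hXi : ∀ τ, I τ → ∀ i, Wl X₀ lev i ⊆ supp N (τ 4) := fun τ hτ i =>
    (Finset.filter_subset _ _).trans hτ.2.2.1
  set σ1 := σ.set N 14 (PFun.val (fun _ _ _ _ => .num 0) N σ) with hσ1
  have hI1 : I σ1 := by
    have h4 : supp N (σ1 4) = X₀ := by rw [hσ1, St.set_ne (by omega)]
    refine ⟨h.set (by omega) _, (Keep.refl.set 14 _).mono (by simp), h4.ge, h4 ▸ hc.inv.subX, ∅, ∅,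
      ⟨by simp, by simp, by simp, by simp⟩, ?_, by simp [h4]⟩
    rw [hσ1, St.supp_set]
    ext v
    simp [PFun.val_def]
  obtain ⟨c, σ', hE, hcc, hI', hexit⟩ := Exec.while_measure (N := N)
    (e := fun _ _ a => andE (notE (packE a 14)) (exE fun z => exE fun y => hangE a (.var z) (.var y)))
    (P := .seq Code.hangStep
    (.seq (.fill 14 fun _ _ a v => orE (inE a 14 (.var v)) (andE (inE a 13 (.var v))
        (allE fun u => allE fun w => orE (notE (andE (inE a 13 (.var u)) (inE a 14 (.var w))))
          (andE (notE (eqE (.var u) (.var w))) (notE (adjE a (.var u) (.var w)))))))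
    (.fill 4 fun _ _ a v => orE (inE a 4 (.var v))
      (ball2E a (.read (a 5) (getE a 11)) (getE a 11) (.var v)))))
    I μ 6 (by
      intro τ hτ ht
      rw [htest τ hτ] at ht
      obtain ⟨τ1, hE1, h1, e1, y, hh, hlast, hcyc, hblob⟩ := hang_exec hτ.1 ht.2
      set z := τ1 11 0 with hz
      rw [hat τ hτ] at hh
      rw [hτ.2.1 3 (by simp), hτ.2.1 5 (by simp), ← hlev, ← hW] at hblob
      set D := supp N (τ1 13) with hD
      set X' := supp N (τ 4) with hX'
      have hzW : z ∈ W := (mem_Wl.1 hh.z_mem).1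
      have hlast' : ∀ j < m, ∀ z' y', Hang G (Vl n lev j) (Wl W lev j) X' z' y' → j ≤ lev z := by
        intro j _ z' y' h3
        have h4 := (mem_Wl.1 h3.z_mem).2
        rw [← h4] at h3 ⊢
        have := hlast z' y' ((hat τ hτ z' y').2 h3)
        rwa [hτ.2.1 5 (by simp)] at this
      obtain ⟨hok, hkeep, hsub, hsubW, R, Φ, hch, hR, hcard⟩ := id hτ
      rw [← hX'] at hcard
      set τ2 := τ1.set N 14 (PFun.val (fun _ _ a v => orE (inE a 14 (.var v)) (andE (inE a 13 (.var v))
        (allE fun u => allE fun w => orE (notE (andE (inE a 13 (.var u)) (inE a 14 (.var w))))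
          (andE (notE (eqE (.var u) (.var w))) (notE (adjE a (.var u) (.var w))))))) N τ1) with hτ2
      have h2 : Ok N n k G τ2 := h1.set (by omega) _
      have e2 : Keep [11, 12, 13, 14] τ τ2 := (e1.set 14 _).mono (by simp)
      have h14 : supp N (τ2 14) = if ∀ d ∈ D, ∀ w ∈ R.biUnion id, d ≠ w ∧ ¬ G.Adj d w then
          R.biUnion id ∪ D else R.biUnion id := by
        have hiff : 0 < (allE fun u => allE fun w =>
            orE (notE (andE (inE τ1 13 (.var u)) (inE τ1 14 (.var w))))
            (andE (notE (eqE (.var u) (.var w))) (notE (adjE τ1 (.var u) (.var w)))) :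
            Expr ℕ (ℕ → ℕ)).eval N ↔ ∀ d ∈ D, ∀ w ∈ R.biUnion id, d ≠ w ∧ ¬ G.Adj d w := by
          simp only [tr_allE, tr_orE, tr_notE, tr_andE, h1.tr_inE (show 1 ≤ 13 by omega),
            h1.tr_inE (show 1 ≤ 14 by omega), tr_eqE, h1.tr_adjE, eval, e1 14 (by simp), hR]
          constructor
          · intro h3 d hd w hw
            refine (h3 d (mem_supp.1 hd).1 w ?_).resolve_left (fun h4 => h4 ⟨hd, hw⟩)
            rw [← hR] at hw
            exact (mem_supp.1 hw).1
          · intro h3 d _ w _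
            by_cases h4 : d ∈ D ∧ w ∈ R.biUnion id
            · exact .inr (h3 d h4.1 w h4.2)
            · exact .inl h4
        rw [hτ2, St.supp_set]
        ext v
        rw [mem_supp, PFun.val_def, tr_orE, tr_andE, hiff, h1.tr_inE (show 1 ≤ 13 by omega),
          h1.tr_inE (show 1 ≤ 14 by omega), e1 14 (by simp), hR, eval]
        have hvR : v ∈ R.biUnion id → v < N := fun hv => by
          rw [← hR] at hv; exact (mem_supp.1 hv).1
        have hvD : v ∈ D → v < N := fun hv => (mem_supp.1 hv).1
        split_ifs with h3
        · rw [Finset.mem_union]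
          exact ⟨fun h4 => h4.2.imp id And.left, fun h4 => ⟨h4.elim hvR hvD, h4.imp id fun h5 => ⟨h5, h3⟩⟩⟩
        · exact ⟨fun h4 => h4.2.resolve_right fun h5 => h3 h5.2, fun h4 => ⟨hvR h4, .inl h4⟩⟩
      set τ3 := τ2.set N 4 (PFun.val (fun _ _ a v => orE (inE a 4 (.var v))
        (ball2E a (.read (a 5) (getE a 11)) (getE a 11) (.var v))) N τ2) with hτ3
      have hz2 : τ2 11 0 = z := by rw [hτ2, St.set_ne (by omega)]
      have hballW : ball2 G (Wl W lev (lev z)) z ⊆ W := by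
        intro v hv
        rcases mem_ball2.1 hv with rfl | ⟨h5, -⟩ | ⟨w, -, -, h5, -⟩
        · exact hzW
        · exact (mem_Wl.1 h5).1
        · exact (mem_Wl.1 h5).1
      have h4 : supp N (τ3 4) = X' ∪ ball2 G (Wl W lev (lev z)) z := by
        rw [hτ3, St.supp_set]
        ext v
        rw [mem_supp, PFun.val_def]
        simp only [tr_orE, h2.tr_inE (show 1 ≤ 4 by omega), h2.tr_ball2E, getE, eval, hz2,
          e2 3 (by simp), e2 4 (by simp), e2 5 (by simp), hkeep 3 (by simp), hkeep 5 (by simp),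
          ← hlev, ← hW, Finset.mem_union]
        refine ⟨fun hv => hv.2, fun hv => ⟨?_, hv⟩⟩
        rcases hv with hv | hv
        · exact (mem_supp.1 hv).1
        · exact (mem_supp.1 (hballW hv)).1
      have h14' : supp N (τ3 14) = supp N (τ2 14) := by rw [hτ3, St.set_ne (by omega)]
      have hb13 : (ball2 G (Wl W lev (lev z)) z).card ≤ 13 := hc.inv.ball_card hh.z_mem
      have hcu := Finset.card_union_le X' (ball2 G (Wl W lev (lev z)) z)
      refine ⟨_, τ3, .seq hE1 (.seq (.fill 14 _ τ1) (.fill 4 _ τ2)), by omega, ⟨h2.set (by omega) _,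
        (hkeep.trans (e2.set 4 _)).mono (by simp), ?_, ?_, ?_⟩, ?_⟩
      · rw [h4]; exact hsub.trans Finset.subset_union_left
      · rw [h4]; exact Finset.union_subset hsubW hballW
      · by_cases hfar : ∀ d ∈ D, ∀ w ∈ R.biUnion id, d ≠ w ∧ ¬ G.Adj d w
        · refine ⟨insert D R, Φ, ?_, ?_, ?_⟩
          · rw [h4]
            exact hch.record (hXi τ hτ _) (hlt z hzW) hh hlast' hcyc hblob fun D' hD' d hd d' hd' =>
              hfar d hd d' (Finset.mem_biUnion.2 ⟨D', hD', hd'⟩)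
          · rw [h14', h14, if_pos hfar, Finset.biUnion_insert, Finset.union_comm]
            rfl
          · have hDR : D ∉ R := by
              intro hDR
              obtain ⟨d, hd⟩ := hcyc.ne
              exact (hfar d hd d (Finset.mem_biUnion.2 ⟨D, hDR, hd⟩)).1 rfl
            rw [h4, Finset.card_insert_of_notMem hDR]
            omega
        · have hfar' := hfar
          push Not at hfar'
          obtain ⟨d, hd, w, hw, hdw⟩ := hfar'
          obtain ⟨D', hD', hw'⟩ := Finset.mem_biUnion.1 hw
          obtain ⟨l, hl, hch'⟩ := hch.charge hfam (hXi τ hτ _) (hlt z hzW) hh hlast'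
            (hblob (by exact_mod_cast hd)) hD' hw' (by
              by_cases e : d = w
              · exact .inl e
              · exact .inr (hdw e))
          refine ⟨R, insert l Φ, ?_, ?_, ?_⟩
          · rw [h4]; exact hch'
          · rw [h14', h14, if_neg hfar]
          · rw [h4, Finset.card_insert_of_notMem hl]
            omega
      · refine Finset.card_lt_card ⟨?_, fun hs => ?_⟩
        · rw [h4]
          exact Finset.sdiff_subset_sdiff subset_rfl Finset.subset_union_left
        · have h5 : z ∈ W \ X' := Finset.mem_sdiff.2 ⟨hzW, hh.z_not⟩
          have h6 := (Finset.mem_sdiff.1 (hs h5)).2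
          rw [h4] at h6
          exact h6 (Finset.mem_union_right _ (mem_ball2.2 (.inl rfl))))
    σ1 hI1
  rw [htest σ' hI'] at hexit
  obtain ⟨hok, hkeep, hsub, hsubW, R, Φ, hch, hR, hcard⟩ := id hI'
  refine ⟨_, σ', .seq (.fill 14 _ σ) hE, ?_, hok, ?_⟩
  · have : μ σ1 ≤ n := (Finset.card_le_card Finset.sdiff_subset).trans hnW
    omega
  · by_cases hp : Pack G k (supp N (σ' 14))
    · exact .inl hp
    right
    have hno : ∀ z y, ¬ Ok.HangAt N n G σ' z y := fun z y hh => hexit ⟨hp, z, y, hh⟩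
    refine ⟨?_, hsubW.trans hc.inv.sub, fun M hM hne hMX ht => ?_⟩
    -- Without a packing there are at most `k - 1` recorded cycles and at most `m - 1` charges,
    -- where `m ≤ k - 1`. For `m ≥ 1` the size is at most `52 H + 4 m + 13 ((k - 1) + (m - 1)) ≤ 52
    -- H + 30 k - 43`. For `m = 0` the set `W` is empty, and array 4 with it.
    · have hRk : R.card < k := by
        by_contra hge
        exact hp (hR ▸ (pack_of_far hch.rec_cyc hch.rec_far).mono (not_lt.1 hge))
      have h1 := hch.card_le
      have h2 := hc.inv.card_le
      have h3 := hc.branch_le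
      have h4 := hc.stages_le
      have h5 : numStages W lev m = m := by rw [numStages, if_pos hemp, Nat.add_zero]
      rw [← hW] at h3
      rw [← hW, ← hlev, ← hm, h5] at h4
      rw [← hW, ← hlev, ← hm, ← hX₀, h5] at h2
      rcases Nat.eq_zero_or_pos m with h0 | h0
      · left
        have : W = ∅ := Finset.eq_empty_of_forall_notMem fun v hv => by
          have := hlt v hv; omega
        rw [this, Finset.subset_empty] at hsubW
        rw [hsubW, Finset.card_empty]
      · right
        omega
    · refine hfam.no_thick (fun i _ => hXi σ' hI' i) (fun i _ z y hh => ?_) hc.no_cycle (M := M)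
        (fun v hv => ?_) ht hne hMX
      · have h4 := (mem_Wl.1 hh.z_mem).2
        rw [← h4] at hh
        exact hno z y ((hat σ' hI' z y).2 hh)
      · exact mem_Vl.2 ⟨by simpa using hM hv, Nat.zero_le _⟩

end InducedErdosPosa

/-! ### Writing the output. -/

namespace InducedErdosPosa

open InducedErdosPosa.Expr

section
variable {G : SimpleGraph ℕ}

/-- The traversal that always proceeds to the least possible vertex. -/
lemma TwoReg.exists_least_isTrav {Y : Finset ℕ} (hY : TwoReg G Y) {v : ℕ} (hv : v ∈ Y) :
    ∃ c, IsTrav G Y c ∧ c 0 = v ∧ (∀ u ∈ nb G Y v, c 1 ≤ u) ∧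
      ∀ t, ∀ u ∈ nb G Y (c (t + 1)), u ≠ c t → c (t + 2) ≤ u := by
  classical
  have hstep : ∀ a : ℕ, ∀ b : Y, ∃ u : Y, u.1 ∈ nb G Y b.1 ∧ u.1 ≠ a ∧
      ∀ u' ∈ nb G Y b.1, u' ≠ a → u.1 ≤ u' := by
    intro a b
    have hex : ∃ u, u ∈ nb G Y b.1 ∧ u ≠ a := by
      by_contra! hcon
      have : nb G Y b.1 ⊆ {a} := fun u hu => by simpa using hcon u hu
      have := Finset.card_le_card this
      rw [hY b.1 b.2, Finset.card_singleton] at this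
      omega
    obtain ⟨h1, h2⟩ := Nat.find_spec hex
    exact ⟨⟨Nat.find hex, (mem_nb.1 h1).1⟩, h1, h2, fun u' h3 h4 => Nat.find_min' hex ⟨h3, h4⟩⟩
  choose f hf hf' hf'' using hstep
  let s : ℕ → Y × Y := fun t => Nat.rec (⟨v, hv⟩, f v ⟨v, hv⟩) (fun _ p => (p.2, f p.1.1 p.2)) t
  have hs1 : ∀ t, (s (t + 1)).1 = (s t).2 := fun t => rfl
  have hs2 : ∀ t, (s (t + 1)).2 = f (s t).1.1 (s t).2 := fun t => rfl
  have hadj : ∀ t, (s t).2.1 ∈ nb G Y (s t).1.1 := by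
    intro t
    cases t with
    | zero => exact hf v ⟨v, hv⟩
    | succ t => rw [hs2, hs1]; exact hf _ _
  refine ⟨fun t => (s t).1.1, ⟨fun t => (s t).1.2, fun t => ?_, fun t => ?_⟩, rfl, fun u hu => ?_,
    fun t u hu hne => ?_⟩
  · show G.Adj _ (s (t + 1)).1.1
    rw [hs1]; exact (mem_nb.1 (hadj t)).2
  · show (s (t + 1 + 1)).1.1 ≠ _
    rw [hs1 (t + 1), hs2]; exact hf' _ _
  · exact hf'' v ⟨v, hv⟩ u hu (mem_nb.1 hu).2.ne'
  · show (s (t + 1 + 1)).1.1 ≤ _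
    rw [hs1 (t + 1), hs2]
    refine hf'' _ _ u ?_ hne
    rw [← hs1]; exact hu

/-- The list `l` runs around the cycle in `G[Y]` with the `i`-th smallest least vertex. -/
def RankCycle (G : SimpleGraph ℕ) (Y : Finset ℕ) (i : ℕ) (l : List ℕ) : Prop :=
  ∃ v ∈ mins G Y, ((mins G Y).filter (· < v)).card = i ∧ ∃ c L, IsTrav G Y c ∧ c 0 = v ∧ 3 ≤ L ∧
    c L = c 0 ∧ (∀ i < L, ∀ j < L, c i = c j → i = j) ∧ l = (List.range (L + 1)).map c

/-- Equal or adjacent vertices lie in one component of `G[Y]`, and that has a single least vertex.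
This gives both the disjointness of the cycles and the absence of edges between them. -/
lemma RankCycle.eq_of_adj {Y : Finset ℕ} {i j : ℕ} {l l' : List ℕ} (h : RankCycle G Y i l)
    (h' : RankCycle G Y j l') {u u' : ℕ} (hu : u ∈ l) (hu' : u' ∈ l') (ha : u = u' ∨ G.Adj u u') :
    i = j := by
  obtain ⟨v, hv, rfl, c, L, hc, rfl, -, -, -, rfl⟩ := h
  obtain ⟨v', hv', rfl, c', L', hc', rfl, -, -, -, rfl⟩ := h'
  simp only [List.mem_map] at hu hu'
  obtain ⟨t, -, rfl⟩ := hu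
  obtain ⟨t', -, rfl⟩ := hu'
  have hr : Reach G ↑Y (c 0) (c' 0) := by
    refine (hc.reach t).trans (Reach.trans ?_ (hc'.reach t').symm)
    rcases ha with e | ha
    · rw [e]; exact .refl
    · exact Reach.single (hc.mem t) (hc'.mem t') ha
  rw [mins_eq hv hv' hr]

lemma RankCycle.mem {Y : Finset ℕ} {i : ℕ} {l : List ℕ} (h : RankCycle G Y i l) {u : ℕ}
    (hu : u ∈ l) : u ∈ Y := by
  obtain ⟨v, hv, rfl, c, L, hc, rfl, -, -, -, rfl⟩ := h
  simp only [List.mem_map] at hu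
  obtain ⟨t, -, rfl⟩ := hu
  exact hc.mem t

lemma RankCycle.length_le {Y : Finset ℕ} {i : ℕ} {l : List ℕ} (h : RankCycle G Y i l) :
    l.length ≤ l.toFinset.card + 1 := by
  obtain ⟨v, hv, rfl, c, L, hc, rfl, -, h0, hinj, rfl⟩ := h
  have h1 : (Finset.range L).image c ⊆ ((List.range (L + 1)).map c).toFinset := by
    intro u hu
    simp only [Finset.mem_image, Finset.mem_range, List.mem_toFinset, List.mem_map,
      List.mem_range] at hu ⊢
    obtain ⟨t, ht, rfl⟩ := hu
    exact ⟨t, by omega, rfl⟩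
  have h2 := Finset.card_le_card h1
  rw [Finset.card_image_of_injOn (by
    intro i hi j hj e
    exact hinj i (by simpa using hi) j (by simpa using hj) e), Finset.card_range] at h2
  simpa using h2

/-- The lists are disjoint as sets. Each repeats one vertex and takes one more cell for its length,
hence the `2 * j`. This determines how long the arrays must be. -/
lemma sum_length_le {Y : Finset ℕ} {j : ℕ} {l : ℕ → List ℕ} (h : ∀ i < j, RankCycle G Y i (l i)) :
    ∑ i ∈ Finset.range j, ((l i).length + 1) ≤ Y.card + 2 * j := by
  have h1 : ∑ i ∈ Finset.range j, ((l i).length + 1) ≤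
      ∑ i ∈ Finset.range j, ((l i).toFinset.card + 2) :=
    Finset.sum_le_sum fun i hi => by
      have := (h i (by simpa using hi)).length_le
      omega
  have h2 : ((Finset.range j).biUnion fun i => (l i).toFinset) ⊆ Y := by
    intro u hu
    simp only [Finset.mem_biUnion, Finset.mem_range, List.mem_toFinset] at hu
    obtain ⟨i, hi, hu⟩ := hu
    exact (h i hi).mem hu
  have h3 := Finset.card_le_card h2
  rw [Finset.card_biUnion (by
    intro i hi i' hi' hne
    rw [Function.onFun, Finset.disjoint_left]
    intro u hu hu'
    exact hne ((h i (by simpa using hi)).eq_of_adj (h i' (by simpa using hi')) (by simpa using hu)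
      (by simpa using hu') (.inl rfl)))] at h3
  have h4 : ∑ i ∈ Finset.range j, ((l i).toFinset.card + 2) =
      ∑ i ∈ Finset.range j, (l i).toFinset.card + j * 2 := by
    rw [Finset.sum_add_distrib, Finset.sum_const, Finset.card_range, smul_eq_mul]
  omega

lemma exists_rank (S : Finset ℕ) {i : ℕ} (hi : i < S.card) :
    ∃ v ∈ S, (S.filter (· < v)).card = i := by
  classical
  induction hn : S.card generalizing S with
  | zero => omega
  | succ m ih =>
    have hne : S.Nonempty := Finset.card_pos.1 (by omega)
    have hm := S.max'_mem hne
    have hc : (S.erase (S.max' hne)).card = m := by rw [Finset.card_erase_of_mem hm]; omega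
    by_cases him : i = m
    · refine ⟨S.max' hne, hm, ?_⟩
      rw [him, ← hc]
      congr 1
      ext u
      simp only [Finset.mem_filter, Finset.mem_erase]
      constructor
      · exact fun h => ⟨h.2.ne, h.1⟩
      · exact fun h => ⟨h.2, lt_of_le_of_ne (S.le_max' u h.2) h.1⟩
    · obtain ⟨v, hv, he⟩ := ih (S.erase (S.max' hne)) (by omega) hc
      refine ⟨v, Finset.mem_of_mem_erase hv, ?_⟩
      rw [← he]
      congr 1
      ext u
      simp only [Finset.mem_filter, Finset.mem_erase]
      have := S.le_max' v (Finset.mem_of_mem_erase hv)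
      constructor
      · exact fun h => ⟨⟨by omega, h.1⟩, h.2⟩
      · exact fun h => ⟨h.1.2, h.2⟩

lemma rank_inj {S : Finset ℕ} {u v : ℕ} (hu : u ∈ S) (hv : v ∈ S)
    (h : (S.filter (· < u)).card = (S.filter (· < v)).card) : u = v := by
  have key : ∀ {u v}, u ∈ S → v ∈ S → u < v → (S.filter (· < u)).card < (S.filter (· < v)).card := by
    intro u v hu hv huv
    refine Finset.card_lt_card ⟨fun w hw => ?_, fun hs => ?_⟩
    · simp only [Finset.mem_filter] at hw ⊢
      exact ⟨hw.1, by omega⟩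
    · have := hs (Finset.mem_filter.2 ⟨hu, huv⟩)
      simp at this
  rcases lt_trichotomy u v with h1 | h1 | h1
  · have := key hu hv h1; omega
  · exact h1
  · have := key hv hu h1; omega

end

variable {N n k : ℕ} {G : SimpleGraph ℕ} {σ : St}

/-- The program for the next cycle. -/
lemma writeCycle_exec (h : Ok N n k G σ) (hN : n + 2 * k + 4 ≤ N) (hp : Pack G k (supp N (σ 9)))
    {j : ℕ} (hj : σ 16 0 = j) (hjk : j < k) {l : ℕ → List ℕ}
    (hl : ∀ i < j, RankCycle G (supp N (σ 9)) i (l i))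
    (hpos : σ 15 0 = 1 + ∑ i ∈ Finset.range j, ((l i).length + 1)) :
    ∃ σ', Exec N Code.writeCycle σ 6 σ' ∧ Ok N n k G σ' ∧
      Keep [1, 10, 11, 15, 16, 17] σ σ' ∧ σ' 16 0 = j + 1 ∧ ∃ w : List ℕ,
        RankCycle G (supp N (σ 9)) j w ∧ σ' 15 0 = σ 15 0 + (w.length + 1) ∧
        (∀ i < σ 15 0, σ' 1 i = σ 1 i) ∧ σ' 1 (σ 15 0) = w.length ∧
        ∀ i, (hi : i < w.length) → σ' 1 (σ 15 0 + 1 + i) = w[i] := by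
  classical
  set Y := supp N (σ 9) with hY
  have hYn : Y.card ≤ n := by
    have : Y ⊆ Finset.range n := by
      intro v hv
      obtain ⟨u, hu⟩ := Finset.card_pos.1 (show 0 < (nb G Y v).card by rw [hp.reg v hv]; omega)
      exact Finset.mem_range.2 (h.holds.lt _ _ (mem_nb.1 hu).2)
    simpa using Finset.card_le_card this
  obtain ⟨v, hv, hvj⟩ := exists_rank (mins G Y) (hjk.trans_le hp.card)
  have hvY : v ∈ Y := (mem_mins.1 hv).1
  have hvN : v < N := (mem_supp.1 hvY).1
  obtain ⟨c, hc, rfl, hc1, hc2⟩ := hp.reg.exists_least_isTrav hvY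
  obtain ⟨L, hL3, hLY, hL0, hinj⟩ := hc.period hp.reg
  have hcN : ∀ t, c t < N := fun t => (mem_supp.1 (hc.mem t)).1
  set w := (List.range (L + 1)).map c with hw
  have hwl : w.length = L + 1 := by simp [hw]
  have hrank : RankCycle G Y j w := ⟨c 0, hv, hvj, c, L, hc, rfl, hL3, hL0, hinj, rfl⟩
  -- The estimate is applied to the lists written so far together with the new one, so the new
  -- entries stay below `N`.
  have hbound : σ 15 0 + (L + 2) ≤ N := by
    have := sum_length_le (G := G) (Y := Y) (j := j + 1) (l := Function.update l j w) (by
      intro i hi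
      by_cases hij : i = j
      · subst hij; rw [Function.update_self]; exact hrank
      · rw [Function.update_of_ne hij]; exact hl i (by omega))
    rw [Finset.sum_range_succ, Function.update_self, hwl, Finset.sum_congr rfl (fun i hi => by
      rw [Function.update_of_ne (by have := Finset.mem_range.1 hi; omega)])] at this
    omega
  set σ1 := σ.set N 11 (PFun.val (fun _ _ a _ => muE fun v => andE (minsE a 9 (.var v))
    (eqE (cntE fun u => andE (minsE a 9 (.var u)) (ltE (.var u) (.var v))) (getE a 16))) N σ) with hσ1
  have h1 : Ok N n k G σ1 := h.set (by omega) _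
  have g1 : σ1 11 0 = c 0 := by
    rw [hσ1, St.set_eq h.pos, PFun.val_def]
    have hiff : ∀ v, 0 < (andE (minsE σ 9 (.var v))
        (eqE (cntE fun u => andE (minsE σ 9 (.var u)) (ltE (.var u) (.var v))) (getE σ 16)) :
        Expr ℕ (ℕ → ℕ)).eval N ↔ v ∈ mins G Y ∧ ((mins G Y).filter (· < v)).card = j := by
      intro v
      rw [tr_andE, tr_eqE, h.tr_minsE (by omega), eval_cntE' (S := (mins G Y).filter (· < v))]
      · simp only [getE, eval, hj, ← hY]
      · intro u
        simp only [tr_andE, h.tr_minsE (show 1 ≤ 9 by omega), tr_ltE, eval, Finset.mem_filter, ← hY]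
        refine ⟨fun h => ⟨?_, h⟩, fun h => h.2⟩
        exact (mem_supp.1 (mem_mins.1 h.1).1).1
    refine eval_muE_eq hvN ((hiff _).2 ⟨hv, hvj⟩) fun i hi hpos => ?_
    obtain ⟨h3, h4⟩ := (hiff i).1 hpos
    have := rank_inj h3 hv (h4.trans hvj.symm)
    omega
  have e1 : Keep [11] σ σ1 := Keep.refl.set 11 _
  set F : PFun := fun _ _ a v => .iter
        (fun t => .cond (.num 0) (.var t)
          (muE fun u => andE (inE a 9 (.var u)) (adjE a (getE a 11) (.var u))) (getE a 11))
        (fun t B i => .cond (.num 0) (eqE (.var i) (.add (.var t) (.num 2)))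
          (muE fun u => andE (andE (inE a 9 (.var u))
            (adjE a (.read B (.add (.var t) (.num 1))) (.var u)))
            (notE (eqE (.var u) (.read B (.var t))))) (.read B (.var i)))
        fun B => .read B (.var v) with hF
  set σ2 := σ1.set N 17 (F.val N σ1) with hσ2
  have h2 : Ok N n k G σ2 := h1.set (by omega) _
  have hnb : ∀ b u, u ∈ nb G Y b ↔ u ∈ Y ∧ G.Adj b u := fun b u => mem_nb
  have g2 : ∀ i < N, σ2 17 i = c i := by
    intro i hi
    rw [hσ2, St.set_eq hi, PFun.val_def, hF, eval]
    simp only [eval]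
    set f : ℕ → ℕ := fun i => if 0 < i then
      (muE fun u => andE (inE σ1 9 (.var u)) (adjE σ1 (getE σ1 11) (.var u)) :
        Expr ℕ (ℕ → ℕ)).eval N else (getE σ1 11 : Expr ℕ (ℕ → ℕ)).eval N with hf
    set g : ℕ → (ℕ → ℕ) → ℕ → ℕ := fun t B i =>
      if 0 < (eqE (.var i) (.add (.var t) (.num 2)) : Expr ℕ (ℕ → ℕ)).eval N then
      (muE fun u => andE (andE (inE σ1 9 (.var u))
            (adjE σ1 (.read B (.add (.var t) (.num 1))) (.var u)))
            (notE (eqE (.var u) (.read B (.var t)))) : Expr ℕ (ℕ → ℕ)).eval N else B i with hg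
    -- Initially cells `0` and `1` are right, and round `t` writes cell `t + 2` from the two cells
    -- before it.
    have key : ∀ t, ∀ i < N, i ≤ t + 1 → iterate N f g t i = c i := by
      intro t
      induction t with
      | zero =>
        intro i hi hi1
        simp only [iterate, if_pos hi, hf]
        by_cases hi0 : 0 < i
        · obtain rfl : i = 1 := by omega
          rw [if_pos hi0]
          have hiff : ∀ u, 0 < (andE (inE σ1 9 (.var u)) (adjE σ1 (getE σ1 11) (.var u)) :
              Expr ℕ (ℕ → ℕ)).eval N ↔ u ∈ nb G Y (c 0) := by
            intro u
            rw [tr_andE, h1.tr_inE (by omega), h1.tr_adjE, e1 9 (by simp), hnb]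
            simp only [getE, eval, g1, ← hY]
          refine eval_muE_eq (hcN 1) ((hiff _).2 (mem_nb.2 ⟨hc.mem 1, hc.adj 0⟩)) fun u hu hpos => ?_
          have := hc1 u ((hiff u).1 hpos)
          omega
        · obtain rfl : i = 0 := by omega
          rw [if_neg hi0]
          simp only [getE, eval, g1]
      | succ t ih =>
        intro i hi hi1
        have hgt : iterate N f g (t + 1) i = g t (iterate N f g t) i := by
          simp only [iterate, if_pos hi]
        rw [hgt]
        generalize iterate N f g t = B at ih ⊢
        simp only [hg, tr_eqE, eval]
        split_ifs with hit
        · have hb1 := ih (t + 1) (by omega) le_rfl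
          have hb0 := ih t (by omega) (by omega)
          have hiff : ∀ u, 0 < (andE (andE (inE σ1 9 (.var u))
              (adjE σ1 (.read B (.add (.var t) (.num 1))) (.var u)))
              (notE (eqE (.var u) (.read B (.var t)))) :
              Expr ℕ (ℕ → ℕ)).eval N ↔ u ∈ nb G Y (c (t + 1)) ∧ u ≠ c t := by
            intro u
            rw [tr_andE, tr_andE, h1.tr_inE (by omega), h1.tr_adjE, e1 9 (by simp), hnb, tr_notE,
              tr_eqE]
            simp only [eval, hb1, hb0, ← hY, ne_eq]
          rw [hit]
          refine eval_muE_eq (hcN _) ((hiff _).2 ⟨mem_nb.2 ⟨hc.mem _, hc.adj _⟩, hc.ne t⟩)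
            fun u hu hpos => ?_
          obtain ⟨h5, h6⟩ := (hiff u).1 hpos
          have := hc2 t u h5 h6
          omega
        · exact ih i hi (by omega)
    exact key N i hi (by omega)
  have e2 : Keep [17, 11] σ σ2 := e1.set 17 _
  set σ3 := σ2.set N 10 (PFun.val (fun _ _ a _ => muE fun t => andE (ltE (.num 0) (.var t))
        (eqE (.read (a 17) (.var t)) (getE a 11))) N σ2) with hσ3
  have h3 : Ok N n k G σ3 := h2.set (by omega) _
  have e3 : Keep [10, 17, 11] σ σ3 := e2.set 10 _
  have g11 : σ2 11 0 = c 0 := by rw [hσ2, St.set_ne (by omega), g1]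
  have g3 : σ3 10 0 = L := by
    rw [hσ3, St.set_eq h.pos, PFun.val_def]
    refine eval_muE_eq (by omega) ?_ fun t ht hpos => ?_
    · simp only [tr_andE, tr_ltE, tr_eqE, eval, getE]
      rw [g2 L (by omega), g11]
      exact ⟨by omega, hL0⟩
    · simp only [tr_andE, tr_ltE, tr_eqE, eval, getE] at hpos
      rw [g2 t (by omega), g11] at hpos
      have := hinj t ht 0 (by omega) hpos.2
      omega
  have g317 : ∀ i < N, σ3 17 i = c i := by
    intro i hi; rw [hσ3, St.set_ne (by omega), g2 i hi]
  set σ4 := σ3.set N 1 (PFun.val (fun _ _ a i => .cond (.var i) (getE a 15) (.read (a 1) (.var i))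
        (.cond (getE a 15) (.var i) (.read (a 17) (.sub (.sub (.var i) (getE a 15)) (.num 1)))
          (.add (getE a 10) (.num 1)))) N σ3) with hσ4
  have h4 : Ok N n k G σ4 := h3.set (by omega) _
  have e4 : Keep [1, 10, 17, 11] σ σ4 := e3.set 1 _
  have g4 : ∀ i < N, σ4 1 i = if i < σ 15 0 then σ 1 i else
      if σ 15 0 < i then σ3 17 (i - σ 15 0 - 1) else L + 1 := by
    intro i hi
    rw [hσ4, St.set_eq hi, PFun.val_def]
    simp only [eval, getE, e3 15 (by simp), e3 1 (by simp), g3]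
  set σ5 := σ4.set N 15 (PFun.val (fun _ _ a _ => .add (getE a 15) (.add (getE a 10) (.num 2))) N σ4)
    with hσ5
  have h5 : Ok N n k G σ5 := h4.set (by omega) _
  have e5 : Keep [15, 1, 10, 17, 11] σ σ5 := e4.set 15 _
  set σ6 := σ5.set N 16 (PFun.val (fun _ _ a _ => .add (getE a 16) (.num 1)) N σ5) with hσ6
  have h61 : σ6 1 = σ4 1 := by rw [hσ6, St.set_ne (by omega), hσ5, St.set_ne (by omega)]
  refine ⟨σ6, .seq (.fill 11 _ σ) (.seq (.fill 17 _ σ1) (.seq (.fill 10 _ σ2) (.seq (.fill 1 _ σ3)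
    (.seq (.fill 15 _ σ4) (.fill 16 _ σ5))))), h5.set (by omega) _, (e5.set 16 _).mono (by simp), ?_,
    w, hrank, ?_, fun i hi => ?_, ?_, fun i hi => ?_⟩
  · rw [hσ6, St.set_eq h.pos, PFun.val_def]
    simp only [eval, getE, e5 16 (by simp), hj]
  · rw [hσ6, St.set_ne (by omega), hσ5, St.set_eq h.pos, PFun.val_def]
    have : σ4 10 0 = L := by rw [hσ4, St.set_ne (by omega), g3]
    simp only [eval, getE, e4 15 (by simp), this, hwl]
  · rw [h61, g4 i (by omega), if_pos hi]
  · rw [h61, g4 _ (by omega), if_neg (by omega), if_neg (by omega), hwl]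
  · rw [hwl] at hi
    rw [h61, g4 _ (by omega), if_neg (by omega), if_pos (by omega), g317 _ (by omega)]
    simp only [hw, List.getElem_map, List.getElem_range]
    congr 1
    omega

/-- The final contents of the output arrays. -/
def Outputs (σ : St) (out : List ℕ) : Prop := (List.range (σ 2 0)).map (σ 1) = out

lemma writeCycles_exec (h : Ok N n k G σ) (hN : n + 2 * k + 4 ≤ N) (hp : Pack G k (supp N (σ 9))) :
    ∃ c σ', Exec N Code.writeCycles σ c σ' ∧ c ≤ 7 * k + 5 ∧ ∃ l : ℕ → List ℕ,
      (∀ i < k, RankCycle G (supp N (σ 9)) i (l i)) ∧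
      Outputs σ' (0 :: (List.range k).flatMap fun i => (l i).length :: l i) := by
  classical
  set σ1 := σ.set N 1 (PFun.val (fun _ _ _ _ => .num 0) N σ) with hσ1
  set σ2 := σ1.set N 15 (PFun.val (fun _ _ _ _ => .num 1) N σ1) with hσ2
  set σ3 := σ2.set N 16 (PFun.val (fun _ _ _ _ => .num 0) N σ2) with hσ3
  have h3 : Ok N n k G σ3 := ((h.set (by omega) _).set (by omega) _).set (by omega) _
  let I : St → Prop := fun τ => Ok N n k G τ ∧ Keep [1, 10, 11, 15, 16, 17] σ τ ∧ τ 16 0 ≤ k ∧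
    ∃ l : ℕ → List ℕ, (∀ i < τ 16 0, RankCycle G (supp N (σ 9)) i (l i)) ∧
      τ 15 0 = 1 + ∑ i ∈ Finset.range (τ 16 0), ((l i).length + 1) ∧
      (List.range (τ 15 0)).map (τ 1) =
        0 :: (List.range (τ 16 0)).flatMap fun i => (l i).length :: l i
  have hI3 : I σ3 := by
    have e16 : σ3 16 0 = 0 := by rw [hσ3, St.set_eq h.pos, PFun.val_def, eval]
    have e15 : σ3 15 0 = 1 := by rw [hσ3, St.set_ne (by omega), hσ2, St.set_eq h.pos, PFun.val_def, eval]
    have e1 : σ3 1 0 = 0 := by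
      rw [hσ3, St.set_ne (by omega), hσ2, St.set_ne (by omega), hσ1, St.set_eq h.pos, PFun.val_def, eval]
    refine ⟨h3, (((Keep.refl.set 1 _).set 15 _).set 16 _).mono (by simp), by omega, fun _ => [], ?_, ?_, ?_⟩
    · intro i hi; omega
    · simp [e15, e16]
    · simp [e15, e16, e1, List.range_succ]
  obtain ⟨c, σ4, hE, hc, hI4, hexit⟩ := Exec.while_measure (N := N)
    (e := fun _ _ a => ltE (getE a 16) (kE a)) (P := Code.writeCycle) I (fun τ => k - τ 16 0) 6 (by
      rintro τ ⟨hok, hk, hle, l, hl, hpos, hout⟩ ht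
      have hlt : τ 16 0 < k := by
        rw [PTerm.val_def, tr_ltE] at ht
        simpa only [getE, kE, eval, hok.holds.k_eq] using ht
      have h9 : supp N (τ 9) = supp N (σ 9) := by rw [hk 9 (by simp)]
      obtain ⟨τ', hE, hok', hk', h16, w, hw, h15, hpre, hlen, hget⟩ := writeCycle_exec hok hN
        (h9 ▸ hp) rfl hlt (l := l) (by rw [h9]; exact hl) hpos
      refine ⟨6, τ', hE, le_rfl, ⟨hok', (hk.trans hk').mono (by simp), by omega,
        Function.update l (τ 16 0) w, ?_, ?_, ?_⟩, by omega⟩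
      · intro i hi
        rw [h16] at hi
        by_cases hij : i = τ 16 0
        · rw [hij, Function.update_self, ← h9]; exact hw
        · rw [Function.update_of_ne hij]; exact hl i (by omega)
      · rw [h16, Finset.sum_range_succ, Function.update_self, Finset.sum_congr rfl (fun i hi => by
          rw [Function.update_of_ne (by have := Finset.mem_range.1 hi; omega)]), h15, hpos]
        omega
      · have hfl : ((List.range (τ 16 0)).flatMap fun i =>
            (Function.update l (τ 16 0) w i).length :: Function.update l (τ 16 0) w i) =
            (List.range (τ 16 0)).flatMap fun i => (l i).length :: l i := by
          refine List.flatMap_congr fun i hi => ?_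
          have := List.mem_range.1 hi
          rw [Function.update_of_ne (by omega)]
        rw [h16, List.range_succ, List.flatMap_append, hfl]
        simp only [List.flatMap_cons, List.flatMap_nil, Function.update_self, List.append_nil]
        rw [← List.cons_append, ← hout, h15]
        refine List.ext_getElem (by simp) fun i h1 h2 => ?_
        simp only [List.length_map, List.length_range] at h1
        simp only [List.getElem_map, List.getElem_range]
        rcases lt_trichotomy i (τ 15 0) with hi | hi | hi
        · rw [List.getElem_append_left (by simpa using hi), hpre i hi]
          simp
        · subst hi
          rw [List.getElem_append_right (by simp), hlen]
          simp
        · rw [List.getElem_append_right (by simpa using hi.le)]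
          have := hget (i - τ 15 0 - 1) (by omega)
          rw [show τ 15 0 + 1 + (i - τ 15 0 - 1) = i by omega] at this
          rw [this]
          simp only [List.length_map, List.length_range]
          rw [List.getElem_cons, dif_neg (by omega)])
    σ3 hI3
  obtain ⟨hok, hk, hle, l, hl, hpos, hout⟩ := hI4
  have hkk : σ4 16 0 = k := by
    rw [PTerm.val_def, tr_ltE] at hexit
    simp only [getE, kE, eval, hok.holds.k_eq] at hexit
    omega
  set σ5 := σ4.set N 2 (PFun.val (fun _ _ a _ => getE a 15) N σ4) with hσ5
  refine ⟨_, σ5, .seq (.fill 1 _ σ) (.seq (.fill 15 _ σ1) (.seq (.fill 16 _ σ2) (.seq hE (.fill 2 _ σ4)))),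
    by omega, l, by rw [← hkk]; exact hl, ?_⟩
  rw [Outputs, hσ5, St.set_eq h.pos, PFun.val_def, St.set_ne (by omega)]
  simp only [getE, eval]
  rw [hout, hkk]

end InducedErdosPosa

namespace InducedErdosPosa

open InducedErdosPosa.Expr

variable {N n k : ℕ} {G : SimpleGraph ℕ} {σ : St}

lemma writeSet_exec (h : Ok N n k G σ) (hX : (supp N (σ 4)).card < N) :
    ∃ σ', Exec N Code.writeSet σ 2 σ' ∧ ∃ l : List ℕ, l.Nodup ∧ l.toFinset = supp N (σ 4) ∧
      Outputs σ' (1 :: l) := by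
  classical
  set X := supp N (σ 4) with hXdef
  choose r hr hr' using fun i : Fin X.card => exists_rank X i.2
  set l : List ℕ := List.ofFn r with hl
  have hrinj : Function.Injective r := fun i j e => Fin.ext ((hr' i).symm.trans ((e ▸ hr' j)))
  have hnd : l.Nodup := List.nodup_ofFn.2 hrinj
  have hlX : l.toFinset = X := by
    refine Finset.eq_of_subset_of_card_le (fun v hv => ?_) ?_
    · simp only [hl, List.mem_toFinset, List.mem_ofFn] at hv
      obtain ⟨i, rfl⟩ := hv
      exact hr i
    · rw [List.toFinset_card_of_nodup hnd, hl, List.length_ofFn]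
  set σ1 := σ.set N 1 (PFun.val (fun _ _ a i => .cond (.num 0) (.var i) (muE fun v =>
      andE (inE a 4 (.var v))
      (eqE (.add (cntE fun u => andE (inE a 4 (.var u)) (ltE (.var u) (.var v))) (.num 1)) (.var i)))
      (.num 1)) N σ) with hσ1
  have h1 : Ok N n k G σ1 := h.set (by omega) _
  set σ2 := σ1.set N 2 (PFun.val (fun _ _ a _ => .add (cntE fun u => inE a 4 (.var u)) (.num 1)) N σ1)
    with hσ2
  refine ⟨σ2, .seq (.fill 1 _ σ) (.fill 2 _ σ1), l, hnd, hlX, ?_⟩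
  have hcount : (cntE fun u => inE σ1 4 (.var u) : Expr ℕ (ℕ → ℕ)).eval N = X.card := by
    refine eval_cntE' fun u => ?_
    rw [h1.tr_inE (by omega), hσ1, St.set_ne (by omega), eval, hXdef, mem_supp]
    tauto
  have g2 : σ2 2 0 = X.card + 1 := by
    rw [hσ2, St.set_eq h.pos, PFun.val_def, eval, hcount, eval]
  have g1 : ∀ i < N, σ2 1 i = if 0 < i then (muE fun v => andE (inE σ 4 (.var v))
      (eqE (.add (cntE fun u => andE (inE σ 4 (.var u)) (ltE (.var u) (.var v))) (.num 1)) (.var i)) :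
      Expr ℕ (ℕ → ℕ)).eval N else 1 := by
    intro i hi
    rw [hσ2, St.set_ne (by omega), hσ1, St.set_eq hi, PFun.val_def, eval]
    rfl
  rw [Outputs, g2]
  refine List.ext_getElem (by simp [hl]) fun i hi hi' => ?_
  simp only [List.length_map, List.length_range] at hi
  simp only [List.getElem_map, List.getElem_range]
  rw [g1 i (by omega)]
  rcases Nat.eq_zero_or_pos i with rfl | hi0
  · simp
  · obtain ⟨i, rfl⟩ : ∃ j, i = j + 1 := ⟨i - 1, by omega⟩
    rw [if_pos hi0]
    simp only [hl, List.getElem_cons_succ, List.getElem_ofFn]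
    have hiff : ∀ v, 0 < (andE (inE σ 4 (.var v))
        (eqE (.add (cntE fun u => andE (inE σ 4 (.var u)) (ltE (.var u) (.var v))) (.num 1))
          (.var (i + 1))) : Expr ℕ (ℕ → ℕ)).eval N ↔ v ∈ X ∧ (X.filter (· < v)).card = i := by
      intro v
      rw [tr_andE, tr_eqE, h.tr_inE (by omega), eval, eval, eval, eval_cntE' (S := X.filter (· < v))]
      · simp only [eval, Nat.add_right_cancel_iff, ← hXdef]
      · intro u
        simp only [tr_andE, h.tr_inE (show 1 ≤ 4 by omega), tr_ltE, eval, Finset.mem_filter, ← hXdef]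
        exact ⟨fun h => ⟨(mem_supp.1 h.1).1, h⟩, fun h => h.2⟩
    refine eval_muE_eq (mem_supp.1 (hr ⟨i, by omega⟩)).1
      ((hiff _).2 ⟨hr ⟨i, by omega⟩, hr' ⟨i, by omega⟩⟩) fun u hu hpos => ?_
    obtain ⟨h3, h4⟩ := (hiff u).1 hpos
    have := rank_inj h3 (hr ⟨i, by omega⟩) (h4.trans (hr' ⟨i, by omega⟩).symm)
    omega

/-- A list that describes a packing or a set that meets all cycles together with its neighbours. -/
def IsResult (n k H : ℕ) (G : SimpleGraph ℕ) (out : List ℕ) : Prop :=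
  (∃ (Y : Finset ℕ) (l : ℕ → List ℕ), (∀ i < k, RankCycle G Y i (l i)) ∧
    out = 0 :: (List.range k).flatMap fun i => (l i).length :: l i) ∨
  ∃ (X : Finset ℕ) (l : List ℕ), (X.card = 0 ∨ 2 ≤ k ∧ X.card + 43 ≤ 52 * H + 30 * k) ∧
    X ⊆ Finset.range n ∧ (∀ M ⊆ Finset.range n, M.Nonempty →
      (∀ v ∈ M, v ∉ X ∧ ∀ x ∈ X, ¬ G.Adj v x) → ¬ Thick G M) ∧
    l.Nodup ∧ l.toFinset = X ∧ out = 1 :: l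

theorem main_exec {H : ℕ} (hH : ErdosPosaUpTo n k H G) (h : Ok N n k G σ) (hk : 1 ≤ k)
    (hN : n + 2 * k + 4 ≤ N) (h0 : ∀ j, 1 ≤ j → ∀ i, σ j i = 0) :
    ∃ c σ' out, Exec N Code.main σ c σ' ∧
      c ≤ (5 * (3 * 2 ^ (52 * H + 4 * k + 26) + 14) + 7 * k + 30) * (n + 1) ∧ IsResult n k H G out ∧
      Outputs σ' out := by
  have hempty : ∀ j, 1 ≤ j → supp N (σ j) = ∅ := fun j hj => by
    ext v; simp [h0 j hj]
  have hst : Staged N n k H G σ := by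
    have hi := Inv.init G n (lev := σ 5) (fun v _ => h0 5 (by omega) v)
    refine ⟨?_, ?_, ?_⟩
    · rw [hempty 3 (by omega), hempty 4 (by omega), h0 6 (by omega)]; exact hi
    · rw [hempty 3 (by omega)]; simp [branch]
    · rw [hempty 3 (by omega), h0 6 (by omega)]
      simpa [numStages, Wl] using hk
  obtain ⟨c1, σ1, hE1, hc1, h1, hres⟩ := phase1_exec hH h (h0 7 (by omega) 0) hst
  set A := 3 * 2 ^ (52 * H + 4 * k + 26) + 14 with hA
  have hmid : ∃ c2 σ2, Exec N (.ite (fun _ _ a => eqE (getE a 7) (.num 2)) Code.skip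
      (.seq Code.phase2 (.fill 9 fun _ _ a v => inE a 14 (.var v)))) σ1 c2 σ2 ∧ c2 ≤ 7 * n + 4 ∧
      Ok N n k G σ2 ∧ (Pack G k (supp N (σ2 9)) ∨ Solved N n k H G σ2) := by
    have t1 : 0 < PTerm.val (fun _ _ a => eqE (getE a 7) (.num 2)) N σ1 ↔ σ1 7 0 = 2 := by
      simp only [PTerm.val_def, tr_eqE, getE, eval]
    rcases hres with ⟨h7, hc⟩ | ⟨h7, hp⟩
    · obtain ⟨c, σ', hE, hcb, hok, hr⟩ := phase2_exec h1 hc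
      refine ⟨_, _, .ite_false (by rw [t1]; omega) (.seq hE (.fill 9 _ σ')), by omega,
        hok.set (by omega) _, ?_⟩
      refine hr.imp (fun hp => ?_) fun hs => ?_
      · have : supp N (PFun.val (fun _ _ a v => inE a 14 (.var v)) N σ') = supp N (σ' 14) := by
          ext v
          rw [mem_supp, PFun.val_def, hok.tr_inE (by omega), eval, mem_supp]
          tauto
        rw [St.supp_set, this]
        exact hp
      · obtain ⟨g1, g2, g3⟩ := hs
        refine ⟨?_, ?_, ?_⟩ <;> rw [St.set_ne (by omega)] <;> assumption
    · refine ⟨_, _, .ite_true (t1.2 h7) (.fill 7 _ σ1), by omega, h1.set (by omega) _, .inl ?_⟩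
      rw [St.set_ne (by omega)]
      exact hp
  obtain ⟨c2, σ2, hE2, hc2, h2, hr2⟩ := hmid
  have hcost : c1 + (7 * n + 4) + (7 * k + 6) ≤ (5 * A + 7 * k + 30) * (n + 1) := by
    have e1 : (5 * A + 7 * k + 30) * (n + 1) = 5 * (A * n) + 5 * A + 7 * (k * n) + 7 * k + 30 * n + 30 := by
      ring
    have e2 : (3 * n + 5) * A = 3 * (A * n) + 5 * A := by ring
    omega
  have t2 : 0 < PTerm.val (fun _ _ a => packE a 9) N σ2 ↔ Pack G k (supp N (σ2 9)) := by
    rw [PTerm.val_def, h2.tr_packE (by omega)]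
  by_cases hp : Pack G k (supp N (σ2 9))
  · obtain ⟨c3, σ3, hE3, hc3, l, hl, ho⟩ := writeCycles_exec h2 hN hp
    exact ⟨_, σ3, _, .seq hE1 (.seq hE2 (.ite_true (t2.2 hp) hE3)), by omega,
      .inl ⟨_, l, hl, rfl⟩, ho⟩
  · have hs := hr2.resolve_left hp
    have hcard : (supp N (σ2 4)).card ≤ n := by simpa using Finset.card_le_card hs.sub
    obtain ⟨σ3, hE3, l, hl1, hl2, ho⟩ := writeSet_exec h2 (by omega)
    exact ⟨_, σ3, _, .seq hE1 (.seq hE2 (.ite_false (fun h3 => hp (t2.1 h3)) hE3)), by omega,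
      .inr ⟨_, l, hs.card, hs.sub, hs.no_thick, hl1, hl2, rfl⟩, ho⟩

end InducedErdosPosa

/-! ### Transfer to the given graph, and the conclusion. -/

namespace InducedErdosPosa

open SimpleGraph

section
variable {V : Type} {H : SimpleGraph V} {G : SimpleGraph ℕ} {n k : ℕ}

lemma RankCycle.exists_walk (f : H ↪g G) (hf : ∀ v < n, ∃ b, f b = v) (hG : ∀ u v, G.Adj u v → u < n)
    {Y : Finset ℕ} {i : ℕ} {l : List ℕ} (h : RankCycle G Y i l) :
    ∃ w : ClosedWalk H, w.2.IsCycle ∧ w.2.support.map f = l := by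
  classical
  obtain ⟨v, hv, rfl, c, L, hc, rfl, hL3, h0, hinj, rfl⟩ := h
  choose c' hc' using fun t => hf (c t) (hG _ _ (hc.adj t))
  obtain ⟨w, hw, hs⟩ := exists_isCycle (G := H) (c := c')
    (fun t => f.map_adj_iff.1 (by rw [hc', hc']; exact hc.adj t)) hL3
    (f.injective (by rw [hc', hc', h0]))
    (fun i hi j hj e => hinj i hi j hj (by rw [← hc', ← hc', e]))
  refine ⟨⟨_, w⟩, hw, ?_⟩
  rw [hs, List.map_map]
  exact List.map_congr_left fun t _ => hc' t

lemma exists_packing (f : H ↪g G) (hf : ∀ v < n, ∃ b, f b = v) (hG : ∀ u v, G.Adj u v → u < n)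
    {Y : Finset ℕ} {l : ℕ → List ℕ} (hl : ∀ i < k, RankCycle G Y i (l i)) :
    ∃ p : Fin k → ClosedWalk H, IsInducedCyclePacking p ∧ ∀ i, (p i).2.support.map f = l i := by
  choose p hp hp' using fun i : Fin k => (hl i i.2).exists_walk f hf hG
  have key : ∀ i j, i ≠ j → ∀ u ∈ (p i).2.support, ∀ v ∈ (p j).2.support, ¬ (u = v ∨ H.Adj u v) := by
    intro i j hij u hu v hv huv
    refine hij (Fin.ext ((hl i i.2).eq_of_adj (hl j j.2) (u := f u) (u' := f v) ?_ ?_ ?_))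
    · rw [← hp']; exact List.mem_map_of_mem hu
    · rw [← hp']; exact List.mem_map_of_mem hv
    · exact huv.imp (fun e => by rw [e]) f.map_adj_iff.2
  exact ⟨p, ⟨⟨hp, fun i j hij => fun u hu hu' => key i j hij u hu u hu' (.inl rfl)⟩,
    fun i j hij u hu v hv ha => key i j hij u hu v hv (.inr ha)⟩, hp'⟩

/-- Distance at most one means equality or adjacency, so vertices outside the ball neither lie in
`X` nor have a neighbour there. -/
lemma isForestWithout_ball (f : H ↪g G) (hlt : ∀ b, f b < n) {X : Finset ℕ} {X' : Set V}
    (hX : ∀ b, b ∈ X' ↔ f b ∈ X) (hXf : ∀ x ∈ X, ∃ b, f b = x)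
    (hM : ∀ M ⊆ Finset.range n, M.Nonempty → (∀ v ∈ M, v ∉ X ∧ ∀ x ∈ X, ¬ G.Adj v x) → ¬ Thick G M) :
    IsForestWithout H (ballAround H X' 1) := by
  refine isAcyclic_of_core (f.comp (Embedding.induce _)) fun M hb hne => ?_
  refine hM M (fun v hv => ?_) hne fun v hv => ?_
  · obtain ⟨b, rfl⟩ := hb v hv
    exact Finset.mem_range.2 (hlt _)
  · obtain ⟨⟨b, hb'⟩, rfl⟩ := hb v hv
    have hb2 : ∀ x ∈ X', ¬ H.edist b x ≤ 1 := fun x hx hd => hb' ⟨x, hx, hd⟩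
    refine ⟨fun hx => ?_, fun x hx ha => ?_⟩
    · exact hb2 b ((hX b).2 hx) (by simp)
    · obtain ⟨b', rfl⟩ := hXf x hx
      exact hb2 b' ((hX b').2 hx) (edist_eq_one_iff_adj.2 (f.map_adj_iff.1 ha)).le

/-- Heredity provides the alternatives for the cycles in all subsets. -/
lemma erdosPosaUpTo {C : GraphClass} (hC : C.IsHereditary) {b : ℝ}
    (hh : ∀ (V : Type) [Finite V] (G : SimpleGraph V), C V G →
      (∃ p : Fin k → ClosedWalk G, IsCyclePacking p) ∨
      (∃ X : Finset V, (X.card : ℝ) ≤ b ∧ IsForestWithout G X))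
    [Finite V] (hCH : C V H) (f : H ↪g G) (hf : ∀ v < n, ∃ b, f b = v) :
    ErdosPosaUpTo n k ⌊b⌋₊ G := by
  classical
  intro W hW
  choose g hg using fun v : (↑W : Set ℕ) => hf v.1 (Finset.mem_range.1 (hW v.2))
  have hind : (G.induce (↑W : Set ℕ)).IsIndContained H :=
    ⟨⟨⟨g, fun u v e => Subtype.ext (by rw [← hg, ← hg, e])⟩, fun {u v} => by
      rw [← f.map_adj_iff]
      show G.Adj (f (g u)) (f (g v)) ↔ G.Adj u.1 v.1
      rw [hg, hg]⟩⟩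
  rcases hh _ _ (hC _ _ _ _ hind hCH) with ⟨p, hp⟩ | ⟨X, hX, hF⟩
  · left
    have : ∀ i, ∃ M ⊆ ((p i).2.support.map (Embedding.induce (G := G) (↑W : Set ℕ))).toFinset,
        IsCyc G M := fun i => exists_isCyc_subset ⟨_, List.mem_toFinset.2
          (List.mem_map_of_mem (p i).2.start_mem_support)⟩ (thick_support _ (hp.isCycle i))
    choose M hM hM' using this
    have hmem : ∀ i, ∀ v ∈ M i, ∃ u ∈ (p i).2.support, u.1 = v := by
      intro i v hv
      have := hM i hv
      rw [List.mem_toFinset, List.mem_map] at this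
      exact this
    refine ⟨M, fun i v hv => ?_, hM', fun i j hij => ?_⟩
    · obtain ⟨u, -, rfl⟩ := hmem i v hv
      exact u.2
    · rw [Finset.disjoint_left]
      intro v hv hv'
      obtain ⟨u, hu, rfl⟩ := hmem i v hv
      obtain ⟨u', hu', e⟩ := hmem j _ hv'
      obtain rfl : u' = u := Subtype.ext e
      exact hp.disjoint i j hij hu hu'
  · right
    refine ⟨X.image Subtype.val, fun v hv => ?_, (Finset.card_image_le).trans (Nat.le_floor hX), ?_⟩
    · obtain ⟨u, -, rfl⟩ := Finset.mem_image.1 hv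
      exact u.2
    · rw [core_nonempty]
      rintro ⟨M, hM, hne, ht⟩
      obtain ⟨_, w, hw⟩ := exists_isCycle_of_thick
        ((Embedding.induce (G := G) (↑W : Set ℕ)).comp (Embedding.induce (↑X : Set _)ᶜ)) hne ht
        (fun v hv => by
          have := Finset.mem_sdiff.1 (hM hv)
          refine ⟨⟨⟨v, this.1⟩, fun hvX => this.2 (Finset.mem_image.2 ⟨_, hvX, rfl⟩)⟩, rfl⟩)
      exact hF w hw

lemma getD_flatMap {α : Type*} {m : ℕ} {f : α → List ℕ} (hlen : ∀ a, (f a).length = m)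
    (L : List α) {u : ℕ} (hu : u < L.length) {v : ℕ} (hv : v < m) :
    (L.flatMap f).getD (u * m + v) 0 = (f L[u]).getD v 0 := by
  induction L generalizing u with
  | nil => simp at hu
  | cons a L ih =>
    rw [List.flatMap_cons]
    cases u with
    | zero =>
      rw [List.getD_append _ _ _ _ (by rw [hlen]; omega)]
      simp
    | succ u =>
      have : (u + 1) * m + v = m + (u * m + v) := by ring
      rw [List.getD_append_right _ _ _ _ (by rw [hlen]; omega), hlen, this, Nat.add_sub_cancel_left,
        ih (by simpa using hu)]
      simp

/-- The memory on a given input. -/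
def inputState (l : List ℕ) : St := fun j i => if j = 0 then l.getD i 0 else 0

lemma inputState_ok (Gn : SimpleGraph (Fin n)) {N : ℕ} (hN : n ≤ N) (h0 : 0 < N) :
    Ok N n k (Gn.map Fin.valEmbedding) (inputState (encodeInput Gn k)) := by
  classical
  refine ⟨⟨hN, ?_, ?_, fun u hu v hv => ?_, fun u v ha => ?_⟩, h0, fun j hj i _ => ?_⟩
  · simp [inputState, encodeInput]
  · simp [inputState, encodeInput]
  · have e : inputState (encodeInput Gn k) 0 (2 + (u * n + v)) =
        if Gn.Adj ⟨u, hu⟩ ⟨v, hv⟩ then 1 else 0 := by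
      simp only [inputState, if_true, encodeInput]
      rw [show 2 + (u * n + v) = u * n + v + 1 + 1 by omega, List.getD_cons_succ, List.getD_cons_succ,
        getD_flatMap (m := n) (by simp) _ (by simpa using hu) hv,
        List.getD_eq_getElem _ _ (by simpa using hv)]
      simp
    rw [e]
    have : (Gn.map Fin.valEmbedding).Adj u v ↔ Gn.Adj ⟨u, hu⟩ ⟨v, hv⟩ :=
      (Embedding.map Fin.valEmbedding Gn).map_adj_iff (v := ⟨u, hu⟩) (w := ⟨v, hv⟩)
    rw [this]
    split_ifs with ha <;> simp [ha]
  · rw [map_adj] at ha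
    obtain ⟨a, b, -, rfl, -⟩ := ha
    exact a.2
  · simp only [inputState]
    rw [if_neg (by omega)]

/-- The bound on the size of the set. -/
lemma card_le_bound {b : ℝ} (hb : 0 ≤ b) {c : ℕ}
    (hc : c = 0 ∨ 2 ≤ k ∧ c + 43 ≤ 52 * ⌊b⌋₊ + 30 * k) : (c : ℝ) ≤ max 0 (63 * b + 164 * k - 173) := by
  rcases hc with rfl | ⟨hk, hc⟩
  · simp
  · refine le_max_of_le_right ?_
    have h1 : ((c + 43 : ℕ) : ℝ) ≤ ((52 * ⌊b⌋₊ + 30 * k : ℕ) : ℝ) := by exact_mod_cast hc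
    have h2 := Nat.floor_le hb
    have h3 : (2 : ℝ) ≤ k := by exact_mod_cast hk
    push_cast at h1
    -- What is needed beyond the floor bound is `0 ≤ 11 b + 134 k - 130`, which `k ≥ 2` gives with
    -- room to spare.
    linarith

/-- The empty graph embeds into `H`, so it belongs to the class. It has no closed walk, which forces
the second alternative for it. Nonnegativity is what makes `⌊b⌋₊ ≤ b` available. -/
lemma nonneg_of_class {C : GraphClass} (hC : C.IsHereditary) {b : ℝ} (hk : 1 ≤ k)
    (hh : ∀ (V : Type) [Finite V] (G : SimpleGraph V), C V G →
      (∃ p : Fin k → ClosedWalk G, IsCyclePacking p) ∨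
      (∃ X : Finset V, (X.card : ℝ) ≤ b ∧ IsForestWithout G X))
    [Finite V] (hCH : C V H) : 0 ≤ b := by
  have hind : (⊥ : SimpleGraph Empty).IsIndContained H :=
    ⟨⟨⟨fun x => x.elim, fun x => x.elim⟩, fun {x} => x.elim⟩⟩
  rcases hh _ _ (hC _ _ _ _ hind hCH) with ⟨p, -⟩ | ⟨X, hX, -⟩
  · exact (p ⟨0, hk⟩).1.elim
  · exact (Nat.cast_nonneg _).trans hX

end

/-- The whole program. -/
noncomputable def solver : Program :=
  -- The first two input cells are `n` and `k`, and register `0` becomes `n + 2 k + 4`. At the end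
  -- the output length is loaded from cell `0` of array 2 into register `1`.
  .seq (.seq (.const 1 0) (.seq (.load 2 0 1) (.seq (.const 1 1) (.seq (.load 3 0 1)
    (.seq (.add 0 2 3) (.seq (.add 0 0 3) (.seq (.const 1 4) (.add 0 0 1))))))))
  (.seq Code.main.compile (.seq (.const 2 0) (.load 1 2 2)))

/-- Eight instructions set up `N` and two load the output length; this is the `10`. -/
lemma solver_runs : ∃ K, ∀ (l : List ℕ) (N : ℕ), N = l.getD 0 0 + l.getD 1 0 + l.getD 1 0 + 4 →
    ∀ c σ' out, Exec N Code.main (inputState l) c σ' → Outputs σ' out →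
      solver.OutputsWithin l out (c * unit N K + 10) := by
  obtain ⟨K, hK⟩ := Code.main.runs main_wf
  refine ⟨K, fun l N hN c σ' out hE ho => ?_⟩
  have hpre : ∃ s, Runs (.seq (.const 1 0) (.seq (.load 2 0 1) (.seq (.const 1 1) (.seq (.load 3 0 1)
      (.seq (.add 0 2 3) (.seq (.add 0 0 3) (.seq (.const 1 4) (.add 0 0 1))))))))
      (initState l) 8 s ∧ Rep N (inputState l) s := by
    refine ⟨_, .seq (.const _ _ _) (.seq (.load _ _ _ _) (.seq (.const _ _ _) (.seq (.load _ _ _ _)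
      (.seq (.add _ _ _ _) (.seq (.add _ _ _ _) (.seq (.const _ _ _) (.add _ _ _ _))))))), ⟨?_, ?_⟩, ?_⟩
    · simp [initState, hN]
    · intro a ha i _
      have : a ≠ 0 := by omega
      simp [initState, this]
    · intro j _
      funext i
      by_cases hj : j = 0
      · subst hj; simp [initState, inputState]
      · simp [initState, inputState, hj]
  obtain ⟨s, hs, hrep⟩ := hpre
  obtain ⟨t, s', hr, ht, hrep'⟩ := hK N _ c σ' hE s hrep
  refine ⟨_, _, ?_, .seq hs (.seq hr (.seq (.const _ _ _) (.load _ _ _ _))), ?_⟩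
  · omega
  · rw [← ho, State.output]
    have h1 := hrep'.2 1 (by simp [numGlobals])
    have h2 := hrep'.2 2 (by simp [numGlobals])
    simp [h1, h2]

section
variable {C : GraphClass} {b : ℝ} {n k : ℕ}

lemma exists_isResult (hC : C.IsHereditary) (hk : 1 ≤ k)
    (hh : ∀ (V : Type) [Finite V] (G : SimpleGraph V), C V G →
      (∃ p : Fin k → ClosedWalk G, IsCyclePacking p) ∨
      (∃ X : Finset V, (X.card : ℝ) ≤ b ∧ IsForestWithout G X))
    {Gn : SimpleGraph (Fin n)} (hG : C (Fin n) Gn) :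
    ∃ c σ' out, Exec (n + 2 * k + 4) Code.main (inputState (encodeInput Gn k)) c σ' ∧
      c ≤ (5 * (3 * 2 ^ (52 * ⌊b⌋₊ + 4 * k + 26) + 14) + 7 * k + 30) * (n + 1) ∧
      IsResult n k ⌊b⌋₊ (Gn.map Fin.valEmbedding) out ∧ Outputs σ' out := by
  refine main_exec (erdosPosaUpTo hC hh hG (Embedding.map Fin.valEmbedding Gn)
    fun v hv => ⟨⟨v, hv⟩, rfl⟩) (inputState_ok Gn (by omega) (by omega)) hk le_rfl fun j hj i => ?_
  simp only [inputState]
  rw [if_neg (by omega)]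

lemma lt_of_map_adj {Gn : SimpleGraph (Fin n)} (u v : ℕ) (h : (Gn.map Fin.valEmbedding).Adj u v) :
    u < n := by
  rw [map_adj] at h
  obtain ⟨a, b, -, rfl, -⟩ := h
  exact a.2

lemma IsResult.isSolution {Gn : SimpleGraph (Fin n)} {out : List ℕ} (hb : 0 ≤ b)
    (h : IsResult n k ⌊b⌋₊ (Gn.map Fin.valEmbedding) out) :
    IsSolution Gn k (max 0 (63 * b + 164 * k - 173)) out := by
  classical
  have hf : ∀ v < n, ∃ a, (Embedding.map Fin.valEmbedding Gn) a = v := fun v hv => ⟨⟨v, hv⟩, rfl⟩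
  rcases h with ⟨Y, l, hl, rfl⟩ | ⟨X, l, hc, hX, hM, hnd, rfl, rfl⟩
  · left
    obtain ⟨p, hp, hp'⟩ := exists_packing (Embedding.map Fin.valEmbedding Gn) hf lt_of_map_adj hl
    refine ⟨p, hp, ?_⟩
    rw [encodeWalks, List.ofFn_eq_map, List.flatMap_map, ← List.map_coe_finRange_eq_range,
      List.flatMap_map]
    congr 1
    refine List.flatMap_congr fun i _ => ?_
    rw [← hp' i, List.length_map]
    rfl
  · right
    have hln : ∀ v ∈ l, v < n := fun v hv => Finset.mem_range.1 (hX (by simpa using hv))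
    refine ⟨Finset.univ.filter fun a => a.1 ∈ l, ?_, ?_, l.pmap Fin.mk hln, ?_, ?_, ?_⟩
    · refine card_le_bound hb ?_
      have : (Finset.univ.filter fun a : Fin n => a.1 ∈ l).card = l.toFinset.card := by
        rw [← Finset.card_map Fin.valEmbedding]
        congr 1
        ext v
        simp only [Finset.mem_map, Finset.mem_filter, Finset.mem_univ, true_and, List.mem_toFinset]
        exact ⟨fun ⟨a, h1, h2⟩ => h2 ▸ h1, fun hv => ⟨⟨v, hln v hv⟩, hv, rfl⟩⟩
      rw [this]
      exact hc
    · refine isForestWithout_ball (Embedding.map Fin.valEmbedding Gn) (fun a => a.2) (fun a => ?_)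
        (fun x hx => hf x (hln x (by simpa using hx))) hM
      simp
    · exact hnd.pmap fun _ _ _ _ e => congrArg Fin.val e
    · ext a
      simp only [List.mem_toFinset, List.mem_pmap, Finset.mem_filter, Finset.mem_univ, true_and]
      exact ⟨fun ⟨v, h1, h2⟩ => h2 ▸ h1, fun ha => ⟨a.1, ha, rfl⟩⟩
    · rw [List.map_pmap]
      simp

lemma IsResult.exists_solution {V : Type} {G : SimpleGraph V} (φ : V ≃ Fin n) {out : List ℕ}
    (hb : 0 ≤ b)
    (h : IsResult n k ⌊b⌋₊ ((G.map φ.toEmbedding).map Fin.valEmbedding) out) :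
    (∃ p : Fin k → ClosedWalk G, IsInducedCyclePacking p) ∨
    (∃ X : Finset V, (X.card : ℝ) ≤ max 0 (63 * b + 164 * k - 173) ∧
      IsForestWithout G (ballAround G X 1)) := by
  classical
  set f := (Embedding.map Fin.valEmbedding (G.map φ.toEmbedding)).comp
    (Embedding.map φ.toEmbedding G) with hf'
  have hfv : ∀ a, f a = (φ a).1 := fun _ => rfl
  have hf : ∀ v < n, ∃ a, f a = v := fun v hv => ⟨φ.symm ⟨v, hv⟩, by rw [hfv, φ.apply_symm_apply]⟩
  rcases h with ⟨Y, l, hl, rfl⟩ | ⟨X, l, hc, hX, hM, -, -, -⟩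
  · obtain ⟨p, hp, -⟩ := exists_packing f hf lt_of_map_adj hl
    exact .inl ⟨p, hp⟩
  · right
    have hXn : ∀ v ∈ X, ∃ a, f a = v := fun v hv => hf v (Finset.mem_range.1 (hX hv))
    refine ⟨X.preimage f f.injective.injOn, card_le_bound hb ?_, ?_⟩
    · rw [Finset.card_preimage, Finset.filter_true_of_mem (p := (· ∈ Set.range f)) hXn]
      exact hc
    · exact isForestWithout_ball f (fun a => (φ a).2) (fun a => by simp) hXn hM

end

end InducedErdosPosa

theorem theorem1p4
    (C : InducedErdosPosa.GraphClass) (hC : C.IsHereditary) (h : ℕ → ℝ)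
    (hh : ∀ k : ℕ, 1 ≤ k → ∀ (V : Type) [Finite V] (G : SimpleGraph V), C V G →
      (∃ p : Fin k → InducedErdosPosa.ClosedWalk G, InducedErdosPosa.IsCyclePacking p) ∨
      (∃ X : Finset V, (X.card : ℝ) ≤ h k ∧ InducedErdosPosa.IsForestWithout G X)) :
    (∀ k : ℕ, 1 ≤ k → ∀ (V : Type) [Finite V] (G : SimpleGraph V), C V G →
      (∃ p : Fin k → InducedErdosPosa.ClosedWalk G, InducedErdosPosa.IsInducedCyclePacking p) ∨
      (∃ X : Finset V, (X.card : ℝ) ≤ max 0 (63 * h k + 164 * k - 173) ∧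
        InducedErdosPosa.IsForestWithout G (InducedErdosPosa.ballAround G X 1))) ∧
    (∃ (P : InducedErdosPosa.Program) (c : ℕ) (a : ℕ → ℕ),
      ∀ k : ℕ, 1 ≤ k → ∀ (n : ℕ) (G : SimpleGraph (Fin n)), C (Fin n) G →
        ∃ out : List ℕ,
          P.OutputsWithin (InducedErdosPosa.encodeInput G k) out (a k * (n + 1) ^ c) ∧
          InducedErdosPosa.IsSolution G k (max 0 (63 * h k + 164 * k - 173)) out) := by
  constructor
  · intro k hk V _ G hG
    obtain ⟨n, ⟨φ⟩⟩ := Finite.exists_equiv_fin V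
    -- The existence statement is read off from the run of the program on an isomorphic copy with
    -- vertices `0, …, n - 1`.
    have hG' : C (Fin n) (G.map φ.toEmbedding) :=
      hC _ _ _ _ ⟨(SimpleGraph.Iso.map φ G).symm.toEmbedding⟩ hG
    obtain ⟨c, σ, out, -, -, hr, -⟩ := InducedErdosPosa.exists_isResult hC hk (hh k hk) hG'
    exact hr.exists_solution φ (InducedErdosPosa.nonneg_of_class hC hk (hh k hk) hG)
  · obtain ⟨K, hK⟩ := InducedErdosPosa.solver_runs
    -- One factor `n + 1` comes from the number of actions and tests, the power `K` from the cost of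
    -- each. The parameter is separated by `n + 2 k + 5 ≤ (2 k + 5) (n + 1)`.
    refine ⟨InducedErdosPosa.solver, K + 1, fun k =>
      (5 * (3 * 2 ^ (52 * ⌊h k⌋₊ + 4 * k + 26) + 14) + 7 * k + 30) * (K * (2 * k + 5) ^ K) + 10,
      fun k hk n G hG => ?_⟩
    obtain ⟨c, σ, out, hE, hc, hr, ho⟩ := InducedErdosPosa.exists_isResult hC hk (hh k hk) hG
    refine ⟨out, ?_, hr.isSolution (InducedErdosPosa.nonneg_of_class hC hk (hh k hk) hG)⟩
    obtain ⟨t, s, ht, hs⟩ := hK (InducedErdosPosa.encodeInput G k) (n + 2 * k + 4)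
      (by simp [InducedErdosPosa.encodeInput]; ring) c σ out hE ho
    refine ⟨t, s, ht.trans ?_, hs⟩
    set D := 5 * (3 * 2 ^ (52 * ⌊h k⌋₊ + 4 * k + 26) + 14) + 7 * k + 30
    have h1 : (n + 2 * k + 4 + 1) ^ K ≤ (2 * k + 5) ^ K * (n + 1) ^ K := by
      rw [← mul_pow]
      refine Nat.pow_le_pow_left ?_ K
      nlinarith [Nat.zero_le (k * n)]
    have h2 : 1 ≤ (n + 1) ^ (K + 1) := Nat.one_le_pow _ _ (by omega)
    calc c * InducedErdosPosa.unit (n + 2 * k + 4) K + 10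
        ≤ D * (n + 1) * (K * ((2 * k + 5) ^ K * (n + 1) ^ K)) + 10 * (n + 1) ^ (K + 1) := by
          refine Nat.add_le_add (Nat.mul_le_mul hc (Nat.mul_le_mul_left _ h1)) (by omega)
      _ = (D * (K * (2 * k + 5) ^ K) + 10) * (n + 1) ^ (K + 1) := by ring
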